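/- **Conventions.** An *involutive category* $(\mathbf C,J,j)$ is a category with an endofunctor $J$ and a natural isomorphism $j:\mathrm{Id}\Rightarrow J^2$ such that $jJ=Jj$. It is *involutive (symmetric) monoidal* if $\mathbf C$ is (symmetric) monoidal, $J$ carries a (lax) (symmetric) monoidal structure $(J_2,J_0)$, and $j$ is a monoidal natural transformation. A *$\ast$-object* is a morphism $\ast:c\to Jc$ with $J(\ast)\circ\ast=j_c$, and a $\ast$-morphism $(c,\ast)\to(c',\ast')$ is a morphism $f:c\to c'$ with $J(f)\circ\ast=\ast'\circ f$; these form a category $\ast\text{-}\mathbf{Obj}(\mathbf C,J,j)$. If $(\mathbf C,J,j)$ is involutive (symmetric) monoidal, then $\ast\text{-}\mathbf{Obj}(\mathbf C,J,j)$ is (symmetric) monoidal with $(\ast:c\to Jc)\otimes(\ast':c'\to Jc')=(J_2\circ(\ast\otimes\ast'):c\otimes c'\to J(c\otimes c'))$, unit $J_0:I\to JI$, and the coherence isomorphisms of $\mathbf C$. Let $\mathfrak C$ be a non-empty set and $(\mathbf M,J,j)$ an involutive symmetric monoidal category whose underlying category $\mathbf M$ is cocomplete closed symmetric monoidal. Let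 $\Sigma_{\mathfrak C}$ be the groupoid of finite sequences $\underline c=(c_1,\dots,c_n)$ in $\mathfrak C$ with right permutations $\sigma:\underline c\to\underline c\sigma$ as morphisms, symmetric monoidal under concatenation. Put $\mathbf{SymSeq}_{\mathfrak C}(\mathbf M)=\mathbf M^{\Sigma_{\mathfrak C}\times\mathfrak C}$ ($\mathfrak C$ regarded as a discrete category), with the circle product $$(X\circ Y)\big(\substack{t\\ \underline c}\big)=\int^{\underline a}\int^{(\underline b_1,\dots,\underline b_m)}\Sigma_{\mathfrak C}(\underline b_1\otimes\cdots\otimes\underline b_m,\underline c)\otimes X\big(\substack{t\\ \underline a}\big)\otimes Y\big(\substack{a_1\\ \underline b_1}\big)\otimes\cdots\otimes Y\big(\substack{a_m\\ \underline b_m}\big)$$ and the circle unit $I_\circ\big(\substack{t\\ \underline c}\big)=\Sigma_{\mathfrak C}(t,\underline c)\otimes I$, where $S\otimes m=\coprod_{s\in S}m$ for a set $S$. With the associator and unitors induced by the coherence isomorphisms of $\mathbf M$ and $\Sigma_{\mathfrak C}$, this is a monoidal category; likewise for $\ast\text{-}\mathbf{Obj}(\mathbf M,J,j)$, which is again cocomplete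 and symmetric monoidal, in place of $\mathbf M$. For a (lax) symmetric monoidal functor $F:\mathbf M\to\mathbf N$ between cocomplete symmetric monoidal categories let $F_\ast:\mathbf{SymSeq}_{\mathfrak C}(\mathbf M)\to\mathbf{SymSeq}_{\mathfrak C}(\mathbf N)$ be postcomposition with $F$, and let $F_\ast X\circ F_\ast Y\to F_\ast(X\circ Y)$ and $I_\circ\to F_\ast I_\circ$ be the canonical comparison morphisms induced by the monoidal structure of $F$ and the universal properties of the coends and coproducts. With these comparison morphisms for $F=J$, and with $(j_\ast)_X=jX$, the triple $(\mathbf{SymSeq}_{\mathfrak C}(\mathbf M),J_\ast,j_\ast)$ is an involutive monoidal category. **Proposition.** The assignment which sends a $\ast$-object $\ast:X\to J_\ast X$ to the symmetric sequence $(\underline c,t)\mapsto\big(\ast_{(\underline c,t)}:X\big(\substack{t\\ \underline c}\big)\to JX\big(\substack{t\\ \underline c}\big)\big)$, and a $\ast$-morphism to its components, is an isomorphism of monoidal categories $$\ast\text{-}\mathbf{Obj}\big(\mathbf{SymSeq}_{\mathfrak C}(\mathbf M),J_\ast,j_\ast\big)\;\cong\;\mathbf{SymSeq}_{\mathfrak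 C}\big(\ast\text{-}\mathbf{Obj}(\mathbf M,J,j)\big).$$ That is: it is an isomorphism of categories (its strict inverse regards a symmetric sequence of $\ast$-objects as its underlying symmetric sequence together with the components' involutions), and it is a strong monoidal functor for the circle products. Its coherence isomorphisms for tensor products and units are the canonical ones: their underlying morphisms of symmetric sequences in $\mathbf M$ are inverse to the comparison morphisms above for $F$ the forgetful functor $\ast\text{-}\mathbf{Obj}(\mathbf M,J,j)\to\mathbf M$. -/

import Mathlib

open CategoryTheory MonoidalCategory Limits Opposite
open Functor.LaxMonoidal (ε μ)

universe w v u v₁ u₁ v₂ u₂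

namespace SymSeqInv

/-! ### Involutive categories and `*`-objects -/

/-- An involutive structure `(J, j)` on a category. -/
class InvolutiveCategory (C : Type u) [Category.{v} C] where
  /-- the involution endofunctor -/
  J : C ⥤ C
  /-- the natural isomorphism `Id ≅ J²` -/
  j : 𝟭 C ≅ J ⋙ J
  j_J : ∀ X : C, j.hom.app (J.obj X) = J.map (j.hom.app X)

/-- The involution endofunctor of an involutive category. -/
abbrev invJ (C : Type u) [Category.{v} C] [InvolutiveCategory C] : C ⥤ C :=
  InvolutiveCategory.J

/-- The natural isomorphism `Id ≅ J²` of an involutive category. -/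
abbrev invj (C : Type u) [Category.{v} C] [InvolutiveCategory C] : 𝟭 C ≅ invJ C ⋙ invJ C :=
  InvolutiveCategory.j

/-- An involutive monoidal category: `J` is a (lax) monoidal endofunctor and `j` is a monoidal
natural isomorphism. The involutive structure on the underlying category is a parameter. -/
class InvolutiveMonoidalCategory (C : Type u) [Category.{v} C] [MonoidalCategory C]
    [InvolutiveCategory C] where
  [laxJ : (invJ C).LaxMonoidal]
  isMonoidal_j : NatTrans.IsMonoidal (invj C).hom

attribute [reducible, instance] InvolutiveMonoidalCategory.laxJ
attribute [instance] InvolutiveMonoidalCategory.isMonoidal_j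

/-- An involutive symmetric monoidal category: moreover `J` preserves the braiding. -/
class InvolutiveSymmetricMonoidalCategory (C : Type u) [Category.{v} C] [MonoidalCategory C]
    [SymmetricCategory C] [InvolutiveCategory C] extends InvolutiveMonoidalCategory C where
  braided_J : ∀ X Y : C, μ (invJ C) X Y ≫ (invJ C).map (β_ X Y).hom =
    (β_ ((invJ C).obj X) ((invJ C).obj Y)).hom ≫ μ (invJ C) Y X

instance (C : Type u) [Category.{v} C] [MonoidalCategory C] [SymmetricCategory C]
    [InvolutiveCategory C] [InvolutiveSymmetricMonoidalCategory C] : (invJ C).LaxBraided where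
  braided := InvolutiveSymmetricMonoidalCategory.braided_J

/-- A `*`-object in an involutive category: `* : c ⟶ J c` with `* ≫ J * = j_c`. -/
structure StarObj (C : Type u) [Category.{v} C] [InvolutiveCategory C] where
  obj : C
  star : obj ⟶ (invJ C).obj obj
  star_star : star ≫ (invJ C).map star = (invj C).hom.app obj

namespace StarObj

section Basic

variable {C : Type u} [Category.{v} C] [InvolutiveCategory C]

/-- A `*`-morphism. -/
@[ext]
structure Hom (A B : StarObj C) where
  hom : A.obj ⟶ B.obj
  comm : A.star ≫ (invJ C).map hom = hom ≫ B.star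

instance : Category (StarObj C) where
  Hom := Hom
  id A := ⟨𝟙 A.obj, by simp⟩
  comp f g := ⟨f.hom ≫ g.hom, by
    rw [Functor.map_comp, ← Category.assoc, f.comm, Category.assoc, g.comm, Category.assoc]⟩

@[ext]
lemma hom_ext {A B : StarObj C} {f g : A ⟶ B} (h : f.hom = g.hom) : f = g := Hom.ext h

@[simp] lemma id_hom (A : StarObj C) : Hom.hom (𝟙 A) = 𝟙 A.obj := rfl

@[simp] lemma comp_hom {A B D : StarObj C} (f : A ⟶ B) (g : B ⟶ D) :
    (f ≫ g).hom = f.hom ≫ g.hom := rfl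

/-- The forgetful functor from `*`-objects. -/
def forget (C : Type u) [Category.{v} C] [InvolutiveCategory C] : StarObj C ⥤ C where
  obj A := A.obj
  map f := f.hom

@[simp] lemma forget_obj (A : StarObj C) : (forget C).obj A = A.obj := rfl
@[simp] lemma forget_map {A B : StarObj C} (f : A ⟶ B) : (forget C).map f = f.hom := rfl

instance : (forget C).Faithful where
  map_injective h := hom_ext h

/-- An isomorphism compatible with the involutions is an isomorphism of `*`-objects. -/
def mkIso {A B : StarObj C} (e : A.obj ≅ B.obj)
    (h : A.star ≫ (invJ C).map e.hom = e.hom ≫ B.star) : A ≅ B where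
  hom := ⟨e.hom, h⟩
  inv := ⟨e.inv, by
    rw [← cancel_epi e.hom, ← Category.assoc, ← h, Category.assoc, ← Functor.map_comp]
    simp⟩

@[simp] lemma mkIso_hom_hom {A B : StarObj C} (e : A.obj ≅ B.obj)
    (h : A.star ≫ (invJ C).map e.hom = e.hom ≫ B.star) : (mkIso e h).hom.hom = e.hom := rfl

end Basic

section Colimits

variable {C : Type u} [Category.{v} C] [InvolutiveCategory C]
  {K : Type u₁} [Category.{v₁} K]

/-- The involution induced on a colimit by a natural transformation `G ⟶ G ⋙ J`. -/
noncomputable def colimStar (G : K ⥤ C) [HasColimit G] (s : G ⟶ G ⋙ invJ C) :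
    colimit G ⟶ (invJ C).obj (colimit G) :=
  colimit.desc G ⟨_, s ≫ Functor.whiskerRight (colimit.cocone G).ι (invJ C) ≫
    (Functor.constComp _ _ _).hom⟩

lemma ι_colimStar (G : K ⥤ C) [HasColimit G] (s : G ⟶ G ⋙ invJ C) (k : K) :
    colimit.ι G k ≫ colimStar G s = s.app k ≫ (invJ C).map (colimit.ι G k) := by
  refine (colimit.ι_desc _ _).trans ?_
  simp

lemma colimStar_star (G : K ⥤ C) [HasColimit G] (s : G ⟶ G ⋙ invJ C)
    (hs : ∀ k, s.app k ≫ (invJ C).map (s.app k) = (invj C).hom.app (G.obj k)) :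
    colimStar G s ≫ (invJ C).map (colimStar G s) = (invj C).hom.app (colimit G) := by
  refine colimit.hom_ext fun k => ?_
  have h := (invj C).hom.naturality (colimit.ι G k)
  simp only [Functor.id_map] at h
  rw [h, ← hs k, ← Category.assoc, ι_colimStar, Category.assoc, ← Functor.map_comp, ι_colimStar]
  simp

lemma colimStar_desc (G : K ⥤ C) [HasColimit G] (s : G ⟶ G ⋙ invJ C) (c : Cocone G)
    (t : c.pt ⟶ (invJ C).obj c.pt)
    (h : ∀ k, s.app k ≫ (invJ C).map (c.ι.app k) = c.ι.app k ≫ t) :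
    colimStar G s ≫ (invJ C).map (colimit.desc G c) = colimit.desc G c ≫ t := by
  refine colimit.hom_ext fun k => ?_
  rw [← Category.assoc, ι_colimStar, Category.assoc, ← Functor.map_comp, colimit.ι_desc,
    ← Category.assoc, colimit.ι_desc, h]

variable (F : K ⥤ StarObj C) [HasColimit (F ⋙ forget C)]

/-- The involutions of a diagram of `*`-objects, as a natural transformation. -/
def starNat (F : K ⥤ StarObj C) : F ⋙ forget C ⟶ (F ⋙ forget C) ⋙ invJ C where
  app k := (F.obj k).star
  naturality _ _ f := (F.map f).comm.symm

/-- The colimit cocone of a diagram of `*`-objects. -/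
noncomputable def colimCocone : Cocone F where
  pt := ⟨colimit (F ⋙ forget C), colimStar (F ⋙ forget C) (starNat F),
    colimStar_star _ _ fun k => (F.obj k).star_star⟩
  ι :=
    { app := fun k => ⟨colimit.ι (F ⋙ forget C) k, (ι_colimStar _ (starNat F) k).symm⟩
      naturality := fun _ _ f => hom_ext
        ((colimit.w (F ⋙ forget C) f).trans (Category.comp_id _).symm) }

/-- The colimit cocone of a diagram of `*`-objects is colimiting. -/
noncomputable def colimIsColimit : IsColimit (colimCocone F) where
  desc s := ⟨colimit.desc (F ⋙ forget C) ((forget C).mapCocone s),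
    colimStar_desc _ (starNat F) ((forget C).mapCocone s) s.pt.star fun k => (s.ι.app k).comm⟩
  fac s k := hom_ext (colimit.ι_desc ((forget C).mapCocone s) k)
  uniq s _ h := hom_ext (colimit.hom_ext fun k =>
    (congrArg Hom.hom (h k)).trans (colimit.ι_desc ((forget C).mapCocone s) k).symm)

instance : HasColimit F := ⟨⟨colimCocone F, colimIsColimit F⟩⟩

end Colimits

instance (C : Type u) [Category.{v} C] [InvolutiveCategory C] [HasColimitsOfSize.{v₁, u₁} C] :
    HasColimitsOfSize.{v₁, u₁} (StarObj C) where
  has_colimits_of_shape _ _ := { has_colimit := fun _ => inferInstance }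

section Monoidal

variable {C : Type u} [Category.{v} C] [MonoidalCategory C] [InvolutiveCategory C]
  [InvolutiveMonoidalCategory C]

/-- The tensor product of `*`-objects, with involution `(* ⊗ *') ≫ J₂`. -/
def tensor (A B : StarObj C) : StarObj C where
  obj := A.obj ⊗ B.obj
  star := (A.star ⊗ₘ B.star) ≫ μ (invJ C) A.obj B.obj
  star_star := by
    have h := NatTrans.IsMonoidal.tensor (τ := (invj C).hom) A.obj B.obj
    simp only [Functor.LaxMonoidal.comp_μ] at h
    simp only [Functor.map_comp, Category.assoc]
    rw [← Functor.LaxMonoidal.μ_natural_assoc, MonoidalCategory.tensorHom_comp_tensorHom_assoc,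
      A.star_star, B.star_star]
    exact h.symm.trans (Category.id_comp _)

/-- The unit `*`-object `J₀ : I ⟶ J I`. -/
def unit (C : Type u) [Category.{v} C] [MonoidalCategory C] [InvolutiveCategory C]
    [InvolutiveMonoidalCategory C] : StarObj C where
  obj := 𝟙_ C
  star := ε (invJ C)
  star_star := by
    have h := NatTrans.IsMonoidal.unit (τ := (invj C).hom)
    simp only [Functor.LaxMonoidal.comp_ε] at h
    exact h.symm.trans (Category.id_comp _)

/-- The tensor product of `*`-morphisms. -/
def tensorHom {A B A' B' : StarObj C} (f : A ⟶ A') (g : B ⟶ B') : tensor A B ⟶ tensor A' B' where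
  hom := f.hom ⊗ₘ g.hom
  comm := by
    simp only [tensor, Category.assoc, ← Functor.LaxMonoidal.μ_natural]
    rw [MonoidalCategory.tensorHom_comp_tensorHom_assoc, f.comm, g.comm,
      MonoidalCategory.tensorHom_comp_tensorHom_assoc]

instance : MonoidalCategoryStruct (StarObj C) where
  tensorObj := tensor
  tensorHom := tensorHom
  whiskerLeft A _ _ g := ⟨A.obj ◁ g.hom, by
    have h := (tensorHom (𝟙 A) g).comm
    simp only [tensorHom, id_hom, id_tensorHom] at h
    exact h⟩
  whiskerRight f B := ⟨f.hom ▷ B.obj, by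
    have h := (tensorHom f (𝟙 B)).comm
    simp only [tensorHom, id_hom, tensorHom_id] at h
    exact h⟩
  tensorUnit := unit C
  associator X Y Z := mkIso (α_ X.obj Y.obj Z.obj) (by
    simp only [tensor, MonoidalCategory.tensorHom_def, comp_whiskerRight, Category.assoc,
      MonoidalCategory.whiskerLeft_comp]
    have h := Functor.LaxMonoidal.associativity (invJ C) X.obj Y.obj Z.obj
    rw [← whisker_exchange_assoc, h]
    simp)
  leftUnitor X := mkIso (λ_ X.obj) (by
    simp only [tensor, unit, MonoidalCategory.tensorHom_def', Category.assoc]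
    rw [← Functor.LaxMonoidal.left_unitality]
    simp)
  rightUnitor X := mkIso (ρ_ X.obj) (by
    simp only [tensor, unit, MonoidalCategory.tensorHom_def, Category.assoc]
    rw [← Functor.LaxMonoidal.right_unitality]
    simp)

instance : MonoidalCategory (StarObj C) where
  tensorHom_def f g := hom_ext (MonoidalCategory.tensorHom_def f.hom g.hom)
  id_tensorHom_id A B := hom_ext (MonoidalCategory.id_tensorHom_id A.obj B.obj)
  tensorHom_comp_tensorHom f₁ f₂ g₁ g₂ :=
    hom_ext (MonoidalCategory.tensorHom_comp_tensorHom f₁.hom f₂.hom g₁.hom g₂.hom)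
  whiskerLeft_id A B := hom_ext (MonoidalCategory.whiskerLeft_id A.obj B.obj)
  id_whiskerRight A B := hom_ext (MonoidalCategory.id_whiskerRight A.obj B.obj)
  associator_naturality f g h :=
    hom_ext (MonoidalCategory.associator_naturality f.hom g.hom h.hom)
  leftUnitor_naturality f := hom_ext (MonoidalCategory.leftUnitor_naturality f.hom)
  rightUnitor_naturality f := hom_ext (MonoidalCategory.rightUnitor_naturality f.hom)
  pentagon W X Y Z := hom_ext (MonoidalCategory.pentagon W.obj X.obj Y.obj Z.obj)
  triangle X Y := hom_ext (MonoidalCategory.triangle X.obj Y.obj)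

/-- The forgetful functor is strictly monoidal. -/
instance : (forget C).LaxMonoidal where
  ε := 𝟙 (𝟙_ C)
  μ A B := 𝟙 (A.obj ⊗ B.obj)
  μ_natural_left f B := (Category.comp_id _).trans (Category.id_comp _).symm
  μ_natural_right A g := (Category.comp_id _).trans (Category.id_comp _).symm
  associativity X Y Z := by
    have h : 𝟙 (X.obj ⊗ Y.obj) ▷ Z.obj ≫ 𝟙 ((X.obj ⊗ Y.obj) ⊗ Z.obj) ≫
        (α_ X.obj Y.obj Z.obj).hom = (α_ X.obj Y.obj Z.obj).hom ≫
          X.obj ◁ 𝟙 (Y.obj ⊗ Z.obj) ≫ 𝟙 (X.obj ⊗ Y.obj ⊗ Z.obj) := by simp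
    exact h
  left_unitality X := by
    have h : (λ_ X.obj).hom = 𝟙 (𝟙_ C) ▷ X.obj ≫ 𝟙 (𝟙_ C ⊗ X.obj) ≫ (λ_ X.obj).hom := by simp
    exact h
  right_unitality X := by
    have h : (ρ_ X.obj).hom = X.obj ◁ 𝟙 (𝟙_ C) ≫ 𝟙 (X.obj ⊗ 𝟙_ C) ≫ (ρ_ X.obj).hom := by simp
    exact h

end Monoidal

section Symmetric

variable {C : Type u} [Category.{v} C] [MonoidalCategory C] [SymmetricCategory C]
  [InvolutiveCategory C] [InvolutiveSymmetricMonoidalCategory C]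

instance : SymmetricCategory (StarObj C) where
  braiding X Y := mkIso (β_ X.obj Y.obj) (by
    have h := InvolutiveSymmetricMonoidalCategory.braided_J X.obj Y.obj
    have h2 : ((X.star ⊗ₘ Y.star) ≫ μ (invJ C) X.obj Y.obj) ≫ (invJ C).map (β_ X.obj Y.obj).hom =
        (β_ X.obj Y.obj).hom ≫ (Y.star ⊗ₘ X.star) ≫ μ (invJ C) Y.obj X.obj := by
      rw [Category.assoc, h, BraidedCategory.braiding_naturality_assoc]
    exact h2)
  braiding_naturality_right X _ _ f :=
    hom_ext (BraidedCategory.braiding_naturality_right X.obj f.hom)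
  braiding_naturality_left f Z :=
    hom_ext (BraidedCategory.braiding_naturality_left f.hom Z.obj)
  hexagon_forward X Y Z := hom_ext (BraidedCategory.hexagon_forward X.obj Y.obj Z.obj)
  hexagon_reverse X Y Z := hom_ext (BraidedCategory.hexagon_reverse X.obj Y.obj Z.obj)
  symmetry X Y := hom_ext (SymmetricCategory.symmetry X.obj Y.obj)

instance : (forget C).LaxBraided where
  braided X Y := (Category.id_comp (β_ X.obj Y.obj).hom).trans
    (Category.comp_id (β_ X.obj Y.obj).hom).symm

end Symmetric

end StarObj
/-! ### Deleting an element of `Fin (n + 1)` -/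

/-- The `i`-th natural number different from `k`. -/
def skipNat : ℕ → ℕ → ℕ
  | 0, i => i + 1
  | _ + 1, 0 => 0
  | k + 1, i + 1 => skipNat k i + 1

lemma skipNat_eq (k i : ℕ) : skipNat k i = if i < k then i else i + 1 := by
  induction k generalizing i with
  | zero => simp [skipNat]
  | succ k ih => cases i with
    | zero => simp [skipNat]
    | succ i => simp only [skipNat, ih]; split_ifs <;> omega

/-- The order embedding of `Fin n` into `Fin (n + 1)` whose image omits `k`. -/
def skip {n : ℕ} (k : Fin (n + 1)) (i : Fin n) : Fin (n + 1) :=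
  ⟨skipNat k i, by rw [skipNat_eq]; split_ifs <;> omega⟩

lemma skip_val {n : ℕ} (k : Fin (n + 1)) (i : Fin n) :
    (skip k i : ℕ) = if (i : ℕ) < k then (i : ℕ) else i + 1 := skipNat_eq _ _

lemma skip_ne {n : ℕ} (k : Fin (n + 1)) (i : Fin n) : skip k i ≠ k := by
  intro h
  have h' := congrArg Fin.val h
  rw [skip_val] at h'
  split_ifs at h' <;> omega

lemma skip_injective {n : ℕ} (k : Fin (n + 1)) : Function.Injective (skip k) := by
  intro i j h
  have h' := congrArg Fin.val h
  rw [skip_val, skip_val] at h'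
  ext
  split_ifs at h' <;> omega

/-- The position of `l` among the elements different from `k`. -/
def unskip {n : ℕ} (k l : Fin (n + 1)) (h : l ≠ k) : Fin n :=
  ⟨if (l : ℕ) < k then l else l - 1, by
    have := Fin.val_ne_of_ne h
    split_ifs <;> omega⟩

@[simp] lemma skip_unskip {n : ℕ} (k l : Fin (n + 1)) (h : l ≠ k) : skip k (unskip k l h) = l := by
  have := Fin.val_ne_of_ne h
  ext
  rw [skip_val]
  simp only [unskip]
  split_ifs <;> omega

/-- Restriction of a bijection to the complements of `k` and of its image. -/
def removeAt {p q : ℕ} (e : Fin (p + 1) ≃ Fin (q + 1)) (k : Fin (p + 1)) : Fin p ≃ Fin q where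
  toFun i := unskip (e k) (e (skip k i)) fun h => skip_ne k i (e.injective h)
  invFun j := unskip k (e.symm (skip (e k) j)) fun h =>
    skip_ne (e k) j ((e.symm_apply_eq).1 h)
  left_inv i := skip_injective k (by simp)
  right_inv j := skip_injective (e k) (by simp)

@[simp] lemma skip_removeAt {p q : ℕ} (e : Fin (p + 1) ≃ Fin (q + 1)) (k : Fin (p + 1))
    (i : Fin p) : skip (e k) (removeAt e k i) = e (skip k i) :=
  skip_unskip _ _ fun h => skip_ne k i (e.injective h)

lemma apply_skip {p q : ℕ} {e : Fin (p + 1) ≃ Fin (q + 1)} {k : Fin (p + 1)} {i : Fin p} {j : Fin q}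
    (h : removeAt e k i = j) : e (skip k i) = skip (e k) j := by
  rw [← h, skip_removeAt]

lemma apply_succ {p q : ℕ} {e : Fin (p + 1) ≃ Fin (q + 1)} {i : Fin p} {j : Fin q}
    (h : removeAt e 0 i = j) : e i.succ = skip (e 0) j :=
  apply_skip h

/-! ### Ordered tensor products of finite families -/

section Tensor

variable {C : Type u} [Category.{v} C] [MonoidalCategory C]

/-- The ordered tensor product `x₀ ⊗ (x₁ ⊗ (⋯ ⊗ I))` of a finite family of objects. -/
def tens : (n : ℕ) → (Fin n → C) → C
  | 0, _ => 𝟙_ C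
  | n + 1, x => x 0 ⊗ tens n (fun i => x i.succ)

/-- The tensor product of a finite family of morphisms. -/
def tensMap : (n : ℕ) → {x y : Fin n → C} → (∀ i, x i ⟶ y i) → (tens n x ⟶ tens n y)
  | 0, _, _, _ => 𝟙 _
  | n + 1, _, _, f => f 0 ⊗ₘ tensMap n (fun i => f i.succ)

lemma tensMap_id (n : ℕ) (x : Fin n → C) : tensMap n (fun i => 𝟙 (x i)) = 𝟙 _ := by
  induction n with
  | zero => rfl
  | succ n ih =>
    simp only [tensMap, ih]
    exact id_tensorHom_id _ _

lemma tensMap_comp (n : ℕ) {x y z : Fin n → C} (f : ∀ i, x i ⟶ y i) (g : ∀ i, y i ⟶ z i) :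
    tensMap n (fun i => f i ≫ g i) = tensMap n f ≫ tensMap n g := by
  induction n with
  | zero => exact (Category.id_comp _).symm
  | succ n ih =>
    simp only [tensMap, ih]
    exact (tensorHom_comp_tensorHom _ _ _ _).symm

lemma comp_aux {A B D E F G H K : C} {T : A ⟶ B} {a : B ⟶ D ⊗ E} {b : A ⟶ F ⊗ G} {c : F ⟶ D}
    {d : G ⟶ E} (h : T ≫ a = b ≫ (c ⊗ₘ d)) (m : D ⟶ H) (n : E ⟶ K) :
    T ≫ a ≫ (m ⊗ₘ n) = b ≫ ((c ≫ m) ⊗ₘ (d ≫ n)) := by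
  rw [reassoc_of% h, tensorHom_comp_tensorHom]

variable [SymmetricCategory C]

/-- The interchange `a ⊗ (b ⊗ c) ⟶ b ⊗ (a ⊗ c)`. -/
def swapL (a b c : C) : a ⊗ (b ⊗ c) ⟶ b ⊗ (a ⊗ c) :=
  (α_ a b c).inv ≫ (β_ a b).hom ▷ c ≫ (α_ b a c).hom

lemma swapL_natural {a a' b b' c c' : C} (f : a ⟶ a') (g : b ⟶ b') (h : c ⟶ c') :
    (f ⊗ₘ (g ⊗ₘ h)) ≫ swapL a' b' c' = swapL a b c ≫ (g ⊗ₘ (f ⊗ₘ h)) := by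
  simp only [swapL, Category.assoc]
  rw [associator_inv_naturality_assoc, ← associator_naturality, ← tensorHom_id, ← tensorHom_id,
    tensorHom_comp_tensorHom_assoc, tensorHom_comp_tensorHom_assoc,
    BraidedCategory.braiding_naturality, Category.id_comp, Category.comp_id]

lemma swapL_swapL (a b c : C) : swapL a b c ≫ swapL b a c = 𝟙 _ := by
  simp only [swapL, Category.assoc, Iso.hom_inv_id_assoc]
  rw [← comp_whiskerRight_assoc, SymmetricCategory.symmetry]
  simp

lemma swapL_hexagon (a b c d : C) :
    a ◁ swapL b c d ≫ swapL a c (b ⊗ d) ≫ c ◁ swapL a b d =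
      swapL a b (c ⊗ d) ≫ b ◁ swapL a c d ≫ swapL b c (a ⊗ d) := by
  have h1 : a ◁ swapL b c d ≫ swapL a c (b ⊗ d) ≫ c ◁ swapL a b d =
      𝟙 _ ⊗≫ ((a ◁ (β_ b c).hom ⊗≫ (β_ a c).hom ▷ b ⊗≫ c ◁ (β_ a b).hom) ▷ d) ⊗≫ 𝟙 _ := by
    simp only [swapL]
    monoidal
  have h2 : swapL a b (c ⊗ d) ≫ b ◁ swapL a c d ≫ swapL b c (a ⊗ d) =
      𝟙 _ ⊗≫ (((β_ a b).hom ▷ c ⊗≫ b ◁ (β_ a c).hom ⊗≫ (β_ b c).hom ▷ a) ▷ d) ⊗≫ 𝟙 _ := by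
    simp only [swapL]
    monoidal
  rw [h1, h2, BraidedCategory.yang_baxter']
  monoidal

/-- Moving the `k`-th factor of an ordered tensor product to the front. -/
def pull : (k n : ℕ) → (h : k < n + 1) → (x : Fin (n + 1) → C) →
    (tens (n + 1) x ⟶ x ⟨k, h⟩ ⊗ tens n (fun i => x (skip ⟨k, h⟩ i)))
  | 0, n, _, x => 𝟙 (x 0 ⊗ tens n (fun i => x i.succ))
  | _ + 1, 0, h, _ => absurd h (by omega)
  | k + 1, n + 1, h, x =>
    x 0 ◁ pull k n (by omega) (fun i => x i.succ) ≫
      swapL (x 0) (x ⟨k+1, h⟩) (tens n fun i => x (skip ⟨k, by omega⟩ i).succ)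

/-- The morphism `x₀ ⊗ ⋯ ⊗ x_{q-1} ⟶ y₀ ⊗ ⋯ ⊗ y_{p-1}` induced by a bijection `e` and morphisms
`f i : x (e i) ⟶ y i`, defined through the symmetry: the factors `x (e 0)`, `x (e 1)`, … are moved
to the front one after the other. (The morphism `f i` is written as a function of all `j` with
`e i = j`, in order to avoid transports along equalities.) -/
def tensPerm : (p q : ℕ) → (e : Fin p ≃ Fin q) → (x : Fin q → C) → (y : Fin p → C) →
    (∀ i j, e i = j → (x j ⟶ y i)) → (tens q x ⟶ tens p y)
  | 0, 0, _, _, _, _ => 𝟙 (𝟙_ C)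
  | 0, _ + 1, e, _, _, _ => (e.symm 0).elim0
  | _ + 1, 0, e, _, _, _ => (e 0).elim0
  | p + 1, q + 1, e, x, y, f =>
    pull (e 0) q (e 0).2 x ≫ (f 0 (e 0) rfl ⊗ₘ
      tensPerm p q (removeAt e 0) (fun j => x (skip (e 0) j)) (fun i => y i.succ)
        (fun i j h => f i.succ (skip (e 0) j) (apply_succ h)))

lemma tensPerm_succ (p q : ℕ) (e : Fin (p + 1) ≃ Fin (q + 1)) (x : Fin (q + 1) → C)
    (y : Fin (p + 1) → C) (f : ∀ i j, e i = j → (x j ⟶ y i)) :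
    tensPerm (p + 1) (q + 1) e x y f = pull (e 0) q (e 0).2 x ≫ (f 0 (e 0) rfl ⊗ₘ
      tensPerm p q (removeAt e 0) (fun j => x (skip (e 0) j)) (fun i => y i.succ)
        (fun i j h => f i.succ (skip (e 0) j) (apply_succ h))) := rfl

lemma swapL_step {A A' B B' P P' Q Q' : C} (a : A ⟶ A') {b : B ⟶ B'} {q : Q ⟶ Q'} {g : P ⟶ P'}
    {p : P ⟶ B ⊗ Q} {p' : P' ⟶ B' ⊗ Q'} (h : g ≫ p' = p ≫ (b ⊗ₘ q)) :
    (a ⊗ₘ g) ≫ (A' ◁ p' ≫ swapL A' B' Q') = (A ◁ p ≫ swapL A B Q) ≫ (b ⊗ₘ (a ⊗ₘ q)) := by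
  rw [Category.assoc, ← swapL_natural, ← id_tensorHom, ← id_tensorHom,
    tensorHom_comp_tensorHom_assoc, tensorHom_comp_tensorHom_assoc, h, Category.comp_id,
    Category.id_comp]

lemma tensMap_pull (k n : ℕ) (h : k < n + 1) {x y : Fin (n + 1) → C} (f : ∀ i, x i ⟶ y i) :
    tensMap (n + 1) f ≫ pull k n h y =
      pull k n h x ≫ (f ⟨k, h⟩ ⊗ₘ tensMap n (fun i => f (skip ⟨k, h⟩ i))) := by
  induction k generalizing n with
  | zero => exact (Category.comp_id _).trans (Category.id_comp _).symm
  | succ k ih =>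
    cases n with
    | zero => omega
    | succ n => exact swapL_step (f 0) (ih n (by omega) (fun i => f i.succ))

/-- The position of `a` after deleting the element `skipNat a b`. -/
def coskipNat : ℕ → ℕ → ℕ
  | 0, _ => 0
  | a + 1, 0 => a
  | a + 1, b + 1 => coskipNat a b + 1

lemma coskipNat_eq (a b : ℕ) : coskipNat a b = if b < a then a - 1 else a := by
  induction a generalizing b with
  | zero => simp [coskipNat]
  | succ k ih => cases b with
    | zero => simp [coskipNat]
    | succ i => simp only [coskipNat, ih]; split_ifs <;> omega

lemma skipNat_skipNat (a b : ℕ) : skipNat (skipNat a b) (coskipNat a b) = a := by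
  simp only [skipNat_eq, coskipNat_eq]
  split_ifs <;> omega

lemma skipNat_skipNat_skipNat (a b i : ℕ) :
    skipNat (skipNat a b) (skipNat (coskipNat a b) i) = skipNat a (skipNat b i) := by
  simp only [skipNat_eq, coskipNat_eq]
  split_ifs <;> omega

lemma skip_skip_eq {n a b : ℕ} (ha : a < n + 2) (hc : skipNat a b < n + 2)
    (hd : coskipNat a b < n + 1) :
    skip (⟨skipNat a b, hc⟩ : Fin (n + 2)) ⟨coskipNat a b, hd⟩ = ⟨a, ha⟩ :=
  Fin.ext (skipNat_skipNat a b)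

lemma skip_skip_skip_eq {n a b : ℕ} (ha : a < n + 2) (hb : b < n + 1) (hc : skipNat a b < n + 2)
    (hd : coskipNat a b < n + 1) (i : Fin n) :
    skip (⟨skipNat a b, hc⟩ : Fin (n + 2)) (skip ⟨coskipNat a b, hd⟩ i) =
      skip ⟨a, ha⟩ (skip ⟨b, hb⟩ i) :=
  Fin.ext (skipNat_skipNat_skipNat a b i)

lemma pull_pull_aux {X P A PA B Q PB A' Q' : C} {pa : P ⟶ A ⊗ PA} {pb : PA ⟶ B ⊗ Q}
    {pc : P ⟶ B ⊗ PB} {pd : PB ⟶ A' ⊗ Q'} {s : A' ⟶ A} {t : Q' ⟶ Q}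
    (h : pa ≫ A ◁ pb ≫ swapL A B Q = pc ≫ B ◁ (pd ≫ (s ⊗ₘ t))) :
    (X ◁ pa ≫ swapL X A PA) ≫ A ◁ (X ◁ pb ≫ swapL X B Q) ≫ swapL A B (X ⊗ Q) =
      (X ◁ pc ≫ swapL X B PB) ≫ B ◁ ((X ◁ pd ≫ swapL X A' Q') ≫ (s ⊗ₘ (𝟙 X ⊗ₘ t))) := by
  have n1 := swapL_natural (𝟙 X) (𝟙 A) pb
  have n2 := swapL_natural (𝟙 X) s t
  have n3 := swapL_natural (𝟙 X) (𝟙 B) (pd ≫ (s ⊗ₘ t))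
  simp only [id_tensorHom] at n1 n2 n3
  have h' := congrArg (fun f => X ◁ f ≫ swapL X B (A ⊗ Q) ≫ B ◁ swapL X A Q) h
  simp only [MonoidalCategory.whiskerLeft_comp, Category.assoc] at h' n3 ⊢
  rw [← reassoc_of% n1, ← swapL_hexagon, h', id_tensorHom, ← MonoidalCategory.whiskerLeft_comp B
    (swapL X A' Q'), ← n2]
  simp only [MonoidalCategory.whiskerLeft_comp]
  rw [reassoc_of% n3]

lemma pull_pull (a b n : ℕ) (ha : a < n + 2) (hb : b < n + 1) (hc : skipNat a b < n + 2)
    (hd : coskipNat a b < n + 1) (x : Fin (n + 2) → C) :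
    pull a (n + 1) ha x ≫ x ⟨a, ha⟩ ◁ pull b n hb (fun i => x (skip ⟨a, ha⟩ i)) ≫ swapL _ _ _ =
      pull (skipNat a b) (n + 1) hc x ≫ _ ◁ (pull (coskipNat a b) n hd
        (fun i => x (skip ⟨_, hc⟩ i)) ≫
          (eqToHom (congrArg x (skip_skip_eq ha hc hd)) ⊗ₘ
            tensMap n (fun i => eqToHom (congrArg x (skip_skip_skip_eq ha hb hc hd i))))) := by
  induction a generalizing b n with
  | zero =>
    have h : ∀ {A B P Q : C} {p : P ⟶ B ⊗ Q} {t : Q ⟶ Q}, t = 𝟙 Q →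
        𝟙 (A ⊗ P) ≫ A ◁ p ≫ swapL A B Q =
          (A ◁ p ≫ swapL A B Q) ≫ B ◁ (𝟙 (A ⊗ Q) ≫ (𝟙 A ⊗ₘ t)) := by
      intro A B P Q p t ht
      simp [ht]
    exact h (tensMap_id n _)
  | succ a ih =>
    cases b with
    | zero =>
      have h : ∀ {A B P Q : C} {p : P ⟶ B ⊗ Q} {t : Q ⟶ Q}, t = 𝟙 Q →
          (A ◁ p ≫ swapL A B Q) ≫ B ◁ 𝟙 (A ⊗ Q) ≫ swapL B A Q =
            𝟙 (A ⊗ P) ≫ A ◁ (p ≫ (𝟙 B ⊗ₘ t)) := by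
        intro A B P Q p t ht
        simp [ht, swapL_swapL]
      exact h (tensMap_id _ _)
    | succ b =>
      cases n with
      | zero => omega
      | succ n => exact pull_pull_aux (ih b n (by omega) (by omega) (by
          simp only [skipNat] at hc; omega) (by simp only [coskipNat] at hd; omega)
          (fun i => x i.succ))

lemma eq_coskip {n : ℕ} {a c : Fin (n + 2)} {b d : Fin (n + 1)} (hc : skip a b = c)
    (hd : skip c d = a) : coskipNat a b = d := by
  have h1 := congrArg Fin.val hc
  have h2 := congrArg Fin.val hd
  rw [skip_val] at h1 h2
  rw [coskipNat_eq]
  split_ifs at h1 h2 ⊢ <;> omega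

lemma skip_comm {n : ℕ} {a c : Fin (n + 2)} {b d : Fin (n + 1)} (hc : skip a b = c)
    (hd : skip c d = a) (i : Fin n) : skip c (skip d i) = skip a (skip b i) := by
  have h := eq_coskip hc hd
  subst hc
  ext
  change skipNat (skipNat a b) (skipNat d i) = skipNat a (skipNat b i)
  rw [← h]
  exact skipNat_skipNat_skipNat _ _ _

lemma pull_pull_comp {n : ℕ} {x : Fin (n + 2) → C} {A B Q : C} (a : Fin (n + 2)) (b : Fin (n + 1))
    (c : Fin (n + 2)) (d : Fin (n + 1)) (hc : skip a b = c) (hd : skip c d = a)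
    (s : ∀ l, l = a → (x l ⟶ A)) (r : ∀ l, l = c → (x l ⟶ B))
    (t : ∀ m : Fin n → Fin (n + 2), (∀ i, m i = skip a (skip b i)) →
      (tens n (fun i => x (m i)) ⟶ Q)) :
    pull a (n + 1) a.2 x ≫ (x a ◁ pull b n b.2 (fun i => x (skip a i)) ≫ swapL _ _ _) ≫
        (r (skip a b) hc ⊗ₘ (s a rfl ⊗ₘ t (fun i => skip a (skip b i)) (fun _ => rfl))) =
      pull c (n + 1) c.2 x ≫ (r c rfl ⊗ₘ (pull d n d.2 (fun i => x (skip c i)) ≫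
        (s (skip c d) hd ⊗ₘ t (fun i => skip c (skip d i)) (skip_comm hc hd)))) := by
  obtain ⟨d, hd1⟩ := d
  obtain rfl : coskipNat a b = d := eq_coskip hc hd
  subst hc
  have hs : ∀ l (h : l = a), s l h = eqToHom (congrArg x h) ≫ s a rfl := by
    rintro _ rfl
    simp
  have ht' : ∀ m (h : ∀ i, m i = skip a (skip b i)), t m h =
      tensMap n (fun i => eqToHom (congrArg x (h i))) ≫
        t (fun i => skip a (skip b i)) (fun _ => rfl) := by
    intro m h
    obtain rfl : m = fun i => skip a (skip b i) := funext h
    simp only [eqToHom_refl]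
    rw [tensMap_id, Category.id_comp]
  have h := pull_pull (C := C) a b n a.2 b.2 (skip a b).2 hd1 x
  rw [hs _ hd, ht' _ (skip_comm rfl hd), ← tensorHom_comp_tensorHom]
  have aux : ∀ {P P' R A₁ A₂ A₃ B₁ B₂ Q₁ Q₂ Q₃ : C} {f : P ⟶ R} {f' : R ⟶ B₁ ⊗ (A₂ ⊗ Q₂)}
      {g : P ⟶ B₁ ⊗ P'}
      {k : P' ⟶ A₁ ⊗ Q₁} {m : A₁ ⊗ Q₁ ⟶ A₂ ⊗ Q₂} (i : A₂ ⟶ A₃) (j : B₁ ⟶ B₂) (l : Q₂ ⟶ Q₃),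
      f ≫ f' = g ≫ B₁ ◁ (k ≫ m) →
      f ≫ f' ≫ (j ⊗ₘ (i ⊗ₘ l)) = g ≫ (j ⊗ₘ (k ≫ m ≫ (i ⊗ₘ l))) := by
    intro P P' R A₁ A₂ A₃ B₁ B₂ Q₁ Q₂ Q₃ f f' g k m i j l hf
    rw [reassoc_of% hf, ← id_tensorHom, tensorHom_comp_tensorHom, Category.id_comp,
      Category.assoc]
  exact aux _ _ _ h

lemma tensPerm_congr {p q : ℕ} {e e' : Fin p ≃ Fin q} {x : Fin q → C} {y : Fin p → C}
    {f : ∀ i j, e i = j → (x j ⟶ y i)} {f' : ∀ i j, e' i = j → (x j ⟶ y i)}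
    (he : e = e') (hf : ∀ i j h h', f i j h = f' i j h') :
    tensPerm p q e x y f = tensPerm p q e' x y f' := by
  subst he
  obtain rfl : f = f' := by
    funext i j h
    exact hf i j h h
  rfl

lemma removeAt_removeAt {p q : ℕ} (e : Fin (p + 2) ≃ Fin (q + 2)) (k : Fin (p + 1)) :
    removeAt (removeAt e k.succ) 0 = removeAt (removeAt e 0) k := by
  have h1 : skip (e k.succ) (removeAt e k.succ 0) = e 0 := skip_removeAt e k.succ 0
  have h2 : skip (e 0) (removeAt e 0 k) = e k.succ := skip_removeAt e 0 k
  ext i : 1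
  apply skip_injective (removeAt e 0 k)
  apply skip_injective (e 0)
  rw [← skip_comm h2 h1]
  simp only [skip_removeAt]
  rfl

lemma tensPerm_pull (k p q : ℕ) (h : k < p + 1) (e : Fin (p + 1) ≃ Fin (q + 1))
    (x : Fin (q + 1) → C) (y : Fin (p + 1) → C) (f : ∀ i j, e i = j → (x j ⟶ y i)) :
    tensPerm (p + 1) (q + 1) e x y f ≫ pull k p h y =
      pull (e ⟨k, h⟩) q (e ⟨k, h⟩).2 x ≫ (f ⟨k, h⟩ (e ⟨k, h⟩) rfl ⊗ₘ
        tensPerm p q (removeAt e ⟨k, h⟩) (fun j => x (skip (e ⟨k, h⟩) j))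
          (fun i => y (skip ⟨k, h⟩ i))
          (fun i j hij => f (skip ⟨k, h⟩ i) (skip (e ⟨k, h⟩) j)
            (apply_skip hij))) := by
  induction k generalizing p q with
  | zero => exact Category.comp_id _
  | succ k ih =>
    cases p with
    | zero => omega
    | succ p =>
      cases q with
      | zero => exact absurd (Fintype.card_congr e) (by simp)
      | succ q =>
        have hk : k < p + 1 := by omega
        have h1 := ih p q hk (removeAt e 0) (fun j => x (skip (e 0) j)) (fun i => y i.succ)
          (fun i j h => f i.succ (skip (e 0) j) (apply_succ h))
        have h2 := swapL_step (f 0 (e 0) rfl) h1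
        have e1 : skip (e 0) (removeAt e 0 ⟨k, hk⟩) = e ⟨k + 1, h⟩ := skip_removeAt e 0 ⟨k, hk⟩
        have e2 : skip (e ⟨k + 1, h⟩) (removeAt e ⟨k + 1, h⟩ 0) = e 0 :=
          skip_removeAt e ⟨k + 1, h⟩ 0
        have h3 := pull_pull_comp (x := x) (e 0) (removeAt e 0 ⟨k, hk⟩) (e ⟨k + 1, h⟩)
          (removeAt e ⟨k + 1, h⟩ 0) e1 e2 (fun l hl => f 0 l hl.symm)
          (fun l hl => f ⟨k + 1, h⟩ l hl.symm)
          (fun m hm => tensPerm p q (removeAt (removeAt e 0) ⟨k, hk⟩) (fun j => x (m j))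
            (fun i => y (skip ⟨k, hk⟩ i).succ)
            (fun i j hij => f (skip ⟨k, hk⟩ i).succ (m j) (by
              rw [hm, ← hij, skip_removeAt, skip_removeAt]; rfl)))
        refine (Category.assoc _ _ _).trans ?_
        refine (congrArg (fun m => pull (e 0) (q + 1) (e 0).2 x ≫ m) h2).trans ?_
        refine h3.trans ?_
        refine congrArg (fun m => pull (e ⟨k + 1, h⟩) (q + 1) (e ⟨k + 1, h⟩).2 x ≫
          (f ⟨k + 1, h⟩ (e ⟨k + 1, h⟩) rfl ⊗ₘ m)) ?_
        refine congrArg (fun m => pull (removeAt e ⟨k + 1, h⟩ 0) q _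
          (fun j => x (skip (e ⟨k + 1, h⟩) j)) ≫
            (f 0 (skip (e ⟨k + 1, h⟩) (removeAt e ⟨k + 1, h⟩ 0)) e2.symm ⊗ₘ m)) ?_
        exact tensPerm_congr (removeAt_removeAt e ⟨k, hk⟩).symm (fun _ _ _ _ => rfl)

lemma tensPerm_comp (r p q : ℕ) (e : Fin p ≃ Fin q) (e' : Fin r ≃ Fin p) (x : Fin q → C)
    (y : Fin p → C) (z : Fin r → C) (f : ∀ i j, e i = j → (x j ⟶ y i))
    (g : ∀ i j, e' i = j → (y j ⟶ z i)) :
    tensPerm p q e x y f ≫ tensPerm r p e' y z g =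
      tensPerm r q (e'.trans e) x z (fun i j h => f (e' i) j h ≫ g i (e' i) rfl) := by
  induction r generalizing p q with
  | zero =>
    cases p with
    | succ p => exact (e'.symm 0).elim0
    | zero =>
      cases q with
      | succ q => exact (e.symm 0).elim0
      | zero => exact Category.id_comp _
  | succ r ih =>
    cases p with
    | zero => exact (e' 0).elim0
    | succ p =>
      cases q with
      | zero => exact (e 0).elim0
      | succ q =>
        refine (comp_aux (tensPerm_pull (e' 0) p q (e' 0).2 e x y f) _ _).trans ?_
        refine congrArg (fun m => pull (e (e' 0)) q (e (e' 0)).2 x ≫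
          ((f (e' 0) (e (e' 0)) rfl ≫ g 0 (e' 0) rfl) ⊗ₘ m)) ?_
        refine (ih p q _ _ _ _ _ _ _).trans ?_
        refine tensPerm_congr ?_ ?_
        · ext i : 1
          apply skip_injective (e (e' 0))
          rw [Equiv.trans_apply, skip_removeAt, skip_removeAt]
          exact (skip_removeAt (e'.trans e) 0 i).symm
        · intro i j h h'
          have h2 : ∀ l (hl : e' i.succ = l) (hl' : e l = skip (e (e' 0)) j),
              f l (skip (e (e' 0)) j) hl' ≫ g i.succ l hl =
                f (e' i.succ) (skip (e (e' 0)) j) (hl ▸ hl') ≫ g i.succ (e' i.succ) rfl := by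
            rintro _ rfl _
            rfl
          exact h2 _ (apply_succ rfl) (apply_skip h)

lemma tensPerm_refl (n : ℕ) {x y : Fin n → C} (f : ∀ i j, i = j → (x j ⟶ y i)) :
    tensPerm n n (Equiv.refl _) x y f = tensMap n (fun i => f i i rfl) := by
  induction n with
  | zero => rfl
  | succ n ih =>
    have h : removeAt (Equiv.refl (Fin (n + 1))) 0 = Equiv.refl (Fin n) := by
      ext i : 1
      exact skip_injective 0 (skip_removeAt (Equiv.refl _) 0 i)
    refine (Category.id_comp _).trans ?_
    refine congrArg (fun m => f 0 0 rfl ⊗ₘ m) ?_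
    refine Eq.trans ?_ (ih (fun i j h => f i.succ j.succ (h ▸ rfl)))
    exact tensPerm_congr h (fun _ _ _ _ => rfl)

end Tensor

/-! ### Finite families and profiles -/

/-- A finite sequence `(x₀, …, x_{n-1})` of objects. -/
structure FinFam (K : Type u) where
  len : ℕ
  obj : Fin len → K

namespace FinFam

section Category

variable {K : Type u} [Category.{v} K]

/-- A morphism of finite sequences: a bijection of positions `σ`, together with morphisms
`x (σ i) ⟶ y i`. -/
structure Hom (x y : FinFam K) where
  perm : Fin y.len ≃ Fin x.len
  hom : ∀ i, x.obj (perm i) ⟶ y.obj i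

instance : Category.{v} (FinFam K) where
  Hom := Hom
  id x := ⟨Equiv.refl _, fun i => 𝟙 (x.obj i)⟩
  comp f g := ⟨g.perm.trans f.perm, fun i => f.hom (g.perm i) ≫ g.hom i⟩
  id_comp f := congrArg (Hom.mk f.perm) (funext fun i => Category.id_comp (f.hom i))
  comp_id f := congrArg (Hom.mk f.perm) (funext fun i => Category.comp_id (f.hom i))
  assoc f g h := congrArg (Hom.mk ((h.perm.trans g.perm).trans f.perm))
    (funext fun i => Category.assoc (f.hom (g.perm (h.perm i))) (g.hom (h.perm i)) (h.hom i))

lemma hom_ext {x y : FinFam K} {f g : x ⟶ y} (h : ∀ i, f.perm i = g.perm i)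
    (h' : ∀ i, f.hom i = eqToHom (congrArg x.obj (h i)) ≫ g.hom i) : f = g := by
  obtain ⟨p, f⟩ := f
  obtain ⟨q, g⟩ := g
  obtain rfl : p = q := Equiv.ext h
  obtain rfl : f = g := funext fun i => (h' i).trans (Category.id_comp _)
  rfl

@[simp] lemma id_perm (x : FinFam K) : Hom.perm (𝟙 x) = Equiv.refl _ := rfl
@[simp] lemma id_hom (x : FinFam K) (i : Fin x.len) : Hom.hom (𝟙 x) i = 𝟙 (x.obj i) := rfl
@[simp] lemma comp_perm {x y z : FinFam K} (f : x ⟶ y) (g : y ⟶ z) :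
    (f ≫ g).perm = g.perm.trans f.perm := rfl
@[simp] lemma comp_hom {x y z : FinFam K} (f : x ⟶ y) (g : y ⟶ z) (i : Fin z.len) :
    (f ≫ g).hom i = f.hom (g.perm i) ≫ g.hom i := rfl

/-- The sequence given by a family indexed by a type `I` with an enumeration `s`. -/
def ofEquiv {n : ℕ} {I : Type} (s : Fin n ≃ I) (x : I → K) : FinFam K := ⟨n, fun i => x (s i)⟩

/-- The morphism of sequences given by a bijection of index types. -/
def ofEquivHom {n m : ℕ} {I J : Type} {s : Fin n ≃ I} {t : Fin m ≃ J} {x : I → K} {y : J → K}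
    (e : J ≃ I) (f : ∀ j, x (e j) ⟶ y j) : ofEquiv s x ⟶ ofEquiv t y where
  perm := (t.trans e).trans s.symm
  hom i := eqToHom (congrArg x (s.apply_symm_apply (e (t i)))) ≫ f (t i)

lemma ofEquivHom_id {n : ℕ} {I : Type} {s : Fin n ≃ I} {x : I → K} :
    ofEquivHom (s := s) (t := s) (Equiv.refl I) (fun i => 𝟙 (x i)) = 𝟙 (ofEquiv s x) :=
  hom_ext (fun i => s.symm_apply_apply i)
    (fun _ => rfl)

lemma ofEquivHom_comp_aux {I J : Type} {x : I → K} {y : J → K} (e : J → I)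
    (f : ∀ j, x (e j) ⟶ y j) {a b : I} {j j' : J} {c : K} (ha : a = e j) (hj : j = j')
    (hb : b = e j') (hab : x a = x b) (g : y j' ⟶ c) :
    (eqToHom (congrArg x ha) ≫ f j) ≫ (eqToHom (congrArg y hj) ≫ g) =
      eqToHom hab ≫ eqToHom (congrArg x hb) ≫ (f j' ≫ g) := by
  subst ha hj hb
  simp

lemma ofEquivHom_comp {n m l : ℕ} {I J L : Type} {s : Fin n ≃ I} {t : Fin m ≃ J} {r : Fin l ≃ L}
    {x : I → K} {y : J → K} {z : L → K}
    (e : J ≃ I) (f : ∀ j, x (e j) ⟶ y j) (e' : L ≃ J) (g : ∀ k, y (e' k) ⟶ z k) :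
    ofEquivHom (s := s) (t := t) e f ≫ ofEquivHom (t := r) e' g =
      ofEquivHom (e'.trans e) (fun k => f (e' k) ≫ g k) := by
  refine hom_ext (fun i => congrArg (fun j => s.symm (e j)) (t.apply_symm_apply _)) fun i => ?_
  exact ofEquivHom_comp_aux e f (s.apply_symm_apply (e (t (t.symm (e' (r i))))))
    (t.apply_symm_apply (e' (r i))) (s.apply_symm_apply (e (e' (r i)))) _ (g (r i))

/-- Equality of morphisms given by bijections of index types. -/
lemma ofEquivHom_congr {n m : ℕ} {I J : Type} {s : Fin n ≃ I} {t : Fin m ≃ J} {x : I → K}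
    {y : J → K} {e e' : J ≃ I} {f : ∀ j, x (e j) ⟶ y j} {f' : ∀ j, x (e' j) ⟶ y j}
    (h : ∀ j, e j = e' j) (h' : ∀ j, f j = eqToHom (congrArg x (h j)) ≫ f' j) :
    ofEquivHom (s := s) (t := t) e f = ofEquivHom e' f' := by
  obtain rfl : e = e' := Equiv.ext h
  obtain rfl : f = f' := funext fun j => (h' j).trans (Category.id_comp _)
  rfl

/-- The one-term sequence. -/
def single : K ⥤ FinFam K where
  obj a := ⟨1, fun _ => a⟩
  map f := ⟨Equiv.refl _, fun _ => f⟩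

/-- The block permutation underlying the concatenation of a morphism of sequences. -/
def concatEquiv {x y : FinFam (FinFam K)} (f : x ⟶ y) :
    ((i : Fin y.len) × Fin (y.obj i).len) ≃ ((i : Fin x.len) × Fin (x.obj i).len) :=
  (Equiv.sigmaCongrRight fun i => (f.hom i).perm).trans
    (Equiv.sigmaCongrLeft (β := fun i => Fin (x.obj i).len) f.perm)

lemma concatEquiv_apply {x y : FinFam (FinFam K)} (f : x ⟶ y)
    (p : (i : Fin y.len) × Fin (y.obj i).len) :
    concatEquiv f p = ⟨f.perm p.1, (f.hom p.1).perm p.2⟩ := rfl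

/-- Concatenation `x₀ ⊗ ⋯ ⊗ x_{n-1}` of a sequence of sequences, in lexicographic order; on
morphisms it is given by block permutations. -/
def concat : FinFam (FinFam K) ⥤ FinFam K where
  obj x := ofEquiv finSigmaFinEquiv.symm
    (fun p : (i : Fin x.len) × Fin (x.obj i).len => (x.obj p.1).obj p.2)
  map f := ofEquivHom (concatEquiv f) (fun p => (f.hom p.1).hom p.2)
  map_id x := (ofEquivHom_congr (e' := Equiv.refl _)
    (f' := fun p => 𝟙 ((x.obj p.1).obj p.2)) (fun _ => rfl)
    fun _ => (Category.id_comp _).symm).trans ofEquivHom_id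
  map_comp {x y z} f g := by
    have h := ofEquivHom_comp (s := finSigmaFinEquiv.symm) (t := finSigmaFinEquiv.symm)
      (r := finSigmaFinEquiv.symm)
      (x := fun p : (i : Fin x.len) × Fin (x.obj i).len => (x.obj p.1).obj p.2)
      (y := fun p : (i : Fin y.len) × Fin (y.obj i).len => (y.obj p.1).obj p.2)
      (z := fun p : (i : Fin z.len) × Fin (z.obj i).len => (z.obj p.1).obj p.2)
      (concatEquiv f) (fun p => (f.hom p.1).hom p.2) (concatEquiv g)
      (fun p => (g.hom p.1).hom p.2)
    refine Eq.trans ?_ h.symm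
    exact ofEquivHom_congr (fun _ => rfl) fun _ => (Category.id_comp _).symm

lemma concat_obj_obj (x : FinFam (FinFam K)) (p : (i : Fin x.len) × Fin (x.obj i).len) :
    (concat.obj x).obj (finSigmaFinEquiv p) = (x.obj p.1).obj p.2 :=
  congrArg (fun q : (i : Fin x.len) × Fin (x.obj i).len => (x.obj q.1).obj q.2)
    (finSigmaFinEquiv.symm_apply_apply p)

/-- The unit isomorphism `x ⟶ concat (x)` for a single sequence `x`. -/
def toConcatSingle (x : FinFam K) : x ⟶ concat.obj (single.obj x) :=
  ofEquivHom (s := Equiv.refl (Fin x.len)) (t := finSigmaFinEquiv.symm) (x := x.obj)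
    (y := fun p : (_ : Fin 1) × Fin x.len => x.obj p.2)
    ⟨fun p => p.2, fun i => ⟨0, i⟩, fun p => by rcases p with ⟨i, j⟩; fin_cases i; rfl,
      fun _ => rfl⟩ (fun p => 𝟙 (x.obj p.2))

variable {L : Type u₁} [Category.{v₁} L]

/-- Termwise application of a functor to a sequence. -/
def map (F : K ⥤ L) : FinFam K ⥤ FinFam L where
  obj x := ⟨x.len, fun i => F.obj (x.obj i)⟩
  map f := ⟨f.perm, fun i => F.map (f.hom i)⟩
  map_id x := congrArg (Hom.mk (Equiv.refl _)) (funext fun i => F.map_id (x.obj i))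
  map_comp f g := congrArg (Hom.mk _) (funext fun i => F.map_comp (f.hom (g.perm i)) (g.hom i))

/-- Termwise application of a natural transformation. -/
def mapNat {F G : K ⥤ L} (α : F ⟶ G) : map F ⟶ map G where
  app x := ⟨Equiv.refl _, fun i => α.app (x.obj i)⟩
  naturality _ _ f := hom_ext (fun _ => rfl)
    fun i => (α.naturality (f.hom i)).trans (Category.id_comp _).symm

lemma mapNat_id (F : K ⥤ L) : mapNat (𝟙 F) = 𝟙 (map F) := rfl

lemma mapNat_comp {F G H : K ⥤ L} (α : F ⟶ G) (β : G ⟶ H) :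
    mapNat (α ≫ β) = mapNat α ≫ mapNat β := rfl

/-- The unit isomorphism `x ⟶ concat ((x₀), …, (x_{n-1}))` for a sequence `x`. -/
def toConcatMapSingle (x : FinFam K) : x ⟶ concat.obj ((map single).obj x) :=
  ofEquivHom (s := Equiv.refl (Fin x.len)) (t := finSigmaFinEquiv.symm) (x := x.obj)
    (y := fun p : (_ : Fin x.len) × Fin 1 => x.obj p.1)
    ⟨fun p => p.1, fun i => ⟨i, 0⟩, fun p => by rcases p with ⟨i, j⟩; fin_cases j; rfl,
      fun _ => rfl⟩ (fun p => 𝟙 (x.obj p.1))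

/-- The reindexing `∐_{(i, k)} I (i, k) ≃ ∐_i ∐_k I (i, k)` underlying associativity. -/
def concatAssocEquiv (n : ℕ) (m : Fin n → ℕ) (l : ((i : Fin n) × Fin (m i)) → ℕ) :
    ((j : Fin (∑ i, m i)) × Fin (l (finSigmaFinEquiv.symm j))) ≃
      ((i : Fin n) × Fin (∑ k, l ⟨i, k⟩)) :=
  (finSigmaFinEquiv.symm.sigmaCongrLeft (β := fun p => Fin (l p))).trans
    ((Equiv.sigmaAssoc fun i k => Fin (l ⟨i, k⟩)).trans
      (Equiv.sigmaCongrRight fun _ => finSigmaFinEquiv))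

/-- The associativity isomorphism of concatenation: concatenating the concatenations `concat xᵢ`
agrees with concatenating the concatenation of the sequence of the `xᵢ`. -/
def concatAssoc (x : FinFam (FinFam (FinFam K))) :
    concat.obj ((map concat).obj x) ⟶ concat.obj (concat.obj x) :=
  ofEquivHom (s := finSigmaFinEquiv.symm) (t := finSigmaFinEquiv.symm)
    (x := fun p : (i : Fin x.len) × Fin (concat.obj (x.obj i)).len =>
      (concat.obj (x.obj p.1)).obj p.2)
    (y := fun p : (i : Fin (concat.obj x).len) × Fin ((concat.obj x).obj i).len =>
      ((concat.obj x).obj p.1).obj p.2)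
    (concatAssocEquiv x.len (fun i => (x.obj i).len) fun p => ((x.obj p.1).obj p.2).len)
    (fun p => eqToHom (concat_obj_obj (x.obj (finSigmaFinEquiv.symm p.1).1)
      ⟨(finSigmaFinEquiv.symm p.1).2, p.2⟩))

end Category
end FinFam

/-! ### Tensor products of finite sequences and their canonical morphisms -/

section TensF

variable {C : Type u} [Category.{v} C] [MonoidalCategory C] [SymmetricCategory C]

/-- The tensor product `x₀ ⊗ (x₁ ⊗ (⋯ ⊗ I))` of a finite sequence, as a functor. -/
def tensF (C : Type u) [Category.{v} C] [MonoidalCategory C] [SymmetricCategory C] :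
    FinFam C ⥤ C where
  obj x := tens x.len x.obj
  map {x y} φ := tensPerm y.len x.len φ.perm x.obj y.obj
    (fun i _ h => eqToHom (congrArg x.obj h.symm) ≫ φ.hom i)
  map_id x := by
    refine (tensPerm_refl x.len _).trans ((congrArg _ (funext fun i => ?_)).trans
      (tensMap_id x.len x.obj))
    exact Category.id_comp _
  map_comp f g := by
    refine Eq.trans ?_ (tensPerm_comp _ _ _ _ _ _ _ _ _ _).symm
    refine tensPerm_congr rfl fun i j h h' => ?_
    simp only [FinFam.comp_hom, eqToHom_refl, Category.id_comp, Category.assoc]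
    rfl

/-- The canonical morphism `(x₀ ⊗ ⋯ ⊗ x_{m-1}) ⊗ (y₀ ⊗ ⋯ ⊗ y_{k-1}) ⟶ z₀ ⊗ ⋯ ⊗ z_{n-1}`, where the
sequence `z` is the sequence `x` followed by the sequence `y`. -/
def tensAppend : (m k n : ℕ) → (h : k + m = n) → (x : Fin m → C) → (y : Fin k → C) →
    (z : Fin n → C) → (∀ (i : Fin m) (l : Fin n), (l : ℕ) = i → x i = z l) →
    (∀ (j : Fin k) (l : Fin n), (l : ℕ) = m + j → y j = z l) →
    (tens m x ⊗ tens k y ⟶ tens n z)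
  | 0, k, n, h, _, y, z, _, hy => (λ_ (tens k y)).hom ≫ tensPerm n k (finCongr h.symm) y z
      (fun l j hlj => eqToHom (hy j l (by simp [← hlj])))
  | _ + 1, _, 0, h, _, _, _, _, _ => absurd h (by omega)
  | m + 1, k, n + 1, h, x, y, z, hx, hy => (α_ _ _ _).hom ≫
      (eqToHom (hx 0 0 rfl) ⊗ₘ tensAppend m k n (by omega) (fun i => x i.succ) y
        (fun l => z l.succ) (fun i l hl => hx i.succ l.succ (by simp [hl]))
        (fun j l hl => hy j l.succ (by simp only [Fin.val_succ, hl]; omega)))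

lemma finSigmaFinEquiv_succ {n : ℕ} (m : Fin (n + 1) → ℕ) (i : Fin n) (k : Fin (m i.succ)) :
    (finSigmaFinEquiv (⟨i.succ, k⟩ : (i : Fin (n + 1)) × Fin (m i)) : ℕ) =
      m 0 + finSigmaFinEquiv (⟨i, k⟩ : (i : Fin n) × Fin (m i.succ)) := by
  rw [finSigmaFinEquiv_apply, finSigmaFinEquiv_apply]
  simp only [Fin.val_succ, Fin.sum_univ_succ]
  rw [← add_assoc]
  rfl

/-- The canonical morphism `⨂_i ⨂_k x_{i,k} ⟶ z₀ ⊗ ⋯ ⊗ z_{N-1}`, where `z` is the sequence of all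
`x_{i,k}` in lexicographic order. -/
def tensJoin : (n N : ℕ) → (m : Fin n → ℕ) → (h : ∑ i, m i = N) → (x : ∀ i, Fin (m i) → C) →
    (z : Fin N → C) →
    (∀ (p : (i : Fin n) × Fin (m i)) (l : Fin N), (l : ℕ) = finSigmaFinEquiv p → x p.1 p.2 = z l) →
    (tens n (fun i => tens (m i) (x i)) ⟶ tens N z)
  | 0, N, _, h, _, _, _ => tensPerm N 0 (finCongr (by rw [← h]; rfl)) Fin.elim0 _
      (fun _ j _ => j.elim0)
  | n + 1, N, m, h, x, z, hz =>
    _ ◁ tensJoin n (∑ i, m (Fin.succ i)) (fun i => m i.succ) rfl (fun i => x i.succ)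
        (fun l => z ⟨m 0 + l, by rw [← h, Fin.sum_univ_succ]; omega⟩)
        (fun p l hl => hz ⟨p.1.succ, p.2⟩ _ (by
          rw [finSigmaFinEquiv_succ]
          exact congrArg (fun t => m 0 + t) hl)) ≫
      tensAppend (m 0) (∑ i, m (Fin.succ i)) N (by rw [← h, Fin.sum_univ_succ]; omega) (x 0) _ z
        (fun i l hl => hz ⟨0, i⟩ l (by
          rw [hl, finSigmaFinEquiv_apply]
          simp))
        (fun j l hl => congrArg z (Fin.ext hl.symm))

/-- The canonical morphism `⨂_i ⨂_k x_{i,k} ⟶ ⨂ concat x` for a sequence of sequences. -/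
def tensConcat (x : FinFam (FinFam C)) :
    (tensF C).obj ((FinFam.map (tensF C)).obj x) ⟶ (tensF C).obj (FinFam.concat.obj x) :=
  tensJoin x.len (∑ i, (x.obj i).len) (fun i => (x.obj i).len) rfl (fun i => (x.obj i).obj)
    (FinFam.concat.obj x).obj (by
      intro p l hl
      obtain rfl : l = finSigmaFinEquiv p := Fin.ext hl
      exact (FinFam.concat_obj_obj x p).symm)

/-- The canonical morphism `(⨂_i x_i) ⊗ (⨂_i y_i) ⟶ ⨂_i (x_i ⊗ y_i)`. -/
def tensZip : (n : ℕ) → (x y : Fin n → C) → (tens n x ⊗ tens n y ⟶ tens n (fun i => x i ⊗ y i))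
  | 0, _, _ => (λ_ (𝟙_ C)).hom
  | n + 1, x, y => tensorμ _ _ _ _ ≫
      (x 0 ⊗ y 0) ◁ tensZip n (fun i => x i.succ) (fun i => y i.succ)

/-- The canonical morphism `I ⟶ I ⊗ ⋯ ⊗ I`. -/
def tensUnit : (n : ℕ) → (𝟙_ C ⟶ tens n (fun _ => 𝟙_ C))
  | 0 => 𝟙 _
  | n + 1 => (λ_ (𝟙_ C)).inv ≫ 𝟙_ C ◁ tensUnit n

end TensF

section TensLax

variable {C : Type u₁} [Category.{v₁} C] [MonoidalCategory C] [SymmetricCategory C]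
  {D : Type u₂} [Category.{v₂} D] [MonoidalCategory D] [SymmetricCategory D]
  (F : C ⥤ D) [F.LaxBraided]

/-- The canonical morphism `F x₀ ⊗ ⋯ ⊗ F x_{n-1} ⟶ F (x₀ ⊗ ⋯ ⊗ x_{n-1})` of a lax monoidal
functor. -/
def tensLax : (n : ℕ) → (x : Fin n → C) → (tens n (fun i => F.obj (x i)) ⟶ F.obj (tens n x))
  | 0, _ => ε F
  | n + 1, x => F.obj (x 0) ◁ tensLax n (fun i => x i.succ) ≫ μ F (x 0) _

lemma swapL_lax (a b c : C) : swapL (F.obj a) (F.obj b) (F.obj c) ≫ F.obj b ◁ μ F a c ≫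
    μ F b (a ⊗ c) = F.obj a ◁ μ F b c ≫ μ F a (b ⊗ c) ≫ F.map (swapL a b c) := by
  simp only [swapL, Functor.map_comp, Category.assoc]
  rw [Functor.LaxMonoidal.associativity_inv_assoc, ← Functor.LaxMonoidal.μ_natural_left_assoc,
    ← comp_whiskerRight_assoc, Functor.LaxBraided.braided, comp_whiskerRight_assoc]
  congr 2
  exact (Functor.LaxMonoidal.associativity F b a c).symm

lemma tensLax_pull (k n : ℕ) (h : k < n + 1) (x : Fin (n + 1) → C) :
    tensLax F (n + 1) x ≫ F.map (pull k n h x) =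
      pull k n h (fun i => F.obj (x i)) ≫
        F.obj (x ⟨k, h⟩) ◁ tensLax F n (fun i => x (skip ⟨k, h⟩ i)) ≫ μ F _ _ := by
  induction k generalizing n with
  | zero =>
    refine (congrArg _ (F.map_id _)).trans ((Category.comp_id _).trans (Category.id_comp _).symm)
  | succ k ih =>
    cases n with
    | zero => omega
    | succ n =>
      have aux : ∀ {A B P Q : C} {P' Q' : D} {l : P' ⟶ F.obj P} {p : P ⟶ B ⊗ Q}
          {p' : P' ⟶ F.obj B ⊗ Q'} {l' : Q' ⟶ F.obj Q},
          l ≫ F.map p = p' ≫ F.obj B ◁ l' ≫ μ F B Q →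
          (F.obj A ◁ l ≫ μ F A P) ≫ F.map (A ◁ p ≫ swapL A B Q) =
            (F.obj A ◁ p' ≫ swapL (F.obj A) (F.obj B) Q') ≫
              F.obj B ◁ (F.obj A ◁ l' ≫ μ F A Q) ≫ μ F B (A ⊗ Q) := by
        intro A B P Q P' Q' l p p' l' hl
        have n1 := swapL_natural (𝟙 (F.obj A)) (𝟙 (F.obj B)) l'
        simp only [id_tensorHom] at n1
        have h2 := congrArg (fun t => F.obj A ◁ t) hl
        simp only [MonoidalCategory.whiskerLeft_comp] at h2
        simp only [Functor.map_comp, Category.assoc, MonoidalCategory.whiskerLeft_comp]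
        rw [← Functor.LaxMonoidal.μ_natural_right_assoc, reassoc_of% h2, ← swapL_lax,
          reassoc_of% n1]
      exact aux (ih n (by omega) (fun i => x i.succ))

lemma tensLax_natural (p q : ℕ) (e : Fin p ≃ Fin q) (x : Fin q → C) (y : Fin p → C)
    (f : ∀ i j, e i = j → (x j ⟶ y i)) :
    tensLax F q x ≫ F.map (tensPerm p q e x y f) =
      tensPerm p q e (fun i => F.obj (x i)) (fun i => F.obj (y i))
        (fun i j h => F.map (f i j h)) ≫ tensLax F p y := by
  induction p generalizing q with
  | zero =>
    cases q with
    | succ q => exact (e.symm 0).elim0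
    | zero =>
      exact (congrArg _ (F.map_id _)).trans ((Category.comp_id _).trans (Category.id_comp _).symm)
  | succ p ih =>
    cases q with
    | zero => exact (e 0).elim0
    | succ q =>
      have aux : ∀ {A B Q R : C} {P : C} {P' Q' R' : D} {l : P' ⟶ F.obj P} {p : P ⟶ A ⊗ Q}
          {p' : P' ⟶ F.obj A ⊗ Q'} {l' : Q' ⟶ F.obj Q} {l'' : R' ⟶ F.obj R} {t : Q ⟶ R}
          {t' : Q' ⟶ R'} {s : A ⟶ B},
          l ≫ F.map p = p' ≫ F.obj A ◁ l' ≫ μ F A Q → l' ≫ F.map t = t' ≫ l'' →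
          l ≫ F.map (p ≫ (s ⊗ₘ t)) = (p' ≫ (F.map s ⊗ₘ t')) ≫ F.obj B ◁ l'' ≫ μ F B R := by
        intro A B Q R P P' Q' R' l p p' l' l'' t t' s h1 h2
        rw [Functor.map_comp, reassoc_of% h1, ← Functor.LaxMonoidal.μ_natural]
        simp only [← id_tensorHom, tensorHom_comp_tensorHom_assoc, Category.assoc, h2,
          Category.id_comp, Category.comp_id]
      exact aux (tensLax_pull F (e 0) q (e 0).2 x) (ih q (removeAt e 0) _ _ _)

end TensLax

/-! ### Coends `∫^b P(K b, c) ⊗ T b` -/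

section Coend

variable {B : Type w} [Category.{w} B] {P : Type u₁} [Category.{w} P]
  {M : Type u} [Category.{v} M] [HasColimitsOfSize.{w, w} M]

/-- The bifunctor `(b', b) ↦ P(K b', c) ⊗ T b`, where `S ⊗ m` denotes the coproduct of copies of `m`
indexed by a set `S`. -/
noncomputable def weightBif (K : B ⥤ P) (T : B ⥤ M) (c : P) : Bᵒᵖ ⥤ B ⥤ M where
  obj b' :=
    { obj := fun b => ∐ fun _ : (K.obj b'.unop ⟶ c) => T.obj b
      map := fun f => Limits.Sigma.map fun _ => T.map f
      map_id := fun _ => Limits.Sigma.hom_ext _ _ (by simp)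
      map_comp := fun _ _ => Limits.Sigma.hom_ext _ _ (by simp) }
  map f :=
    { app := fun b => Limits.Sigma.desc fun s =>
        Limits.Sigma.ι (fun _ : (K.obj _ ⟶ c) => T.obj b) (K.map f.unop ≫ s)
      naturality := fun _ _ _ => Limits.Sigma.hom_ext _ _ (by simp) }
  map_id _ := by
    ext b : 2
    exact Limits.Sigma.hom_ext _ _ (by simp)
  map_comp _ _ := by
    ext b : 2
    exact Limits.Sigma.hom_ext _ _ (by simp)

/-- The coend `∫^b P(K b, c) ⊗ T b`. -/
noncomputable def wcoend (K : B ⥤ P) (T : B ⥤ M) (c : P) : M := coend (weightBif K T c)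

namespace wcoend

/-- The canonical morphism `T b ⟶ ∫^b P(K b, c) ⊗ T b` at an element `s` of `P(K b, c)`. -/
noncomputable def ι (K : B ⥤ P) (T : B ⥤ M) (c : P) (b : B) (s : K.obj b ⟶ c) :
    T.obj b ⟶ wcoend K T c :=
  Limits.Sigma.ι (fun _ : (K.obj b ⟶ c) => T.obj b) s ≫ coend.ι (weightBif K T c) b

variable {K : B ⥤ P} {T : B ⥤ M} {c : P}

lemma condition {b b' : B} (f : b ⟶ b') (s : K.obj b' ⟶ c) :
    ι K T c b (K.map f ≫ s) = T.map f ≫ ι K T c b' s := by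
  have h := coend.condition (weightBif K T c) f
  have e1 : Limits.Sigma.ι (fun _ : (K.obj b' ⟶ c) => T.obj b) s ≫
      ((weightBif K T c).map f.op).app b =
        Limits.Sigma.ι (fun _ : (K.obj b ⟶ c) => T.obj b) (K.map f ≫ s) := Limits.Sigma.ι_desc _ s
  have e2 : Limits.Sigma.ι (fun _ : (K.obj b' ⟶ c) => T.obj b) s ≫
      ((weightBif K T c).obj (op b')).map f =
        T.map f ≫ Limits.Sigma.ι (fun _ : (K.obj b' ⟶ c) => T.obj b') s :=
    Limits.Sigma.ι_map (fun _ => T.map f) s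
  have aux : ∀ {U V V' W W' X : M} {a : U ⟶ V} {p : V ⟶ W} {q : W ⟶ X} {p' : V ⟶ W'}
      {q' : W' ⟶ X} {r : U ⟶ W} {r₁ : U ⟶ V'} {r₂ : V' ⟶ W'}, p ≫ q = p' ≫ q' → a ≫ p = r →
        a ≫ p' = r₁ ≫ r₂ → r ≫ q = r₁ ≫ r₂ ≫ q' := by
    intro U V V' W W' X a p q p' q' r r₁ r₂ h1 h2 h3
    rw [← h2, Category.assoc, h1, reassoc_of% h3]
  exact aux h e1 e2

lemma hom_ext {Z : M} {f g : wcoend K T c ⟶ Z}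
    (h : ∀ b s, ι K T c b s ≫ f = ι K T c b s ≫ g) : f = g := by
  refine coend.hom_ext fun b => Limits.Sigma.hom_ext _ _ fun s => ?_
  exact (Category.assoc _ _ _).symm.trans ((h b s).trans (Category.assoc _ _ _))

/-- Morphisms out of the coend. -/
noncomputable def desc {Z : M} (k : ∀ b, (K.obj b ⟶ c) → (T.obj b ⟶ Z))
    (hk : ∀ {b b' : B} (f : b ⟶ b') (s : K.obj b' ⟶ c), k b (K.map f ≫ s) = T.map f ≫ k b' s) :
    wcoend K T c ⟶ Z :=
  coend.desc (F := weightBif K T c) (fun b => Limits.Sigma.desc fun s => k b s) (fun b b' f => by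
    refine Limits.Sigma.hom_ext _ _ fun s => ?_
    simp [weightBif, hk])

lemma ι_desc {Z : M} (k : ∀ b, (K.obj b ⟶ c) → (T.obj b ⟶ Z))
    (hk : ∀ {b b' : B} (f : b ⟶ b') (s : K.obj b' ⟶ c), k b (K.map f ≫ s) = T.map f ≫ k b' s)
    (b : B) (s : K.obj b ⟶ c) : ι K T c b s ≫ desc k hk = k b s := by
  refine (Category.assoc _ _ _).trans ?_
  refine (congrArg _ (coend.ι_desc (F := weightBif K T c) _ _ b)).trans ?_
  exact Limits.Sigma.ι_desc _ s

lemma map_aux {T T' : B ⥤ M} {c c' : P} (α : T ⟶ T') (s : c ⟶ c') {b b' : B} (f : b ⟶ b')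
    (r : K.obj b' ⟶ c) : α.app b ≫ ι K T' c' b ((K.map f ≫ r) ≫ s) =
      T.map f ≫ α.app b' ≫ ι K T' c' b' (r ≫ s) := by
  rw [Category.assoc, condition, α.naturality_assoc]

/-- Functoriality of the coend in `T` and `c`. -/
noncomputable def map {T T' : B ⥤ M} {c c' : P} (α : T ⟶ T') (s : c ⟶ c') :
    wcoend K T c ⟶ wcoend K T' c' :=
  desc (fun b r => α.app b ≫ ι K T' c' b (r ≫ s)) (map_aux α s)

lemma ι_map {T T' : B ⥤ M} {c c' : P} (α : T ⟶ T') (s : c ⟶ c') (b : B) (r : K.obj b ⟶ c) :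
    ι K T c b r ≫ map α s = α.app b ≫ ι K T' c' b (r ≫ s) :=
  ι_desc (fun b r => α.app b ≫ ι K T' c' b (r ≫ s)) (map_aux α s) b r

lemma map_id (T : B ⥤ M) (c : P) : map (K := K) (𝟙 T) (𝟙 c) = 𝟙 _ :=
  hom_ext fun b s => by simp [ι_map]

lemma map_comp {T T' T'' : B ⥤ M} {c c' c'' : P} (α : T ⟶ T') (α' : T' ⟶ T'') (s : c ⟶ c')
    (s' : c' ⟶ c'') : map (K := K) (α ≫ α') (s ≫ s') = map α s ≫ map α' s' :=
  hom_ext fun b r => by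
    have h := ι_map (K := K) α s b r
    rw [reassoc_of% h]
    simp [ι_map]

end wcoend

end Coend

/-! ### Symmetric sequences and the circle product -/

/-- The groupoid of `𝔠`-profiles: finite sequences of colours, with right permutations
`σ : c ⟶ cσ` as morphisms. -/
abbrev Profile (𝔠 : Type w) : Type w := FinFam (Discrete 𝔠)

/-- `𝔠`-coloured symmetric sequences in `M`: functors `Σ_𝔠 × 𝔠 ⥤ M`. -/
def SymSeq (𝔠 : Type w) (M : Type u) [Category.{v} M] : Type (max w v u) :=
  Profile 𝔠 × Discrete 𝔠 ⥤ M

instance (𝔠 : Type w) (M : Type u) [Category.{v} M] : Category.{max w v} (SymSeq 𝔠 M) :=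
  inferInstanceAs (Category.{max w v} (Profile 𝔠 × Discrete 𝔠 ⥤ M))

/-- The groupoid of families `((b₀, a₀), …, (b_{m-1}, a_{m-1}))` of profiles `b_i` and
colours `a_i`. -/
abbrev Br (𝔠 : Type w) : Type w := FinFam (Profile 𝔠 × Discrete 𝔠)

/-- The profile `a = (a₀, …, a_{m-1})` of a family. -/
def colours (𝔠 : Type w) : Br 𝔠 ⥤ Profile 𝔠 := FinFam.map (CategoryTheory.Prod.snd _ _)

/-- The concatenation `b₀ ⊗ ⋯ ⊗ b_{m-1}` of a family. -/
def conc (𝔠 : Type w) : Br 𝔠 ⥤ Profile 𝔠 :=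
  FinFam.map (CategoryTheory.Prod.fst _ _) ⋙ FinFam.concat

namespace SymSeq

variable {𝔠 : Type w} {M : Type u} [Category.{v} M]

/-- The underlying functor of a symmetric sequence. -/
def toFunctor (X : SymSeq 𝔠 M) : Profile 𝔠 × Discrete 𝔠 ⥤ M := X

/-- The components of a morphism of symmetric sequences. -/
def app {X Y : SymSeq 𝔠 M} (f : X ⟶ Y) (p : Profile 𝔠 × Discrete 𝔠) :
    X.toFunctor.obj p ⟶ Y.toFunctor.obj p := NatTrans.app f p

/-- The morphism of symmetric sequences with given components. -/
def mkHom {X Y : SymSeq 𝔠 M} (f : ∀ p, X.toFunctor.obj p ⟶ Y.toFunctor.obj p)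
    (h : ∀ {p q} (s : p ⟶ q), X.toFunctor.map s ≫ f q = f p ≫ Y.toFunctor.map s) : X ⟶ Y :=
  NatTrans.mk f fun _ _ s => h s

lemma naturality {X Y : SymSeq 𝔠 M} (f : X ⟶ Y) {p q : Profile 𝔠 × Discrete 𝔠} (s : p ⟶ q) :
    X.toFunctor.map s ≫ app f q = app f p ≫ Y.toFunctor.map s := NatTrans.naturality f s

@[simp] lemma app_mkHom {X Y : SymSeq 𝔠 M} (f : ∀ p, X.toFunctor.obj p ⟶ Y.toFunctor.obj p)
    (h : ∀ {p q} (s : p ⟶ q), X.toFunctor.map s ≫ f q = f p ≫ Y.toFunctor.map s) (p) :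
    app (mkHom f h) p = f p := rfl

@[simp] lemma app_id (X : SymSeq 𝔠 M) (p) : app (𝟙 X) p = 𝟙 (X.toFunctor.obj p) := rfl

@[simp] lemma app_comp {X Y Z : SymSeq 𝔠 M} (f : X ⟶ Y) (g : Y ⟶ Z) (p) :
    app (f ≫ g) p = app f p ≫ app g p := rfl

@[ext] lemma hom_ext {X Y : SymSeq 𝔠 M} {f g : X ⟶ Y} (h : ∀ p, app f p = app g p) : f = g :=
  NatTrans.ext (funext h)

variable {N : Type u₁} [Category.{v₁} N]

/-- Postcomposition of symmetric sequences with a functor. -/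
def map (𝔠 : Type w) (F : M ⥤ N) : SymSeq 𝔠 M ⥤ SymSeq 𝔠 N where
  obj X := X.toFunctor ⋙ F
  map f := mkHom (X := _ ⋙ F) (Y := _ ⋙ F) (fun p => F.map (app f p)) fun s => by
    have h := congrArg (fun t => F.map t) (naturality f s)
    simp only [Functor.map_comp] at h
    exact h
  map_id X := hom_ext fun p => F.map_id _
  map_comp f g := hom_ext fun p => F.map_comp _ _

/-- Whiskering of symmetric sequences with a natural transformation. -/
def whisker {F G : M ⥤ N} (α : F ⟶ G) : map 𝔠 F ⟶ map 𝔠 G where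
  app X := mkHom (fun p => α.app (X.toFunctor.obj p)) fun s => α.naturality (X.toFunctor.map s)
  naturality _ _ f := hom_ext fun p => α.naturality (app f p)

end SymSeq

section Root

variable {𝔠 : Type w} {M : Type u} [Category.{v} M]

/-- Functoriality of `X(a; t)` in `X` and `t`. -/
def rootMap {X X' : SymSeq 𝔠 M} (f : X ⟶ X') {t t' : Discrete 𝔠} (s : t ⟶ t') :
    Functor.prod' (colours 𝔠) ((Functor.const _).obj t) ⋙ X.toFunctor ⟶
      Functor.prod' (colours 𝔠) ((Functor.const _).obj t') ⋙ X'.toFunctor :=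
  Functor.whiskerRight (NatTrans.prod' (𝟙 (colours 𝔠)) ((Functor.const _).map s)) X.toFunctor ≫
    Functor.whiskerLeft _ f

lemma rootMap_app {X X' : SymSeq 𝔠 M} (f : X ⟶ X') {t t' : Discrete 𝔠} (s : t ⟶ t') (b : Br 𝔠) :
    (rootMap f s).app b = X.toFunctor.map (Prod.mkHom (𝟙 ((colours 𝔠).obj b)) s) ≫
      SymSeq.app f ((colours 𝔠).obj b, t') := rfl

lemma rootMap_id (X : SymSeq 𝔠 M) (t : Discrete 𝔠) : rootMap (𝟙 X) (𝟙 t) = 𝟙 _ := by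
  ext b
  exact (Category.comp_id _).trans (X.toFunctor.map_id ((colours 𝔠).obj b, t))

lemma rootMap_comp {X X' X'' : SymSeq 𝔠 M} (f : X ⟶ X') (f' : X' ⟶ X'') {t t' t'' : Discrete 𝔠}
    (s : t ⟶ t') (s' : t' ⟶ t'') : rootMap (f ≫ f') (s ≫ s') = rootMap f s ≫ rootMap f' s' := by
  ext b
  have h := X.toFunctor.map_comp (Prod.mkHom (𝟙 ((colours 𝔠).obj b)) s)
    (Prod.mkHom (𝟙 ((colours 𝔠).obj b)) s')
  have h' := SymSeq.naturality f (Prod.mkHom (𝟙 ((colours 𝔠).obj b)) s')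
  have e : Prod.mkHom (𝟙 ((colours 𝔠).obj b)) (s ≫ s') =
      Prod.mkHom (𝟙 ((colours 𝔠).obj b)) s ≫ Prod.mkHom (𝟙 ((colours 𝔠).obj b)) s' :=
    Prod.ext (Category.id_comp _).symm rfl
  rw [NatTrans.comp_app, rootMap_app, rootMap_app, rootMap_app, SymSeq.app_comp, e, h,
    Category.assoc, Category.assoc, reassoc_of% h']

lemma rootMap_id_app (X : SymSeq 𝔠 M) {t t' : Discrete 𝔠} (s : t ⟶ t') (b : Br 𝔠) :
    (rootMap (𝟙 X) s).app b = X.toFunctor.map (Prod.mkHom (𝟙 ((colours 𝔠).obj b)) s) :=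
  Category.comp_id _

end Root

section Circle

variable {𝔠 : Type w} {M : Type u} [Category.{v} M] [MonoidalCategory M] [SymmetricCategory M]

/-- The functor `(b_i, a_i)_i ↦ ⨂_i Y(b_i; a_i)`. -/
def branches (Y : SymSeq 𝔠 M) : Br 𝔠 ⥤ M := FinFam.map Y.toFunctor ⋙ tensF M

/-- The functor `(b_i, a_i)_i ↦ X(a; t) ⊗ ⨂_i Y(b_i; a_i)`. -/
def circleTerm (X Y : SymSeq 𝔠 M) (t : Discrete 𝔠) : Br 𝔠 ⥤ M :=
  Functor.prod' (Functor.prod' (colours 𝔠) ((Functor.const _).obj t) ⋙ X.toFunctor) (branches Y) ⋙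
    tensor M

/-- Functoriality of `⨂_i Y(b_i; a_i)` in `Y`. -/
def branchesMap {Y Y' : SymSeq 𝔠 M} (g : Y ⟶ Y') : branches Y ⟶ branches Y' :=
  Functor.whiskerRight (FinFam.mapNat g) (tensF M)

lemma branchesMap_id (Y : SymSeq 𝔠 M) : branchesMap (𝟙 Y) = 𝟙 (branches Y) :=
  Functor.whiskerRight_id (tensF M)

lemma branchesMap_comp {Y Y' Y'' : SymSeq 𝔠 M} (g : Y ⟶ Y') (g' : Y' ⟶ Y'') :
    branchesMap (g ≫ g') = branchesMap g ≫ branchesMap g' :=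
  Functor.whiskerRight_comp (FinFam.mapNat g) (FinFam.mapNat g') (tensF M)

/-- Functoriality of `X(a; t) ⊗ ⨂_i Y(b_i; a_i)` in `X`, `Y` and `t`. -/
def circleTermMap {X X' Y Y' : SymSeq 𝔠 M} (f : X ⟶ X') (g : Y ⟶ Y') {t t' : Discrete 𝔠}
    (s : t ⟶ t') : circleTerm X Y t ⟶ circleTerm X' Y' t' :=
  Functor.whiskerRight (NatTrans.prod' (rootMap f s) (branchesMap g)) (tensor M)

lemma circleTermMap_id_app (X Y : SymSeq 𝔠 M) {t t' : Discrete 𝔠} (s : t ⟶ t') (b : Br 𝔠) :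
    (circleTermMap (𝟙 X) (𝟙 Y) s).app b =
      X.toFunctor.map (Prod.mkHom (𝟙 ((colours 𝔠).obj b)) s) ▷ (branches Y).obj b := by
  have h : (circleTermMap (𝟙 X) (𝟙 Y) s).app b =
      (rootMap (𝟙 X) s).app b ⊗ₘ (branchesMap (𝟙 Y)).app b := rfl
  rw [h, rootMap_id_app, branchesMap_id]
  exact tensorHom_id _ _

lemma circleTermMap_id (X Y : SymSeq 𝔠 M) (t : Discrete 𝔠) :
    circleTermMap (𝟙 X) (𝟙 Y) (𝟙 t) = 𝟙 _ := by
  rw [circleTermMap, rootMap_id, branchesMap_id]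
  ext b
  exact id_tensorHom_id _ _

lemma circleTermMap_comp {X X' X'' Y Y' Y'' : SymSeq 𝔠 M} (f : X ⟶ X') (f' : X' ⟶ X'')
    (g : Y ⟶ Y') (g' : Y' ⟶ Y'') {t t' t'' : Discrete 𝔠} (s : t ⟶ t') (s' : t' ⟶ t'') :
    circleTermMap (f ≫ f') (g ≫ g') (s ≫ s') = circleTermMap f g s ≫ circleTermMap f' g' s' := by
  rw [circleTermMap, rootMap_comp, branchesMap_comp]
  ext b
  exact (tensorHom_comp_tensorHom _ _ _ _).symm

lemma circleTermMap_id_comp (X Y : SymSeq 𝔠 M) {t t' t'' : Discrete 𝔠} (s : t ⟶ t')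
    (s' : t' ⟶ t'') : circleTermMap (𝟙 X) (𝟙 Y) (s ≫ s') =
      circleTermMap (𝟙 X) (𝟙 Y) s ≫ circleTermMap (𝟙 X) (𝟙 Y) s' := by
  rw [← circleTermMap_comp, Category.comp_id, Category.comp_id]

variable [HasColimitsOfSize.{w, w} M]

/-- The circle product
`(X ∘ Y)(c; t) = ∫^{(b_i, a_i)_i} Σ_𝔠(b₀ ⊗ ⋯ ⊗ b_{m-1}, c) ⊗ (X(a; t) ⊗ ⨂_i Y(b_i; a_i))`. -/
noncomputable def circle (X Y : SymSeq 𝔠 M) : SymSeq 𝔠 M :=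
  { obj := fun p => wcoend (conc 𝔠) (circleTerm X Y p.2) p.1
    map := fun s => wcoend.map (circleTermMap (𝟙 X) (𝟙 Y) s.2) s.1
    map_id := fun p => (congrArg (fun α => wcoend.map α (𝟙 p.1))
      (circleTermMap_id X Y p.2)).trans (wcoend.map_id _ _)
    map_comp := fun s s' => (congrArg (fun α => wcoend.map α (s.1 ≫ s'.1))
      (circleTermMap_id_comp X Y s.2 s'.2)).trans (wcoend.map_comp _ _ _ _)
    : Profile 𝔠 × Discrete 𝔠 ⥤ M }

end Circle

section CircleMap

variable {𝔠 : Type w} {M : Type u} [Category.{v} M] [MonoidalCategory M] [SymmetricCategory M]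
  [HasColimitsOfSize.{w, w} M]

/-- Functoriality of the circle product. -/
noncomputable def circleMap {X X' Y Y' : SymSeq 𝔠 M} (f : X ⟶ X') (g : Y ⟶ Y') :
    circle X Y ⟶ circle X' Y' :=
  SymSeq.mkHom (X := circle X Y) (Y := circle X' Y')
    (fun p => wcoend.map (circleTermMap f g (𝟙 p.2)) (𝟙 p.1)) fun {p q} s => by
      have h1 := wcoend.map_comp (K := conc 𝔠) (circleTermMap (𝟙 X) (𝟙 Y) s.2)
        (circleTermMap f g (𝟙 q.2)) s.1 (𝟙 q.1)
      have h2 := wcoend.map_comp (K := conc 𝔠) (circleTermMap f g (𝟙 p.2))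
        (circleTermMap (𝟙 X') (𝟙 Y') s.2) (𝟙 p.1) s.1
      rw [← circleTermMap_comp] at h1 h2
      simp only [Category.id_comp, Category.comp_id] at h1 h2
      exact h1.symm.trans h2

/-- The canonical morphism `X(a; t) ⊗ ⨂_i Y(b_i; a_i) ⟶ (X ∘ Y)(c; t)` at a permutation
`s : b₀ ⊗ ⋯ ⊗ b_{m-1} ⟶ c`. -/
noncomputable def circleι (X Y : SymSeq 𝔠 M) (p : Profile 𝔠 × Discrete 𝔠) (b : Br 𝔠)
    (s : (conc 𝔠).obj b ⟶ p.1) :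
    X.toFunctor.obj ((colours 𝔠).obj b, p.2) ⊗ (branches Y).obj b ⟶ (circle X Y).toFunctor.obj p :=
  wcoend.ι (conc 𝔠) (circleTerm X Y p.2) p.1 b s

lemma circleι_map (X Y : SymSeq 𝔠 M) {p q : Profile 𝔠 × Discrete 𝔠} (f : p ⟶ q) (b : Br 𝔠)
    (s : (conc 𝔠).obj b ⟶ p.1) :
    circleι X Y p b s ≫ (circle X Y).toFunctor.map f =
      (circleTermMap (𝟙 X) (𝟙 Y) f.2).app b ≫ circleι X Y q b (s ≫ f.1) :=
  wcoend.ι_map (K := conc 𝔠) (circleTermMap (𝟙 X) (𝟙 Y) f.2) f.1 b s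

end CircleMap

section CircleUnit

variable {𝔠 : Type w} {M : Type u} [Category.{v} M] [MonoidalCategory M] [HasColimitsOfSize.{w, w} M]

/-- The object `∐_S I`. -/
noncomputable abbrev copies (M : Type u) [Category.{v} M] [MonoidalCategory M]
    [HasColimitsOfSize.{w, w} M] (S : Type w) : M := ∐ fun _ : S => 𝟙_ M

variable (𝔠 M) in
/-- The unit `(c; t) ↦ Σ_𝔠(t, c) ⊗ I` of the circle product. -/
noncomputable def circleUnit : SymSeq 𝔠 M :=
  { obj := fun p => copies M (FinFam.single.obj p.2 ⟶ p.1)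
    map := fun f => Limits.Sigma.desc fun s =>
      Limits.Sigma.ι (fun _ => 𝟙_ M) (FinFam.single.map (inv f.2) ≫ s ≫ f.1)
    map_id := fun p => Limits.Sigma.hom_ext _ _ fun s => by
      refine (Limits.Sigma.ι_desc _ s).trans (Eq.trans ?_ (Category.comp_id _).symm)
      refine congrArg (fun r => Limits.Sigma.ι (fun _ => 𝟙_ M) r) ?_
      exact (Category.id_comp _).trans (Category.comp_id _)
    map_comp := fun {p q r} f g => Limits.Sigma.hom_ext _ _ fun s => by
      have aux : ∀ {U V W X : M} {a : U ⟶ V} {p : V ⟶ W} {q : W ⟶ X} {r : U ⟶ W} {t t' : U ⟶ X},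
          a ≫ p = r → r ≫ q = t → t' = t → t' = a ≫ p ≫ q := by
        rintro U V W X a p q _ _ _ rfl rfl rfl
        exact Category.assoc _ _ _
      refine (Limits.Sigma.ι_desc _ s).trans (aux (Limits.Sigma.ι_desc _ s)
        (Limits.Sigma.ι_desc _ (FinFam.single.map (inv f.2) ≫ s ≫ f.1)) ?_)
      refine congrArg (fun r => Limits.Sigma.ι (fun _ => 𝟙_ M) r) ?_
      have e : FinFam.single.map (inv (f ≫ g).2) =
          FinFam.single.map (inv g.2) ≫ FinFam.single.map (inv f.2) := by
        rw [← Functor.map_comp]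
        exact congrArg _ (Subsingleton.elim _ _)
      rw [e, Category.assoc, Category.assoc, Category.assoc]
      rfl
    : Profile 𝔠 × Discrete 𝔠 ⥤ M }

/-- The canonical morphism `I ⟶ Σ_𝔠(t, c) ⊗ I` at an element of `Σ_𝔠(t, c)`. -/
noncomputable def unitι (M : Type u) [Category.{v} M] [MonoidalCategory M]
    [HasColimitsOfSize.{w, w} M] (p : Profile 𝔠 × Discrete 𝔠)
    (s : FinFam.single.obj p.2 ⟶ p.1) : 𝟙_ M ⟶ (circleUnit 𝔠 M).toFunctor.obj p :=
  Limits.Sigma.ι (fun _ : (FinFam.single.obj p.2 ⟶ p.1) => 𝟙_ M) s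

lemma unitι_map {p q : Profile 𝔠 × Discrete 𝔠} (f : p ⟶ q) (s : FinFam.single.obj p.2 ⟶ p.1) :
    unitι M p s ≫ (circleUnit 𝔠 M).toFunctor.map f =
      unitι M q (FinFam.single.map (inv f.2) ≫ s ≫ f.1) :=
  Limits.Sigma.ι_desc _ s

end CircleUnit

section Aux

variable {N : Type u} [Category.{v} N]

lemma circleμ_aux2 {T T' C C' FT FT' D D' : N} {i : T ⟶ C} {m : C ⟶ C'} {t : T ⟶ T'} {i' : T' ⟶ C'}
    {d' : C' ⟶ D'} {l' : T' ⟶ FT'} {k' : FT' ⟶ D'} {d : C ⟶ D} {l : T ⟶ FT} {k : FT ⟶ D}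
    {m' : D ⟶ D'} {t' : FT ⟶ FT'} (e1 : i ≫ m = t ≫ i') (e2 : i' ≫ d' = l' ≫ k')
    (e3 : i ≫ d = l ≫ k) (e4 : k ≫ m' = t' ≫ k') (e5 : t ≫ l' = l ≫ t') :
    i ≫ m ≫ d' = i ≫ d ≫ m' := by
  rw [reassoc_of% e1, e2, reassoc_of% e3, e4, reassoc_of% e5]

lemma circleε_aux {I C C' I' D D' : N} {i : I ⟶ C} {m : C ⟶ C'} {i' : I ⟶ C'} {d' : C' ⟶ D'}
    {e : I ⟶ I'} {k' : I' ⟶ D'} {d : C ⟶ D} {k : I' ⟶ D} {m' : D ⟶ D'} (e1 : i ≫ m = i')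
    (e2 : i' ≫ d' = e ≫ k') (e3 : i ≫ d = e ≫ k) (e4 : k ≫ m' = k') :
    i ≫ m ≫ d' = i ≫ d ≫ m' := by
  rw [reassoc_of% e1, e2, reassoc_of% e3, e4]

end Aux

section Lax

variable {𝔠 : Type w} {M : Type u₁} [Category.{v₁} M] [MonoidalCategory M] [SymmetricCategory M]
  {N : Type u₂} [Category.{v₂} N] [MonoidalCategory N] [SymmetricCategory N]
  (F : M ⥤ N) [F.LaxBraided]

/-- The canonical natural transformation `⨂_i F Y(b_i; a_i) ⟶ F (⨂_i Y(b_i; a_i))`. -/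
def branchesLax (Y : SymSeq 𝔠 M) : branches ((SymSeq.map 𝔠 F).obj Y) ⟶ branches Y ⋙ F where
  app b := tensLax F b.len (fun i => Y.toFunctor.obj (b.obj i))
  naturality b b' f := by
    have h := tensLax_natural F b'.len b.len f.perm (fun i => Y.toFunctor.obj (b.obj i))
      (fun i => Y.toFunctor.obj (b'.obj i)) (fun i j h =>
        eqToHom (congrArg (fun i => Y.toFunctor.obj (b.obj i)) h.symm) ≫ Y.toFunctor.map (f.hom i))
    refine Eq.trans (congrArg (fun t => t ≫ _) (tensPerm_congr rfl fun i j hj _ => ?_)) h.symm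
    rw [Functor.map_comp, eqToHom_map]
    rfl

/-- The canonical natural transformation
`F X(a; t) ⊗ ⨂_i F Y(b_i; a_i) ⟶ F (X(a; t) ⊗ ⨂_i Y(b_i; a_i))`. -/
def circleTermLax (X Y : SymSeq 𝔠 M) (t : Discrete 𝔠) :
    circleTerm ((SymSeq.map 𝔠 F).obj X) ((SymSeq.map 𝔠 F).obj Y) t ⟶ circleTerm X Y t ⋙ F where
  app b := F.obj (X.toFunctor.obj ((colours 𝔠).obj b, t)) ◁ (branchesLax F Y).app b ≫ μ F _ _
  naturality b b' f := by
    have h := (branchesLax F Y).naturality f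
    have aux : ∀ {A A' B B' : M} {P P' : N} {u : A ⟶ A'} {v : B ⟶ B'} {p : P ⟶ P'}
        {l : P ⟶ F.obj B} {l' : P' ⟶ F.obj B'}, p ≫ l' = l ≫ F.map v →
        (F.map u ⊗ₘ p) ≫ F.obj A' ◁ l' ≫ μ F A' B' =
          (F.obj A ◁ l ≫ μ F A B) ≫ F.map (u ⊗ₘ v) := by
      intro A A' B B' P P' u v p l l' h
      rw [Category.assoc, ← Functor.LaxMonoidal.μ_natural]
      simp only [← id_tensorHom, tensorHom_comp_tensorHom_assoc, h, Category.id_comp,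
        Category.comp_id]
    exact aux h

lemma circleTermLax_natural (X Y : SymSeq 𝔠 M) {t t' : Discrete 𝔠} (s : t ⟶ t') (b : Br 𝔠) :
    (circleTermMap (𝟙 ((SymSeq.map 𝔠 F).obj X)) (𝟙 ((SymSeq.map 𝔠 F).obj Y)) s).app b ≫
        (circleTermLax F X Y t').app b =
      (circleTermLax F X Y t).app b ≫ F.map ((circleTermMap (𝟙 X) (𝟙 Y) s).app b) := by
  rw [circleTermMap_id_app, circleTermMap_id_app]
  have aux : ∀ {A A' B : M} {P : N} {u : A ⟶ A'} {l : P ⟶ F.obj B},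
      F.map u ▷ P ≫ F.obj A' ◁ l ≫ μ F A' B = (F.obj A ◁ l ≫ μ F A B) ≫ F.map (u ▷ B) := by
    intro A A' B P u l
    rw [Category.assoc, ← Functor.LaxMonoidal.μ_natural_left, ← whisker_exchange_assoc]
  exact aux

variable [HasColimitsOfSize.{w, w} M]

lemma circleμ_aux (X Y : SymSeq 𝔠 M) (p : Profile 𝔠 × Discrete 𝔠) {b b' : Br 𝔠} (f : b ⟶ b')
    (s : (conc 𝔠).obj b' ⟶ p.1) :
    (circleTermLax F X Y p.2).app b ≫ F.map (circleι X Y p b ((conc 𝔠).map f ≫ s)) =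
      (circleTerm ((SymSeq.map 𝔠 F).obj X) ((SymSeq.map 𝔠 F).obj Y) p.2).map f ≫
        (circleTermLax F X Y p.2).app b' ≫ F.map (circleι X Y p b' s) := by
  have h := (circleTermLax F X Y p.2).naturality f
  have h' := congrArg (fun t => F.map t) (wcoend.condition (T := circleTerm X Y p.2) f s)
  simp only [Functor.map_comp] at h'
  rw [reassoc_of% h]
  exact congrArg _ h'

variable [HasColimitsOfSize.{w, w} N]

/-- The components of `circleμ`. -/
noncomputable def circleμApp (X Y : SymSeq 𝔠 M) (p : Profile 𝔠 × Discrete 𝔠) :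
    (circle ((SymSeq.map 𝔠 F).obj X) ((SymSeq.map 𝔠 F).obj Y)).toFunctor.obj p ⟶
      F.obj ((circle X Y).toFunctor.obj p) :=
  wcoend.desc (fun b s => (circleTermLax F X Y p.2).app b ≫ F.map (circleι X Y p b s))
    (circleμ_aux F X Y p)

lemma ι_circleμApp (X Y : SymSeq 𝔠 M) (p : Profile 𝔠 × Discrete 𝔠) (b : Br 𝔠)
    (s : (conc 𝔠).obj b ⟶ p.1) :
    circleι ((SymSeq.map 𝔠 F).obj X) ((SymSeq.map 𝔠 F).obj Y) p b s ≫ circleμApp F X Y p =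
      (circleTermLax F X Y p.2).app b ≫ F.map (circleι X Y p b s) :=
  wcoend.ι_desc (fun b s => (circleTermLax F X Y p.2).app b ≫ F.map (circleι X Y p b s))
    (circleμ_aux F X Y p) b s

/-- The canonical morphism `(F_* X) ∘ (F_* Y) ⟶ F_* (X ∘ Y)` of symmetric sequences induced by a
lax symmetric monoidal functor `F`: it is built from the lax monoidal structure of `F` and the
canonical comparison of `F` with coends. -/
noncomputable def circleμ (X Y : SymSeq 𝔠 M) :
    circle ((SymSeq.map 𝔠 F).obj X) ((SymSeq.map 𝔠 F).obj Y) ⟶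
      (SymSeq.map 𝔠 F).obj (circle X Y) :=
  SymSeq.mkHom (fun p => circleμApp F X Y p) fun {p q} f => by
    refine wcoend.hom_ext fun b s => ?_
    have e1 := circleι_map ((SymSeq.map 𝔠 F).obj X) ((SymSeq.map 𝔠 F).obj Y) f b s
    have e2 := ι_circleμApp F X Y q b (s ≫ f.1)
    have e3 := ι_circleμApp F X Y p b s
    have e4 := (F.map_comp _ _).symm.trans
      ((congrArg (fun t => F.map t) (circleι_map X Y f b s)).trans (F.map_comp _ _))
    have e5 := circleTermLax_natural F X Y f.2 b
    exact circleμ_aux2 e1 e2 e3 e4 e5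

/-- The canonical morphism `I_∘ ⟶ F_* I_∘` induced by `F`. -/
noncomputable def circleε : circleUnit 𝔠 N ⟶ (SymSeq.map 𝔠 F).obj (circleUnit 𝔠 M) :=
  SymSeq.mkHom (fun p => Limits.Sigma.desc fun s => ε F ≫ F.map (unitι M p s)) fun {p q} f => by
    refine Limits.Sigma.hom_ext _ _ fun s => ?_
    have e1 := unitι_map (M := N) f s
    have e2 := Limits.Sigma.ι_desc (fun s => ε F ≫ F.map (unitι M q s))
      (FinFam.single.map (inv f.2) ≫ s ≫ f.1)
    have e3 := Limits.Sigma.ι_desc (fun s => ε F ≫ F.map (unitι M p s)) s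
    have e4 := (F.map_comp _ _).symm.trans
      (congrArg (fun t => F.map t) (unitι_map (M := M) f s))
    exact circleε_aux e1 e2 e3 e4

end Lax

/-! ### The involutive structure on symmetric sequences -/

instance (𝔠 : Type w) (M : Type u) [Category.{v} M] [InvolutiveCategory M] :
    InvolutiveCategory (SymSeq 𝔠 M) where
  J := SymSeq.map 𝔠 (invJ M)
  j :=
    { hom :=
        { app := fun X => SymSeq.mkHom (X := X) (fun p => (invj M).hom.app (X.toFunctor.obj p))
            fun s => (invj M).hom.naturality (X.toFunctor.map s)
          naturality := fun _ _ f => SymSeq.hom_ext fun p =>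
            (invj M).hom.naturality (SymSeq.app f p) }
      inv :=
        { app := fun X => SymSeq.mkHom (Y := X) (fun p => (invj M).inv.app (X.toFunctor.obj p))
            fun s => (invj M).inv.naturality (X.toFunctor.map s)
          naturality := fun _ _ f => SymSeq.hom_ext fun p =>
            (invj M).inv.naturality (SymSeq.app f p) }
      hom_inv_id := by
        ext X : 2
        exact SymSeq.hom_ext fun p => (invj M).hom_inv_id_app (X.toFunctor.obj p)
      inv_hom_id := by
        ext X : 2
        exact SymSeq.hom_ext fun p => (invj M).inv_hom_id_app (X.toFunctor.obj p) }
  j_J X := SymSeq.hom_ext fun p => InvolutiveCategory.j_J (X.toFunctor.obj p)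

section Identification

variable (𝔠 : Type w) (M : Type u) [Category.{v} M] [InvolutiveCategory M]

/-- The canonical functor from `*`-objects in symmetric sequences to symmetric sequences of
`*`-objects. -/
def starSymSeq : StarObj (SymSeq 𝔠 M) ⥤ SymSeq 𝔠 (StarObj M) where
  obj A :=
    { obj := fun p => ⟨A.obj.toFunctor.obj p, SymSeq.app A.star p,
        congrArg (fun f => SymSeq.app f p) A.star_star⟩
      map := fun s => ⟨A.obj.toFunctor.map s, (SymSeq.naturality A.star s).symm⟩
      map_id := fun p => StarObj.hom_ext (A.obj.toFunctor.map_id p)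
      map_comp := fun s s' => StarObj.hom_ext (A.obj.toFunctor.map_comp s s')
      : Profile 𝔠 × Discrete 𝔠 ⥤ StarObj M }
  map f := SymSeq.mkHom
    (fun p => ⟨SymSeq.app f.hom p, congrArg (fun g => SymSeq.app g p) f.comm⟩)
    fun s => StarObj.hom_ext (SymSeq.naturality f.hom s)
  map_id _ := rfl
  map_comp _ _ := rfl

/-- The canonical functor from symmetric sequences of `*`-objects to `*`-objects in symmetric
sequences. -/
def symSeqStar : SymSeq 𝔠 (StarObj M) ⥤ StarObj (SymSeq 𝔠 M) where
  obj X :=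
    { obj := (SymSeq.map 𝔠 (StarObj.forget M)).obj X
      star := SymSeq.mkHom (fun p => (X.toFunctor.obj p).star)
        fun s => (X.toFunctor.map s).comm.symm
      star_star := SymSeq.hom_ext fun p => (X.toFunctor.obj p).star_star }
  map f := ⟨(SymSeq.map 𝔠 (StarObj.forget M)).map f,
    SymSeq.hom_ext fun p => (SymSeq.app f p).comm⟩
  map_id _ := rfl
  map_comp _ _ := rfl

end Identification

/-! ### The monoidal structure given by the circle product -/

section Coherence

variable {𝔠 : Type w}

/-- The data `((g_i, a_i))_i`, where each `g_i` is itself a family of pairs, as the family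
obtained by joining all the `g_i`. -/
def joinBr : FinFam (Br 𝔠 × Discrete 𝔠) ⥤ Br 𝔠 :=
  FinFam.map (CategoryTheory.Prod.fst _ _) ⋙ FinFam.concat

/-- The family of pairs `(b_i, a_i)`, where `b_i` is the profile of colours of `g_i`. -/
def innerColours : FinFam (Br 𝔠 × Discrete 𝔠) ⥤ Br 𝔠 :=
  FinFam.map (Functor.prod (colours 𝔠) (𝟭 _))

/-- The family of pairs `(b_i, a_i)`, where `b_i` is the concatenation of `g_i`. -/
def innerConc : FinFam (Br 𝔠 × Discrete 𝔠) ⥤ Br 𝔠 :=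
  FinFam.map (Functor.prod (conc 𝔠) (𝟭 _))

/-- The profile of colours of the joined family is the concatenation of the profiles of colours. -/
def joinColours (h : FinFam (Br 𝔠 × Discrete 𝔠)) :
    (conc 𝔠).obj (innerColours.obj h) ⟶ (colours 𝔠).obj (joinBr.obj h) :=
  𝟙 ((conc 𝔠).obj (innerColours.obj h))

/-- The associativity isomorphism between the two total concatenations. -/
def joinConc (h : FinFam (Br 𝔠 × Discrete 𝔠)) :
    (conc 𝔠).obj (innerConc.obj h) ⟶ (conc 𝔠).obj (joinBr.obj h) :=
  FinFam.concatAssoc ((FinFam.map (CategoryTheory.Prod.fst _ _ ⋙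
    FinFam.map (CategoryTheory.Prod.fst _ _))).obj h)

/-- The family `((c₀), c₀), …, ((c_{n-1}), c_{n-1})` associated with a profile. -/
def singles : Profile 𝔠 ⥤ Br 𝔠 := FinFam.map (Functor.prod' FinFam.single (𝟭 _))

variable {M : Type u} [Category.{v} M] [MonoidalCategory M] [SymmetricCategory M]
  [HasColimitsOfSize.{w, w} M]

/-- For a family `h = (g_i, a_i)_i`, the canonical morphism from
`(X(a; t) ⊗ ⨂_i Y(colours g_i; a_i)) ⊗ ⨂_i ⨂_k Z(g_{i,k})` to `(X ∘ Y) ∘ Z`. -/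
noncomputable def generatorLeft (X Y Z : SymSeq 𝔠 M) (h : FinFam (Br 𝔠 × Discrete 𝔠))
    (t : Discrete 𝔠) :
    (X.toFunctor.obj ((colours 𝔠).obj (innerColours.obj h), t) ⊗
        (branches Y).obj (innerColours.obj h)) ⊗
        tens h.len (fun i => (branches Z).obj (h.obj i).1) ⟶
      (circle (circle X Y) Z).toFunctor.obj ((conc 𝔠).obj (joinBr.obj h), t) :=
  (circleι X Y ((colours 𝔠).obj (joinBr.obj h), t) (innerColours.obj h) (joinColours h) ⊗ₘ
    tensConcat ((FinFam.map (CategoryTheory.Prod.fst _ _ ⋙ FinFam.map Z.toFunctor)).obj h)) ≫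
  circleι (circle X Y) Z ((conc 𝔠).obj (joinBr.obj h), t) (joinBr.obj h) (𝟙 _)

/-- For a family `h = (g_i, a_i)_i`, the canonical morphism from
`(X(a; t) ⊗ ⨂_i Y(colours g_i; a_i)) ⊗ ⨂_i ⨂_k Z(g_{i,k})` to `X ∘ (Y ∘ Z)`. -/
noncomputable def generatorRight (X Y Z : SymSeq 𝔠 M) (h : FinFam (Br 𝔠 × Discrete 𝔠))
    (t : Discrete 𝔠) :
    (X.toFunctor.obj ((colours 𝔠).obj (innerColours.obj h), t) ⊗
        (branches Y).obj (innerColours.obj h)) ⊗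
        tens h.len (fun i => (branches Z).obj (h.obj i).1) ⟶
      (circle X (circle Y Z)).toFunctor.obj ((conc 𝔠).obj (joinBr.obj h), t) :=
  (α_ _ _ _).hom ≫
  X.toFunctor.obj ((colours 𝔠).obj (innerColours.obj h), t) ◁
    (tensZip h.len (fun i => Y.toFunctor.obj ((colours 𝔠).obj (h.obj i).1, (h.obj i).2))
        (fun i => (branches Z).obj (h.obj i).1) ≫
      tensMap h.len (fun i => circleι Y Z ((conc 𝔠).obj (h.obj i).1, (h.obj i).2)
        (h.obj i).1 (𝟙 _))) ≫
  circleι X (circle Y Z) ((conc 𝔠).obj (joinBr.obj h), t) (innerConc.obj h) (joinConc h)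

/-- The canonical morphism from `I ⊗ (X(b; t) ⊗ I)` to `I_∘ ∘ X`. -/
noncomputable def generatorUnitLeft (X : SymSeq 𝔠 M) (b : Profile 𝔠) (t : Discrete 𝔠) :
    𝟙_ M ⊗ (X.toFunctor.obj (b, t) ⊗ 𝟙_ M) ⟶
      (circle (circleUnit 𝔠 M) X).toFunctor.obj (FinFam.concat.obj (FinFam.single.obj b), t) :=
  unitι M (FinFam.single.obj t, t) (𝟙 _) ▷ (X.toFunctor.obj (b, t) ⊗ 𝟙_ M) ≫
  circleι (circleUnit 𝔠 M) X (FinFam.concat.obj (FinFam.single.obj b), t)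
    (FinFam.single.obj (b, t)) (𝟙 _)

/-- The canonical morphism from `X(a; t) ⊗ (I ⊗ ⋯ ⊗ I)` to `X ∘ I_∘`. -/
noncomputable def generatorUnitRight (X : SymSeq 𝔠 M) (a : Profile 𝔠) (t : Discrete 𝔠) :
    X.toFunctor.obj (a, t) ⊗ tens a.len (fun _ => 𝟙_ M) ⟶
      (circle X (circleUnit 𝔠 M)).toFunctor.obj
        (FinFam.concat.obj ((FinFam.map FinFam.single).obj a), t) :=
  X.toFunctor.obj (a, t) ◁
    tensMap a.len (fun i => unitι M (FinFam.single.obj (a.obj i), a.obj i) (𝟙 _)) ≫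
  circleι X (circleUnit 𝔠 M) (FinFam.concat.obj ((FinFam.map FinFam.single).obj a), t)
    (singles.obj a) (𝟙 _)

variable (𝔠 M) in
/-- The monoidal structure `(∘, I_∘)` on symmetric sequences. The associator and the unitors are
the canonical ones: they are pinned down by their values on the canonical morphisms into the
coends, where they are given by the coherence isomorphisms of `M` and of `Σ_𝔠`. -/
structure CircleMonoidal where
  /-- the associator -/
  assoc (X Y Z : SymSeq 𝔠 M) : circle (circle X Y) Z ≅ circle X (circle Y Z)
  /-- the left unitor -/
  leftUnitor (X : SymSeq 𝔠 M) : circle (circleUnit 𝔠 M) X ≅ X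
  /-- the right unitor -/
  rightUnitor (X : SymSeq 𝔠 M) : circle X (circleUnit 𝔠 M) ≅ X
  assoc_generator (X Y Z : SymSeq 𝔠 M) (h : FinFam (Br 𝔠 × Discrete 𝔠)) (t : Discrete 𝔠) :
    generatorLeft X Y Z h t ≫ SymSeq.app (assoc X Y Z).hom _ = generatorRight X Y Z h t
  leftUnitor_generator (X : SymSeq 𝔠 M) (b : Profile 𝔠) (t : Discrete 𝔠) :
    generatorUnitLeft X b t ≫ SymSeq.app (leftUnitor X).hom _ =
      (λ_ _).hom ≫ (ρ_ _).hom ≫ X.toFunctor.map (Prod.mkHom (FinFam.toConcatSingle b) (𝟙 t))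
  rightUnitor_generator (X : SymSeq 𝔠 M) (a : Profile 𝔠) (t : Discrete 𝔠) :
    (ρ_ _).inv ≫ X.toFunctor.obj (a, t) ◁ tensUnit a.len ≫
        generatorUnitRight X a t ≫ SymSeq.app (rightUnitor X).hom _ =
      X.toFunctor.map (Prod.mkHom (FinFam.toConcatMapSingle a) (𝟙 t))
  assoc_naturality {X X' Y Y' Z Z' : SymSeq 𝔠 M} (f : X ⟶ X') (g : Y ⟶ Y') (h : Z ⟶ Z') :
    circleMap (circleMap f g) h ≫ (assoc X' Y' Z').hom =
      (assoc X Y Z).hom ≫ circleMap f (circleMap g h)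
  leftUnitor_naturality {X X' : SymSeq 𝔠 M} (f : X ⟶ X') :
    circleMap (𝟙 (circleUnit 𝔠 M)) f ≫ (leftUnitor X').hom = (leftUnitor X).hom ≫ f
  rightUnitor_naturality {X X' : SymSeq 𝔠 M} (f : X ⟶ X') :
    circleMap f (𝟙 (circleUnit 𝔠 M)) ≫ (rightUnitor X').hom = (rightUnitor X).hom ≫ f
  pentagon (W X Y Z : SymSeq 𝔠 M) :
    circleMap (assoc W X Y).hom (𝟙 Z) ≫ (assoc W (circle X Y) Z).hom ≫
        circleMap (𝟙 W) (assoc X Y Z).hom =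
      (assoc (circle W X) Y Z).hom ≫ (assoc W X (circle Y Z)).hom
  triangle (X Y : SymSeq 𝔠 M) :
    (assoc X (circleUnit 𝔠 M) Y).hom ≫ circleMap (𝟙 X) (leftUnitor Y).hom =
      circleMap (rightUnitor X).hom (𝟙 Y)

lemma circleMap_id (X Y : SymSeq 𝔠 M) : circleMap (𝟙 X) (𝟙 Y) = 𝟙 (circle X Y) :=
  SymSeq.hom_ext fun p => (congrArg (fun α => wcoend.map α (𝟙 p.1))
    (circleTermMap_id X Y p.2)).trans (wcoend.map_id _ _)

lemma circleMap_comp {X X' X'' Y Y' Y'' : SymSeq 𝔠 M} (f : X ⟶ X') (f' : X' ⟶ X'')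
    (g : Y ⟶ Y') (g' : Y' ⟶ Y'') :
    circleMap (f ≫ f') (g ≫ g') = circleMap f g ≫ circleMap f' g' := by
  refine SymSeq.hom_ext fun p => ?_
  have h := wcoend.map_comp (K := conc 𝔠) (circleTermMap f g (𝟙 p.2)) (circleTermMap f' g' (𝟙 p.2))
    (𝟙 p.1) (𝟙 p.1)
  rw [← circleTermMap_comp, Category.comp_id, Category.comp_id] at h
  exact h

/-- The monoidal category `(SymSeq 𝔠 M, ∘, I_∘)`. -/
@[reducible]
noncomputable def CircleMonoidal.monoidalCategory (K : CircleMonoidal 𝔠 M) :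
    MonoidalCategory (SymSeq 𝔠 M) where
  tensorObj X Y := circle X Y
  tensorHom f g := circleMap f g
  whiskerLeft X _ _ g := circleMap (𝟙 X) g
  whiskerRight f Y := circleMap f (𝟙 Y)
  tensorUnit := circleUnit 𝔠 M
  associator := K.assoc
  leftUnitor := K.leftUnitor
  rightUnitor := K.rightUnitor
  tensorHom_def f g := by
    rw [← circleMap_comp, Category.comp_id, Category.id_comp]
  id_tensorHom_id X Y := circleMap_id X Y
  tensorHom_comp_tensorHom f g f' g' := (circleMap_comp f f' g g').symm
  whiskerLeft_id X Y := circleMap_id X Y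
  id_whiskerRight X Y := circleMap_id X Y
  associator_naturality := K.assoc_naturality
  leftUnitor_naturality := K.leftUnitor_naturality
  rightUnitor_naturality := K.rightUnitor_naturality
  pentagon := K.pentagon
  triangle := K.triangle

/-- The involutive monoidal structure on the monoidal category of symmetric sequences, whose
involution endofunctor `J_*` carries the canonical monoidal structure. -/
structure CircleInvolution [InvolutiveCategory M] [InvolutiveSymmetricMonoidalCategory M]
    (K : CircleMonoidal 𝔠 M) where
  /-- the involutive monoidal category -/
  toInvolutive :
    letI := K.monoidalCategory
    InvolutiveMonoidalCategory (SymSeq 𝔠 M)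
  μ_eq (X Y : SymSeq 𝔠 M) :
    letI := K.monoidalCategory
    letI := toInvolutive
    μ (invJ (SymSeq 𝔠 M)) X Y = circleμ (invJ M) X Y
  ε_eq :
    letI := K.monoidalCategory
    letI := toInvolutive
    ε (invJ (SymSeq 𝔠 M)) = circleε (invJ M)

end Coherence

end SymSeqInv

open SymSeqInv

set_option linter.unusedSimpArgs false
set_option linter.unusedVariables false
set_option linter.unusedSectionVars false

namespace SymSeqInv

section TensAppend

variable {C : Type u} [Category.{v} C] [MonoidalCategory C] [SymmetricCategory C]

lemma tensPerm_succ_of_apply_zero {p q : ℕ} (e : Fin (p + 1) ≃ Fin (q + 1)) (x : Fin (q + 1) → C)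
    (y : Fin (p + 1) → C) (f : ∀ i j, e i = j → (x j ⟶ y i)) (k : Fin (q + 1)) (hk : e 0 = k)
    (e' : Fin p ≃ Fin q) (he : ∀ i, e i.succ = skip k (e' i)) :
    tensPerm (p + 1) (q + 1) e x y f = pull k q k.2 x ≫ (f 0 k hk ⊗ₘ
      tensPerm p q e' (fun j => x (skip k j)) (fun i => y i.succ)
        (fun i j h => f i.succ (skip k j) (by rw [he, h]))) := by
  subst hk
  have h : removeAt e 0 = e' := by
    ext i : 1
    exact skip_injective (e 0) ((skip_removeAt e 0 i).trans (he i))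
  exact congrArg (fun t => pull (e 0) q (e 0).2 x ≫ (f 0 (e 0) rfl ⊗ₘ t))
    (tensPerm_congr h (fun _ _ _ _ => rfl))

lemma tensPerm_succ_fix {p q : ℕ} (e : Fin (p + 1) ≃ Fin (q + 1)) (x : Fin (q + 1) → C)
    (y : Fin (p + 1) → C) (f : ∀ i j, e i = j → (x j ⟶ y i)) (h0 : e 0 = 0)
    (e' : Fin p ≃ Fin q) (he : ∀ i, e i.succ = (e' i).succ) :
    tensPerm (p + 1) (q + 1) e x y f = f 0 0 h0 ⊗ₘ
      tensPerm p q e' (fun j => x j.succ) (fun i => y i.succ)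
        (fun i j h => f i.succ j.succ (by rw [he, h])) :=
  (tensPerm_succ_of_apply_zero e x y f 0 h0 e' he).trans (Category.id_comp _)

lemma tensPerm_eq_id {p : ℕ} (e : Fin p ≃ Fin p) (x : Fin p → C)
    (f : ∀ i j, e i = j → (x j ⟶ x i)) (he : ∀ i, e i = i) (hf : ∀ i h, f i i h = 𝟙 _) :
    tensPerm p p e x x f = 𝟙 _ := by
  obtain rfl : e = Equiv.refl _ := Equiv.ext he
  refine (tensPerm_refl p f).trans (Eq.trans ?_ (tensMap_id p x))
  exact congrArg _ (funext fun i => hf i rfl)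

lemma removeAt_zero_succ {p q : ℕ} (e : Fin (p + 1) ≃ Fin (q + 1)) (h : e 0 = 0) (i : Fin p) :
    e i.succ = (removeAt e 0 i).succ := by
  have h' := skip_removeAt e 0 i
  rw [h] at h'
  exact h'.symm

lemma tensAppend_natural_right (m : ℕ) : ∀ (k k' n n' : ℕ) (h : k + m = n) (h' : k' + m = n')
    (x : Fin m → C) (y : Fin k → C) (y' : Fin k' → C) (z : Fin n → C) (z' : Fin n' → C)
    (hx : ∀ (i : Fin m) (l : Fin n), (l : ℕ) = i → x i = z l)
    (hy : ∀ (j : Fin k) (l : Fin n), (l : ℕ) = m + j → y j = z l)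
    (hx' : ∀ (i : Fin m) (l : Fin n'), (l : ℕ) = i → x i = z' l)
    (hy' : ∀ (j : Fin k') (l : Fin n'), (l : ℕ) = m + j → y' j = z' l)
    (e : Fin k' ≃ Fin k) (f : ∀ i j, e i = j → (y j ⟶ y' i))
    (E : Fin n' ≃ Fin n) (F : ∀ i j, E i = j → (z j ⟶ z' i))
    (_ : ∀ l : Fin n', (l : ℕ) < m → (E l : ℕ) = l)
    (_ : ∀ (l : Fin n') (i : Fin k'), (l : ℕ) = m + i → (E l : ℕ) = m + e i)
    (_ : ∀ (i : Fin m) (l : Fin n') (l' : Fin n) (hl : (l : ℕ) = i) (hl' : (l' : ℕ) = i) H,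
      F l l' H = eqToHom ((hx i l' hl').symm.trans (hx' i l hl)))
    (_ : ∀ (i : Fin k') (j : Fin k) hij (l : Fin n') (l' : Fin n) (hl : (l : ℕ) = m + i) (hl' : (l' : ℕ) = m + j) H,
      F l l' H = eqToHom (hy j l' hl').symm ≫ f i j hij ≫ eqToHom (hy' i l hl)),
    tens m x ◁ tensPerm k' k e y y' f ≫ tensAppend m k' n' h' x y' z' hx' hy' =
      tensAppend m k n h x y z hx hy ≫ tensPerm n' n E z z' F := by
  induction m with
  | zero =>
    intro k k' n n' h h' x y y' z z' hx hy hx' hy' e f E F hE1 hE2 hF1 hF2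
    obtain rfl : k = n := h
    obtain rfl : k' = n' := h'
    have e1 : tensPerm k' k e y y' f ≫ tensPerm k' k' (finCongr rfl) y' z'
        (fun l j hlj => eqToHom (hy' j l (by simp [← hlj]))) =
        tensPerm k k (finCongr rfl) y z (fun l j hlj => eqToHom (hy j l (by simp [← hlj]))) ≫
          tensPerm k' k E z z' F := by
      rw [tensPerm_comp, tensPerm_comp]
      have hE : ∀ i, E i = e i := fun i => Fin.ext (by simpa using hE2 i i (by simp))
      refine tensPerm_congr ?_ ?_
      · ext i : 1
        simp [hE]
      · intro i j h1 h2
        obtain rfl : e i = j := h1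
        have h3 := hF2 i (e i) rfl i (E i) (by simp) (by simp [hE]) rfl
        have aux : ∀ {A A' B B' : C} {a : A ⟶ A'} {b b' : A' ⟶ A} {g : A ⟶ B} {c d : B ⟶ B'},
            a ≫ b' = 𝟙 _ → c = d → b = b' → g ≫ c = a ≫ b ≫ g ≫ d := by
          rintro A A' B B' a b _ g c _ h rfl rfl
          rw [reassoc_of% h]
        refine (aux ?_ rfl rfl).trans (congrArg _ h3.symm)
        simp
    refine (leftUnitor_naturality_assoc _ _).trans ?_
    refine Eq.trans ?_ (Category.assoc _ _ _).symm
    exact congrArg _ e1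
  | succ m ih =>
    intro k k' n n' h h' x y y' z z' hx hy hx' hy' e f E F hE1 hE2 hF1 hF2
    cases n with
    | zero => omega
    | succ n =>
    cases n' with
    | zero => omega
    | succ n' =>
    have h0 : E 0 = 0 := Fin.ext (hE1 0 (by simp))
    have hs := removeAt_zero_succ E h0
    have hs' : ∀ i, (removeAt E 0 i : ℕ) + 1 = E i.succ := fun i => by rw [hs]; rfl
    have IH := ih k k' n n' (by omega) (by omega) (fun i => x i.succ) y y' (fun i => z i.succ)
      (fun i => z' i.succ) (fun i l hl => hx i.succ l.succ (by simp [hl]))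
      (fun j l hl => hy j l.succ (by simp only [Fin.val_succ, hl]; omega))
      (fun i l hl => hx' i.succ l.succ (by simp [hl]))
      (fun j l hl => hy' j l.succ (by simp only [Fin.val_succ, hl]; omega)) e f
      (removeAt E 0) (fun i j h => F i.succ j.succ (by rw [hs, h]))
      (fun l hl => by
        have h1 : (E l.succ : ℕ) = l + 1 := hE1 l.succ (by simp [hl])
        have h2 := hs' l
        omega)
      (fun l i hl => by
        have := hE2 l.succ i (by simp [hl]; omega); have := hs' l; omega)
      (fun i l l' hl hl' H => hF1 i.succ l.succ l'.succ (by simp [hl]) (by simp [hl']) (by rw [hs, H]))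
      (fun i j hij l l' hl hl' H => hF2 i j hij l.succ l'.succ (by simp [hl]; omega)
        (by simp [hl']; omega) (by rw [hs, H]))
    rw [tensPerm_succ_fix E z z' F h0 _ hs, hF1 0 0 0 rfl rfl h0]
    have aux : ∀ {A A' A'' X Y Y' Z Z' : C} {p : Y ⟶ Y'} {q : X ⊗ Y' ⟶ Z'} {r : X ⊗ Y ⟶ Z}
        {s : Z ⟶ Z'} {a : A ⟶ A'} {b : A' ⟶ A''} {c : A ⟶ A''} (_ : c = a ≫ b)
        (_ : X ◁ p ≫ q = r ≫ s),
        (A ⊗ X) ◁ p ≫ (α_ _ _ _).hom ≫ (c ⊗ₘ q) = ((α_ _ _ _).hom ≫ (a ⊗ₘ r)) ≫ (b ⊗ₘ s) := by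
      intro A A' A'' X Y Y' Z Z' p q r s a b c hc h
      have h2 : (c ⊗ₘ X ◁ p ≫ q) = A ◁ X ◁ p ≫ (c ⊗ₘ q) := by
        rw [← id_tensorHom A, tensorHom_comp_tensorHom, Category.id_comp]
      rw [Category.assoc, tensorHom_comp_tensorHom, ← h, ← hc, h2]
      simp
    exact aux (by simp) IH

lemma tensAppend_assoc (m : ℕ) : ∀ (k r a b n : ℕ) (h₁ : k + m = a) (h₂ : r + a = n)
    (h₃ : r + k = b) (h₄ : b + m = n) (x : Fin m → C) (y : Fin k → C) (t : Fin r → C)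
    (z : Fin a → C) (s : Fin b → C) (c : Fin n → C)
    (hxz : ∀ (i : Fin m) (l : Fin a), (l : ℕ) = i → x i = z l)
    (hyz : ∀ (j : Fin k) (l : Fin a), (l : ℕ) = m + j → y j = z l)
    (hzc : ∀ (i : Fin a) (l : Fin n), (l : ℕ) = i → z i = c l)
    (htc : ∀ (j : Fin r) (l : Fin n), (l : ℕ) = a + j → t j = c l)
    (hys : ∀ (i : Fin k) (l : Fin b), (l : ℕ) = i → y i = s l)
    (hts : ∀ (j : Fin r) (l : Fin b), (l : ℕ) = k + j → t j = s l)
    (hxc : ∀ (i : Fin m) (l : Fin n), (l : ℕ) = i → x i = c l)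
    (hsc : ∀ (j : Fin b) (l : Fin n), (l : ℕ) = m + j → s j = c l),
    tensAppend m k a h₁ x y z hxz hyz ▷ tens r t ≫ tensAppend a r n h₂ z t c hzc htc =
      (α_ _ _ _).hom ≫ tens m x ◁ tensAppend k r b h₃ y t s hys hts ≫
        tensAppend m b n h₄ x s c hxc hsc := by
  induction m with
  | zero =>
    intro k r a b n h₁ h₂ h₃ h₄ x y t z s c hxz hyz hzc htc hys hts hxc hsc
    obtain rfl : k = a := h₁
    obtain rfl : b = n := h₄
    obtain rfl : y = z := funext fun j => hyz j j (by simp)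
    obtain rfl : s = c := funext fun j => hsc j j (by simp)
    have e1 : ∀ (l : ℕ) (y : Fin l → C) (h : ∀ (j i : Fin l), (i : ℕ) = 0 + j → y j = y i)
        (hl : l = l), tensPerm l l (finCongr hl) y y
          (fun i j hij => eqToHom (h j i (by simp [← hij]))) = 𝟙 _ :=
      fun l y h hl => tensPerm_eq_id _ _ _ (fun i => rfl) (fun i h => rfl)
    have aux : ∀ {A B X : C} {p : A ⟶ A} {q : A ⊗ B ⟶ X} {r : X ⟶ X}, p = 𝟙 _ → r = 𝟙 _ →
        ((λ_ A).hom ≫ p) ▷ B ≫ q = (α_ _ _ _).hom ≫ _ ◁ q ≫ (λ_ X).hom ≫ r := by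
      rintro A B X p q r rfl rfl
      simp
    exact aux (e1 _ _ hyz _) (e1 _ _ hsc _)
  | succ m ih =>
    intro k r a b n h₁ h₂ h₃ h₄ x y t z s c hxz hyz hzc htc hys hts hxc hsc
    cases n with
    | zero => omega
    | succ n =>
    cases a with
    | zero => omega
    | succ a =>
    have IH := ih k r a b n (by omega) (by omega) h₃ (by omega) (fun i => x i.succ) y t
      (fun i => z i.succ) s (fun i => c i.succ)
      (fun i l hl => hxz i.succ l.succ (by simp [hl]))
      (fun j l hl => hyz j l.succ (by simp only [Fin.val_succ, hl]; omega))
      (fun i l hl => hzc i.succ l.succ (by simp [hl]))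
      (fun j l hl => htc j l.succ (by simp only [Fin.val_succ, hl]; omega)) hys hts
      (fun i l hl => hxc i.succ l.succ (by simp [hl]))
      (fun j l hl => hsc j l.succ (by simp only [Fin.val_succ, hl]; omega))
    have aux : ∀ {A A' A'' X Y T Z S W : C} {p : X ⊗ Y ⟶ Z} {q : Z ⊗ T ⟶ W} {r : Y ⊗ T ⟶ S}
        {s : X ⊗ S ⟶ W} {a : A ⟶ A'} {b : A' ⟶ A''} {c : A ⟶ A''} (_ : c = a ≫ b)
        (_ : p ▷ T ≫ q = (α_ _ _ _).hom ≫ X ◁ r ≫ s),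
        ((α_ A X Y).hom ≫ (a ⊗ₘ p)) ▷ T ≫ (α_ _ _ _).hom ≫ (b ⊗ₘ q) =
          (α_ _ _ _).hom ≫ (A ⊗ X) ◁ r ≫ (α_ _ _ _).hom ≫ (c ⊗ₘ s) := by
      rintro A A' A'' X Y T Z S W p q r s a b _ rfl h
      have h1 : (a ⊗ₘ p) ▷ T ≫ (α_ _ _ _).hom ≫ (b ⊗ₘ q) =
          (α_ _ _ _).hom ≫ ((a ≫ b) ⊗ₘ (p ▷ T ≫ q)) := by
        rw [← tensorHom_id, associator_naturality_assoc, tensorHom_id, tensorHom_comp_tensorHom]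
      rw [comp_whiskerRight, Category.assoc, h1, h]
      have h2 : (a ≫ b ⊗ₘ (α_ X Y T).hom ≫ X ◁ r ≫ s) =
          A ◁ (α_ X Y T).hom ≫ A ◁ X ◁ r ≫ (a ≫ b ⊗ₘ s) := by
        simp only [← id_tensorHom, tensorHom_comp_tensorHom, Category.id_comp]
      rw [h2]
      simp
    exact aux (by simp) IH

lemma tensAppend_zero_right (m : ℕ) : ∀ (n : ℕ) (h : 0 + m = n) (x : Fin m → C) (y : Fin 0 → C)
    (z : Fin n → C) (hx : ∀ (i : Fin m) (l : Fin n), (l : ℕ) = i → x i = z l)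
    (hy : ∀ (j : Fin 0) (l : Fin n), (l : ℕ) = m + j → y j = z l),
    tensAppend m 0 n h x y z hx hy = (ρ_ (tens m x)).hom ≫ tensPerm n m (finCongr (by omega)) x z
      (fun l j hlj => eqToHom (hx j l (by simp [← hlj]))) := by
  induction m with
  | zero =>
    intro n h x y z hx hy
    obtain rfl : 0 = n := by omega
    exact congrArg (fun t => t ≫ 𝟙 (𝟙_ C)) unitors_equal
  | succ m ih =>
    intro n h x y z hx hy
    cases n with
    | zero => omega
    | succ n =>
    have IH := ih n (by omega) (fun i => x i.succ) y (fun i => z i.succ)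
      (fun i l hl => hx i.succ l.succ (by simp [hl]))
      (fun j l hl => hy j l.succ (by simp only [Fin.val_succ, hl]; omega))
    rw [tensPerm_succ_fix (e' := finCongr (by omega)) (h0 := rfl) (he := fun _ => rfl)]
    have aux : ∀ {A A' X Z : C} {p : X ⊗ 𝟙_ C ⟶ Z} {q : X ⟶ Z} {a b : A ⟶ A'} (_ : a = b)
        (_ : p = (ρ_ _).hom ≫ q),
        (α_ _ _ _).hom ≫ (a ⊗ₘ p) = (ρ_ (A ⊗ X)).hom ≫ (b ⊗ₘ q) := by
      rintro A A' X Z _ q a _ rfl rfl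
      simp [MonoidalCategory.tensorHom_def]
    exact aux rfl IH

lemma swapL_whisker_braiding (a b c : C) :
    swapL a b c ≫ b ◁ (β_ a c).hom = (β_ a (b ⊗ c)).hom ≫ (α_ b c a).hom := by
  simp [swapL]

lemma swapL_tensor (a a' b c : C) : (α_ a a' (b ⊗ c)).hom ≫ a ◁ swapL a' b c ≫
    swapL a b (a' ⊗ c) = swapL (a ⊗ a') b c ≫ b ◁ (α_ a a' c).hom := by
  simp only [swapL, BraidedCategory.braiding_tensor_left_hom]
  monoidal

lemma swapL_unit_left (b c : C) : swapL (𝟙_ C) b c ≫ b ◁ (λ_ c).hom = (λ_ (b ⊗ c)).hom := by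
  simp [swapL, braiding_tensorUnit_left]

lemma tensAppend_pull (m : ℕ) : ∀ (k n : ℕ) (h : k + 1 + m = n + 1) (hm : m < n + 1)
    (x : Fin m → C) (y : Fin (k + 1) → C) (z : Fin (n + 1) → C)
    (hx : ∀ (i : Fin m) (l : Fin (n + 1)), (l : ℕ) = i → x i = z l)
    (hy : ∀ (j : Fin (k + 1)) (l : Fin (n + 1)), (l : ℕ) = m + j → y j = z l),
    tensAppend m (k + 1) (n + 1) h x y z hx hy ≫ pull m n hm z =
      swapL (tens m x) (y 0) (tens k fun j => y j.succ) ≫ (eqToHom (hy 0 ⟨m, hm⟩ rfl) ⊗ₘ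
        tensAppend m k n (by omega) x (fun j => y j.succ) (fun l => z (skip ⟨m, hm⟩ l))
          (fun i l hl => hx i _ (by rw [skip_val, if_pos]; exacts [hl, by simp; omega]))
          (fun j l hl => hy j.succ _ (by
            rw [skip_val, if_neg] <;> simp only [hl, Fin.val_succ] <;> omega))) := by
  induction m with
  | zero =>
    intro k n h hm x y z hx hy
    obtain rfl : k = n := by omega
    obtain rfl : y = z := funext fun j => hy j j (by simp)
    have e1 : tensPerm (k + 1) (k + 1) (finCongr h.symm) y y
        (fun l j hlj => eqToHom (hy j l (by simp [← hlj]))) = 𝟙 _ :=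
      tensPerm_eq_id _ _ _ (fun _ => rfl) (fun _ _ => rfl)
    have e2 : ∀ (h : k = k) (hz : ∀ (l j : Fin k), finCongr h l = j →
        y j.succ = y (skip ⟨0, hm⟩ l)), tensPerm k k (finCongr h) (fun j => y j.succ)
        (fun l => y (skip ⟨0, hm⟩ l))
        (fun l j hlj => eqToHom (hz l j hlj)) = 𝟙 _ :=
      fun _ _ => tensPerm_eq_id _ _ _ (fun _ => rfl) (fun _ _ => rfl)
    have aux : ∀ {A X : C} {p : A ⊗ X ⟶ A ⊗ X} {q : X ⟶ X} {a : A ⟶ A} (_ : p = 𝟙 _)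
        (_ : q = 𝟙 _) (_ : a = 𝟙 _), ((λ_ (A ⊗ X)).hom ≫ p) ≫ 𝟙 _ =
          swapL (𝟙_ C) A X ≫ (a ⊗ₘ (λ_ X).hom ≫ q) := by
      rintro A X _ _ _ rfl rfl rfl
      simp [swapL_unit_left]
    exact aux e1 (e2 _ _) rfl
  | succ m ih =>
    intro k n h hm x y z hx hy
    cases n with
    | zero => omega
    | succ n =>
    have IH := ih k n (by omega) (by omega) (fun i => x i.succ) y (fun i => z i.succ)
      (fun i l hl => hx i.succ l.succ (by simp [hl]))
      (fun j l hl => hy j l.succ (by simp only [Fin.val_succ, hl]; omega))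
    have aux : ∀ {A A' B B' X Y Z W : C} {p : X ⊗ (B ⊗ Y) ⟶ Z} {q : Z ⟶ B' ⊗ W}
        {r : X ⊗ Y ⟶ W} {b : B ⟶ B'} {a : A ⟶ A'} (_ : p ≫ q = swapL X B Y ≫ (b ⊗ₘ r)),
        ((α_ _ _ _).hom ≫ (a ⊗ₘ p)) ≫ A' ◁ q ≫ swapL A' B' W =
          swapL (A ⊗ X) B Y ≫ (b ⊗ₘ ((α_ _ _ _).hom ≫ (a ⊗ₘ r))) := by
      intro A A' B B' X Y Z W p q r b a h
      have h1 : (a ⊗ₘ p) ≫ A' ◁ q = A ◁ swapL X B Y ≫ (a ⊗ₘ (b ⊗ₘ r)) := by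
        rw [← id_tensorHom, ← id_tensorHom, tensorHom_comp_tensorHom, h, tensorHom_comp_tensorHom]
        simp
      have h2 : (b ⊗ₘ ((α_ A X Y).hom ≫ (a ⊗ₘ r))) = B ◁ (α_ A X Y).hom ≫ (b ⊗ₘ (a ⊗ₘ r)) := by
        rw [← id_tensorHom, tensorHom_comp_tensorHom, Category.id_comp]
      rw [Category.assoc, reassoc_of% h1, swapL_natural, h2, reassoc_of% swapL_tensor A X B Y]
    exact aux IH

lemma tensAppend_braid (k : ℕ) : ∀ (m n : ℕ) (h : k + m = n) (h' : m + k = n) (x : Fin m → C)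
    (y : Fin k → C) (z z' : Fin n → C)
    (hx : ∀ (i : Fin m) (l : Fin n), (l : ℕ) = i → x i = z l)
    (hy : ∀ (j : Fin k) (l : Fin n), (l : ℕ) = m + j → y j = z l)
    (hy' : ∀ (i : Fin k) (l : Fin n), (l : ℕ) = i → y i = z' l)
    (hx' : ∀ (j : Fin m) (l : Fin n), (l : ℕ) = k + j → x j = z' l)
    (E : Fin n ≃ Fin n) (F : ∀ i j, E i = j → (z j ⟶ z' i))
    (_ : ∀ l : Fin n, (l : ℕ) < k → (E l : ℕ) = m + l)
    (_ : ∀ (l : Fin n) (i : Fin m), (l : ℕ) = k + i → (E l : ℕ) = i)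
    (_ : ∀ l l' H, ∃ h, F l l' H = eqToHom h),
    tensAppend m k n h x y z hx hy ≫ tensPerm n n E z z' F =
      (β_ _ _).hom ≫ tensAppend k m n h' y x z' hy' hx' := by
  induction k with
  | zero =>
    intro m n h h' x y z z' hx hy hy' hx' E F hE1 hE2 hF
    obtain rfl : m = n := h'
    obtain rfl : x = z := funext fun j => hx j j rfl
    obtain rfl : x = z' := funext fun j => hx' j j (by simp)
    rw [tensAppend_zero_right]
    have e1 : ∀ (h : m = m) (hz : ∀ (l j : Fin m), finCongr h l = j → x j = x l), tensPerm m m (finCongr h) x x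
        (fun l j hlj => eqToHom (hz l j hlj)) = 𝟙 _ :=
      fun _ _ => tensPerm_eq_id _ _ _ (fun _ => rfl) (fun _ _ => rfl)
    have e2 : tensPerm m m E x x F = 𝟙 _ :=
      tensPerm_eq_id _ _ _ (fun i => Fin.ext (hE2 i i (by simp))) (fun i h => by
        obtain ⟨_, h⟩ := hF i i h
        rw [h, eqToHom_refl])
    have aux : ∀ {A : C} {p q r : A ⟶ A}, p = 𝟙 _ → q = 𝟙 _ → r = 𝟙 _ →
        ((ρ_ A).hom ≫ p) ≫ q = (β_ A (𝟙_ C)).hom ≫ (λ_ A).hom ≫ r := by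
      rintro A _ _ _ rfl rfl rfl
      simp [braiding_tensorUnit_right]
    exact aux (e1 _ _) e2 (e1 _ _)
  | succ k ih =>
    intro m n h h' x y z z' hx hy hy' hx' E F hE1 hE2 hF
    cases n with
    | zero => omega
    | succ n =>
    have hm : m < n + 1 := by omega
    have h0 : E 0 = ⟨m, hm⟩ := Fin.ext (by simpa using hE1 0 (by simp))
    have hs : ∀ i, E i.succ = skip ⟨m, hm⟩ (removeAt E 0 i) := fun i => by
      rw [← h0]
      exact (skip_removeAt E 0 i).symm
    have hs' : ∀ i, (E i.succ : ℕ) = if (removeAt E 0 i : ℕ) < m then (removeAt E 0 i : ℕ)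
        else removeAt E 0 i + 1 := fun i => by
      rw [hs, skip_val]
    have IH := ih m n (by omega) (by omega) x (fun j => y j.succ) (fun l => z (skip ⟨m, hm⟩ l))
      (fun l => z' l.succ)
      (fun i l hl => hx i _ (by rw [skip_val, if_pos]; exacts [hl, by simp; omega]))
      (fun j l hl => hy j.succ _ (by
            rw [skip_val, if_neg] <;> simp only [hl, Fin.val_succ] <;> omega))
      (fun i l hl => hy' i.succ l.succ (by simp [hl]))
      (fun j l hl => hx' j l.succ (by simp only [Fin.val_succ, hl]; omega))
      (removeAt E 0) (fun i j h => F i.succ (skip ⟨m, hm⟩ j) (by rw [hs, h]))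
      (fun l hl => by
        have := hE1 l.succ (by simp [hl])
        rw [hs'] at this
        simp only [Fin.val_succ] at this
        split_ifs at this <;> omega)
      (fun l i hl => by
        have := hE2 l.succ i (by simp [hl]; omega)
        rw [hs'] at this
        split_ifs at this <;> omega)
      (fun l l' H => hF _ _ _)
    obtain ⟨_, hF0⟩ := hF 0 ⟨m, hm⟩ h0
    rw [tensPerm_succ_of_apply_zero E z z' F _ h0 _ hs, hF0]
    refine (Category.assoc _ _ _).symm.trans ?_
    refine (congrArg (fun t => t ≫ _) (tensAppend_pull m k n h hm x y z hx hy)).trans ?_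
    have aux : ∀ {A B B' B'' X Y Z : C} {p : A ⊗ Y ⟶ X} {q : X ⟶ Z} {b : B ⟶ B'} {b' : B' ⟶ B''}
        {b'' : B ⟶ B''} {r : Y ⊗ A ⟶ Z} (_ : p ≫ q = (β_ _ _).hom ≫ r) (_ : b'' = b ≫ b'),
        (swapL A B Y ≫ (b ⊗ₘ p)) ≫ (b' ⊗ₘ q) =
          (β_ A (B ⊗ Y)).hom ≫ (α_ _ _ _).hom ≫ (b'' ⊗ₘ r) := by
      rintro A B B' B'' X Y Z p q b b' _ r h rfl
      rw [Category.assoc, tensorHom_comp_tensorHom, h, ← reassoc_of% swapL_whisker_braiding A B Y,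
        ← id_tensorHom, tensorHom_comp_tensorHom, Category.id_comp]
    exact aux IH (by simp)

lemma tensAppend_braiding {m k n n' : ℕ} (h : k + m = n) (h' : m + k = n') {x : Fin m → C}
    {y : Fin k → C} {z : Fin n → C} {z' : Fin n' → C}
    (hx : ∀ (i : Fin m) (l : Fin n), (l : ℕ) = i → x i = z l)
    (hy : ∀ (j : Fin k) (l : Fin n), (l : ℕ) = m + j → y j = z l)
    (hy' : ∀ (i : Fin k) (l : Fin n'), (l : ℕ) = i → y i = z' l)
    (hx' : ∀ (j : Fin m) (l : Fin n'), (l : ℕ) = k + j → x j = z' l)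
    (E : Fin n' ≃ Fin n) (F : ∀ i j, E i = j → (z j ⟶ z' i))
    (hE : ∀ l : Fin n', (l : ℕ) < k → (E l : ℕ) = m + l)
    (hE' : ∀ (l : Fin n') (i : Fin m), (l : ℕ) = k + i → (E l : ℕ) = i)
    (hF : ∀ l l' H, ∃ h, F l l' H = eqToHom h) :
    tensAppend m k n h x y z hx hy ≫ tensPerm n' n E z z' F =
      (β_ _ _).hom ≫ tensAppend k m n' h' y x z' hy' hx' := by
  obtain rfl : n = n' := by omega
  exact tensAppend_braid k m n h h' x y z z' hx hy hy' hx' E F hE hE' hF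

lemma tensAppend_comp_tensPerm {m k n n' : ℕ} (h : k + m = n) (h' : k + m = n') {x : Fin m → C}
    {y : Fin k → C} {z : Fin n → C} {z' : Fin n' → C}
    (hx : ∀ (i : Fin m) (l : Fin n), (l : ℕ) = i → x i = z l)
    (hy : ∀ (j : Fin k) (l : Fin n), (l : ℕ) = m + j → y j = z l)
    (hx' : ∀ (i : Fin m) (l : Fin n'), (l : ℕ) = i → x i = z' l)
    (hy' : ∀ (j : Fin k) (l : Fin n'), (l : ℕ) = m + j → y j = z' l)
    (E : Fin n' ≃ Fin n) (F : ∀ i j, E i = j → (z j ⟶ z' i)) (hE : ∀ l, (E l : ℕ) = l)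
    (hF : ∀ l l' H, ∃ h, F l l' H = eqToHom h) :
    tensAppend m k n h x y z hx hy ≫ tensPerm n' n E z z' F =
      tensAppend m k n' h' x y z' hx' hy' := by
  obtain rfl : n = n' := by omega
  obtain rfl : z = z' := funext fun l => (hF l l (Fin.ext (hE l))).choose
  have h1 : tensPerm n n E z z F = 𝟙 _ :=
    tensPerm_eq_id _ _ _ (fun i => Fin.ext (hE i)) (fun i h => by
      obtain ⟨_, h⟩ := hF i i h
      rw [h, eqToHom_refl])
  rw [h1]
  exact Category.comp_id _

instance isIso_tensPerm (p q : ℕ) (e : Fin p ≃ Fin q) (x : Fin q → C) (y : Fin p → C)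
    (f : ∀ i j, e i = j → (x j ⟶ y i)) [hf : ∀ i j h, IsIso (f i j h)] :
    IsIso (tensPerm p q e x y f) := by
  refine ⟨tensPerm q p e.symm y x (fun j i h => inv (f i j (by rw [← h, e.apply_symm_apply]))),
    ?_, ?_⟩
  · rw [tensPerm_comp]
    refine tensPerm_eq_id _ _ _ (fun i => by simp) (fun i h => ?_)
    have : ∀ j (hj : e.symm i = j) (hi : e j = i),
        f j i hi ≫ inv (f j i (by rw [← hj, e.apply_symm_apply])) = 𝟙 _ := by
      rintro _ rfl hi
      exact IsIso.hom_inv_id _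
    exact this _ rfl _
  · rw [tensPerm_comp]
    refine tensPerm_eq_id _ _ _ (fun i => by simp) (fun i h => ?_)
    exact IsIso.inv_hom_id (f i (e i) rfl)

instance isIso_tensAppend (m : ℕ) : ∀ (k n : ℕ) (h : k + m = n) (x : Fin m → C) (y : Fin k → C)
    (z : Fin n → C) (hx : ∀ (i : Fin m) (l : Fin n), (l : ℕ) = i → x i = z l)
    (hy : ∀ (j : Fin k) (l : Fin n), (l : ℕ) = m + j → y j = z l),
    IsIso (tensAppend m k n h x y z hx hy) := by
  induction m with
  | zero =>
    intro k n h x y z hx hy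
    have := isIso_tensPerm n k (finCongr h.symm) y z
      (fun l j hlj => eqToHom (hy j l (by simp [← hlj])))
    have aux : ∀ {X Y : C} (p : X ⟶ Y) [IsIso p], IsIso ((λ_ X).hom ≫ p) :=
      fun _ => inferInstance
    exact aux _
  | succ m ih =>
    intro k n h x y z hx hy
    cases n with
    | zero => omega
    | succ n =>
      have := ih k n (by omega) (fun i => x i.succ) y (fun l => z l.succ)
        (fun i l hl => hx i.succ l.succ (by simp [hl]))
        (fun j l hl => hy j l.succ (by simp only [Fin.val_succ, hl]; omega))
      have aux : ∀ {A A' X Y Z : C} (a : A ⟶ A') (p : X ⊗ Y ⟶ Z) [IsIso a] [IsIso p],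
          IsIso ((α_ A X Y).hom ≫ (a ⊗ₘ p)) := fun _ _ _ _ => inferInstance
      exact aux _ _

end TensAppend

/-- A finite family of objects, indexed by an enumerated type. -/
structure Fam (C : Type u) where
  len : ℕ
  I : Type
  enum : Fin len ≃ I
  obj : I → C

namespace Fam

section Category

variable {C : Type u} [Category.{v} C]

/-- A morphism of families: for each index of the target a morphism from some member of the
source, such that the resulting map of indices is bijective. -/
structure Hom (X Y : Fam C) where
  comp : ∀ j : Y.I, Σ i : X.I, (X.obj i ⟶ Y.obj j)
  bij : Function.Bijective fun j => (comp j).1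

/-- The elements of a family over an object `c`: the morphisms from its members to `c`. -/
abbrev Elt (X : Fam C) (c : C) := Σ i : X.I, (X.obj i ⟶ c)

/-- Elements can be pulled back along morphisms. -/
def Hom.pull {X Y : Fam C} (φ : Hom X Y) {c : C} (a : Y.Elt c) : X.Elt c :=
  ⟨(φ.comp a.1).1, (φ.comp a.1).2 ≫ a.2⟩

lemma Hom.ext_comp {X Y : Fam C} {φ ψ : Hom X Y} (h : ∀ j, φ.comp j = ψ.comp j) : φ = ψ := by
  obtain ⟨f, _⟩ := φ
  obtain ⟨g, _⟩ := ψ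
  obtain rfl : f = g := funext h
  rfl

/-- The morphism given by a bijection of indices. -/
def Hom.ofEquiv {X Y : Fam C} (e : Y.I ≃ X.I) (f : ∀ j, X.obj (e j) ⟶ Y.obj j) : Hom X Y :=
  ⟨fun j => ⟨e j, f j⟩, e.bijective⟩

instance : Category (Fam C) where
  Hom := Hom
  id X := Hom.ofEquiv (Equiv.refl _) (fun i => 𝟙 (X.obj i))
  comp φ ψ := ⟨fun k => φ.pull (ψ.comp k), φ.bij.comp ψ.bij⟩
  id_comp _ := Hom.ext_comp fun _ => Sigma.ext rfl (heq_of_eq (Category.id_comp _))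
  comp_id _ := Hom.ext_comp fun _ => Sigma.ext rfl (heq_of_eq (Category.comp_id _))
  assoc _ _ _ := Hom.ext_comp fun _ => Sigma.ext rfl (heq_of_eq (Category.assoc _ _ _))

/-- Pullback of elements. -/
def pb {X Y : Fam C} (φ : X ⟶ Y) {c : C} (a : Y.Elt c) : X.Elt c := Hom.pull φ a

lemma pb_id (X : Fam C) {c : C} (a : X.Elt c) : pb (𝟙 X) a = a :=
  Sigma.ext rfl (heq_of_eq (Category.id_comp _))

lemma pb_comp {X Y Z : Fam C} (φ : X ⟶ Y) (ψ : Y ⟶ Z) {c : C} (a : Z.Elt c) :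
    pb (φ ≫ ψ) a = pb φ (pb ψ a) :=
  Sigma.ext rfl (heq_of_eq (Category.assoc _ _ _))

lemma hom_ext {X Y : Fam C} {φ ψ : X ⟶ Y} (h : ∀ j, φ.comp j = ψ.comp j) : φ = ψ :=
  Hom.ext_comp h

lemma hom_ext_pb {X Y : Fam C} {φ ψ : X ⟶ Y} (h : ∀ c (a : Y.Elt c), pb φ a = pb ψ a) :
    φ = ψ := by
  refine hom_ext fun j => ?_
  have h' := h _ ⟨j, 𝟙 _⟩
  have : ∀ χ : X ⟶ Y, pb χ ⟨j, 𝟙 (Y.obj j)⟩ = χ.comp j :=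
    fun χ => Sigma.ext rfl (heq_of_eq (Category.comp_id _))
  rwa [this, this] at h'

/-- The sum of families. -/
def tensor (X Y : Fam C) : Fam C :=
  ⟨X.len + Y.len, X.I ⊕ Y.I, finSumFinEquiv.symm.trans (X.enum.sumCongr Y.enum),
    Sum.elim X.obj Y.obj⟩

/-- Elements of the left summand. -/
def inl {X Y : Fam C} {c : C} (a : X.Elt c) : (tensor X Y).Elt c := ⟨Sum.inl a.1, a.2⟩

/-- Elements of the right summand. -/
def inr {X Y : Fam C} {c : C} (a : Y.Elt c) : (tensor X Y).Elt c := ⟨Sum.inr a.1, a.2⟩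

/-- The sum of morphisms of families. -/
def tensorHom {X Y X' Y' : Fam C} (φ : X ⟶ X') (ψ : Y ⟶ Y') : tensor X Y ⟶ tensor X' Y' where
  comp j := match j with
    | Sum.inl j => inl (φ.comp j)
    | Sum.inr j => inr (ψ.comp j)
  bij := by
    have h : (fun j : X'.I ⊕ Y'.I => (match j with
        | Sum.inl j => inl (φ.comp j)
        | Sum.inr j => inr (ψ.comp j) : (tensor X Y).Elt ((tensor X' Y').obj j)).1) =
        Sum.map (fun j => (φ.comp j).1) (fun j => (ψ.comp j).1) := by
      funext j
      rcases j with j | j <;> rfl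
    exact h ▸ φ.bij.sumMap ψ.bij

instance : MonoidalCategoryStruct (Fam C) where
  tensorObj := tensor
  tensorHom := tensorHom
  whiskerLeft X _ _ φ := tensorHom (𝟙 X) φ
  whiskerRight φ X := tensorHom φ (𝟙 X)
  tensorUnit := ⟨0, Empty, Equiv.equivOfIsEmpty _ _, Empty.elim⟩
  associator X Y Z :=
    { hom := Hom.ofEquiv (X := tensor (tensor X Y) Z) (Y := tensor X (tensor Y Z))
        (Equiv.sumAssoc X.I Y.I Z.I).symm
        (fun j => match j with
          | Sum.inl i => 𝟙 (X.obj i)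
          | Sum.inr (Sum.inl i) => 𝟙 (Y.obj i)
          | Sum.inr (Sum.inr i) => 𝟙 (Z.obj i))
      inv := Hom.ofEquiv (X := tensor X (tensor Y Z)) (Y := tensor (tensor X Y) Z)
        (Equiv.sumAssoc X.I Y.I Z.I)
        (fun j => match j with
          | Sum.inl (Sum.inl i) => 𝟙 (X.obj i)
          | Sum.inl (Sum.inr i) => 𝟙 (Y.obj i)
          | Sum.inr i => 𝟙 (Z.obj i))
      hom_inv_id := hom_ext (by
        rintro ((i | i) | i) <;> exact Sigma.ext rfl (heq_of_eq (Category.comp_id _)))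
      inv_hom_id := hom_ext (by
        rintro (i | (i | i)) <;> exact Sigma.ext rfl (heq_of_eq (Category.comp_id _))) }
  leftUnitor X :=
    { hom := Hom.ofEquiv (X := tensor _ X) (Y := X) (Equiv.emptySum Empty X.I).symm
        (fun i => 𝟙 (X.obj i))
      inv := Hom.ofEquiv (X := X) (Y := tensor _ X) (Equiv.emptySum Empty X.I)
        (fun j => match j with
          | Sum.inr i => 𝟙 (X.obj i))
      hom_inv_id := hom_ext (by
        rintro (i | i)
        · exact i.elim
        · exact Sigma.ext rfl (heq_of_eq (Category.comp_id _)))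
      inv_hom_id := hom_ext fun i => Sigma.ext rfl (heq_of_eq (Category.comp_id _)) }
  rightUnitor X :=
    { hom := Hom.ofEquiv (X := tensor X _) (Y := X) (Equiv.sumEmpty X.I Empty).symm
        (fun i => 𝟙 (X.obj i))
      inv := Hom.ofEquiv (X := X) (Y := tensor X _) (Equiv.sumEmpty X.I Empty)
        (fun j => match j with
          | Sum.inl i => 𝟙 (X.obj i))
      hom_inv_id := hom_ext (by
        rintro (i | i)
        · exact Sigma.ext rfl (heq_of_eq (Category.comp_id _))
        · exact i.elim)
      inv_hom_id := hom_ext fun i => Sigma.ext rfl (heq_of_eq (Category.comp_id _)) }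

section Pullback

variable {X Y Z X' Y' : Fam C} {c : C}

@[simp] lemma pb_tensorHom_inl (φ : X ⟶ X') (ψ : Y ⟶ Y') (a : X'.Elt c) :
    pb (φ ⊗ₘ ψ) (inl a) = inl (pb φ a) := rfl
@[simp] lemma pb_tensorHom_inr (φ : X ⟶ X') (ψ : Y ⟶ Y') (a : Y'.Elt c) :
    pb (φ ⊗ₘ ψ) (inr a) = inr (pb ψ a) := rfl
lemma pb_whiskerLeft_inl (φ : Y ⟶ Y') (a : X.Elt c) :
    pb (X ◁ φ) (inl a) = inl (pb (𝟙 X) a) := rfl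
lemma pb_whiskerLeft_inr (φ : Y ⟶ Y') (a : Y'.Elt c) :
    pb (X ◁ φ) (inr a) = inr (pb φ a) := rfl
lemma pb_associator_inl (a : X.Elt c) :
    pb (α_ X Y Z).hom (inl a) = inl (inl a) :=
  Sigma.ext rfl (heq_of_eq (Category.id_comp _))
lemma pb_associator_inr_inl (a : Y.Elt c) :
    pb (α_ X Y Z).hom (inr (inl a)) = inl (inr a) :=
  Sigma.ext rfl (heq_of_eq (Category.id_comp _))
lemma pb_associator_inr_inr (a : Z.Elt c) :
    pb (α_ X Y Z).hom (inr (inr a)) = inr a :=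
  Sigma.ext rfl (heq_of_eq (Category.id_comp _))
lemma pb_associator_inv_inl_inl (a : X.Elt c) :
    pb (α_ X Y Z).inv (inl (inl a)) = inl a :=
  Sigma.ext rfl (heq_of_eq (Category.id_comp _))
lemma pb_associator_inv_inl_inr (a : Y.Elt c) :
    pb (α_ X Y Z).inv (inl (inr a)) = inr (inl a) :=
  Sigma.ext rfl (heq_of_eq (Category.id_comp _))
lemma pb_associator_inv_inr (a : Z.Elt c) :
    pb (α_ X Y Z).inv (inr a) = inr (inr a) :=
  Sigma.ext rfl (heq_of_eq (Category.id_comp _))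
lemma pb_leftUnitor (a : X.Elt c) : pb (λ_ X).hom a = inr a :=
  Sigma.ext rfl (heq_of_eq (Category.id_comp _))
lemma pb_rightUnitor (a : X.Elt c) : pb (ρ_ X).hom a = inl a :=
  Sigma.ext rfl (heq_of_eq (Category.id_comp _))

lemma tensor_hom_ext {φ ψ : X ⟶ Y ⊗ Z} (hl : ∀ c (a : Y.Elt c), pb φ (inl a) = pb ψ (inl a))
    (hr : ∀ c (a : Z.Elt c), pb φ (inr a) = pb ψ (inr a)) : φ = ψ := by
  refine hom_ext_pb ?_
  rintro c ⟨i | i, f⟩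
  · exact hl c ⟨i, f⟩
  · exact hr c ⟨i, f⟩

end Pullback

instance : MonoidalCategory (Fam C) :=
  MonoidalCategory.ofTensorHom
    (id_tensorHom_id := fun X Y => tensor_hom_ext (fun c a => rfl) (fun c a => rfl))
    (tensorHom_comp_tensorHom := fun f₁ f₂ g₁ g₂ => tensor_hom_ext (fun c a => by
        simp only [pb_comp, pb_tensorHom_inl]) (fun c a => by
        simp only [pb_comp, pb_tensorHom_inr]))
    (associator_naturality := fun f₁ f₂ f₃ => hom_ext_pb (by
      rintro c ⟨i | (i | i), f⟩
      · change pb _ (inl ⟨i, f⟩) = pb _ (inl ⟨i, f⟩)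
        simp only [pb_comp, pb_associator_inl, pb_tensorHom_inl]
      · change pb _ (inr (inl ⟨i, f⟩)) = pb _ (inr (inl ⟨i, f⟩))
        simp only [pb_comp, pb_associator_inr_inl, pb_tensorHom_inl, pb_tensorHom_inr]
      · change pb _ (inr (inr ⟨i, f⟩)) = pb _ (inr (inr ⟨i, f⟩))
        simp only [pb_comp, pb_associator_inr_inr, pb_tensorHom_inr]))
    (leftUnitor_naturality := fun f => hom_ext_pb fun c a => by
      simp only [pb_comp, pb_leftUnitor, pb_tensorHom_inr])
    (rightUnitor_naturality := fun f => hom_ext_pb fun c a => by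
      simp only [pb_comp, pb_rightUnitor, pb_tensorHom_inl])
    (pentagon := fun W X Y Z => tensor_hom_ext (fun c a => by
        simp only [pb_comp, pb_associator_inl, pb_tensorHom_inl, pb_id])
      (fun c a => by
        rcases a with ⟨i | (i | i), f⟩
        · change pb _ (inr (inl ⟨i, f⟩)) = pb _ (inr (inl ⟨i, f⟩))
          simp only [pb_comp, pb_associator_inl, pb_associator_inr_inl, pb_tensorHom_inl,
            pb_tensorHom_inr, pb_id]
        · change pb _ (inr (inr (inl ⟨i, f⟩))) = pb _ (inr (inr (inl ⟨i, f⟩)))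
          simp only [pb_comp, pb_associator_inr_inr, pb_associator_inr_inl, pb_tensorHom_inl,
            pb_tensorHom_inr, pb_id]
        · change pb _ (inr (inr (inr ⟨i, f⟩))) = pb _ (inr (inr (inr ⟨i, f⟩)))
          simp only [pb_comp, pb_associator_inr_inr, pb_associator_inr_inl, pb_tensorHom_inl,
            pb_tensorHom_inr, pb_id]))
    (triangle := fun X Y => tensor_hom_ext (fun c a => by
        simp only [pb_comp, pb_associator_inl, pb_tensorHom_inl, pb_id, pb_rightUnitor])
      (fun c a => by
        simp only [pb_comp, pb_associator_inr_inr, pb_tensorHom_inr, pb_id, pb_leftUnitor]))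

/-- The interchange of the summands. -/
def swap (X Y : Fam C) : X ⊗ Y ⟶ Y ⊗ X :=
  Hom.ofEquiv (X := tensor X Y) (Y := tensor Y X) (Equiv.sumComm Y.I X.I)
        (fun j => match j with
          | Sum.inl i => 𝟙 (Y.obj i)
          | Sum.inr i => 𝟙 (X.obj i))

lemma pb_swap_inl {X Y : Fam C} {c : C} (a : Y.Elt c) : pb (swap X Y) (inl a) = inr a :=
  Sigma.ext rfl (heq_of_eq (Category.id_comp _))
lemma pb_swap_inr {X Y : Fam C} {c : C} (a : X.Elt c) : pb (swap X Y) (inr a) = inl a :=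
  Sigma.ext rfl (heq_of_eq (Category.id_comp _))

lemma swap_swap (X Y : Fam C) : swap X Y ≫ swap Y X = 𝟙 (X ⊗ Y) :=
  tensor_hom_ext (fun c a => by
    simp only [pb_comp, pb_id, pb_swap_inl, pb_swap_inr]) (fun c a => by
    simp only [pb_comp, pb_id, pb_swap_inl, pb_swap_inr])

instance : SymmetricCategory (Fam C) where
  braiding X Y := ⟨swap X Y, swap Y X, swap_swap X Y, swap_swap Y X⟩
  braiding_naturality_right X _ _ f := tensor_hom_ext
    (fun c a => by
      simp only [pb_comp, ← id_tensorHom, ← tensorHom_id, pb_tensorHom_inl, pb_tensorHom_inr,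
        pb_swap_inl, pb_swap_inr])
    (fun c a => by
      simp only [pb_comp, ← id_tensorHom, ← tensorHom_id, pb_tensorHom_inl, pb_tensorHom_inr,
        pb_swap_inl, pb_swap_inr])
  braiding_naturality_left f Z := tensor_hom_ext
    (fun c a => by
      simp only [pb_comp, ← id_tensorHom, ← tensorHom_id, pb_tensorHom_inl, pb_tensorHom_inr,
        pb_swap_inl, pb_swap_inr])
    (fun c a => by
      simp only [pb_comp, ← id_tensorHom, ← tensorHom_id, pb_tensorHom_inl, pb_tensorHom_inr,
        pb_swap_inl, pb_swap_inr])
  hexagon_forward X Y Z := hom_ext_pb (by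
      rintro c ⟨i | (i | i), f⟩
      · exact Sigma.ext rfl (heq_of_eq rfl)
      · exact Sigma.ext rfl (heq_of_eq rfl)
      · exact Sigma.ext rfl (heq_of_eq rfl))
  hexagon_reverse X Y Z := hom_ext_pb (by
      rintro c ⟨(i | i) | i, f⟩
      · exact Sigma.ext rfl (heq_of_eq rfl)
      · exact Sigma.ext rfl (heq_of_eq rfl)
      · exact Sigma.ext rfl (heq_of_eq rfl))
  symmetry X Y := swap_swap X Y

lemma pb_braiding_inl {X Y : Fam C} {c : C} (a : Y.Elt c) : pb (β_ X Y).hom (inl a) = inr a :=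
  pb_swap_inl a
lemma pb_braiding_inr {X Y : Fam C} {c : C} (a : X.Elt c) : pb (β_ X Y).hom (inr a) = inl a :=
  pb_swap_inr a


end Category

section Eval

variable {C : Type u} [Category.{v} C]

/-- The component of a morphism of families at a pair of corresponding indices. -/
def Hom.at {X Y : Fam C} (φ : Hom X Y) (i : X.I) (j : Y.I) (h : (φ.comp j).1 = i) :
    X.obj i ⟶ Y.obj j :=
  eqToHom (congrArg X.obj h.symm) ≫ (φ.comp j).2

/-- The bijection of positions underlying a morphism of families. -/
noncomputable def Hom.perm {X Y : Fam C} (φ : Hom X Y) : Fin Y.len ≃ Fin X.len :=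
  (Y.enum.trans (Equiv.ofBijective _ φ.bij)).trans X.enum.symm

lemma Hom.perm_apply {X Y : Fam C} (φ : Hom X Y) (i : Fin Y.len) :
    φ.perm i = X.enum.symm (φ.comp (Y.enum i)).1 := rfl

lemma Hom.comp_of_perm {X Y : Fam C} (φ : Hom X Y) {i : Fin Y.len} {j : Fin X.len}
    (h : φ.perm i = j) : (φ.comp (Y.enum i)).1 = X.enum j := by
  rw [← h, Hom.perm_apply, Equiv.apply_symm_apply]

lemma at_comp {X Y Z : Fam C} (φ : X ⟶ Y) (ψ : Y ⟶ Z) {i : X.I} {j : Y.I} {k : Z.I}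
    (hj : (ψ.comp k).1 = j) (hi : (φ.comp j).1 = i) (h : (Hom.comp (φ ≫ ψ) k).1 = i) :
    Hom.at (φ ≫ ψ) i k h = Hom.at φ i j hi ≫ Hom.at ψ j k hj := by
  subst hj
  obtain rfl : (φ.comp (ψ.comp k).1).1 = i := hi
  have e : Hom.at (φ ≫ ψ) _ k h = (φ.comp (ψ.comp k).1).2 ≫ (ψ.comp k).2 := Category.id_comp _
  refine e.trans ?_
  simp only [Hom.at, eqToHom_refl, Category.id_comp]

lemma at_id {X : Fam C} {i j : X.I} (h : (Hom.comp (𝟙 X) j).1 = i) :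
    Hom.at (𝟙 X) i j h = eqToHom (congrArg X.obj h.symm) := by
  obtain rfl : j = i := h
  exact Category.id_comp _

lemma at_congr {X Y : Fam C} (φ : X ⟶ Y) {i i' : X.I} {j j' : Y.I}
    (h : (φ.comp j).1 = i) (hi : i' = i) (hj : j' = j) (h' : (φ.comp j').1 = i') :
    Hom.at φ i' j' h' = eqToHom (congrArg X.obj hi) ≫ Hom.at φ i j h ≫
      eqToHom (congrArg Y.obj hj.symm) := by
  subst hi hj
  simp

lemma tensor_enum_left (X Y : Fam C) {i : Fin X.len} {l : Fin (X ⊗ Y : Fam C).len}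
    (h : (l : ℕ) = i) : (X ⊗ Y : Fam C).enum l = Sum.inl (X.enum i) := by
  obtain rfl : l = Fin.castAdd Y.len i := Fin.ext h
  exact congrArg (Sum.map X.enum Y.enum) (finSumFinEquiv_symm_apply_castAdd i)

lemma tensor_enum_right (X Y : Fam C) {i : Fin Y.len} {l : Fin (X ⊗ Y : Fam C).len}
    (h : (l : ℕ) = X.len + i) : (X ⊗ Y : Fam C).enum l = Sum.inr (Y.enum i) := by
  obtain rfl : l = Fin.natAdd X.len i := Fin.ext h
  exact congrArg (Sum.map X.enum Y.enum) (finSumFinEquiv_symm_apply_natAdd i)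

lemma tensor_enum_symm_left (X Y : Fam C) (i : X.I) :
    ((X ⊗ Y : Fam C).enum.symm (Sum.inl i) : ℕ) = X.enum.symm i := by
  have h := tensor_enum_left X Y (i := X.enum.symm i)
    (l := Fin.castAdd Y.len (X.enum.symm i)) rfl
  rw [Equiv.apply_symm_apply] at h
  rw [← h]
  exact congrArg Fin.val ((X ⊗ Y : Fam C).enum.symm_apply_apply _)

lemma tensor_enum_symm_right (X Y : Fam C) (i : Y.I) :
    ((X ⊗ Y : Fam C).enum.symm (Sum.inr i) : ℕ) = X.len + Y.enum.symm i := by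
  have h := tensor_enum_right X Y (i := Y.enum.symm i)
    (l := Fin.natAdd X.len (Y.enum.symm i)) rfl
  rw [Equiv.apply_symm_apply] at h
  rw [← h]
  exact congrArg Fin.val ((X ⊗ Y : Fam C).enum.symm_apply_apply _)

lemma tensor_obj_left (X Y : Fam C) (i : Fin X.len) (l : Fin (X ⊗ Y : Fam C).len)
    (h : (l : ℕ) = i) : X.obj (X.enum i) = (X ⊗ Y : Fam C).obj ((X ⊗ Y : Fam C).enum l) := by
  rw [tensor_enum_left X Y h]
  rfl

lemma tensor_obj_right (X Y : Fam C) (i : Fin Y.len) (l : Fin (X ⊗ Y : Fam C).len)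
    (h : (l : ℕ) = X.len + i) :
    Y.obj (Y.enum i) = (X ⊗ Y : Fam C).obj ((X ⊗ Y : Fam C).enum l) := by
  rw [tensor_enum_right X Y h]
  rfl

lemma Hom.perm_val_left {W X Y : Fam C} (φ : W ⟶ X ⊗ Y) {l : Fin (X ⊗ Y : Fam C).len} (i : Fin X.len)
    (h : (l : ℕ) = i) : Hom.perm φ l = W.enum.symm (Hom.comp φ (Sum.inl (X.enum i))).1 :=
  congrArg (fun j => W.enum.symm (Hom.comp φ j).1) (tensor_enum_left X Y h)

lemma Hom.perm_val_right {W X Y : Fam C} (φ : W ⟶ X ⊗ Y) {l : Fin (X ⊗ Y : Fam C).len}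
    (i : Fin Y.len) (h : (l : ℕ) = X.len + i) :
    Hom.perm φ l = W.enum.symm (Hom.comp φ (Sum.inr (Y.enum i))).1 :=
  congrArg (fun j => W.enum.symm (Hom.comp φ j).1) (tensor_enum_right X Y h)

lemma at_eq_eqToHom {X Y : Fam C} (φ : X ⟶ Y) {i : X.I} {j : Y.I} (h : (φ.comp j).1 = i)
    (hj : ∃ h', (φ.comp j).2 = eqToHom h') : ∃ h', Hom.at φ i j h = eqToHom h' := by
  obtain ⟨_, hj⟩ := hj
  exact ⟨_, by rw [Hom.at, hj, eqToHom_trans]⟩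

variable [MonoidalCategory C] [SymmetricCategory C]

variable (C) in
/-- The tensor product of a family of objects. -/
noncomputable def eval : Fam C ⥤ C where
  obj X := tens X.len fun i => X.obj (X.enum i)
  map {X Y} φ := tensPerm Y.len X.len (Hom.perm φ) _ _
    fun i j h => Hom.at φ (X.enum j) (Y.enum i) (Hom.comp_of_perm φ h)
  map_id X := tensPerm_eq_id _ _ _ (fun i => X.enum.symm_apply_apply i) fun i h =>
    (at_id (X := X) _).trans (eqToHom_refl _ _)
  map_comp {X Y Z} φ ψ := by
    rw [tensPerm_comp]
    refine tensPerm_congr ?_ fun i j h h' => ?_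
    · ext i : 1
      refine congrArg (fun j => X.enum.symm (φ.comp j).1) ?_
      exact (Y.enum.apply_symm_apply (ψ.comp (Z.enum i)).1).symm
    · exact at_comp φ ψ (Hom.comp_of_perm ψ rfl) (Hom.comp_of_perm φ h') _

/-- The tensor product of a sum of families. -/
noncomputable def evalμ (X Y : Fam C) : (eval C).obj X ⊗ (eval C).obj Y ⟶ (eval C).obj (X ⊗ Y) :=
  tensAppend X.len Y.len (X ⊗ Y : Fam C).len (Nat.add_comm _ _) _ _ _ (tensor_obj_left X Y)
    (tensor_obj_right X Y)

lemma evalμ_natural_right (X : Fam C) {Y Y' : Fam C} (φ : Y ⟶ Y') :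
    (eval C).obj X ◁ (eval C).map φ ≫ evalμ X Y' = evalμ X Y ≫ (eval C).map (X ◁ φ) := by
  refine tensAppend_natural_right X.len Y.len Y'.len (X ⊗ Y : Fam C).len (X ⊗ Y' : Fam C).len _ _
    _ _ _ _ _ _ _ _ _ (Hom.perm φ) _ (Hom.perm (X ◁ φ)) _ ?_ ?_ ?_ ?_
  · intro l hl
    rw [Hom.perm_val_left (X ◁ φ) ⟨l, hl⟩ rfl]
    refine (tensor_enum_symm_left X Y _).trans ?_
    exact congrArg Fin.val (X.enum.symm_apply_apply ⟨l, hl⟩)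
  · intro l i hl
    rw [Hom.perm_val_right (X ◁ φ) i hl]
    exact tensor_enum_symm_right X Y _
  · intro i l l' hl hl' H
    exact (at_eq_eqToHom (X ◁ φ) (Hom.comp_of_perm (X ◁ φ) H)
      ((tensor_enum_left X Y' hl).symm ▸ ⟨rfl, rfl⟩)).choose_spec
  · intro i j hij l l' hl hl' H
    exact at_congr (X ◁ φ) (i := Sum.inr (Y.enum j)) (j := Sum.inr (Y'.enum i))
      (congrArg Sum.inr (Hom.comp_of_perm φ hij))
      (tensor_enum_right X Y hl') (tensor_enum_right X Y' hl) _

lemma evalμ_braiding (X Y : Fam C) :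
    evalμ X Y ≫ (eval C).map (β_ X Y).hom = (β_ _ _).hom ≫ evalμ Y X := by
  refine tensAppend_braiding (n := (X ⊗ Y : Fam C).len) (n' := (Y ⊗ X : Fam C).len)
    (Nat.add_comm _ _) (Nat.add_comm _ _) _ _ _ _ (Hom.perm (β_ X Y).hom) _ ?_ ?_ ?_
  · intro l hl
    rw [Hom.perm_val_left (β_ X Y).hom ⟨l, hl⟩ rfl]
    refine (tensor_enum_symm_right X Y _).trans ?_
    exact congrArg (fun i : Fin Y.len => X.len + (i : ℕ)) (Y.enum.symm_apply_apply ⟨l, hl⟩)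
  · intro l i hl
    rw [Hom.perm_val_right (β_ X Y).hom i hl]
    refine (tensor_enum_symm_left X Y _).trans ?_
    exact congrArg Fin.val (X.enum.symm_apply_apply i)
  · intro l l' H
    refine at_eq_eqToHom (β_ X Y).hom _ ?_
    rcases (Y ⊗ X : Fam C).enum l with j | j
    · exact ⟨rfl, rfl⟩
    · exact ⟨rfl, rfl⟩

lemma perm_associator (X Y Z : Fam C) (l : Fin (X ⊗ (Y ⊗ Z) : Fam C).len) :
    (Hom.perm (α_ X Y Z).hom l : ℕ) = l := by
  obtain ⟨j, hj⟩ := ((X ⊗ (Y ⊗ Z) : Fam C).enum.symm).surjective l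
  have h : Hom.perm (α_ X Y Z).hom l =
      ((X ⊗ Y) ⊗ Z : Fam C).enum.symm (Hom.comp (α_ X Y Z).hom j).1 := by
    rw [Hom.perm_apply, ← hj, Equiv.apply_symm_apply]
  rw [h, ← hj]
  rcases j with j | (j | j)
  · refine (tensor_enum_symm_left (X ⊗ Y) Z (Sum.inl j)).trans ?_
    rw [tensor_enum_symm_left X Y j]
    exact (tensor_enum_symm_left X (Y ⊗ Z) j).symm
  · refine (tensor_enum_symm_left (X ⊗ Y) Z (Sum.inr j)).trans ?_
    rw [tensor_enum_symm_right X Y j]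
    refine Eq.trans ?_ (tensor_enum_symm_right X (Y ⊗ Z) (Sum.inl j)).symm
    rw [tensor_enum_symm_left Y Z j]
  · refine (tensor_enum_symm_right (X ⊗ Y) Z j).trans ?_
    refine Eq.trans ?_ (tensor_enum_symm_right X (Y ⊗ Z) (Sum.inr j)).symm
    rw [tensor_enum_symm_right Y Z j]
    exact Nat.add_assoc _ _ _

lemma evalμ_assoc (X Y Z : Fam C) :
    evalμ X Y ▷ (eval C).obj Z ≫ evalμ (X ⊗ Y) Z ≫ (eval C).map (α_ X Y Z).hom =
      (α_ _ _ _).hom ≫ (eval C).obj X ◁ evalμ Y Z ≫ evalμ X (Y ⊗ Z) := by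
  have hl : ∀ (i : Fin (X ⊗ Y : Fam C).len) (l : Fin (X ⊗ (Y ⊗ Z) : Fam C).len), (l : ℕ) = i →
      (X ⊗ Y : Fam C).obj ((X ⊗ Y : Fam C).enum i) =
        (X ⊗ (Y ⊗ Z) : Fam C).obj ((X ⊗ (Y ⊗ Z) : Fam C).enum l) := by
    intro i l h
    obtain ⟨j, rfl⟩ := ((X ⊗ Y : Fam C).enum.symm).surjective i
    rw [Equiv.apply_symm_apply]
    rcases j with j | j
    · rw [tensor_enum_symm_left] at h
      rw [tensor_enum_left X (Y ⊗ Z) h, Equiv.apply_symm_apply]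
      rfl
    · rw [tensor_enum_symm_right] at h
      have h' : (l : ℕ) = X.len + (Fin.castAdd Z.len (Y.enum.symm j) : Fin (Y ⊗ Z : Fam C).len) := h
      have e := tensor_obj_left Y Z (Y.enum.symm j) (Fin.castAdd Z.len (Y.enum.symm j)) rfl
      rw [Equiv.apply_symm_apply] at e
      exact e.trans (tensor_obj_right X (Y ⊗ Z) _ l h')
  have hr : ∀ (i : Fin Z.len) (l : Fin (X ⊗ (Y ⊗ Z) : Fam C).len),
      (l : ℕ) = (X ⊗ Y : Fam C).len + i →
      Z.obj (Z.enum i) = (X ⊗ (Y ⊗ Z) : Fam C).obj ((X ⊗ (Y ⊗ Z) : Fam C).enum l) := by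
    intro i l h
    have h' : (l : ℕ) = X.len + (Fin.natAdd Y.len i : Fin (Y ⊗ Z : Fam C).len) :=
      h.trans (Nat.add_assoc _ _ _)
    exact (tensor_obj_right Y Z i _ rfl).trans (tensor_obj_right X (Y ⊗ Z) _ l h')
  have h1 := tensAppend_comp_tensPerm (n := ((X ⊗ Y) ⊗ Z : Fam C).len)
    (n' := (X ⊗ (Y ⊗ Z) : Fam C).len) (Nat.add_comm _ _)
    ((Nat.add_comm _ _).trans (Nat.add_assoc _ _ _))
    (tensor_obj_left (X ⊗ Y) Z) (tensor_obj_right (X ⊗ Y) Z) hl hr (Hom.perm (α_ X Y Z).hom)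
    (fun i j h => Hom.at (α_ X Y Z).hom _ _ (Hom.comp_of_perm (α_ X Y Z).hom h))
    (perm_associator X Y Z) (fun l l' H => by
      refine at_eq_eqToHom (α_ X Y Z).hom _ ?_
      rcases (X ⊗ (Y ⊗ Z) : Fam C).enum l with j | (j | j)
      · exact ⟨rfl, rfl⟩
      · exact ⟨rfl, rfl⟩
      · exact ⟨rfl, rfl⟩)
  refine (congrArg _ h1).trans ?_
  exact tensAppend_assoc _ _ _ _ _ _ _ _ _ _ _ _ _ _ _ _ _ _ _ _ _ _ _ _

lemma evalμ_natural_left {X X' : Fam C} (φ : X ⟶ X') (Y : Fam C) :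
    (eval C).map φ ▷ (eval C).obj Y ≫ evalμ X' Y = evalμ X Y ≫ (eval C).map (φ ▷ Y) := by
  have h : ∀ X : Fam C, evalμ X Y = (β_ _ _).hom ≫ evalμ Y X ≫ (eval C).map (β_ Y X).hom := by
    intro X
    rw [evalμ_braiding, SymmetricCategory.symmetry_assoc]
  rw [h, h, BraidedCategory.braiding_naturality_left_assoc, reassoc_of% evalμ_natural_right,
    Category.assoc, Category.assoc, ← Functor.map_comp, ← Functor.map_comp,
    BraidedCategory.braiding_naturality_right]

lemma perm_leftUnitor (X : Fam C) (l : Fin X.len) : (Hom.perm (λ_ X).hom l : ℕ) = l := by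
  refine (tensor_enum_symm_right (𝟙_ (Fam C)) X (X.enum l)).trans ?_
  rw [Equiv.symm_apply_apply]
  exact Nat.zero_add _

lemma evalμ_leftUnitor (X : Fam C) :
    evalμ (𝟙_ (Fam C)) X ≫ (eval C).map (λ_ X).hom = (λ_ ((eval C).obj X)).hom := by
  have h1 := tensAppend_comp_tensPerm (n := (𝟙_ (Fam C) ⊗ X : Fam C).len) (n' := X.len)
    (Nat.add_comm _ _) (Nat.add_zero _)
    (tensor_obj_left (𝟙_ (Fam C)) X) (tensor_obj_right (𝟙_ (Fam C)) X)
    (z' := fun l => X.obj (X.enum l)) (fun i => i.elim0)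
    (fun i l h => congrArg (fun i => X.obj (X.enum i)) (Fin.ext (by rw [h]; exact (Nat.zero_add _).symm)))
    (Hom.perm (λ_ X).hom)
    (fun i j h => Hom.at (λ_ X).hom _ _ (Hom.comp_of_perm (λ_ X).hom h))
    (perm_leftUnitor X) (fun l l' H => at_eq_eqToHom (λ_ X).hom _ ⟨rfl, rfl⟩)
  refine h1.trans ?_
  refine (congrArg _ (tensPerm_eq_id _ _ _ (fun i => rfl) (fun i h => rfl))).trans ?_
  exact Category.comp_id _

noncomputable instance : (eval C).LaxMonoidal where
  ε := 𝟙 (𝟙_ C)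
  μ := evalμ
  μ_natural_left := evalμ_natural_left
  μ_natural_right X f := evalμ_natural_right X f
  associativity := evalμ_assoc
  left_unitality X := by
    refine (evalμ_leftUnitor X).symm.trans (Eq.trans ?_ (congrArg (fun t => t ≫ _ ≫ _)
      (id_whiskerRight (𝟙_ C) ((eval C).obj X))).symm)
    exact (Category.id_comp _).symm
  right_unitality X := by
    refine Eq.trans ?_ (congrArg (fun t => t ≫ _ ≫ _)
      (whiskerLeft_id ((eval C).obj X) (𝟙_ C))).symm
    refine Eq.trans ?_ (Category.id_comp _).symm
    have h2 : (ρ_ X).hom = (β_ X (𝟙_ (Fam C))).hom ≫ (λ_ X).hom := by simp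
    have h3 : evalμ X (𝟙_ (Fam C)) ≫ (eval C).map (ρ_ X).hom =
        (β_ _ _).hom ≫ (λ_ ((eval C).obj X)).hom := by
      rw [h2, Functor.map_comp, ← Category.assoc, evalμ_braiding, Category.assoc,
        evalμ_leftUnitor]
      rfl
    exact (braiding_leftUnitor ((eval C).obj X)).symm.trans h3.symm

noncomputable instance : (eval C).LaxBraided where
  braided := evalμ_braiding

lemma eval_μ (X Y : Fam C) : μ (eval C) X Y = evalμ X Y := rfl

lemma eval_ε : ε (eval C) = 𝟙 (𝟙_ C) := rfl

instance (X Y : Fam C) : IsIso (evalμ X Y) :=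
  isIso_tensAppend _ _ _ _ _ _ _ _ _

end Eval


end Fam

section TensLaxMore

variable {C : Type u₁} [Category.{v₁} C] [MonoidalCategory C] [SymmetricCategory C]
  {D : Type u₂} [Category.{v₂} D] [MonoidalCategory D] [SymmetricCategory D]
  (F : C ⥤ D) [F.LaxBraided]

lemma tensLax_tensMap (n : ℕ) {x y : Fin n → C} (f : ∀ i, x i ⟶ y i) :
    tensLax F n x ≫ F.map (tensMap n f) = tensMap n (fun i => F.map (f i)) ≫ tensLax F n y := by
  have h := tensLax_natural F n n (Equiv.refl _) x y
    (fun i j h => eqToHom (congrArg x (Eq.symm h)) ≫ f i)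
  have e : ∀ i, eqToHom (congrArg x (Eq.refl i)) ≫ f i = f i := fun i => Category.id_comp _
  have h1 := (tensPerm_refl n (fun i j (h : i = j) => eqToHom (congrArg x (Eq.symm h)) ≫ f i)).trans
    (congrArg (fun g => tensMap n g) (funext e))
  have h2 := (tensPerm_refl n
    (fun i j (h : i = j) => F.map (eqToHom (congrArg x (Eq.symm h)) ≫ f i))).trans
    (congrArg (fun g => tensMap n g) (funext fun i => congrArg F.map (e i)))
  exact (congrArg (fun t => tensLax F n x ≫ F.map t) h1.symm).trans
    (h.trans (congrArg (fun t => t ≫ tensLax F n y) h2))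

lemma tensLax_tensAppend (m : ℕ) : ∀ (k n : ℕ) (h : k + m = n) (x : Fin m → C) (y : Fin k → C)
    (z : Fin n → C) (hx : ∀ (i : Fin m) (l : Fin n), (l : ℕ) = i → x i = z l)
    (hy : ∀ (j : Fin k) (l : Fin n), (l : ℕ) = m + j → y j = z l),
    (tensLax F m x ⊗ₘ tensLax F k y) ≫ μ F _ _ ≫ F.map (tensAppend m k n h x y z hx hy) =
      tensAppend m k n h (fun i => F.obj (x i)) (fun i => F.obj (y i)) (fun i => F.obj (z i))
        (fun i l hl => congrArg F.obj (hx i l hl)) (fun i l hl => congrArg F.obj (hy i l hl)) ≫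
          tensLax F n z := by
  induction m with
  | zero =>
    intro k n h x y z hx hy
    have h1 := tensLax_natural F n k (finCongr h.symm) y z
      (fun l j hlj => eqToHom (hy j l (by simp [← hlj])))
    have h2 : tensPerm n k (finCongr h.symm) (fun i => F.obj (y i)) (fun i => F.obj (z i))
        (fun l j hlj => F.map (eqToHom (hy j l (by simp [← hlj])))) =
        tensPerm n k (finCongr h.symm) (fun i => F.obj (y i)) (fun i => F.obj (z i))
        (fun l j hlj => eqToHom (congrArg F.obj (hy j l (by simp [← hlj])))) :=
      tensPerm_congr rfl fun i j _ _ => eqToHom_map F _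
    rw [h2] at h1
    have aux : ∀ {A B : C} {A' B' : D} {l : A' ⟶ F.obj A} {p : A ⟶ B} {p' : A' ⟶ B'}
        {l' : B' ⟶ F.obj B}, l ≫ F.map p = p' ≫ l' →
        (ε F ⊗ₘ l) ≫ μ F _ _ ≫ F.map ((λ_ A).hom ≫ p) = ((λ_ A').hom ≫ p') ≫ l' := by
      intro A B A' B' l p p' l' h
      rw [Category.assoc, ← h, ← leftUnitor_naturality_assoc, Functor.LaxMonoidal.left_unitality,
        tensorHom_def']
      simp
    exact aux h1
  | succ m ih =>
    intro k n h x y z hx hy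
    cases n with
    | zero => omega
    | succ n =>
    have IH := ih k n (by omega) (fun i => x i.succ) y (fun l => z l.succ)
        (fun i l hl => hx i.succ l.succ (by simp [hl]))
        (fun j l hl => hy j l.succ (by simp only [Fin.val_succ, hl]; omega))
    have aux : ∀ {A A' X Y Z : C} {X' Y' Z' : D} {a : A ⟶ A'} {a' : F.obj A ⟶ F.obj A'}
        {p : X ⊗ Y ⟶ Z} {p' : X' ⊗ Y' ⟶ Z'} {l : X' ⟶ F.obj X} {l' : Y' ⟶ F.obj Y}
        {l'' : Z' ⟶ F.obj Z} (_ : a' = F.map a)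
        (_ : (l ⊗ₘ l') ≫ μ F _ _ ≫ F.map p = p' ≫ l''),
        ((F.obj A ◁ l ≫ μ F A X) ⊗ₘ l') ≫ μ F _ _ ≫ F.map ((α_ _ _ _).hom ≫ (a ⊗ₘ p)) =
          ((α_ _ _ _).hom ≫ (a' ⊗ₘ p')) ≫ F.obj A' ◁ l'' ≫ μ F A' Z := by
      rintro A A' X Y Z X' Y' Z' a _ p p' l l' l'' rfl h
      have h1 : ((F.obj A ◁ l ≫ μ F A X) ⊗ₘ l') = ((𝟙 _ ⊗ₘ l) ⊗ₘ l') ≫ μ F A X ▷ F.obj Y := by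
        rw [← tensorHom_id, tensorHom_comp_tensorHom, Category.comp_id, id_tensorHom]
      have h2 : (F.map a ⊗ₘ p') ≫ F.obj A' ◁ l'' = (F.map a ⊗ₘ ((l ⊗ₘ l') ≫ μ F _ _ ≫ F.map p)) := by
        rw [h, ← id_tensorHom, tensorHom_comp_tensorHom, Category.comp_id]
      have h3 : (F.map a ⊗ₘ ((l ⊗ₘ l') ≫ μ F _ _ ≫ F.map p)) =
          (𝟙 _ ⊗ₘ (l ⊗ₘ l')) ≫ F.obj A ◁ μ F X Y ≫ (F.map a ⊗ₘ F.map p) := by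
        rw [← id_tensorHom, tensorHom_comp_tensorHom, tensorHom_comp_tensorHom]
        simp
      rw [Functor.map_comp, h1, Category.assoc, Category.assoc, reassoc_of% h2, h3]
      have h4 := Functor.LaxMonoidal.associativity F A X Y
      rw [reassoc_of% h4, associator_naturality_assoc]
      simp only [Category.assoc, Functor.LaxMonoidal.μ_natural]
    exact aux (eqToHom_map F _).symm IH

lemma tensLax_tensJoin (n : ℕ) : ∀ (N : ℕ) (m : Fin n → ℕ) (h : ∑ i, m i = N)
    (x : ∀ i, Fin (m i) → C) (z : Fin N → C) (hz : ∀ (p : (i : Fin n) × Fin (m i)) (l : Fin N),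
      (l : ℕ) = finSigmaFinEquiv p → x p.1 p.2 = z l),
    tensMap n (fun i => tensLax F (m i) (x i)) ≫ tensLax F n (fun i => tens (m i) (x i)) ≫
        F.map (tensJoin n N m h x z hz) =
      tensJoin n N m h (fun i k => F.obj (x i k)) (fun i => F.obj (z i))
        (fun p l hl => congrArg F.obj (hz p l hl)) ≫ tensLax F N z := by
  induction n with
  | zero =>
    intro N m h x z hz
    have h1 := tensLax_natural F N 0 (finCongr (by rw [← h]; rfl)) Fin.elim0 z
      (fun _ j _ => j.elim0)
    have h3 : (fun i : Fin 0 => F.obj (Fin.elim0 i)) = Fin.elim0 := funext fun i => i.elim0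
    have h2 : tensPerm N 0 (finCongr (by rw [← h]; rfl)) (fun i : Fin 0 => F.obj (Fin.elim0 i))
        (fun i => F.obj (z i)) (fun _ j _ => F.map (j.elim0 : Fin.elim0 j ⟶ _)) =
        tensPerm N 0 (finCongr (by rw [← h]; rfl)) Fin.elim0
        (fun i => F.obj (z i)) (fun _ j _ => j.elim0) := by
      subst h
      rfl
    rw [h2] at h1
    exact (Category.id_comp _).trans h1
  | succ n ih =>
    intro N m h x z hz
    have IH := ih (∑ i, m (Fin.succ i)) (fun i => m i.succ) rfl (fun i => x i.succ)
        (fun l => z ⟨m 0 + l, by rw [← h, Fin.sum_univ_succ]; omega⟩)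
        (fun p l hl => hz ⟨p.1.succ, p.2⟩ _ (by
          rw [finSigmaFinEquiv_succ]
          exact congrArg (fun t => m 0 + t) hl))
    have h1 := tensLax_tensAppend F (m 0) (∑ i, m (Fin.succ i)) N
      (by rw [← h, Fin.sum_univ_succ]; omega) (x 0)
      (fun l => z ⟨m 0 + l, by rw [← h, Fin.sum_univ_succ]; omega⟩) z
      (fun i l hl => hz ⟨0, i⟩ l (by
          rw [hl, finSigmaFinEquiv_apply]
          simp)) (fun j l hl => congrArg z (Fin.ext hl.symm))
    have aux : ∀ {A X Y Z : C} {A' X' Y' Z' : D} {a : A' ⟶ F.obj A} {t : X' ⟶ Y'}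
        {l : Y' ⟶ F.obj X} {j : X ⟶ Y} {j' : X' ⟶ Z'} {l' : Z' ⟶ F.obj Y} {p : A ⊗ Y ⟶ Z}
        {W' : D} {p' : A' ⊗ Z' ⟶ W'} {l'' : W' ⟶ F.obj Z} (_ : t ≫ l ≫ F.map j = j' ≫ l')
        (_ : (a ⊗ₘ l') ≫ μ F _ _ ≫ F.map p = p' ≫ l''),
        (a ⊗ₘ t) ≫ (F.obj A ◁ l ≫ μ F _ _) ≫ F.map (A ◁ j ≫ p) =
          (A' ◁ j' ≫ p') ≫ l'' := by
      intro A X Y Z A' X' Y' Z' a t l j j' l' p W' p' l'' h1 h2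
      have h3 : A' ◁ j' ≫ (a ⊗ₘ l') = (a ⊗ₘ t) ≫ F.obj A ◁ l ≫ F.obj A ◁ F.map j := by
        rw [← id_tensorHom, ← id_tensorHom, ← id_tensorHom, tensorHom_comp_tensorHom,
          tensorHom_comp_tensorHom, tensorHom_comp_tensorHom, ← h1]
        simp
      simp only [Category.assoc, Functor.map_comp]
      rw [← h2, reassoc_of% h3, Functor.LaxMonoidal.μ_natural_right_assoc]
    exact aux IH h1

end TensLaxMore

namespace Fam

section Elements

variable {C : Type u} [Category.{v} C] {c : C}

/-- The elements of a member of a finite sequence of families, as elements of the sum. -/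
def inT : (n : ℕ) → (X : Fin n → Fam C) → (i : Fin n) → (X i).Elt c → (tens n X).Elt c
  | 0, _, i, _ => i.elim0
  | n + 1, X, ⟨0, _⟩, a => inl (X := X 0) (Y := tens n fun i => X i.succ) a
  | n + 1, X, ⟨i + 1, h⟩, a => inr (X := X 0) (Y := tens n fun i => X i.succ)
      (inT n (fun i => X i.succ) ⟨i, by omega⟩ a)

lemma exists_inT : ∀ (n : ℕ) (X : Fin n → Fam C) (b : (tens n X).Elt c),
    ∃ i a, b = inT n X i a
  | 0, _, ⟨i, _⟩ => Empty.elim i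
  | n + 1, X, ⟨Sum.inl i, f⟩ => ⟨0, ⟨i, f⟩, rfl⟩
  | n + 1, X, ⟨Sum.inr j, f⟩ => by
    obtain ⟨i, a, h⟩ := exists_inT n (fun i => X i.succ) ⟨j, f⟩
    exact ⟨i.succ, a, congrArg (inr (X := X 0) (Y := tens n fun i => X i.succ)) h⟩

lemma inT_congr {n : ℕ} {X : Fin n → Fam C} {i j : Fin n} (h : i = j) (a : (X i).Elt c)
    (b : (X j).Elt c) (hab : pb (eqToHom (congrArg X h)) b = a) : inT n X i a = inT n X j b := by
  subst h
  rw [← hab]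
  exact congrArg (inT n X i) (pb_id (X i) b)

lemma pb_swapL_inl {X Y Z : Fam C} (a : Y.Elt c) : pb (swapL X Y Z) (inl a) = inr (inl a) := by
  simp only [swapL, pb_comp, pb_associator_inl, ← tensorHom_id, pb_tensorHom_inl,
    pb_braiding_inl, pb_associator_inv_inl_inr]

lemma pb_swapL_inr_inl {X Y Z : Fam C} (a : X.Elt c) :
    pb (swapL X Y Z) (inr (inl a)) = inl a := by
  simp only [swapL, pb_comp, pb_associator_inr_inl, ← tensorHom_id, pb_tensorHom_inl,
    pb_braiding_inr, pb_associator_inv_inl_inl]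

lemma pb_swapL_inr_inr {X Y Z : Fam C} (a : Z.Elt c) :
    pb (swapL X Y Z) (inr (inr a)) = inr (inr a) := by
  simp only [swapL, pb_comp, pb_associator_inr_inr, ← tensorHom_id, pb_tensorHom_inr,
    pb_id, pb_associator_inv_inr]

lemma pb_pull_inl (k : ℕ) : ∀ (n : ℕ) (h : k < n + 1) (X : Fin (n + 1) → Fam C)
    (a : (X ⟨k, h⟩).Elt c), pb (pull k n h X) (inl a) = inT (n + 1) X ⟨k, h⟩ a := by
  induction k with
  | zero =>
    intro n h X a
    exact pb_id _ _
  | succ k ih =>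
    intro n h X a
    cases n with
    | zero => omega
    | succ n =>
      refine (pb_comp _ _ _).trans ?_
      refine (congrArg _ (pb_swapL_inl a)).trans ?_
      refine (pb_whiskerLeft_inr _ _).trans ?_
      exact congrArg _ (ih n (by omega) (fun i => X i.succ) a)

lemma pb_pull_inr (k : ℕ) : ∀ (n : ℕ) (h : k < n + 1) (X : Fin (n + 1) → Fam C) (i : Fin n)
    (a : (X (skip ⟨k, h⟩ i)).Elt c),
    pb (pull k n h X) (inr (inT n (fun i => X (skip ⟨k, h⟩ i)) i a)) =
      inT (n + 1) X (skip ⟨k, h⟩ i) a := by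
  induction k with
  | zero =>
    intro n h X i a
    exact pb_id _ _
  | succ k ih =>
    intro n h X i a
    cases n with
    | zero => omega
    | succ n =>
      refine (pb_comp _ _ _).trans ?_
      obtain ⟨i, hi⟩ := i
      cases i with
      | zero =>
        refine (congrArg _ (pb_swapL_inr_inl (X := X 0) a)).trans ?_
        exact (pb_whiskerLeft_inl (C := C) _ _).trans (congrArg inl (pb_id (C := C) _ _))
      | succ i =>
        refine (congrArg _ (pb_swapL_inr_inr (X := X 0) _)).trans ?_
        refine (pb_whiskerLeft_inr _ _).trans ?_
        exact congrArg _ (ih n (by omega) (fun i => X i.succ) ⟨i, by omega⟩ a)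

lemma pb_tensPerm (p : ℕ) : ∀ (q : ℕ) (e : Fin p ≃ Fin q) (X : Fin q → Fam C) (Y : Fin p → Fam C)
    (f : ∀ i j, e i = j → (X j ⟶ Y i)) (i : Fin p) (a : (Y i).Elt c),
    pb (tensPerm p q e X Y f) (inT p Y i a) = inT q X (e i) (pb (f i (e i) rfl) a) := by
  induction p with
  | zero =>
    intro q e X Y f i
    exact i.elim0
  | succ p ih =>
    intro q e X Y f i a
    cases q with
    | zero => exact (e 0).elim0
    | succ q =>
    refine (pb_comp _ _ _).trans ?_
    cases i using Fin.cases with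
    | zero =>
      refine (congrArg _ (pb_tensorHom_inl _ _ _)).trans ?_
      exact pb_pull_inl _ _ _ _ _
    | succ i =>
      refine (congrArg _ (pb_tensorHom_inr _ _ _)).trans ?_
      rw [ih]
      refine (pb_pull_inr _ _ _ _ _ _).trans ?_
      have : ∀ j (h : e i.succ = j), inT (q + 1) X j (pb (f i.succ j h) a) =
          inT (q + 1) X (e i.succ) (pb (f i.succ (e i.succ) rfl) a) := by
        rintro _ rfl
        rfl
      exact this _ _

lemma pb_tensMap (n : ℕ) (X Y : Fin n → Fam C) (f : ∀ i, X i ⟶ Y i) (i : Fin n)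
    (a : (Y i).Elt c) : pb (tensMap n f) (inT n Y i a) = inT n X i (pb (f i) a) := by
  have h := tensPerm_refl n (x := X) (y := Y) (fun i j h => eqToHom (congrArg X h.symm) ≫ f i)
  have e : ∀ i, eqToHom (congrArg X (Eq.refl i)) ≫ f i = f i := fun i => Category.id_comp _
  have h' := h.trans (congrArg (fun g => tensMap n g) (funext e))
  refine (congrArg (fun t => pb t (inT n Y i a)) h'.symm).trans ?_
  refine (pb_tensPerm _ _ _ _ _ _ _ _).trans ?_
  exact congrArg (fun t => inT n X i (pb t a)) (e i)

lemma pb_tensAppend_left (m : ℕ) : ∀ (k n : ℕ) (h : k + m = n) (X : Fin m → Fam C)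
    (Y : Fin k → Fam C) (Z : Fin n → Fam C)
    (hX : ∀ (i : Fin m) (l : Fin n), (l : ℕ) = i → X i = Z l)
    (hY : ∀ (j : Fin k) (l : Fin n), (l : ℕ) = m + j → Y j = Z l) (i : Fin m) (l : Fin n)
    (hl : (l : ℕ) = i) (a : (Z l).Elt c),
    pb (tensAppend m k n h X Y Z hX hY) (inT n Z l a) =
      inl (inT m X i (pb (eqToHom (hX i l hl)) a)) := by
  induction m with
  | zero => exact fun _ _ _ _ _ _ _ _ i => i.elim0
  | succ m ih =>
    intro k n h X Y Z hX hY i l hl a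
    cases n with
    | zero => omega
    | succ n =>
    refine (pb_comp _ _ _).trans ?_
    cases l using Fin.cases with
    | zero =>
      obtain rfl : i = 0 := Fin.ext hl.symm
      refine (congrArg _ (pb_tensorHom_inl _ _ _)).trans ?_
      exact pb_associator_inl _
    | succ l =>
      cases i using Fin.cases with
      | zero => exact absurd hl (by simp)
      | succ i =>
      refine (congrArg _ (pb_tensorHom_inr _ _ _)).trans ?_
      rw [ih _ _ _ _ _ _ _ _ i l (by simpa using hl)]
      exact pb_associator_inr_inl _

lemma pb_tensAppend_right (m : ℕ) : ∀ (k n : ℕ) (h : k + m = n) (X : Fin m → Fam C)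
    (Y : Fin k → Fam C) (Z : Fin n → Fam C)
    (hX : ∀ (i : Fin m) (l : Fin n), (l : ℕ) = i → X i = Z l)
    (hY : ∀ (j : Fin k) (l : Fin n), (l : ℕ) = m + j → Y j = Z l) (j : Fin k) (l : Fin n)
    (hl : (l : ℕ) = m + j) (a : (Z l).Elt c),
    pb (tensAppend m k n h X Y Z hX hY) (inT n Z l a) =
      inr (inT k Y j (pb (eqToHom (hY j l hl)) a)) := by
  induction m with
  | zero =>
    intro k n h X Y Z hX hY j l hl a
    obtain rfl : k = n := h
    obtain rfl : l = j := Fin.ext (by simpa using hl)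
    refine (pb_comp _ _ _).trans ?_
    refine (congrArg _ (pb_tensPerm _ _ _ _ _ _ _ _)).trans ?_
    exact pb_leftUnitor _
  | succ m ih =>
    intro k n h X Y Z hX hY j l hl a
    cases n with
    | zero => omega
    | succ n =>
    refine (pb_comp _ _ _).trans ?_
    cases l using Fin.cases with
    | zero => exact absurd hl (by simp; omega)
    | succ l =>
      refine (congrArg _ (pb_tensorHom_inr _ _ _)).trans ?_
      rw [ih _ _ _ _ _ _ _ _ j l (by simp at hl; omega)]
      exact pb_associator_inr_inr _

lemma pb_tensJoin (n : ℕ) : ∀ (N : ℕ) (m : Fin n → ℕ) (h : ∑ i, m i = N)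
    (X : ∀ i, Fin (m i) → Fam C) (Z : Fin N → Fam C)
    (hZ : ∀ (p : (i : Fin n) × Fin (m i)) (l : Fin N),
      (l : ℕ) = finSigmaFinEquiv p → X p.1 p.2 = Z l)
    (p : (i : Fin n) × Fin (m i)) (l : Fin N) (hl : (l : ℕ) = finSigmaFinEquiv p)
    (a : (Z l).Elt c), pb (tensJoin n N m h X Z hZ) (inT N Z l a) =
      inT n (fun i => tens (m i) (X i)) p.1 (inT (m p.1) (X p.1) p.2
        (pb (eqToHom (hZ p l hl)) a)) := by
  induction n with
  | zero => exact fun _ _ _ _ _ _ p => p.1.elim0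
  | succ n ih =>
    intro N m h X Z hZ p l hl a
    refine (pb_comp _ _ _).trans ?_
    obtain ⟨i, k⟩ := p
    cases i using Fin.cases with
    | zero =>
      have hk : (l : ℕ) = k := by
        rw [hl, finSigmaFinEquiv_apply]
        simp
      refine (congrArg (pb (C := C) _) (pb_tensAppend_left _ _ _ _ _ _ _ _ _ k l hk a)).trans ?_
      exact (pb_whiskerLeft_inl (C := C) _ _).trans (congrArg inl (pb_id (C := C) _ _))
    | succ i =>
      rw [finSigmaFinEquiv_succ] at hl
      refine (congrArg (pb (C := C) _) (pb_tensAppend_right _ _ _ _ _ _ _ _ _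
        (finSigmaFinEquiv (⟨i, k⟩ : (i : Fin n) × Fin (m i.succ))) l hl a)).trans ?_
      refine (pb_whiskerLeft_inr _ _).trans ?_
      refine (congrArg _ (ih _ _ _ _ _ _ (⟨i, k⟩ : (i : Fin n) × Fin (m i.succ)) _ rfl _)).trans ?_
      rw [← pb_comp, eqToHom_trans]
      rfl

end Elements

end Fam

section TensNaturality

variable {C : Type u} [Category.{v} C] [MonoidalCategory C] [SymmetricCategory C]

lemma tensMap_eq_tensPerm (n : ℕ) {x y : Fin n → C} (f : ∀ i, x i ⟶ y i) :
    tensMap n f = tensPerm n n (Equiv.refl _) x y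
      (fun i j h => eqToHom (congrArg x h.symm) ≫ f i) :=
  ((tensPerm_refl n _).trans (congrArg (fun g => tensMap n g)
    (funext fun i => Category.id_comp (f i)))).symm

lemma tensMap_tensPerm (p q : ℕ) (e : Fin p ≃ Fin q) {x x' : Fin q → C} {y : Fin p → C}
    (f : ∀ j, x j ⟶ x' j) (g : ∀ i j, e i = j → (x' j ⟶ y i)) :
    tensMap q f ≫ tensPerm p q e x' y g = tensPerm p q e x y (fun i j h => f j ≫ g i j h) := by
  rw [tensMap_eq_tensPerm, tensPerm_comp]
  refine tensPerm_congr rfl ?_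
  rintro i _ rfl _
  exact congrArg (fun t => t ≫ _) (Category.id_comp _)

lemma tensPerm_tensMap (p q : ℕ) (e : Fin p ≃ Fin q) {x : Fin q → C} {y y' : Fin p → C}
    (g : ∀ i j, e i = j → (x j ⟶ y i)) (f : ∀ i, y i ⟶ y' i) :
    tensPerm p q e x y g ≫ tensMap p f = tensPerm p q e x y' (fun i j h => g i j h ≫ f i) := by
  rw [tensMap_eq_tensPerm, tensPerm_comp]
  refine tensPerm_congr rfl ?_
  intro i j h _
  exact congrArg (fun t => _ ≫ t) (Category.id_comp _)

instance isIso_tensMap (n : ℕ) {x y : Fin n → C} (f : ∀ i, x i ⟶ y i) [∀ i, IsIso (f i)] :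
    IsIso (tensMap n f) := by
  rw [tensMap_eq_tensPerm]
  have : ∀ (i j : Fin n) (h : Equiv.refl (Fin n) i = j),
      IsIso (eqToHom (congrArg x h.symm) ≫ f i) := by
    rintro i _ rfl
    exact inferInstanceAs (IsIso (𝟙 _ ≫ f i))
  exact isIso_tensPerm (hf := this) _ _ _ _ _ _

variable {E : Type u₁} [Category.{v₁} E] {G G' : E ⥤ C} (α : G ⟶ G')

lemma eqToHom_natural {x y : E} (h : x = y) :
    eqToHom (congrArg G.obj h) ≫ α.app y = α.app x ≫ eqToHom (congrArg G'.obj h) := by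
  subst h
  simp

lemma tensAppend_natTrans (m : ℕ) : ∀ (k n : ℕ) (h : k + m = n) (x : Fin m → E) (y : Fin k → E)
    (z : Fin n → E) (hx : ∀ (i : Fin m) (l : Fin n), (l : ℕ) = i → x i = z l)
    (hy : ∀ (j : Fin k) (l : Fin n), (l : ℕ) = m + j → y j = z l),
    (tensMap m (fun i => α.app (x i)) ⊗ₘ tensMap k (fun i => α.app (y i))) ≫
      tensAppend m k n h (fun i => G'.obj (x i)) (fun i => G'.obj (y i)) (fun i => G'.obj (z i))
        (fun i l hl => congrArg G'.obj (hx i l hl)) (fun i l hl => congrArg G'.obj (hy i l hl)) =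
      tensAppend m k n h (fun i => G.obj (x i)) (fun i => G.obj (y i)) (fun i => G.obj (z i))
        (fun i l hl => congrArg G.obj (hx i l hl)) (fun i l hl => congrArg G.obj (hy i l hl)) ≫
          tensMap n (fun i => α.app (z i)) := by
  induction m with
  | zero =>
    intro k n h x y z hx hy
    have h1 := tensMap_tensPerm n k (finCongr h.symm) (fun i => α.app (y i))
      (fun l j hlj => eqToHom (congrArg G'.obj (hy j l (by simp [← hlj]))))
    have h2 := tensPerm_tensMap n k (finCongr h.symm)
      (fun l j hlj => eqToHom (congrArg G.obj (hy j l (by simp [← hlj]))))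
      (fun i => α.app (z i))
    have h3 := h1.trans ((tensPerm_congr rfl fun i j hij _ =>
      (eqToHom_natural α (hy j i (by simp [← hij]))).symm).trans h2.symm)
    have aux : ∀ {A A' B B' : C} {p : A ⟶ A'} {q : A' ⟶ B'} {q' : A ⟶ B} {p' : B ⟶ B'},
        p ≫ q = q' ≫ p' → (𝟙 (𝟙_ C) ⊗ₘ p) ≫ (λ_ _).hom ≫ q = ((λ_ _).hom ≫ q') ≫ p' := by
      intro A A' B B' p q q' p' h
      rw [Category.assoc, ← h, id_tensorHom, leftUnitor_naturality_assoc]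
    exact aux h3
  | succ m ih =>
    intro k n h x y z hx hy
    cases n with
    | zero => omega
    | succ n =>
    have IH := ih k n (by omega) (fun i => x i.succ) y (fun l => z l.succ)
        (fun i l hl => hx i.succ l.succ (by simp [hl]))
        (fun j l hl => hy j l.succ (by simp only [Fin.val_succ, hl]; omega))
    have aux : ∀ {A A' X X' Y Y' Z Z' B B' : C} {a : A ⟶ A'} {e : A' ⟶ B'} {e' : A ⟶ B}
        {b : B ⟶ B'} {s : X ⊗ Y ⟶ X' ⊗ Y'}
        {f : X ⟶ X'} {g : Y ⟶ Y'} {p : X' ⊗ Y' ⟶ Z'} {p' : X ⊗ Y ⟶ Z} {z : Z ⟶ Z'}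
        (_ : a ≫ e = e' ≫ b) (_ : (f ⊗ₘ g) ≫ p = p' ≫ z),
        ((a ⊗ₘ f) ⊗ₘ g) ≫ (α_ _ _ _).hom ≫ (e ⊗ₘ p) =
          ((α_ _ _ _).hom ≫ (e' ⊗ₘ p')) ≫ (b ⊗ₘ z) := by
      intro A A' X X' Y Y' Z Z' B B' a e e' b s f g p p' z h1 h2
      rw [associator_naturality_assoc, tensorHom_comp_tensorHom, h1, h2, Category.assoc,
        tensorHom_comp_tensorHom]
    exact aux (s := tensMap m (fun i => α.app (x i.succ)) ⊗ₘ tensMap k (fun i => α.app (y i)))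
      (eqToHom_natural α (hx 0 0 rfl)).symm IH

lemma tensJoin_natTrans (n : ℕ) : ∀ (N : ℕ) (m : Fin n → ℕ) (h : ∑ i, m i = N)
    (x : ∀ i, Fin (m i) → E) (z : Fin N → E) (hz : ∀ (p : (i : Fin n) × Fin (m i)) (l : Fin N),
      (l : ℕ) = finSigmaFinEquiv p → x p.1 p.2 = z l),
    tensMap n (fun i => tensMap (m i) (fun k => α.app (x i k))) ≫
        tensJoin n N m h (fun i k => G'.obj (x i k)) (fun i => G'.obj (z i))
          (fun p l hl => congrArg G'.obj (hz p l hl)) =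
      tensJoin n N m h (fun i k => G.obj (x i k)) (fun i => G.obj (z i))
        (fun p l hl => congrArg G.obj (hz p l hl)) ≫ tensMap N (fun i => α.app (z i)) := by
  induction n with
  | zero =>
    intro N m h x z hz
    obtain rfl : 0 = N := h
    exact (Category.id_comp _).trans (Category.comp_id _).symm
  | succ n ih =>
    intro N m h x z hz
    have IH := ih (∑ i, m (Fin.succ i)) (fun i => m i.succ) rfl (fun i => x i.succ)
        (fun l => z ⟨m 0 + l, by rw [← h, Fin.sum_univ_succ]; omega⟩)
        (fun p l hl => hz ⟨p.1.succ, p.2⟩ _ (by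
          rw [finSigmaFinEquiv_succ]
          exact congrArg (fun t => m 0 + t) hl))
    have h1 := tensAppend_natTrans α (m 0) (∑ i, m (Fin.succ i)) N
      (by rw [← h, Fin.sum_univ_succ]; omega) (x 0)
      (fun l => z ⟨m 0 + l, by rw [← h, Fin.sum_univ_succ]; omega⟩) z
      (fun i l hl => hz ⟨0, i⟩ l (by
          rw [hl, finSigmaFinEquiv_apply]
          simp)) (fun j l hl => congrArg z (Fin.ext hl.symm))
    have aux : ∀ {A A' X X' Y Y' Z Z' : C} {a : A ⟶ A'} {f : X ⟶ X'} {j : X' ⟶ Y'} {j' : X ⟶ Y}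
        {g : Y ⟶ Y'} {p : A' ⊗ Y' ⟶ Z'} {p' : A ⊗ Y ⟶ Z} {z : Z ⟶ Z'} (_ : f ≫ j = j' ≫ g)
        (_ : (a ⊗ₘ g) ≫ p = p' ≫ z),
        (a ⊗ₘ f) ≫ A' ◁ j ≫ p = (A ◁ j' ≫ p') ≫ z := by
      intro A A' X X' Y Y' Z Z' a f j j' g p p' z h1 h2
      rw [Category.assoc, ← h2, ← id_tensorHom, ← id_tensorHom, tensorHom_comp_tensorHom_assoc,
        tensorHom_comp_tensorHom_assoc, h1, Category.comp_id, Category.id_comp]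
    exact aux IH h1

instance isIso_tensJoin (n : ℕ) : ∀ (N : ℕ) (m : Fin n → ℕ) (h : ∑ i, m i = N)
    (x : ∀ i, Fin (m i) → C) (z : Fin N → C) (hz : ∀ (p : (i : Fin n) × Fin (m i)) (l : Fin N),
      (l : ℕ) = finSigmaFinEquiv p → x p.1 p.2 = z l), IsIso (tensJoin n N m h x z hz) := by
  induction n with
  | zero =>
    intro N m h x z hz
    obtain rfl : 0 = N := h
    exact inferInstanceAs (IsIso (𝟙 _))
  | succ n ih =>
    intro N m h x z hz
    have := ih (∑ i, m (Fin.succ i)) (fun i => m i.succ) rfl (fun i => x i.succ)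
        (fun l => z ⟨m 0 + l, by rw [← h, Fin.sum_univ_succ]; omega⟩)
        (fun p l hl => hz ⟨p.1.succ, p.2⟩ _ (by
          rw [finSigmaFinEquiv_succ]
          exact congrArg (fun t => m 0 + t) hl))
    have aux : ∀ {A X Y Z : C} (f : X ⟶ Y) (g : A ⊗ Y ⟶ Z), IsIso f → IsIso g →
        IsIso (A ◁ f ≫ g) := fun _ _ _ _ => inferInstance
    exact aux _ _ this (isIso_tensAppend _ _ _ _ _ _ _ _ _)

instance isIso_tensConcat (x : FinFam (FinFam C)) : IsIso (tensConcat x) :=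
  isIso_tensJoin _ _ _ _ _ _ _

lemma tensZip_tensMap (n : ℕ) {x x' y y' : Fin n → C} (f : ∀ i, x i ⟶ x' i)
    (g : ∀ i, y i ⟶ y' i) :
    (tensMap n f ⊗ₘ tensMap n g) ≫ tensZip n x' y' =
      tensZip n x y ≫ tensMap n (fun i => f i ⊗ₘ g i) := by
  induction n with
  | zero =>
    have h : (𝟙 (𝟙_ C) ⊗ₘ 𝟙 (𝟙_ C)) ≫ (λ_ (𝟙_ C)).hom = (λ_ (𝟙_ C)).hom ≫ 𝟙 _ := by simp
    exact h
  | succ n ih =>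
    have IH := ih (fun i => f i.succ) (fun i => g i.succ)
    have aux : ∀ {A A' B B' X X' Y Y' Z Z' : C} {a : A ⟶ A'} {b : B ⟶ B'} {f : X ⟶ X'}
        {g : Y ⟶ Y'} {p : X' ⊗ Y' ⟶ Z'} {p' : X ⊗ Y ⟶ Z} {z : Z ⟶ Z'},
        (f ⊗ₘ g) ≫ p = p' ≫ z → ((a ⊗ₘ f) ⊗ₘ (b ⊗ₘ g)) ≫ tensorμ _ _ _ _ ≫ (A' ⊗ B') ◁ p =
          (tensorμ _ _ _ _ ≫ (A ⊗ B) ◁ p') ≫ ((a ⊗ₘ b) ⊗ₘ z) := by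
      intro A A' B B' X X' Y Y' Z Z' a b f g p p' z h
      rw [tensorμ_natural_assoc, Category.assoc, ← id_tensorHom, ← id_tensorHom,
        tensorHom_comp_tensorHom, tensorHom_comp_tensorHom, h, Category.comp_id, Category.id_comp]
    exact aux IH

instance isIso_tensZip (n : ℕ) : ∀ (x y : Fin n → C), IsIso (tensZip n x y) := by
  induction n with
  | zero => exact fun x y => inferInstanceAs (IsIso (λ_ (𝟙_ C)).hom)
  | succ n ih =>
    intro x y
    have := ih (fun i => x i.succ) (fun i => y i.succ)
    have : ∀ a b c d : C, IsIso (tensorμ a b c d) := fun a b c d =>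
      ⟨tensorδ a b c d, by simp, by simp⟩
    have aux : ∀ {A X Y Z : C} (f : X ⟶ Y) (g : Z ⟶ A ⊗ X), IsIso f → IsIso g →
        IsIso (g ≫ A ◁ f) := fun _ _ _ _ => inferInstance
    exact aux _ _ ‹_› (this _ _ _ _)

/-- Reassociating pairwise tensor products of finite families. -/
lemma tensZip_assoc (n : ℕ) (x y z : Fin n → C) :
    tensZip n x y ▷ tens n z ≫ tensZip n (fun i => x i ⊗ y i) z ≫
        tensMap n (fun i => (α_ (x i) (y i) (z i)).hom) =
      (α_ _ _ _).hom ≫ tens n x ◁ tensZip n y z ≫ tensZip n x (fun i => y i ⊗ z i) := by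
  induction n with
  | zero =>
    have h : (λ_ (𝟙_ C)).hom ▷ 𝟙_ C ≫ (λ_ (𝟙_ C)).hom ≫ 𝟙 _ =
        (α_ _ _ _).hom ≫ 𝟙_ C ◁ (λ_ (𝟙_ C)).hom ≫ (λ_ (𝟙_ C)).hom := by monoidal
    exact h
  | succ n ih =>
    have IH := ih (fun i => x i.succ) (fun i => y i.succ) (fun i => z i.succ)
    have aux : ∀ {a b c X Y Z P Q R S : C} {p : X ⊗ Y ⟶ P} {q : P ⊗ Z ⟶ Q} {r : Y ⊗ Z ⟶ R}
        {s : X ⊗ R ⟶ S} {t : Q ⟶ S}, p ▷ Z ≫ q ≫ t = (α_ _ _ _).hom ≫ X ◁ r ≫ s →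
        (tensorμ a X b Y ≫ (a ⊗ b) ◁ p) ▷ (c ⊗ Z) ≫ (tensorμ (a ⊗ b) P c Z ≫ ((a ⊗ b) ⊗ c) ◁ q) ≫
            ((α_ a b c).hom ⊗ₘ t) =
          (α_ _ _ _).hom ≫ (a ⊗ X) ◁ (tensorμ b Y c Z ≫ (b ⊗ c) ◁ r) ≫
            tensorμ a X (b ⊗ c) R ≫ (a ⊗ (b ⊗ c)) ◁ s := by
      intro a b c X Y Z P Q R S p q r s t h
      have h1 := tensorμ_natural (𝟙 (a ⊗ b)) p (𝟙 c) (𝟙 Z)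
      have h2 := tensorμ_natural (𝟙 a) (𝟙 X) (𝟙 (b ⊗ c)) r
      simp only [id_tensorHom, tensorHom_id, id_whiskerRight] at h1 h2
      have h3 := tensor_associativity a X b Y c Z
      rw [comp_whiskerRight, MonoidalCategory.whiskerLeft_comp]
      simp only [Category.assoc]
      rw [reassoc_of% h1, reassoc_of% h2, ← reassoc_of% h3,
        MonoidalCategory.tensorHom_def' (α_ a b c).hom]
      simp only [← MonoidalCategory.whiskerLeft_comp_assoc]
      rw [h]
      simp only [MonoidalCategory.whiskerLeft_comp, Category.assoc,
        MonoidalCategory.tensorHom_def']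
      simp only [whisker_exchange_assoc, whisker_exchange]
    exact aux IH

lemma tensZip_tensUnit_left (n : ℕ) (x : Fin n → C) :
    (λ_ _).inv ≫ tensUnit n ▷ tens n x ≫ tensZip n (fun _ => 𝟙_ C) x =
      tensMap n (fun i => (λ_ (x i)).inv) := by
  induction n with
  | zero =>
    have h : (λ_ (𝟙_ C)).inv ≫ 𝟙 _ ▷ 𝟙_ C ≫ (λ_ (𝟙_ C)).hom = 𝟙 _ := by monoidal
    exact h
  | succ n ih =>
    have IH := ih (fun i => x i.succ)
    have aux : ∀ {a X U Z : C} {u : 𝟙_ C ⟶ U} {z : U ⊗ X ⟶ Z} {r : X ⟶ Z},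
        (λ_ _).inv ≫ u ▷ X ≫ z = r →
        (λ_ (a ⊗ X)).inv ≫ ((λ_ _).inv ≫ 𝟙_ C ◁ u) ▷ (a ⊗ X) ≫ tensorμ (𝟙_ C) U a X ≫
          (𝟙_ C ⊗ a) ◁ z = (λ_ a).inv ⊗ₘ r := by
      rintro a X U Z u z _ rfl
      have h2 := tensorμ_natural (𝟙 (𝟙_ C)) u (𝟙 a) (𝟙 X)
      simp only [id_tensorHom, tensorHom_id, id_whiskerRight] at h2
      have h3 := tensor_left_unitality a X
      rw [comp_whiskerRight, Category.assoc, reassoc_of% h2]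
      have h4 : (λ_ (a ⊗ X)).inv ≫ (λ_ (𝟙_ C)).inv ▷ (a ⊗ X) ≫ tensorμ (𝟙_ C) (𝟙_ C) a X =
          (λ_ a).inv ⊗ₘ (λ_ X).inv := by
        rw [← cancel_mono ((λ_ a).hom ⊗ₘ (λ_ X).hom), Category.assoc, Category.assoc, ← h3]
        simp
      rw [reassoc_of% h4]
      simp [MonoidalCategory.tensorHom_def]
    exact aux IH

end TensNaturality

section ZipLax

variable {C : Type u₁} [Category.{v₁} C] [MonoidalCategory C] [SymmetricCategory C]
  {D : Type u₂} [Category.{v₂} D] [MonoidalCategory D] [SymmetricCategory D]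
  (F : C ⥤ D) [F.LaxBraided]

/-- Lax symmetric monoidal functors are compatible with pairwise tensor products. -/
lemma tensLax_tensZip (n : ℕ) (x y : Fin n → C) :
    (tensLax F n x ⊗ₘ tensLax F n y) ≫ μ F _ _ ≫ F.map (tensZip n x y) =
      tensZip n (fun i => F.obj (x i)) (fun i => F.obj (y i)) ≫
        tensMap n (fun i => μ F (x i) (y i)) ≫ tensLax F n (fun i => x i ⊗ y i) := by
  induction n with
  | zero =>
    have h : (ε F ⊗ₘ ε F) ≫ μ F _ _ ≫ F.map (λ_ (𝟙_ C)).hom = (λ_ (𝟙_ D)).hom ≫ 𝟙 _ ≫ ε F := by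
      rw [MonoidalCategory.tensorHom_def', Category.assoc, ← Functor.LaxMonoidal.left_unitality]
      simp
    exact h
  | succ n ih =>
    have IH := ih (fun i => x i.succ) (fun i => y i.succ)
    have aux : ∀ {a b X Y Z : C} {X' Y' W Z' : D} {p : X' ⟶ F.obj X} {q : Y' ⟶ F.obj Y}
        {z : X ⊗ Y ⟶ Z} {z' : X' ⊗ Y' ⟶ W} {w : W ⟶ Z'} {r : Z' ⟶ F.obj Z},
        (p ⊗ₘ q) ≫ μ F _ _ ≫ F.map z = z' ≫ w ≫ r →
        ((F.obj a ◁ p ≫ μ F a X) ⊗ₘ (F.obj b ◁ q ≫ μ F b Y)) ≫ μ F _ _ ≫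
            F.map (tensorμ a X b Y ≫ (a ⊗ b) ◁ z) =
          (tensorμ _ _ _ _ ≫ (F.obj a ⊗ F.obj b) ◁ z') ≫ (μ F a b ⊗ₘ w) ≫
            F.obj (a ⊗ b) ◁ r ≫ μ F (a ⊗ b) Z := by
      intro a b X Y Z X' Y' W Z' p q z z' w r h
      have h1 := tensorμ_comp_μ_tensorHom_μ_comp_μ F a X b Y
      have h2 := tensorμ_natural (𝟙 (F.obj a)) p (𝟙 (F.obj b)) q
      rw [← tensorHom_comp_tensorHom, Functor.map_comp, Category.assoc]
      have h3 : (μ F a b ⊗ₘ μ F X Y) ≫ F.obj (a ⊗ b) ◁ F.map z =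
          (F.obj a ⊗ F.obj b) ◁ (μ F X Y ≫ F.map z) ≫ μ F a b ▷ _ := by
        rw [MonoidalCategory.tensorHom_def', Category.assoc, ← whisker_exchange,
          MonoidalCategory.whiskerLeft_comp_assoc]
      simp only [id_tensorHom, MonoidalCategory.whiskerLeft_id] at h2
      rw [← reassoc_of% h1, ← Functor.LaxMonoidal.μ_natural_right, reassoc_of% h2,
        reassoc_of% h3, ← MonoidalCategory.whiskerLeft_comp_assoc, h,
        MonoidalCategory.tensorHom_def' (μ F a b) w]
      simp only [MonoidalCategory.whiskerLeft_comp, Category.assoc]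
      rw [whisker_exchange_assoc]
    exact aux IH

end ZipLax

namespace FinFam

section MapOfEquiv

variable {K : Type u} [Category.{v} K] {L : Type u₁} [Category.{v₁} L] (F : K ⥤ L)

lemma map_ofEquivHom {n m : ℕ} {I J : Type} {s : Fin n ≃ I} {t : Fin m ≃ J} {x : I → K}
    {y : J → K} (e : J ≃ I) (f : ∀ j, x (e j) ⟶ y j) :
    (map F).map (ofEquivHom (s := s) (t := t) e f) =
      ofEquivHom (s := s) (t := t) (x := fun i => F.obj (x i)) (y := fun j => F.obj (y j)) e
        (fun j => F.map (f j)) := by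
  refine hom_ext (fun _ => rfl) fun i => ?_
  refine Eq.trans ?_ (Category.id_comp _).symm
  exact (F.map_comp _ _).trans (congrArg (fun t => t ≫ _) (eqToHom_map F _))

lemma map_concat_map {x y : FinFam (FinFam K)} (φ : x ⟶ y) :
    (map F).map (concat.map φ) = concat.map ((map (map F)).map φ) :=
  map_ofEquivHom F _ _

lemma map_concatAssoc (x : FinFam (FinFam (FinFam K))) :
    (map F).map (concatAssoc x) = concatAssoc ((map (map (map F))).obj x) :=
  (map_ofEquivHom F _ _).trans (ofEquivHom_congr (fun _ => rfl) fun j =>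
    (eqToHom_map F _).trans (Category.id_comp _).symm)

lemma map_toConcatSingle (x : FinFam K) :
    (map F).map (toConcatSingle x) = toConcatSingle ((map F).obj x) :=
  (map_ofEquivHom F _ _).trans (ofEquivHom_congr (fun _ => rfl) fun j =>
    (F.map_id _).trans (Category.id_comp _).symm)

lemma map_toConcatMapSingle (x : FinFam K) :
    (map F).map (toConcatMapSingle x) = toConcatMapSingle ((map F).obj x) :=
  (map_ofEquivHom F _ _).trans (ofEquivHom_congr (fun _ => rfl) fun j =>
    (F.map_id _).trans (Category.id_comp _).symm)

end MapOfEquiv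

end FinFam

section TensLaxNat

variable {C : Type u₁} [Category.{v₁} C] [MonoidalCategory C] [SymmetricCategory C]
  {D : Type u₂} [Category.{v₂} D] [MonoidalCategory D] [SymmetricCategory D]
  (F : C ⥤ D) [F.LaxBraided]

/-- The canonical morphisms of a lax symmetric monoidal functor are natural. -/
def tensLaxNat : FinFam.map F ⋙ tensF D ⟶ tensF C ⋙ F where
  app x := tensLax F x.len x.obj
  naturality x y f := by
    have h := tensLax_natural F y.len x.len f.perm x.obj y.obj
      (fun i j h => eqToHom (congrArg x.obj h.symm) ≫ f.hom i)
    refine Eq.trans (congrArg (fun t => t ≫ _) (tensPerm_congr rfl fun i j hj _ => ?_)) h.symm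
    rw [Functor.map_comp, eqToHom_map]
    rfl

lemma tensLax_one (x : C) :
    (ρ_ (F.obj x)).inv ≫ tensLax F 1 (fun _ => x) = F.map (ρ_ x).inv :=
  (Functor.LaxMonoidal.right_unitality_inv F x)

lemma tensF_map_mapNat {E : Type u} [Category.{v} E] {G G' : E ⥤ C} (α : G ⟶ G') (x : FinFam E) :
    (tensF C).map ((FinFam.mapNat α).app x) = tensMap x.len (fun i => α.app (x.obj i)) :=
  (tensMap_eq_tensPerm _ _).symm

end TensLaxNat

namespace Fam

section MoreElements

variable {C : Type u} [Category.{v} C] {c : C}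

lemma pb_comp_eq {X Y Z : Fam C} {φ : X ⟶ Y} {ψ : Y ⟶ Z} {a : Z.Elt c} {b : Y.Elt c} {d : X.Elt c}
    (h1 : pb ψ a = b) (h2 : pb φ b = d) : pb (φ ≫ ψ) a = d := by
  rw [pb_comp, h1, h2]

lemma pb_eqToHom_eqToHom {X Y : Fam C} (h : X = Y) (h' : Y = X) (a : X.Elt c) :
    pb (eqToHom h) (pb (eqToHom h') a) = a := by
  subst h
  exact (pb_id _ _).trans (pb_id _ _)

/-- The elements of a family indexed by a type with an enumeration. -/
def inE {n : ℕ} {I : Type} (s : Fin n ≃ I) (x : I → Fam C) (i : I) (a : (x i).Elt c) :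
    ((tensF (Fam C)).obj (FinFam.ofEquiv s x)).Elt c :=
  inT n (fun i => x (s i)) (s.symm i) (pb (eqToHom (congrArg x (s.apply_symm_apply i))) a)

lemma inE_enum {n : ℕ} {I : Type} (s : Fin n ≃ I) (x : I → Fam C) (i : Fin n)
    (a : (x (s i)).Elt c) : inE s x (s i) a = inT n (fun i => x (s i)) i a :=
  (inT_congr (X := fun i => x (s i)) (s.symm_apply_apply i).symm a _ (by
    rw [← pb_comp, eqToHom_trans]
    exact pb_id _ _)).symm

lemma hom_ext_inE {n : ℕ} {I : Type} {s : Fin n ≃ I} {x : I → Fam C} {W : Fam C}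
    {φ ψ : W ⟶ (tensF (Fam C)).obj (FinFam.ofEquiv s x)}
    (h : ∀ c i (a : (x i).Elt c), pb φ (inE s x i a) = pb ψ (inE s x i a)) : φ = ψ := by
  refine hom_ext_pb fun c b => ?_
  obtain ⟨i, a, rfl⟩ := exists_inT _ _ b
  have h' := h c (s i) a
  have e := inE_enum s x i a
  exact (congrArg (pb φ) e.symm).trans (h'.trans (congrArg (pb ψ) e))

lemma hom_ext_inT {n : ℕ} {X : Fin n → Fam C} {W : Fam C} {φ ψ : W ⟶ tens n X}
    (h : ∀ c i (a : (X i).Elt c), pb φ (inT n X i a) = pb ψ (inT n X i a)) : φ = ψ := by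
  refine hom_ext_pb fun c b => ?_
  obtain ⟨i, a, rfl⟩ := exists_inT _ _ b
  exact h c i a

lemma pb_tensF_map {x y : FinFam (Fam C)} (φ : x ⟶ y) (i : Fin y.len) (a : (y.obj i).Elt c) :
    pb ((tensF (Fam C)).map φ) (inT y.len y.obj i a) =
      inT x.len x.obj (φ.perm i) (pb (φ.hom i) a) :=
  (pb_tensPerm _ _ _ _ _ _ _ _).trans
    (congrArg (fun t => inT x.len x.obj (φ.perm i) (pb t a)) (Category.id_comp (φ.hom i)))

lemma pb_ofEquivHom {n m : ℕ} {I J : Type} {s : Fin n ≃ I} {t : Fin m ≃ J} {x : I → Fam C}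
    {y : J → Fam C} (e : J ≃ I) (f : ∀ j, x (e j) ⟶ y j) (j : J) (a : (y j).Elt c) :
    pb ((tensF (Fam C)).map (FinFam.ofEquivHom (s := s) (t := t) e f)) (inE t y j a) =
      inE s x (e j) (pb (f j) a) := by
  refine (pb_tensF_map _ _ _).trans ?_
  have : ∀ j' (h : j' = j), inT n (fun i => x (s i)) (s.symm (e j'))
      (pb (eqToHom (congrArg x (s.apply_symm_apply (e j'))) ≫ f j')
        (pb (eqToHom (congrArg y h)) a)) = inE s x (e j) (pb (f j) a) := by
    rintro j' rfl
    rw [pb_comp]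
    exact congrArg (fun b => inT n (fun i => x (s i)) (s.symm (e j'))
      (pb (eqToHom (congrArg x (s.apply_symm_apply (e j')))) (pb (f j') b))) (pb_id _ _)
  exact this _ (t.apply_symm_apply j)

lemma pb_tensConcat (x : FinFam (FinFam (Fam C))) (p : (i : Fin x.len) × Fin (x.obj i).len)
    (a : ((x.obj p.1).obj p.2).Elt c) :
    pb (tensConcat x) (inE finSigmaFinEquiv.symm
      (fun p : (i : Fin x.len) × Fin (x.obj i).len => (x.obj p.1).obj p.2) p a) =
      inT x.len (fun i => (tensF (Fam C)).obj (x.obj i)) p.1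
        (inT (x.obj p.1).len (x.obj p.1).obj p.2 a) := by
  refine (pb_tensJoin _ _ _ _ _ _ _ p (finSigmaFinEquiv p) rfl _).trans ?_
  exact congrArg (fun b => inT x.len (fun i => (tensF (Fam C)).obj (x.obj i)) p.1
        (inT (x.obj p.1).len (x.obj p.1).obj p.2 b)) (pb_eqToHom_eqToHom _ _ _)

lemma pb_tensConcat_inT (x : FinFam (FinFam (Fam C))) (l : Fin (FinFam.concat.obj x).len)
    (a : ((FinFam.concat.obj x).obj l).Elt c) :
    pb (tensConcat x) (inT _ (FinFam.concat.obj x).obj l a) =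
      inT x.len (fun i => (tensF (Fam C)).obj (x.obj i)) (finSigmaFinEquiv.symm l).1
        (inT (x.obj (finSigmaFinEquiv.symm l).1).len (x.obj (finSigmaFinEquiv.symm l).1).obj
          (finSigmaFinEquiv.symm l).2 a) :=
  (congrArg (pb (tensConcat x)) (inE_enum finSigmaFinEquiv.symm
    (fun p : (i : Fin x.len) × Fin (x.obj i).len => (x.obj p.1).obj p.2) l a).symm).trans
    (pb_tensConcat x (finSigmaFinEquiv.symm l) a)

lemma tensConcat_natural {x y : FinFam (FinFam (Fam C))} (φ : x ⟶ y) :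
    (tensF (Fam C)).map ((FinFam.map (tensF (Fam C))).map φ) ≫ tensConcat y =
      tensConcat x ≫ (tensF (Fam C)).map (FinFam.concat.map φ) := by
  refine hom_ext_inE (s := finSigmaFinEquiv.symm)
    (x := fun p : (i : Fin y.len) × Fin (y.obj i).len => (y.obj p.1).obj p.2) fun c p a => ?_
  have h1 := pb_tensConcat y p a
  have h2 := pb_tensF_map ((FinFam.map (tensF (Fam C))).map φ) p.1
    (inT (y.obj p.1).len (y.obj p.1).obj p.2 a)
  have h3 := pb_ofEquivHom (s := finSigmaFinEquiv.symm) (t := finSigmaFinEquiv.symm)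
    (x := fun p : (i : Fin x.len) × Fin (x.obj i).len => (x.obj p.1).obj p.2)
    (y := fun p : (i : Fin y.len) × Fin (y.obj i).len => (y.obj p.1).obj p.2)
    (FinFam.concatEquiv φ) (fun p => (φ.hom p.1).hom p.2) p a
  have h4 := pb_tensConcat x (FinFam.concatEquiv φ p) (pb ((φ.hom p.1).hom p.2) a)
  have h5 := congrArg (inT x.len (fun i => (tensF (Fam C)).obj (x.obj i)) (φ.perm p.1))
    (pb_tensF_map (φ.hom p.1) p.2 a)
  exact (pb_comp_eq h1 (h2.trans h5)).trans (pb_comp_eq h3 h4).symm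

lemma tensConcat_assoc (x : FinFam (FinFam (FinFam (Fam C)))) :
    tensMap x.len (fun i => tensConcat (x.obj i)) ≫ tensConcat ((FinFam.map FinFam.concat).obj x) ≫
        (tensF (Fam C)).map (FinFam.concatAssoc x) =
      tensConcat ((FinFam.map (FinFam.map (tensF (Fam C)))).obj x) ≫
        tensConcat (FinFam.concat.obj x) := by
  refine hom_ext_inE (s := finSigmaFinEquiv.symm)
    (x := fun p : (i : Fin (FinFam.concat.obj x).len) × Fin ((FinFam.concat.obj x).obj i).len =>
      ((FinFam.concat.obj x).obj p.1).obj p.2) fun c p a => ?_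
  have h1 := pb_ofEquivHom (s := finSigmaFinEquiv.symm) (t := finSigmaFinEquiv.symm)
    (x := fun p : (i : Fin x.len) × Fin (FinFam.concat.obj (x.obj i)).len =>
      (FinFam.concat.obj (x.obj p.1)).obj p.2)
    (y := fun p : (i : Fin (FinFam.concat.obj x).len) × Fin ((FinFam.concat.obj x).obj i).len =>
      ((FinFam.concat.obj x).obj p.1).obj p.2)
    (FinFam.concatAssocEquiv x.len (fun i => (x.obj i).len) fun p => ((x.obj p.1).obj p.2).len)
    (fun p => eqToHom (FinFam.concat_obj_obj (x.obj (finSigmaFinEquiv.symm p.1).1)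
      ⟨(finSigmaFinEquiv.symm p.1).2, p.2⟩)) p a
  have h2 := pb_tensConcat ((FinFam.map FinFam.concat).obj x)
    (FinFam.concatAssocEquiv x.len (fun i => (x.obj i).len) (fun p => ((x.obj p.1).obj p.2).len) p)
    (pb (eqToHom (FinFam.concat_obj_obj (x.obj (finSigmaFinEquiv.symm p.1).1)
      ⟨(finSigmaFinEquiv.symm p.1).2, p.2⟩)) a)
  have h3 := pb_tensConcat (x.obj (finSigmaFinEquiv.symm p.1).1)
    ⟨(finSigmaFinEquiv.symm p.1).2, p.2⟩ a
  have h4 := pb_tensMap x.len _ _ (fun i => tensConcat (x.obj i)) (finSigmaFinEquiv.symm p.1).1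
    (inE finSigmaFinEquiv.symm (fun q : (i : Fin (x.obj (finSigmaFinEquiv.symm p.1).1).len) ×
      Fin ((x.obj (finSigmaFinEquiv.symm p.1).1).obj i).len =>
        ((x.obj (finSigmaFinEquiv.symm p.1).1).obj q.1).obj q.2)
        ⟨(finSigmaFinEquiv.symm p.1).2, p.2⟩ a)
  have h5 := pb_tensConcat (FinFam.concat.obj x) p a
  have h6 := pb_tensConcat_inT ((FinFam.map (FinFam.map (tensF (Fam C)))).obj x) p.1
    (inT ((FinFam.concat.obj x).obj p.1).len ((FinFam.concat.obj x).obj p.1).obj p.2 a)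
  have h7 := congrArg (inT x.len (fun i => (tensF (Fam C)).obj ((FinFam.map (tensF (Fam C))).obj
    (x.obj i))) (finSigmaFinEquiv.symm p.1).1) h3
  exact (pb_comp_eq (pb_comp_eq h1 h2) (h4.trans h7)).trans (pb_comp_eq h5 h6).symm

lemma pb_rightUnitor_inv {X : Fam C} (a : X.Elt c) : pb (ρ_ X).inv (inl a) = a :=
  (congrArg (pb (ρ_ X).inv) (pb_rightUnitor a).symm).trans ((pb_comp _ _ _).symm.trans
    ((congrArg (fun φ => pb φ a) (ρ_ X).inv_hom_id).trans (pb_id _ _)))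

lemma toConcatSingle_eq (b : FinFam (Fam C)) :
    (tensF (Fam C)).map (FinFam.toConcatSingle b) =
      (ρ_ _).inv ≫ tensConcat (FinFam.single.obj b) := by
  refine hom_ext_inE (s := finSigmaFinEquiv.symm)
    (x := fun p : (_ : Fin 1) × Fin b.len => b.obj p.2) fun c p a => ?_
  obtain ⟨i, k⟩ := p
  obtain rfl : i = 0 := Subsingleton.elim _ _
  have h1 := pb_tensConcat (FinFam.single.obj b) ⟨(0 : Fin 1), k⟩ a
  have h2 := pb_rightUnitor_inv (X := (tensF (Fam C)).obj b) (inT b.len b.obj k a)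
  have h3 := (inE_enum (Equiv.refl _) b.obj k (pb (𝟙 _) a)).trans
    (congrArg (inT b.len b.obj k) (pb_id _ a))
  have h4 := pb_ofEquivHom (s := Equiv.refl (Fin b.len)) (t := finSigmaFinEquiv.symm) (x := b.obj)
    (y := fun p : (_ : Fin 1) × Fin b.len => b.obj p.2)
    ⟨fun p => p.2, fun i => ⟨0, i⟩, fun p => by rcases p with ⟨i, j⟩; fin_cases i; rfl,
      fun _ => rfl⟩ (fun p => 𝟙 (b.obj p.2)) ⟨0, k⟩ a
  exact (h4.trans h3).trans (pb_comp_eq h1 h2).symm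

lemma toConcatMapSingle_eq (b : FinFam (Fam C)) :
    (tensF (Fam C)).map (FinFam.toConcatMapSingle b) =
      tensMap b.len (fun i => (ρ_ (b.obj i)).inv) ≫
        tensConcat ((FinFam.map FinFam.single).obj b) := by
  refine hom_ext_inE (s := finSigmaFinEquiv.symm)
    (x := fun p : (_ : Fin b.len) × Fin 1 => b.obj p.1) fun c p a => ?_
  obtain ⟨k, i⟩ := p
  obtain rfl : i = 0 := Subsingleton.elim _ _
  have h1 := pb_tensConcat ((FinFam.map FinFam.single).obj b) ⟨k, (0 : Fin 1)⟩ a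
  have h2 := pb_tensMap b.len _ _ (fun i => (ρ_ (b.obj i)).inv) k (inl a)
  have h5 := congrArg (inT b.len b.obj k) (pb_rightUnitor_inv (X := b.obj k) a)
  have h3 := (inE_enum (Equiv.refl _) b.obj k (pb (𝟙 _) a)).trans
    (congrArg (inT b.len b.obj k) (pb_id _ a))
  have h4 := pb_ofEquivHom (s := Equiv.refl (Fin b.len)) (t := finSigmaFinEquiv.symm) (x := b.obj)
    (y := fun p : (_ : Fin b.len) × Fin 1 => b.obj p.1)
    ⟨fun p => p.1, fun i => ⟨i, 0⟩, fun p => by rcases p with ⟨i, j⟩; fin_cases j; rfl,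
      fun _ => rfl⟩ (fun p => 𝟙 (b.obj p.1)) ⟨k, 0⟩ a
  exact (h4.trans h3).trans (pb_comp_eq h1 (h2.trans h5)).symm

section Interchange

variable {W X Y Z : Fam C}

lemma pb_tensorμ_inl_inl (a : W.Elt c) :
    pb (tensorμ W X Y Z) (inl (inl a)) = inl (inl a) := by
  simp only [tensorμ, ← id_tensorHom, pb_comp, pb_associator_inv_inl_inl, pb_tensorHom_inl, pb_id,
    pb_associator_inl]

lemma pb_tensorμ_inl_inr (a : Y.Elt c) :
    pb (tensorμ W X Y Z) (inl (inr a)) = inr (inl a) := by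
  simp only [tensorμ, ← id_tensorHom, ← tensorHom_id, pb_comp, pb_associator_inv_inl_inr,
    pb_tensorHom_inl, pb_tensorHom_inr, pb_id, pb_associator_inl, pb_braiding_inl,
    pb_associator_inv_inl_inr, pb_associator_inr_inr]

lemma pb_tensorμ_inr_inl (a : X.Elt c) :
    pb (tensorμ W X Y Z) (inr (inl a)) = inl (inr a) := by
  simp only [tensorμ, ← id_tensorHom, ← tensorHom_id, pb_comp, pb_associator_inv_inr,
    pb_tensorHom_inl, pb_tensorHom_inr, pb_id, pb_associator_inr_inl, pb_braiding_inr,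
    pb_associator_inv_inl_inl]

lemma pb_tensorμ_inr_inr (a : Z.Elt c) :
    pb (tensorμ W X Y Z) (inr (inr a)) = inr (inr a) := by
  simp only [tensorμ, ← id_tensorHom, ← tensorHom_id, pb_comp, pb_associator_inv_inr,
    pb_tensorHom_inl, pb_tensorHom_inr, pb_id, pb_associator_inr_inr]

end Interchange

lemma pb_tensZip_inl (n : ℕ) : ∀ (X Y : Fin n → Fam C) (i : Fin n) (a : (X i).Elt c),
    pb (tensZip n X Y) (inT n (fun i => X i ⊗ Y i) i (inl a)) = inl (inT n X i a) := by
  induction n with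
  | zero => exact fun _ _ i => i.elim0
  | succ n ih =>
    intro X Y i a
    refine (pb_comp _ _ _).trans ?_
    cases i using Fin.cases with
    | zero =>
      refine (congrArg _ ((pb_whiskerLeft_inl (C := C) _ _).trans
        (congrArg inl (pb_id (C := C) _ _)))).trans ?_
      exact pb_tensorμ_inl_inl (C := C) a
    | succ i =>
      refine (congrArg _ ((pb_whiskerLeft_inr (C := C) _ _).trans
        (congrArg inr (ih (fun i => X i.succ) (fun i => Y i.succ) i a)))).trans ?_
      exact pb_tensorμ_inr_inl (C := C) _

lemma pb_tensZip_inr (n : ℕ) : ∀ (X Y : Fin n → Fam C) (i : Fin n) (a : (Y i).Elt c),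
    pb (tensZip n X Y) (inT n (fun i => X i ⊗ Y i) i (inr a)) = inr (inT n Y i a) := by
  induction n with
  | zero => exact fun _ _ i => i.elim0
  | succ n ih =>
    intro X Y i a
    refine (pb_comp _ _ _).trans ?_
    cases i using Fin.cases with
    | zero =>
      refine (congrArg _ ((pb_whiskerLeft_inl (C := C) _ _).trans
        (congrArg inl (pb_id (C := C) _ _)))).trans ?_
      exact pb_tensorμ_inl_inr (C := C) a
    | succ i =>
      refine (congrArg _ ((pb_whiskerLeft_inr (C := C) _ _).trans
        (congrArg inr (ih (fun i => X i.succ) (fun i => Y i.succ) i a)))).trans ?_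
      exact pb_tensorμ_inr_inr (C := C) _

lemma hom_ext_zip {n : ℕ} {X Y : Fin n → Fam C} {W : Fam C} {φ ψ : W ⟶ tens n (fun i => X i ⊗ Y i)}
    (hl : ∀ c i (a : (X i).Elt c), pb φ (inT n (fun i => X i ⊗ Y i) i (inl a)) =
      pb ψ (inT n (fun i => X i ⊗ Y i) i (inl a)))
    (hr : ∀ c i (a : (Y i).Elt c), pb φ (inT n (fun i => X i ⊗ Y i) i (inr a)) =
      pb ψ (inT n (fun i => X i ⊗ Y i) i (inr a))) : φ = ψ := by
  refine hom_ext_inT ?_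
  rintro c i ⟨j | j, f⟩
  · exact hl c i ⟨j, f⟩
  · exact hr c i ⟨j, f⟩

lemma tensZip_natural (p q : ℕ) (e : Fin p ≃ Fin q) {X Y : Fin q → Fam C} {X' Y' : Fin p → Fam C}
    (f : ∀ i j, e i = j → (X j ⟶ X' i)) (g : ∀ i j, e i = j → (Y j ⟶ Y' i)) :
    (tensPerm p q e X X' f ⊗ₘ tensPerm p q e Y Y' g) ≫ tensZip p X' Y' =
      tensZip q X Y ≫ tensPerm p q e (fun i => X i ⊗ Y i) (fun i => X' i ⊗ Y' i)
        (fun i j h => f i j h ⊗ₘ g i j h) := by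
  refine hom_ext_zip (fun c i a => ?_) (fun c i a => ?_)
  · have h1 := pb_tensZip_inl p X' Y' i a
    have h2 : pb (tensPerm p q e X X' f ⊗ₘ tensPerm p q e Y Y' g) (inl (inT p X' i a)) =
        inl (inT q X (e i) (pb (f i (e i) rfl) a)) :=
      congrArg (inl (X := tens q X) (Y := tens q Y)) (pb_tensPerm p q e X X' f i a)
    have h3 := pb_tensPerm p q e (fun i => X i ⊗ Y i) (fun i => X' i ⊗ Y' i)
      (fun i j h => f i j h ⊗ₘ g i j h) i (inl a)
    have h4 := pb_tensZip_inl q X Y (e i) (pb (f i (e i) rfl) a)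
    exact (pb_comp_eq h1 h2).trans (pb_comp_eq h3 h4).symm
  · have h1 := pb_tensZip_inr p X' Y' i a
    have h2 : pb (tensPerm p q e X X' f ⊗ₘ tensPerm p q e Y Y' g) (inr (inT p Y' i a)) =
        inr (inT q Y (e i) (pb (g i (e i) rfl) a)) :=
      congrArg (inr (X := tens q X) (Y := tens q Y)) (pb_tensPerm p q e Y Y' g i a)
    have h3 := pb_tensPerm p q e (fun i => X i ⊗ Y i) (fun i => X' i ⊗ Y' i)
      (fun i j h => f i j h ⊗ₘ g i j h) i (inr a)
    have h4 := pb_tensZip_inr q X Y (e i) (pb (g i (e i) rfl) a)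
    exact (pb_comp_eq h1 h2).trans (pb_comp_eq h3 h4).symm

end MoreElements

end Fam

namespace Fam

lemma tensZip_tensJoin {C : Type u} [Category.{v} C] (n N : ℕ) (m : Fin n → ℕ)
    (h : ∑ i, m i = N) (X Y : ∀ i, Fin (m i) → Fam C) (Z W : Fin N → Fam C)
    (hZ : ∀ (p : (i : Fin n) × Fin (m i)) (l : Fin N),
      (l : ℕ) = finSigmaFinEquiv p → X p.1 p.2 = Z l)
    (hW : ∀ (p : (i : Fin n) × Fin (m i)) (l : Fin N),
      (l : ℕ) = finSigmaFinEquiv p → Y p.1 p.2 = W l) :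
    (tensJoin n N m h X Z hZ ⊗ₘ tensJoin n N m h Y W hW) ≫ tensZip N Z W =
      tensZip n (fun i => tens (m i) (X i)) (fun i => tens (m i) (Y i)) ≫
        tensMap n (fun i => tensZip (m i) (X i) (Y i)) ≫
        tensJoin n N m h (fun i k => X i k ⊗ Y i k) (fun l => Z l ⊗ W l)
          (fun p l hl => congrArg₂ (fun A B => A ⊗ B) (hZ p l hl) (hW p l hl)) := by
  have key : ∀ l : Fin N, ∃ p : (i : Fin n) × Fin (m i), (l : ℕ) = finSigmaFinEquiv p := by
    intro l
    subst h
    exact ⟨finSigmaFinEquiv.symm l, by rw [Equiv.apply_symm_apply]⟩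
  have aux : ∀ {A A' B B' : Fam C} (e : A = A') (e' : B = B') (c : C) (a : A'.Elt c),
      pb (eqToHom (congrArg₂ (fun A B => A ⊗ B) e e')) (inl (X := A') (Y := B') a) =
        inl (X := A) (Y := B) (pb (eqToHom e) a) := by
    rintro A _ B _ rfl rfl c a
    exact (pb_id _ _).trans (congrArg inl (pb_id _ _).symm)
  have aux' : ∀ {A A' B B' : Fam C} (e : A = A') (e' : B = B') (c : C) (a : B'.Elt c),
      pb (eqToHom (congrArg₂ (fun A B => A ⊗ B) e e')) (inr (X := A') (Y := B') a) =
        inr (X := A) (Y := B) (pb (eqToHom e') a) := by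
    rintro A _ B _ rfl rfl c a
    exact (pb_id _ _).trans (congrArg inr (pb_id _ _).symm)
  refine hom_ext_zip (fun c l a => ?_) (fun c l a => ?_)
  · obtain ⟨p, hl⟩ := key l
    have h1 := pb_tensZip_inl N Z W l a
    have h2 : pb (tensJoin n N m h X Z hZ ⊗ₘ tensJoin n N m h Y W hW) (inl (inT N Z l a)) = _ :=
      congrArg (inl (X := tens n fun i => tens (m i) (X i)) (Y := tens n fun i => tens (m i) (Y i)))
        (pb_tensJoin n N m h X Z hZ p l hl a)
    have h3 := pb_tensJoin n N m h (fun i k => X i k ⊗ Y i k) (fun l => Z l ⊗ W l)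
      (fun p l hl => congrArg₂ (fun A B => A ⊗ B) (hZ p l hl) (hW p l hl)) p l hl (inl a)
    have h4 := h3.trans (congrArg (fun b => inT n (fun i => tens (m i) fun k => X i k ⊗ Y i k) p.1
      (inT (m p.1) (fun k => X p.1 k ⊗ Y p.1 k) p.2 b)) (aux (hZ p l hl) (hW p l hl) c a))
    have h5 := pb_tensMap n _ _ (fun i => tensZip (m i) (X i) (Y i)) p.1
      (inT (m p.1) (fun k => X p.1 k ⊗ Y p.1 k) p.2 (inl (pb (eqToHom (hZ p l hl)) a)))
    have h6 := congrArg (inT n (fun i => tens (m i) (X i) ⊗ tens (m i) (Y i)) p.1)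
      (pb_tensZip_inl (m p.1) (X p.1) (Y p.1) p.2 (pb (eqToHom (hZ p l hl)) a))
    have h7 := pb_tensZip_inl n (fun i => tens (m i) (X i)) (fun i => tens (m i) (Y i)) p.1
      (inT (m p.1) (X p.1) p.2 (pb (eqToHom (hZ p l hl)) a))
    exact (pb_comp_eq h1 h2).trans (pb_comp_eq (pb_comp_eq h4 (h5.trans h6)) h7).symm
  · obtain ⟨p, hl⟩ := key l
    have h1 := pb_tensZip_inr N Z W l a
    have h2 : pb (tensJoin n N m h X Z hZ ⊗ₘ tensJoin n N m h Y W hW) (inr (inT N W l a)) = _ :=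
      congrArg (inr (X := tens n fun i => tens (m i) (X i)) (Y := tens n fun i => tens (m i) (Y i)))
        (pb_tensJoin n N m h Y W hW p l hl a)
    have h3 := pb_tensJoin n N m h (fun i k => X i k ⊗ Y i k) (fun l => Z l ⊗ W l)
      (fun p l hl => congrArg₂ (fun A B => A ⊗ B) (hZ p l hl) (hW p l hl)) p l hl (inr a)
    have h4 := h3.trans (congrArg (fun b => inT n (fun i => tens (m i) fun k => X i k ⊗ Y i k) p.1
      (inT (m p.1) (fun k => X p.1 k ⊗ Y p.1 k) p.2 b)) (aux' (hZ p l hl) (hW p l hl) c a))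
    have h5 := pb_tensMap n _ _ (fun i => tensZip (m i) (X i) (Y i)) p.1
      (inT (m p.1) (fun k => X p.1 k ⊗ Y p.1 k) p.2 (inr (pb (eqToHom (hW p l hl)) a)))
    have h6 := congrArg (inT n (fun i => tens (m i) (X i) ⊗ tens (m i) (Y i)) p.1)
      (pb_tensZip_inr (m p.1) (X p.1) (Y p.1) p.2 (pb (eqToHom (hW p l hl)) a))
    have h7 := pb_tensZip_inr n (fun i => tens (m i) (X i)) (fun i => tens (m i) (Y i)) p.1
      (inT (m p.1) (Y p.1) p.2 (pb (eqToHom (hW p l hl)) a))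
    exact (pb_comp_eq h1 h2).trans (pb_comp_eq (pb_comp_eq h4 (h5.trans h6)) h7).symm

section Realize

variable {C : Type u} [Category.{v} C] [MonoidalCategory C] [SymmetricCategory C]

variable (C) in
/-- The one-member family. -/
def single : C ⥤ Fam C where
  obj x := ⟨1, Fin 1, Equiv.refl _, fun _ => x⟩
  map f := Hom.ofEquiv (Equiv.refl _) fun _ => f
  map_comp _ _ := hom_ext fun _ => rfl

variable (C) in
/-- The canonical isomorphism from an object to the tensor product of the one-member family. -/
noncomputable def unitSingle : 𝟭 C ⟶ single C ⋙ eval C where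
  app x := (ρ_ x).inv
  naturality x y f := by
    have h : (eval C).map ((single C).map f) = f ⊗ₘ 𝟙 (𝟙_ C) := by
      have aux : ∀ (e : Fin 1 ≃ Fin 1) (g : ∀ i j, e i = j → (x ⟶ y)), (∀ i j h, g i j h = f) →
          tensPerm 1 1 e (fun _ => x) (fun _ => y) g = f ⊗ₘ 𝟙 (𝟙_ C) := by
        intro e g h
        refine (tensPerm_congr (e' := Equiv.refl (Fin 1)) (f' := fun _ _ _ => f)
          (Subsingleton.elim _ _) fun i j h' _ => h i j h').trans (tensPerm_refl 1 _)
      exact aux _ _ fun (i j : Fin 1) h => Category.id_comp f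
    refine Eq.trans ?_ (congrArg (fun t => (ρ_ x).inv ≫ t) h.symm)
    have h' : f ≫ (ρ_ y).inv = (ρ_ x).inv ≫ (f ⊗ₘ 𝟙 (𝟙_ C)) := by simp
    exact h'

instance (x : C) : IsIso ((unitSingle C).app x) := inferInstanceAs (IsIso (ρ_ x).inv)

instance isIso_tensLax_eval (n : ℕ) : ∀ X : Fin n → Fam C, IsIso (tensLax (eval C) n X) := by
  induction n with
  | zero => exact fun X => inferInstanceAs (IsIso (𝟙 (𝟙_ C)))
  | succ n ih =>
    intro X
    have aux : ∀ {A X Y Z : C} (f : X ⟶ Y) (g : A ⊗ Y ⟶ Z), IsIso f → IsIso g →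
        IsIso (A ◁ f ≫ g) := fun _ _ _ _ => inferInstance
    exact aux _ _ (ih fun i => X i.succ) (inferInstanceAs (IsIso (evalμ _ _)))

variable (C) in
/-- The tensor product of a sequence of objects as the value of a sum of one-member families. -/
noncomputable def realize : tensF C ⟶ FinFam.map (single C) ⋙ tensF (Fam C) ⋙ eval C :=
  Functor.whiskerRight (FinFam.mapNat (unitSingle C)) (tensF C) ≫
    Functor.whiskerLeft (FinFam.map (single C)) (tensLaxNat (eval C))

lemma realize_app (x : FinFam C) : (realize C).app x =
    tensMap x.len (fun i => (unitSingle C).app (x.obj i)) ≫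
      tensLax (eval C) x.len (fun i => (single C).obj (x.obj i)) :=
  congrArg (fun t => t ≫ _) (tensF_map_mapNat (unitSingle C) x)

instance (x : FinFam C) : IsIso ((realize C).app x) := by
  rw [realize_app]
  have : ∀ i, IsIso ((unitSingle C).app (x.obj i)) := fun _ => inferInstance
  exact IsIso.comp_isIso' (isIso_tensMap _ _) (isIso_tensLax_eval _ _)

variable (C) in
/-- The iterated version of `realize`. -/
noncomputable def realize₂ : FinFam.map (tensF C) ⋙ tensF C ⟶
    FinFam.map (FinFam.map (single C)) ⋙ FinFam.map (tensF (Fam C)) ⋙ tensF (Fam C) ⋙ eval C :=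
  Functor.whiskerRight (FinFam.mapNat (realize C)) (tensF C) ≫
    Functor.whiskerLeft (FinFam.map (FinFam.map (single C) ⋙ tensF (Fam C)))
      (tensLaxNat (eval C))

lemma realize₂_app (x : FinFam (FinFam C)) : (realize₂ C).app x =
    tensMap x.len (fun i => (realize C).app (x.obj i)) ≫
      tensLax (eval C) x.len (fun i => (tensF (Fam C)).obj ((FinFam.map (single C)).obj (x.obj i))) :=
  congrArg (fun t => t ≫ _) (tensF_map_mapNat (realize C) x)

lemma tensConcat_realize (x : FinFam (FinFam C)) :
    tensConcat x ≫ (realize C).app (FinFam.concat.obj x) =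
      (realize₂ C).app x ≫ (eval C).map
        (tensConcat ((FinFam.map (FinFam.map (single C))).obj x)) := by
  have h1 := tensJoin_natTrans (unitSingle C) x.len (∑ i, (x.obj i).len) (fun i => (x.obj i).len)
    rfl (fun i => (x.obj i).obj) (FinFam.concat.obj x).obj (by
      intro p l hl
      obtain rfl : l = finSigmaFinEquiv p := Fin.ext hl
      exact (FinFam.concat_obj_obj x p).symm)
  have h2 := tensLax_tensJoin (eval C) x.len (∑ i, (x.obj i).len) (fun i => (x.obj i).len)
    rfl (fun i k => (single C).obj ((x.obj i).obj k))
    (fun l => (single C).obj ((FinFam.concat.obj x).obj l)) (by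
      intro p l hl
      obtain rfl : l = finSigmaFinEquiv p := Fin.ext hl
      exact congrArg (single C).obj (FinFam.concat_obj_obj x p).symm)
  have h3 := tensMap_comp x.len
    (fun i => tensMap (x.obj i).len (fun k => (unitSingle C).app ((x.obj i).obj k)))
    (fun i => tensLax (eval C) (x.obj i).len (fun k => (single C).obj ((x.obj i).obj k)))
  have h4 := congrArg (fun f => tensMap x.len f) (funext fun i => realize_app (x.obj i))
  have h5 := realize_app (FinFam.concat.obj x)
  have h6 := realize₂_app x
  have aux : ∀ {A A' B B' E E' F G : C} {j : A ⟶ B} {r : B ⟶ F} {u : B ⟶ B'} {l : B' ⟶ F}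
      {uu : A ⟶ A'} {j' : A' ⟶ B'} {ll : A' ⟶ E} {L : E ⟶ G} {J : G ⟶ F} {R : A ⟶ G}
      {rr : A ⟶ E} {rr' : A ⟶ E}
      (_ : uu ≫ j' = j ≫ u) (_ : ll ≫ L ≫ J = j' ≫ l) (_ : rr' = uu ≫ ll) (_ : rr = rr')
      (_ : r = u ≫ l) (_ : R = rr ≫ L), j ≫ r = R ≫ J := by
    rintro A A' B B' E E' F G j _ u l uu j' ll L J _ _ _ h1 h2 rfl rfl rfl rfl
    rw [← reassoc_of% h1, ← h2]
    simp only [Category.assoc]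
  exact aux (E' := 𝟙_ C) h1 h2 h3 h4 h5 h6

end Realize

end Fam

section Consequences

variable {C : Type u} [Category.{v} C] [MonoidalCategory C] [SymmetricCategory C]

lemma tensConcat_natural {x y : FinFam (FinFam C)} (φ : x ⟶ y) :
    (tensF C).map ((FinFam.map (tensF C)).map φ) ≫ tensConcat y =
      tensConcat x ≫ (tensF C).map (FinFam.concat.map φ) := by
  have h1 := Fam.tensConcat_realize y
  have h2 := Fam.tensConcat_realize x
  have h3 := (Fam.realize C).naturality (FinFam.concat.map φ)
  have h4 := (Fam.realize₂ C).naturality φ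
  have h5 := congrArg (fun t => (Fam.eval C).map t)
    (Fam.tensConcat_natural ((FinFam.map (FinFam.map (Fam.single C))).map φ))
  have h6 := congrArg (fun t => (Fam.eval C).map ((tensF (Fam C)).map t))
    (FinFam.map_concat_map (Fam.single C) φ)
  rw [← cancel_mono ((Fam.realize C).app (FinFam.concat.obj y))]
  have aux : ∀ {A A' B B' : C} {P P' Q Q' : Fam C} {a : A ⟶ A'} {t' : A' ⟶ B'} {t : A ⟶ B}
      {b : B ⟶ B'} {r : B ⟶ (Fam.eval C).obj Q} {r' : B' ⟶ (Fam.eval C).obj Q'}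
      {R : A ⟶ (Fam.eval C).obj P} {R' : A' ⟶ (Fam.eval C).obj P'} {p : P ⟶ P'} {q q' : Q ⟶ Q'}
      {s : P ⟶ Q} {s' : P' ⟶ Q'}
      (_ : t' ≫ r' = R' ≫ (Fam.eval C).map s') (_ : t ≫ r = R ≫ (Fam.eval C).map s)
      (_ : b ≫ r' = r ≫ (Fam.eval C).map q) (_ : a ≫ R' = R ≫ (Fam.eval C).map p)
      (_ : (Fam.eval C).map (p ≫ s') = (Fam.eval C).map (s ≫ q'))
      (_ : (Fam.eval C).map q = (Fam.eval C).map q'),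
      (a ≫ t') ≫ r' = (t ≫ b) ≫ r' := by
    intro A A' B B' P P' Q Q' a t' t b r r' R R' p q q' s s' h1 h2 h3 h4 h5 h6
    rw [Category.assoc, h1, reassoc_of% h4, Category.assoc, h3, reassoc_of% h2, h6,
      ← Functor.map_comp, h5, Functor.map_comp]
  exact aux h1 h2 h3 h4 h5 h6

lemma toConcatSingle_eq (b : FinFam C) :
    (tensF C).map (FinFam.toConcatSingle b) =
      (ρ_ ((tensF C).obj b)).inv ≫ tensConcat (FinFam.single.obj b) := by
  have h1 := Fam.tensConcat_realize (FinFam.single.obj b)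
  have h2 := (Fam.realize C).naturality (FinFam.toConcatSingle b)
  have h3 := congrArg (fun t => (Fam.eval C).map ((tensF (Fam C)).map t))
    (FinFam.map_toConcatSingle (Fam.single C) b)
  have h4 := congrArg (fun t => (Fam.eval C).map t)
    (Fam.toConcatSingle_eq ((FinFam.map (Fam.single C)).obj b))
  have h5 := Fam.realize₂_app (FinFam.single.obj b)
  have h6 := tensLax_one (Fam.eval C) ((tensF (Fam C)).obj ((FinFam.map (Fam.single C)).obj b))
  refine (cancel_mono ((Fam.realize C).app (FinFam.concat.obj (FinFam.single.obj b)))).1 ?_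
  have aux : ∀ {A B E : C} {P Q R : Fam C} {t : A ⟶ B} {r : A ⟶ (Fam.eval C).obj P}
      {r' : B ⟶ (Fam.eval C).obj Q} {q q' : P ⟶ Q} {c : A ⊗ 𝟙_ C ⟶ B}
      {R₂ : A ⊗ 𝟙_ C ⟶ (Fam.eval C).obj R} {c' : R ⟶ Q} {i : P ⟶ R}
      {l : (Fam.eval C).obj P ⊗ 𝟙_ C ⟶ (Fam.eval C).obj R}
      (_ : c ≫ r' = R₂ ≫ (Fam.eval C).map c') (_ : t ≫ r' = r ≫ (Fam.eval C).map q)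
      (_ : (Fam.eval C).map q = (Fam.eval C).map q')
      (_ : (Fam.eval C).map q' = (Fam.eval C).map (i ≫ c')) (_ : R₂ = (r ⊗ₘ 𝟙 _) ≫ l)
      (_ : (ρ_ _).inv ≫ l = (Fam.eval C).map i), t ≫ r' = ((ρ_ A).inv ≫ c) ≫ r' := by
    intro A B E P Q R t r r' q q' c R₂ c' i l h1 h2 h3 h4 h5 h6
    rw [h2, Category.assoc, h1, h3, h4, h5, Functor.map_comp, ← h6]
    simp
  exact aux (E := 𝟙_ C) h1 h2 h3 h4 h5 h6

lemma toConcatMapSingle_eq (b : FinFam C) :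
    (tensF C).map (FinFam.toConcatMapSingle b) =
      tensMap b.len (fun i => (ρ_ (b.obj i)).inv) ≫
        tensConcat ((FinFam.map FinFam.single).obj b) := by
  have h1 := Fam.tensConcat_realize ((FinFam.map FinFam.single).obj b)
  have h2 := (Fam.realize C).naturality (FinFam.toConcatMapSingle b)
  have h3 := congrArg (fun t => (Fam.eval C).map ((tensF (Fam C)).map t))
    (FinFam.map_toConcatMapSingle (Fam.single C) b)
  have h4 := congrArg (fun t => (Fam.eval C).map t)
    (Fam.toConcatMapSingle_eq ((FinFam.map (Fam.single C)).obj b))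
  have h5 := Fam.realize₂_app ((FinFam.map FinFam.single).obj b)
  have h7 : ∀ i, (ρ_ (b.obj i)).inv ≫ (Fam.realize C).app (FinFam.single.obj (b.obj i)) =
      (Fam.unitSingle C).app (b.obj i) ≫ (Fam.eval C).map (ρ_ ((Fam.single C).obj (b.obj i))).inv := by
    intro i
    have aux : ∀ {A : C} {P Q : Fam C} {u : A ⟶ (Fam.eval C).obj P}
        {r : A ⊗ 𝟙_ C ⟶ (Fam.eval C).obj Q} {l : (Fam.eval C).obj P ⊗ 𝟙_ C ⟶ (Fam.eval C).obj Q}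
        {q : P ⟶ Q} (_ : r = (u ⊗ₘ 𝟙 _) ≫ l) (_ : (ρ_ _).inv ≫ l = (Fam.eval C).map q),
        (ρ_ A).inv ≫ r = u ≫ (Fam.eval C).map q := by
      intro A P Q u r l q h h'
      rw [h, ← h']
      simp
    exact aux (Fam.realize_app (FinFam.single.obj (b.obj i)))
      (tensLax_one (Fam.eval C) ((Fam.single C).obj (b.obj i)))
  have h8 := congrArg (fun f => tensMap b.len f) (funext h7)
  have h9 := (tensMap_comp b.len _ _).symm.trans (h8.trans (tensMap_comp b.len _ _))
  have h10 := tensLax_tensMap (Fam.eval C) b.len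
    (fun i => (ρ_ ((Fam.single C).obj (b.obj i))).inv)
  have h11 := Fam.realize_app b
  refine (cancel_mono ((Fam.realize C).app
    (FinFam.concat.obj ((FinFam.map FinFam.single).obj b)))).1 ?_
  have aux : ∀ {A B E F F' : C} {P Q R : Fam C} {t : A ⟶ B} {r : A ⟶ (Fam.eval C).obj P}
      {r' : B ⟶ (Fam.eval C).obj Q} {q q' : P ⟶ Q} {m : A ⟶ E} {c : E ⟶ B}
      {R₂ : E ⟶ (Fam.eval C).obj R} {c' : R ⟶ Q} {i : P ⟶ R} {rr : E ⟶ F}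
      {l : F ⟶ (Fam.eval C).obj R} {u : A ⟶ F'} {ρ' : F' ⟶ F} {l' : F' ⟶ (Fam.eval C).obj P}
      (_ : c ≫ r' = R₂ ≫ (Fam.eval C).map c') (_ : t ≫ r' = r ≫ (Fam.eval C).map q)
      (_ : (Fam.eval C).map q = (Fam.eval C).map q')
      (_ : (Fam.eval C).map q' = (Fam.eval C).map (i ≫ c')) (_ : R₂ = rr ≫ l)
      (_ : m ≫ rr = u ≫ ρ') (_ : l' ≫ (Fam.eval C).map i = ρ' ≫ l) (_ : r = u ≫ l'),
      t ≫ r' = (m ≫ c) ≫ r' := by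
    intro A B E F F' P Q R t r r' q q' m c R₂ c' i rr l u ρ' l' h1 h2 h3 h4 h5 h6 h7 h8
    rw [h2, Category.assoc, h1, h3, h4, h5, h8, Functor.map_comp, Category.assoc, Category.assoc,
      reassoc_of% h7, reassoc_of% h6]
  exact aux h1 h2 h3 h4 h5 h9 h10 h11

lemma tensConcat_assoc (x : FinFam (FinFam (FinFam C))) :
    tensMap x.len (fun i => tensConcat (x.obj i)) ≫ tensConcat ((FinFam.map FinFam.concat).obj x) ≫
        (tensF C).map (FinFam.concatAssoc x) =
      tensConcat ((FinFam.map (FinFam.map (tensF C))).obj x) ≫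
        tensConcat (FinFam.concat.obj x) := by
  have e1 := (Fam.realize C).naturality (FinFam.concatAssoc x)
  have e2 := Fam.tensConcat_realize ((FinFam.map FinFam.concat).obj x)
  have e3 := Fam.realize₂_app ((FinFam.map FinFam.concat).obj x)
  have e4 := congrArg (fun f => tensMap x.len f)
    (funext fun i => Fam.tensConcat_realize (x.obj i))
  have e5 := (tensMap_comp x.len _ _).symm.trans (e4.trans (tensMap_comp x.len _ _))
  have e6 := tensLax_tensMap (Fam.eval C) x.len
    (fun i => tensConcat ((FinFam.map (FinFam.map (Fam.single C))).obj (x.obj i)))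
  have e7 := Fam.tensConcat_realize (FinFam.concat.obj x)
  have e8 := Fam.realize₂_app (FinFam.concat.obj x)
  have e9 := tensJoin_natTrans (Fam.realize C) x.len (∑ i, (x.obj i).len) (fun i => (x.obj i).len)
    rfl (fun i => (x.obj i).obj) (FinFam.concat.obj x).obj (by
      intro p l hl
      obtain rfl : l = finSigmaFinEquiv p := Fin.ext hl
      exact (FinFam.concat_obj_obj x p).symm)
  have e10 := tensLax_tensJoin (Fam.eval C) x.len (∑ i, (x.obj i).len) (fun i => (x.obj i).len)
    rfl (fun i k => (tensF (Fam C)).obj ((FinFam.map (Fam.single C)).obj ((x.obj i).obj k)))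
    (fun l => (tensF (Fam C)).obj ((FinFam.map (Fam.single C)).obj
      ((FinFam.concat.obj x).obj l))) (by
      intro p l hl
      obtain rfl : l = finSigmaFinEquiv p := Fin.ext hl
      exact congrArg (fun y => (tensF (Fam C)).obj ((FinFam.map (Fam.single C)).obj y))
        (FinFam.concat_obj_obj x p).symm)
  have e11 := congrArg (fun f => tensMap x.len f)
    (funext fun i => Fam.realize₂_app (x.obj i))
  have e12 := e11.trans (tensMap_comp x.len _ _)
  have e13 := congrArg (fun t => (Fam.eval C).map ((tensF (Fam C)).map t))
    (FinFam.map_concatAssoc (Fam.single C) x)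
  have e14 := congrArg (fun t => (Fam.eval C).map t)
    (Fam.tensConcat_assoc ((FinFam.map (FinFam.map (FinFam.map (Fam.single C)))).obj x))
  refine (cancel_mono ((Fam.realize C).app (FinFam.concat.obj (FinFam.concat.obj x)))).1 ?_
  have aux : ∀ {A B D E A' B₁ B₂ A₁ A₂ : C} {P Q R P' S : Fam C} {m : A ⟶ B} {j : B ⟶ D}
      {p : D ⟶ E} {n : A ⟶ A'} {k : A' ⟶ E} {rD : D ⟶ (Fam.eval C).obj Q}
      {rE : E ⟶ (Fam.eval C).obj R} {q q' : Q ⟶ R} {R₂ : B ⟶ (Fam.eval C).obj P} {c : P ⟶ Q}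
      {rB : B ⟶ B₁} {lB : B₁ ⟶ (Fam.eval C).obj P} {RR : A ⟶ B₂}
      {cc : B₂ ⟶ B₁} {l₂ : B₂ ⟶ (Fam.eval C).obj P'} {c' : P' ⟶ P}
      {R₃ : A' ⟶ (Fam.eval C).obj S} {d : S ⟶ R} {rA' : A' ⟶ A₁} {lA' : A₁ ⟶ (Fam.eval C).obj S}
      {rr : A ⟶ A₂} {n' : A₂ ⟶ A₁} {ll : A₂ ⟶ B₂} {n'' : P' ⟶ S}
      (e1 : p ≫ rE = rD ≫ (Fam.eval C).map q) (e2 : j ≫ rD = R₂ ≫ (Fam.eval C).map c)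
      (e3 : R₂ = rB ≫ lB) (e5 : m ≫ rB = RR ≫ cc) (e6 : l₂ ≫ (Fam.eval C).map c' = cc ≫ lB)
      (e7 : k ≫ rE = R₃ ≫ (Fam.eval C).map d) (e8 : R₃ = rA' ≫ lA') (e9 : rr ≫ n' = n ≫ rA')
      (e10 : ll ≫ l₂ ≫ (Fam.eval C).map n'' = n' ≫ lA') (e12 : RR = rr ≫ ll)
      (e13 : (Fam.eval C).map q = (Fam.eval C).map q')
      (e14 : (Fam.eval C).map (c' ≫ c ≫ q') = (Fam.eval C).map (n'' ≫ d)),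
      (m ≫ j ≫ p) ≫ rE = (n ≫ k) ≫ rE := by
    intro A B D E A' B₁ B₂ A₁ A₂ P Q R P' S m j p n k rD rE q q' R₂ c rB lB RR cc l₂ c' R₃ d rA'
      lA' rr n' ll n'' e1 e2 e3 e5 e6 e7 e8 e9 e10 e12 e13 e14
    simp only [Functor.map_comp] at e14
    simp only [Category.assoc]
    rw [e1, reassoc_of% e2, e3, Category.assoc, reassoc_of% e5, ← reassoc_of% e6, e13, e14, e7, e8,
      Category.assoc, ← reassoc_of% e9, ← reassoc_of% e10, e12, Category.assoc]
  exact aux e1 e2 e3 e5 e6 e7 e8 e9 e10 e12 e13 e14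

variable (C) in
/-- The canonical isomorphism from a tensor product of two objects to the tensor product of the
sum of one-member families. -/
noncomputable def realizePair : tensor C ⟶ (Fam.single C).prod (Fam.single C) ⋙ tensor (Fam C) ⋙
    Fam.eval C where
  app p := ((Fam.unitSingle C).app p.1 ⊗ₘ (Fam.unitSingle C).app p.2) ≫ μ (Fam.eval C) _ _
  naturality p q f := by
    have h1 := (Fam.unitSingle C).naturality f.1
    have h2 := (Fam.unitSingle C).naturality f.2
    have aux : ∀ {A A' B B' : C} {P P' Q Q' : Fam C} {a : A ⟶ A'} {b : B ⟶ B'} {p : P ⟶ P'}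
        {q : Q ⟶ Q'} {u : A ⟶ (Fam.eval C).obj P} {u' : A' ⟶ (Fam.eval C).obj P'}
        {v : B ⟶ (Fam.eval C).obj Q} {v' : B' ⟶ (Fam.eval C).obj Q'}
        (_ : a ≫ u' = u ≫ (Fam.eval C).map p) (_ : b ≫ v' = v ≫ (Fam.eval C).map q),
        (a ⊗ₘ b) ≫ (u' ⊗ₘ v') ≫ μ (Fam.eval C) _ _ =
          ((u ⊗ₘ v) ≫ μ (Fam.eval C) _ _) ≫ (Fam.eval C).map (p ⊗ₘ q) := by
      intro A A' B B' P P' Q Q' a b p q u u' v v' h1 h2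
      rw [tensorHom_comp_tensorHom_assoc, h1, h2, ← tensorHom_comp_tensorHom, Category.assoc,
        Category.assoc, Functor.LaxMonoidal.μ_natural]
    exact aux h1 h2

instance (p : C × C) : IsIso ((realizePair C).app p) := by
  have : IsIso (μ (Fam.eval C) ((Fam.single C).obj p.1) ((Fam.single C).obj p.2)) :=
    inferInstanceAs (IsIso (Fam.evalμ _ _))
  have h : ∀ {A A' B B' D : C} {f : A ⟶ A'} {g : B ⟶ B'} {k : A' ⊗ B' ⟶ D} (_ : IsIso f)
    (_ : IsIso g) (_ : IsIso k), IsIso ((f ⊗ₘ g) ≫ k) := fun _ _ _ => inferInstance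
  exact h inferInstance inferInstance this

/-- The tensor product of a sequence of tensor products as the value of a family. -/
noncomputable def realizeZip (n : ℕ) (x y : Fin n → C) : tens n (fun i => x i ⊗ y i) ⟶
    (Fam.eval C).obj (tens n fun i => (Fam.single C).obj (x i) ⊗ (Fam.single C).obj (y i)) :=
  tensMap n (fun i => (realizePair C).app (x i, y i)) ≫ tensLax (Fam.eval C) n
    (fun i => (Fam.single C).obj (x i) ⊗ (Fam.single C).obj (y i))

instance (n : ℕ) (x y : Fin n → C) : IsIso (realizeZip n x y) := by
  have : ∀ i, IsIso ((realizePair C).app (x i, y i)) := fun _ => inferInstance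
  exact IsIso.comp_isIso' (isIso_tensMap _ _) (Fam.isIso_tensLax_eval _ _)

lemma tensZip_realizeZip (n : ℕ) (x y : Fin n → C) :
    tensZip n x y ≫ realizeZip n x y =
      ((Fam.realize C).app ⟨n, x⟩ ⊗ₘ (Fam.realize C).app ⟨n, y⟩) ≫ μ (Fam.eval C) _ _ ≫
        (Fam.eval C).map (tensZip n (fun i => (Fam.single C).obj (x i))
          (fun i => (Fam.single C).obj (y i))) := by
  have h1 := tensLax_tensZip (Fam.eval C) n (fun i => (Fam.single C).obj (x i))
    (fun i => (Fam.single C).obj (y i))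
  have h2 := tensZip_tensMap n (fun i => (Fam.unitSingle C).app (x i))
    (fun i => (Fam.unitSingle C).app (y i))
  have h3 := tensMap_comp n
    (fun i => (Fam.unitSingle C).app (x i) ⊗ₘ (Fam.unitSingle C).app (y i))
    (fun i => μ (Fam.eval C) ((Fam.single C).obj (x i)) ((Fam.single C).obj (y i)))
  have h4 := Fam.realize_app ⟨n, x⟩
  have h5 := Fam.realize_app ⟨n, y⟩
  have aux : ∀ {X X' X'' Y Y' Y'' Z Z' Z'' W V : C} {z : X ⊗ Y ⟶ Z} {u : X ⟶ X'} {v : Y ⟶ Y'}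
      {z' : X' ⊗ Y' ⟶ Z'} {w : Z ⟶ Z'} {l : X' ⟶ X''} {l' : Y' ⟶ Y''} {m : X'' ⊗ Y'' ⟶ W}
      {t : W ⟶ V} {mm : Z' ⟶ Z''} {L : Z'' ⟶ V} {r : X ⟶ X''} {r' : Y ⟶ Y''} {k : Z ⟶ Z''}
      (_ : (l ⊗ₘ l') ≫ m ≫ t = z' ≫ mm ≫ L) (_ : (u ⊗ₘ v) ≫ z' = z ≫ w) (_ : k = w ≫ mm)
      (_ : r = u ≫ l) (_ : r' = v ≫ l'), z ≫ k ≫ L = (r ⊗ₘ r') ≫ m ≫ t := by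
    rintro X X' X'' Y Y' Y'' Z Z' Z'' W V z u v z' w l l' m t mm L _ _ _ h1 h2 rfl rfl rfl
    rw [← tensorHom_comp_tensorHom, Category.assoc, Category.assoc, h1, reassoc_of% h2]
  exact aux h1 h2 h3 h4 h5

lemma tensPerm_realize (p q : ℕ) (e : Fin p ≃ Fin q) {x : Fin q → C} {y : Fin p → C}
    (f : ∀ i j, e i = j → (x j ⟶ y i)) :
    tensPerm p q e x y f ≫ (Fam.realize C).app ⟨p, y⟩ = (Fam.realize C).app ⟨q, x⟩ ≫
      (Fam.eval C).map (tensPerm p q e (fun i => (Fam.single C).obj (x i))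
        (fun i => (Fam.single C).obj (y i)) (fun i j h => (Fam.single C).map (f i j h))) := by
  have h1 := tensPerm_tensMap p q e f (fun i => (Fam.unitSingle C).app (y i))
  have h2 := tensMap_tensPerm p q e (fun i => (Fam.unitSingle C).app (x i))
    (fun i j h => (Fam.eval C).map ((Fam.single C).map (f i j h)))
  have h3 : tensPerm p q e _ _ (fun i j h => f i j h ≫ (Fam.unitSingle C).app (y i)) =
      tensPerm p q e _ _ (fun i j h => (Fam.unitSingle C).app (x j) ≫
        (Fam.eval C).map ((Fam.single C).map (f i j h))) :=
    tensPerm_congr rfl fun i j h _ => (Fam.unitSingle C).naturality (f i j h)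
  have h4 := tensLax_natural (Fam.eval C) p q e (fun i => (Fam.single C).obj (x i))
    (fun i => (Fam.single C).obj (y i)) (fun i j h => (Fam.single C).map (f i j h))
  have aux : ∀ {A B A' B' P Q : C} {t : A ⟶ B} {u : B ⟶ B'} {l : B' ⟶ Q} {v : A ⟶ A'}
      {l' : A' ⟶ P} {s : P ⟶ Q} {t' : A' ⟶ B'} {k k' : A ⟶ B'} {r : B ⟶ Q} {r' : A ⟶ P}
      (_ : t ≫ u = k) (_ : v ≫ t' = k') (_ : k = k') (_ : l' ≫ s = t' ≫ l) (_ : r = u ≫ l)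
      (_ : r' = v ≫ l'), t ≫ r = r' ≫ s := by
    rintro A B A' B' P Q t u l v l' s t' k k' r r' h1 h2 h3 h4 rfl rfl
    rw [reassoc_of% h1, h3, ← h2, Category.assoc, Category.assoc, h4]
  exact aux h1 h2 h3 h4 (Fam.realize_app ⟨p, y⟩) (Fam.realize_app ⟨q, x⟩)

lemma tensPerm_realizeZip (p q : ℕ) (e : Fin p ≃ Fin q) {x y : Fin q → C} {x' y' : Fin p → C}
    (f : ∀ i j, e i = j → (x j ⟶ x' i)) (g : ∀ i j, e i = j → (y j ⟶ y' i)) :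
    tensPerm p q e (fun i => x i ⊗ y i) (fun i => x' i ⊗ y' i) (fun i j h => f i j h ⊗ₘ g i j h) ≫
        realizeZip p x' y' = realizeZip q x y ≫
      (Fam.eval C).map (tensPerm p q e
        (fun i => (Fam.single C).obj (x i) ⊗ (Fam.single C).obj (y i))
        (fun i => (Fam.single C).obj (x' i) ⊗ (Fam.single C).obj (y' i))
        (fun i j h => (Fam.single C).map (f i j h) ⊗ₘ (Fam.single C).map (g i j h))) := by
  have h1 := tensPerm_tensMap p q e (fun i j h => f i j h ⊗ₘ g i j h)
    (fun i => (realizePair C).app (x' i, y' i))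
  have h2 := tensMap_tensPerm p q e (fun i => (realizePair C).app (x i, y i))
    (fun i j h => (Fam.eval C).map ((Fam.single C).map (f i j h) ⊗ₘ (Fam.single C).map (g i j h)))
  have h3 : tensPerm p q e _ _ (fun i j h => (f i j h ⊗ₘ g i j h) ≫
        (realizePair C).app (x' i, y' i)) =
      tensPerm p q e _ _ (fun i j h => (realizePair C).app (x j, y j) ≫
        (Fam.eval C).map ((Fam.single C).map (f i j h) ⊗ₘ (Fam.single C).map (g i j h))) :=
    tensPerm_congr rfl fun i j h _ => (realizePair C).naturality (Prod.mkHom (f i j h) (g i j h))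
  have h4 := tensLax_natural (Fam.eval C) p q e
    (fun i => (Fam.single C).obj (x i) ⊗ (Fam.single C).obj (y i))
    (fun i => (Fam.single C).obj (x' i) ⊗ (Fam.single C).obj (y' i))
    (fun i j h => (Fam.single C).map (f i j h) ⊗ₘ (Fam.single C).map (g i j h))
  have aux : ∀ {A B A' B' P Q : C} {t : A ⟶ B} {u : B ⟶ B'} {l : B' ⟶ Q} {v : A ⟶ A'}
      {l' : A' ⟶ P} {s : P ⟶ Q} {t' : A' ⟶ B'} {k k' : A ⟶ B'}
      (_ : t ≫ u = k) (_ : v ≫ t' = k') (_ : k = k') (_ : l' ≫ s = t' ≫ l),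
      t ≫ u ≫ l = (v ≫ l') ≫ s := by
    rintro A B A' B' P Q t u l v l' s t' k k' h1 h2 h3 h4
    rw [reassoc_of% h1, h3, ← h2, Category.assoc, Category.assoc, h4]
  exact aux h1 h2 h3 h4

lemma tensZip_natural (p q : ℕ) (e : Fin p ≃ Fin q) {x y : Fin q → C} {x' y' : Fin p → C}
    (f : ∀ i j, e i = j → (x j ⟶ x' i)) (g : ∀ i j, e i = j → (y j ⟶ y' i)) :
    (tensPerm p q e x x' f ⊗ₘ tensPerm p q e y y' g) ≫ tensZip p x' y' =
      tensZip q x y ≫ tensPerm p q e (fun i => x i ⊗ y i) (fun i => x' i ⊗ y' i)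
        (fun i j h => f i j h ⊗ₘ g i j h) := by
  have h1 := tensPerm_realizeZip p q e f g
  have h2 := tensPerm_realize p q e f
  have h3 := tensPerm_realize p q e g
  have h4 := tensZip_realizeZip p x' y'
  have h5 := tensZip_realizeZip q x y
  have h6 := congrArg (fun t => (Fam.eval C).map t) (Fam.tensZip_natural p q e
    (fun i j h => (Fam.single C).map (f i j h)) (fun i j h => (Fam.single C).map (g i j h)))
  refine (cancel_mono (realizeZip p x' y')).1 ?_
  have aux : ∀ {X X' Y Y' Z Z' : C} {P P' Q Q' R R' : Fam C} {a : X ⟶ X'} {b : Y ⟶ Y'}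
      {z' : X' ⊗ Y' ⟶ Z'} {z : X ⊗ Y ⟶ Z} {t : Z ⟶ Z'} {r : Z ⟶ (Fam.eval C).obj R}
      {r' : Z' ⟶ (Fam.eval C).obj R'} {s : R ⟶ R'} {u : X ⟶ (Fam.eval C).obj P}
      {u' : X' ⟶ (Fam.eval C).obj P'} {v : Y ⟶ (Fam.eval C).obj Q}
      {v' : Y' ⟶ (Fam.eval C).obj Q'} {p : P ⟶ P'} {q : Q ⟶ Q'} {w : P ⊗ Q ⟶ R}
      {w' : P' ⊗ Q' ⟶ R'} (_ : t ≫ r' = r ≫ (Fam.eval C).map s)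
      (_ : a ≫ u' = u ≫ (Fam.eval C).map p) (_ : b ≫ v' = v ≫ (Fam.eval C).map q)
      (_ : z' ≫ r' = (u' ⊗ₘ v') ≫ μ (Fam.eval C) _ _ ≫ (Fam.eval C).map w')
      (_ : z ≫ r = (u ⊗ₘ v) ≫ μ (Fam.eval C) _ _ ≫ (Fam.eval C).map w)
      (_ : (Fam.eval C).map ((p ⊗ₘ q) ≫ w') = (Fam.eval C).map (w ≫ s)),
      ((a ⊗ₘ b) ≫ z') ≫ r' = (z ≫ t) ≫ r' := by
    intro X X' Y Y' Z Z' P P' Q Q' R R' a b z' z t r r' s u u' v v' p q w w' h1 h2 h3 h4 h5 h6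
    simp only [Functor.map_comp] at h6
    rw [Category.assoc, h4, tensorHom_comp_tensorHom_assoc, h2, h3, ← tensorHom_comp_tensorHom,
      Category.assoc, Functor.LaxMonoidal.μ_natural_assoc, h6, Category.assoc, h1,
      reassoc_of% h5]
  exact aux h1 h2 h3 h4 h5 h6

lemma tensJoin_realize (n N : ℕ) (m : Fin n → ℕ) (h : ∑ i, m i = N) (x : ∀ i, Fin (m i) → C)
    (z : Fin N → C) (hz : ∀ (p : (i : Fin n) × Fin (m i)) (l : Fin N),
      (l : ℕ) = finSigmaFinEquiv p → x p.1 p.2 = z l) :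
    tensJoin n N m h x z hz ≫ (Fam.realize C).app ⟨N, z⟩ =
      tensMap n (fun i => (Fam.realize C).app ⟨m i, x i⟩) ≫
        tensLax (Fam.eval C) n (fun i => tens (m i) fun k => (Fam.single C).obj (x i k)) ≫
        (Fam.eval C).map (tensJoin n N m h (fun i k => (Fam.single C).obj (x i k))
          (fun l => (Fam.single C).obj (z l))
          (fun p l hl => congrArg (Fam.single C).obj (hz p l hl))) := by
  have h1 := tensJoin_natTrans (Fam.unitSingle C) n N m h x z hz
  have h2 := tensLax_tensJoin (Fam.eval C) n N m h (fun i k => (Fam.single C).obj (x i k))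
    (fun l => (Fam.single C).obj (z l)) (fun p l hl => congrArg (Fam.single C).obj (hz p l hl))
  have h3 := tensMap_comp n (fun i => tensMap (m i) (fun k => (Fam.unitSingle C).app (x i k)))
    (fun i => tensLax (Fam.eval C) (m i) (fun k => (Fam.single C).obj (x i k)))
  have h4 := congrArg (fun f => tensMap n f) (funext fun i => Fam.realize_app ⟨m i, x i⟩)
  have h5 := Fam.realize_app ⟨N, z⟩
  have aux : ∀ {A A' B B' E F G : C} {j : A ⟶ B} {r : B ⟶ F} {u : B ⟶ B'} {l : B' ⟶ F}
      {uu : A ⟶ A'} {j' : A' ⟶ B'} {ll : A' ⟶ E} {L : E ⟶ G} {J : G ⟶ F}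
      {rr : A ⟶ E} {rr' : A ⟶ E}
      (_ : uu ≫ j' = j ≫ u) (_ : ll ≫ L ≫ J = j' ≫ l) (_ : rr' = uu ≫ ll) (_ : rr = rr')
      (_ : r = u ≫ l), j ≫ r = rr ≫ L ≫ J := by
    rintro A A' B B' E F G j _ u l uu j' ll L J _ _ h1 h2 rfl rfl rfl
    rw [← reassoc_of% h1, ← h2]
    simp only [Category.assoc]
  exact aux h1 h2 h3 h4 h5

lemma tensJoin_realizeZip (n N : ℕ) (m : Fin n → ℕ) (h : ∑ i, m i = N)
    (x y : ∀ i, Fin (m i) → C) (z w : Fin N → C) (hz : ∀ (p : (i : Fin n) × Fin (m i)) (l : Fin N),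
      (l : ℕ) = finSigmaFinEquiv p → x p.1 p.2 = z l)
    (hw : ∀ (p : (i : Fin n) × Fin (m i)) (l : Fin N),
      (l : ℕ) = finSigmaFinEquiv p → y p.1 p.2 = w l) :
    tensJoin n N m h (fun i k => x i k ⊗ y i k) (fun l => z l ⊗ w l)
        (fun p l hl => congrArg₂ (fun A B => A ⊗ B) (hz p l hl) (hw p l hl)) ≫
        realizeZip N z w =
      tensMap n (fun i => realizeZip (m i) (x i) (y i)) ≫ tensLax (Fam.eval C) n _ ≫
        (Fam.eval C).map (tensJoin n N m h
          (fun i k => (Fam.single C).obj (x i k) ⊗ (Fam.single C).obj (y i k))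
          (fun l => (Fam.single C).obj (z l) ⊗ (Fam.single C).obj (w l))
          (fun p l hl => congrArg₂ (fun A B => A ⊗ B)
            (congrArg (Fam.single C).obj (hz p l hl))
            (congrArg (Fam.single C).obj (hw p l hl)))) := by
  have h1 := tensJoin_natTrans (realizePair C) n N m h (fun i k => (x i k, y i k))
    (fun l => (z l, w l)) (fun p l hl => Prod.ext (hz p l hl) (hw p l hl))
  have h2 := tensLax_tensJoin (Fam.eval C) n N m h
    (fun i k => (Fam.single C).obj (x i k) ⊗ (Fam.single C).obj (y i k))
    (fun l => (Fam.single C).obj (z l) ⊗ (Fam.single C).obj (w l))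
    (fun p l hl => congrArg₂ (fun A B => A ⊗ B) (congrArg (Fam.single C).obj (hz p l hl))
      (congrArg (Fam.single C).obj (hw p l hl)))
  have h3 := tensMap_comp n (fun i => tensMap (m i) (fun k => (realizePair C).app (x i k, y i k)))
    (fun i => tensLax (Fam.eval C) (m i)
      (fun k => (Fam.single C).obj (x i k) ⊗ (Fam.single C).obj (y i k)))
  have aux : ∀ {A A' B B' E F G : C} {j : A ⟶ B} {u : B ⟶ B'} {l : B' ⟶ F}
      {uu : A ⟶ A'} {j' : A' ⟶ B'} {ll : A' ⟶ E} {L : E ⟶ G} {J : G ⟶ F} {rr : A ⟶ E}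
      (_ : uu ≫ j' = j ≫ u) (_ : ll ≫ L ≫ J = j' ≫ l) (_ : rr = uu ≫ ll),
      j ≫ u ≫ l = rr ≫ L ≫ J := by
    rintro A A' B B' E F G j u l uu j' ll L J _ h1 h2 rfl
    rw [← reassoc_of% h1, ← h2]
    simp only [Category.assoc]
  exact aux h1 h2 h3

lemma tensZip_tensJoin (n N : ℕ) (m : Fin n → ℕ)
    (h : ∑ i, m i = N) (x y : ∀ i, Fin (m i) → C) (z w : Fin N → C)
    (hz : ∀ (p : (i : Fin n) × Fin (m i)) (l : Fin N),
      (l : ℕ) = finSigmaFinEquiv p → x p.1 p.2 = z l)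
    (hw : ∀ (p : (i : Fin n) × Fin (m i)) (l : Fin N),
      (l : ℕ) = finSigmaFinEquiv p → y p.1 p.2 = w l) :
    (tensJoin n N m h x z hz ⊗ₘ tensJoin n N m h y w hw) ≫ tensZip N z w =
      tensZip n (fun i => tens (m i) (x i)) (fun i => tens (m i) (y i)) ≫
        tensMap n (fun i => tensZip (m i) (x i) (y i)) ≫
        tensJoin n N m h (fun i k => x i k ⊗ y i k) (fun l => z l ⊗ w l)
          (fun p l hl => congrArg₂ (fun A B => A ⊗ B) (hz p l hl) (hw p l hl)) := by
  have e1 := tensZip_realizeZip N z w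
  have e2 := tensJoin_realize n N m h x z hz
  have e3 := tensJoin_realize n N m h y w hw
  have e4 := congrArg (fun t => (Fam.eval C).map t) (Fam.tensZip_tensJoin n N m h
    (fun i k => (Fam.single C).obj (x i k)) (fun i k => (Fam.single C).obj (y i k))
    (fun l => (Fam.single C).obj (z l)) (fun l => (Fam.single C).obj (w l))
    (fun p l hl => congrArg (Fam.single C).obj (hz p l hl))
    (fun p l hl => congrArg (Fam.single C).obj (hw p l hl)))
  have e5 := tensLax_tensZip (Fam.eval C) n
    (fun i => tens (m i) fun k => (Fam.single C).obj (x i k))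
    (fun i => tens (m i) fun k => (Fam.single C).obj (y i k))
  have e6 := tensZip_tensMap n (fun i => (Fam.realize C).app ⟨m i, x i⟩)
    (fun i => (Fam.realize C).app ⟨m i, y i⟩)
  have e7 := congrArg (fun f => tensMap n f)
    (funext fun i => tensZip_realizeZip (m i) (x i) (y i))
  have e8 := (tensMap_comp n _ _).symm.trans (e7.trans ((tensMap_comp n _ _).trans
    (congrArg (fun t => _ ≫ t) (tensMap_comp n _ _))))
  have e9 := tensLax_tensMap (Fam.eval C) n (fun i => tensZip (m i)
    (fun k => (Fam.single C).obj (x i k)) (fun k => (Fam.single C).obj (y i k)))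
  have e10 := tensJoin_realizeZip n N m h x y z w hz hw
  refine (cancel_mono (realizeZip N z w)).1 ?_
  have aux : ∀ {X Y Z W V A A' B B' D E E' : C} {P Q P' Q' R S T : Fam C} {j : X ⟶ Z} {k : Y ⟶ W}
      {c : Z ⊗ W ⟶ V} {r : V ⟶ (Fam.eval C).obj R} {rz : Z ⟶ (Fam.eval C).obj P}
      {rw' : W ⟶ (Fam.eval C).obj Q} {cF : P ⊗ Q ⟶ R} {mx : X ⟶ A} {lx : A ⟶ (Fam.eval C).obj P'}
      {jF : P' ⟶ P} {my : Y ⟶ B} {ly : B ⟶ (Fam.eval C).obj Q'} {kF : Q' ⟶ Q} {cF' : P' ⊗ Q' ⟶ S}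
      {mF : S ⟶ T} {JF : T ⟶ R} {zAB : A ⊗ B ⟶ A'} {mm : A' ⟶ B'} {lS : B' ⟶ (Fam.eval C).obj S}
      {zXY : X ⊗ Y ⟶ E} {mE : E ⟶ A'} {tz : E ⟶ E'} {rE : E' ⟶ D} {tzF : B' ⟶ D}
      {lD : D ⟶ (Fam.eval C).obj T} {J : E' ⟶ V}
      (e1 : c ≫ r = (rz ⊗ₘ rw') ≫ μ (Fam.eval C) _ _ ≫ (Fam.eval C).map cF)
      (e2 : j ≫ rz = mx ≫ lx ≫ (Fam.eval C).map jF) (e3 : k ≫ rw' = my ≫ ly ≫ (Fam.eval C).map kF)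
      (e4 : (Fam.eval C).map ((jF ⊗ₘ kF) ≫ cF) = (Fam.eval C).map (cF' ≫ mF ≫ JF))
      (e5 : (lx ⊗ₘ ly) ≫ μ (Fam.eval C) _ _ ≫ (Fam.eval C).map cF' = zAB ≫ mm ≫ lS)
      (e6 : (mx ⊗ₘ my) ≫ zAB = zXY ≫ mE) (e8 : tz ≫ rE = mE ≫ mm ≫ tzF)
      (e9 : lS ≫ (Fam.eval C).map mF = tzF ≫ lD)
      (e10 : J ≫ r = rE ≫ lD ≫ (Fam.eval C).map JF),
      ((j ⊗ₘ k) ≫ c) ≫ r = (zXY ≫ tz ≫ J) ≫ r := by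
    intro X Y Z W V A A' B B' D E E' P Q P' Q' R S T j k c r rz rw' cF mx lx jF my ly kF cF' mF JF zAB
      mm lS zXY mE tz rE tzF lD J e1 e2 e3 e4 e5 e6 e8 e9 e10
    simp only [Functor.map_comp] at e4
    rw [Category.assoc, e1, tensorHom_comp_tensorHom_assoc, e2, e3, ← tensorHom_comp_tensorHom,
      ← tensorHom_comp_tensorHom]
    simp only [Category.assoc]
    rw [Functor.LaxMonoidal.μ_natural_assoc, e4, reassoc_of% e5, reassoc_of% e6, e10,
      reassoc_of% e8, reassoc_of% e9]
  exact aux e1 e2 e3 e4 e5 e6 e8 e9 e10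

end Consequences

/-- The canonical morphisms of iterated tensor products are natural. -/
def tensConcatNat (C : Type u) [Category.{v} C] [MonoidalCategory C] [SymmetricCategory C] :
    FinFam.map (tensF C) ⋙ tensF C ⟶ FinFam.concat ⋙ tensF C where
  app x := tensConcat x
  naturality _ _ φ := tensConcat_natural φ

lemma tensF_map_tensConcat {C : Type u} [Category.{v} C] [MonoidalCategory C]
    [SymmetricCategory C] (x : FinFam (FinFam (FinFam C))) :
    (tensF C).map ((FinFam.mapNat (tensConcatNat C)).app x) ≫
        tensConcat ((FinFam.map FinFam.concat).obj x) ≫ (tensF C).map (FinFam.concatAssoc x) =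
      tensConcat ((FinFam.map (FinFam.map (tensF C))).obj x) ≫
        tensConcat (FinFam.concat.obj x) :=
  (congrArg (fun t => t ≫ _) (tensF_map_mapNat (tensConcatNat C) x)).trans (tensConcat_assoc x)

namespace FinFam

section Coherence

variable {K : Type u} [Category.{v} K]

lemma isIso_of_isIso {x y : FinFam K} (f : x ⟶ y) (h : ∀ i, IsIso (f.hom i)) : IsIso f := by
  have e : ∀ i j, f.perm i = j → f.perm.symm j = i := by
    rintro i _ rfl
    exact f.perm.symm_apply_apply i
  let g : y ⟶ x := ⟨f.perm.symm, fun j => inv (f.hom (f.perm.symm j)) ≫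
    eqToHom (congrArg x.obj (f.perm.apply_symm_apply j))⟩
  refine ⟨g, ?_, ?_⟩
  · refine hom_ext (fun j => f.perm.apply_symm_apply j) fun j => ?_
    exact (IsIso.hom_inv_id_assoc (f.hom (f.perm.symm j)) _).trans (Category.comp_id _).symm
  · refine hom_ext (fun i => f.perm.symm_apply_apply i) fun i => ?_
    change (inv (f.hom (f.perm.symm (f.perm i))) ≫ eqToHom _) ≫ f.hom i = _ ≫ 𝟙 _
    have : ∀ (i' : Fin y.len) (hi : i' = i) (h1 : x.obj (f.perm i') = x.obj (f.perm i)),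
        (inv (f.hom i') ≫ eqToHom h1) ≫ f.hom i = eqToHom (congrArg y.obj hi) ≫ 𝟙 _ := by
      rintro _ rfl _
      simp
    exact this _ (f.perm.symm_apply_apply i) _

instance (𝔠 : Type w) {x y : Profile 𝔠} (f : x ⟶ y) : IsIso f :=
  isIso_of_isIso _ fun _ => inferInstance

lemma profile_hom_ext {𝔠 : Type w} {x y : Profile 𝔠} {f g : x ⟶ y}
    (h : ∀ i, f.perm i = g.perm i) : f = g :=
  hom_ext h fun _ => Subsingleton.elim _ _

/-- Equality of morphisms of sequences can be tested on formal tensor products. -/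
lemma hom_ext_tensF {x y : FinFam K} {f g : x ⟶ y}
    (h : (tensF (Fam K)).map ((map (Fam.single K)).map f) =
      (tensF (Fam K)).map ((map (Fam.single K)).map g)) : f = g := by
  have key : ∀ i : Fin y.len, ∃ e : f.perm i = g.perm i,
      f.hom i = eqToHom (congrArg x.obj e) ≫ g.hom i := by
    intro i
    have h1 := Fam.pb_tensF_map ((map (Fam.single K)).map f) i
      (⟨(0 : Fin 1), 𝟙 (y.obj i)⟩ : ((Fam.single K).obj (y.obj i)).Elt (y.obj i))
    have h2 := Fam.pb_tensF_map ((map (Fam.single K)).map g) i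
      (⟨(0 : Fin 1), 𝟙 (y.obj i)⟩ : ((Fam.single K).obj (y.obj i)).Elt (y.obj i))
    have h3 := h1.symm.trans ((congrArg (fun φ => Fam.pb φ _) h).trans h2)
    have aux : ∀ (n : ℕ) (x : Fin n → K) (i j : Fin n) (c : K) (p : x i ⟶ c) (q : x j ⟶ c),
        Fam.inT n (fun i => (Fam.single K).obj (x i)) i ⟨(0 : Fin 1), p⟩ =
          Fam.inT n (fun i => (Fam.single K).obj (x i)) j ⟨(0 : Fin 1), q⟩ →
        ∃ e : i = j, p = eqToHom (congrArg x e) ≫ q := by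
      intro n
      induction n with
      | zero => exact fun _ i => i.elim0
      | succ n ih =>
        intro x i j c p q h
        cases i using Fin.cases with
        | zero =>
          cases j using Fin.cases with
          | zero =>
            refine ⟨rfl, ?_⟩
            have h' := (Sigma.mk.inj_iff.1 h).2
            exact (eq_of_heq h').trans (Category.id_comp _).symm
          | succ j => exact absurd (Sigma.mk.inj_iff.1 h).1 (by exact Sum.inl_ne_inr)
        | succ i =>
          cases j using Fin.cases with
          | zero => exact absurd (Sigma.mk.inj_iff.1 h).1 (by exact Sum.inr_ne_inl)
          | succ j =>
            have h' := Sigma.mk.inj_iff.1 h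
            obtain ⟨e, he⟩ := ih (fun i => x i.succ) i j c p q
              (Sigma.ext (Sum.inr.inj h'.1) h'.2)
            exact ⟨congrArg Fin.succ e, he⟩
    obtain ⟨e, he⟩ := aux _ _ _ _ _ _ _ h3
    refine ⟨e, ?_⟩
    have e1 : f.hom i ≫ 𝟙 _ = f.hom i := Category.comp_id _
    have e2 : g.hom i ≫ 𝟙 _ = g.hom i := Category.comp_id _
    exact e1.symm.trans (he.trans (congrArg (fun t => _ ≫ t) e2))
  exact hom_ext (fun i => (key i).1) fun i => (key i).2

end Coherence

section Assoc

variable {C : Type u} [Category.{v} C] [MonoidalCategory C] [SymmetricCategory C]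

lemma tensF_concatAssoc_natural {x y : FinFam (FinFam (FinFam C))} (φ : x ⟶ y) :
    (tensF C).map (concat.map ((map concat).map φ) ≫ concatAssoc y) =
      (tensF C).map (concatAssoc x ≫ concat.map (concat.map φ)) := by
  have h1 := tensF_map_tensConcat x
  have h2 := tensF_map_tensConcat y
  have h3 := tensConcat_natural ((map concat).map φ)
  have h4 := (Functor.whiskerRight (mapNat (tensConcatNat C)) (tensF C)).naturality φ
  have h5 := tensConcat_natural (concat.map φ)
  have h6 := (tensConcat_natural ((map (map (tensF C))).map φ)).trans
    (congrArg (fun t => _ ≫ (tensF C).map t) (map_concat_map (tensF C) φ).symm)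
  have i1 : IsIso ((tensF C).map ((mapNat (tensConcatNat C)).app x)) := by
    rw [tensF_map_mapNat]
    have : ∀ i, IsIso ((tensConcatNat C).app (x.obj i)) := fun i => isIso_tensConcat _
    exact isIso_tensMap _ _
  have i2 := isIso_tensConcat ((map concat).obj x)
  have aux : ∀ {A A' B B' D D' E E' G G' : C} {a : A ⟶ B} {b : B ⟶ D} {c : D ⟶ E} {d : A ⟶ G}
      {e : G ⟶ E} {a' : A' ⟶ B'} {b' : B' ⟶ D'} {c' : D' ⟶ E'} {d' : A' ⟶ G'}
      {e' : G' ⟶ E'} {pA : A ⟶ A'} {pB : B ⟶ B'} {pD : D ⟶ D'} {pG : G ⟶ G'} {pE : E ⟶ E'}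
      (_ : a ≫ b ≫ c = d ≫ e) (_ : a' ≫ b' ≫ c' = d' ≫ e') (_ : pB ≫ b' = b ≫ pD)
      (_ : pA ≫ a' = a ≫ pB) (_ : pG ≫ e' = e ≫ pE) (_ : pA ≫ d' = d ≫ pG) (_ : IsIso a)
      (_ : IsIso b), pD ≫ c' = c ≫ pE := by
    intro A A' B B' D D' E E' G G' a b c d e a' b' c' d' e' pA pB pD pG pE h1 h2 h3 h4 h5 h6 _ _
    rw [← cancel_epi b, ← cancel_epi a, ← reassoc_of% h3, ← reassoc_of% h4, h2, reassoc_of% h6, h5,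
      ← reassoc_of% h1]
  rw [Functor.map_comp, Functor.map_comp]
  exact aux h1 h2 h3 h4 h5 h6 i1 i2

end Assoc

section AssocNatural

variable {K : Type u} [Category.{v} K]

lemma concatAssoc_natural {x y : FinFam (FinFam (FinFam K))} (φ : x ⟶ y) :
    concat.map ((map concat).map φ) ≫ concatAssoc y =
      concatAssoc x ≫ concat.map (concat.map φ) := by
  refine hom_ext_tensF ?_
  have h := tensF_concatAssoc_natural ((map (map (map (Fam.single K)))).map φ)
  refine Eq.trans ?_ (h.trans ?_)
  · refine congrArg (fun t => (tensF (Fam K)).map t) ?_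
    refine ((map (Fam.single K)).map_comp _ _).trans ?_
    have e1 := map_concatAssoc (Fam.single K) y
    have e2 := map_concat_map (Fam.single K) ((map concat).map φ)
    have e3 : (map (map (Fam.single K))).map ((map concat).map φ) =
        (map concat).map ((map (map (map (Fam.single K)))).map φ) :=
      hom_ext (fun _ => rfl) fun i =>
        (map_concat_map (Fam.single K) (φ.hom i)).trans (Category.id_comp _).symm
    have e4 := e2.trans (congrArg (fun t => concat.map t) e3)
    exact congr (congrArg (fun s t => s ≫ t) e4) e1
  · refine congrArg (fun t => (tensF (Fam K)).map t) ?_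
    refine Eq.trans ?_ (Functor.map_comp (map (Fam.single K)) (concatAssoc x)
      (concat.map (concat.map φ))).symm
    have e1 := map_concatAssoc (Fam.single K) x
    have e2 := map_concat_map (Fam.single K) (concat.map φ)
    have e3 := map_concat_map (map (Fam.single K)) φ
    have e4 := e2.trans (congrArg (fun t => concat.map t) e3)
    exact (congr (congrArg (fun s t => s ≫ t) e1) e4).symm

lemma concat_map_mapNat {L : Type u₁} [Category.{v₁} L] {F G : K ⥤ L} (α : F ⟶ G)
    (x : FinFam (FinFam K)) :
    concat.map ((mapNat (mapNat α)).app x) = (mapNat α).app (concat.obj x) :=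
  hom_ext (fun i => finSigmaFinEquiv.apply_symm_apply i) fun _ => rfl

end AssocNatural

section Monotone

lemma finSigmaFinEquiv_lt {n : ℕ} {m : Fin n → ℕ} {i i' : Fin n} (h : i < i') (k : Fin (m i))
    (k' : Fin (m i')) : finSigmaFinEquiv (⟨i, k⟩ : (i : Fin n) × Fin (m i)) <
      finSigmaFinEquiv (⟨i', k'⟩ : (i : Fin n) × Fin (m i)) := by
  let g : ℕ → ℕ := fun j => if hj : j < n then m ⟨j, hj⟩ else 0
  have e : ∀ (p : (i : Fin n) × Fin (m i)),
      ((finSigmaFinEquiv p : Fin _) : ℕ) = ∑ j ∈ Finset.range p.1, g j + p.2 := by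
    intro p
    rw [finSigmaFinEquiv_apply, ← Fin.sum_univ_eq_sum_range]
    refine congrArg (fun t => t + (p.2 : ℕ)) (Finset.sum_congr rfl fun j _ => ?_)
    have hj : (j : ℕ) < n := lt_trans j.2 p.1.2
    have h : g j = m ⟨j, hj⟩ := dif_pos hj
    exact h.symm
  rw [Fin.lt_def, e, e]
  have h1 : ∑ j ∈ Finset.range (i + 1), g j ≤ ∑ j ∈ Finset.range i', g j :=
    Finset.sum_le_sum_of_subset (Finset.range_mono h)
  rw [Finset.sum_range_succ] at h1
  have h2 : g i = m i := dif_pos i.2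
  have h3 := k.2
  simp only
  omega

lemma finSigmaFinEquiv_lt_snd {n : ℕ} {m : Fin n → ℕ} {i i' : Fin n} (h : i = i') {k : Fin (m i)}
    {k' : Fin (m i')} (h' : (k : ℕ) < k') :
    finSigmaFinEquiv (⟨i, k⟩ : (i : Fin n) × Fin (m i)) <
      finSigmaFinEquiv (⟨i', k'⟩ : (i : Fin n) × Fin (m i)) := by
  subst h
  rw [Fin.lt_def, finSigmaFinEquiv_apply, finSigmaFinEquiv_apply]
  simp only
  omega

lemma finSigmaFinEquiv_symm_lt {n : ℕ} {m : Fin n → ℕ} {a b : Fin (∑ i, m i)} (h : a < b) :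
    (finSigmaFinEquiv.symm a).1 < (finSigmaFinEquiv.symm b).1 ∨
      ((finSigmaFinEquiv.symm a).1 = (finSigmaFinEquiv.symm b).1 ∧
        ((finSigmaFinEquiv.symm a).2 : ℕ) < (finSigmaFinEquiv.symm b).2) := by
  obtain ⟨⟨i, k⟩, rfl⟩ := finSigmaFinEquiv.surjective a
  obtain ⟨⟨i', k'⟩, rfl⟩ := finSigmaFinEquiv.surjective b
  rw [finSigmaFinEquiv.symm_apply_apply, finSigmaFinEquiv.symm_apply_apply]
  rcases lt_trichotomy i i' with h1 | h1 | h1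
  · exact Or.inl h1
  · subst h1
    refine Or.inr ⟨rfl, ?_⟩
    by_contra h2
    rcases lt_or_eq_of_le (not_lt.1 h2) with h3 | h3
    · exact lt_asymm h (finSigmaFinEquiv_lt_snd rfl h3)
    · obtain rfl : k = k' := Fin.ext h3.symm
      exact lt_irrefl _ h
  · exact absurd (finSigmaFinEquiv_lt h1 _ _) (lt_asymm h)

variable {K : Type u} [Category.{v} K]

/-- Morphisms of sequences whose underlying bijection of positions is increasing. -/
def IsOrdered {x y : FinFam K} (f : x ⟶ y) : Prop := ∀ i, (f.perm i : ℕ) = i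

lemma IsOrdered.of_lt {x y : FinFam K} {f : x ⟶ y} (h : ∀ i j, i < j → f.perm i < f.perm j) :
    IsOrdered f := fun i =>
  Fin.coe_orderIso_apply (StrictMono.orderIsoOfSurjective f.perm (fun i j => h i j)
    f.perm.surjective) i

lemma isOrdered_id (x : FinFam K) : IsOrdered (𝟙 x) := fun _ => rfl

lemma IsOrdered.comp {x y z : FinFam K} {f : x ⟶ y} {g : y ⟶ z} (hf : IsOrdered f)
    (hg : IsOrdered g) : IsOrdered (f ≫ g) := fun i => (hf (g.perm i)).trans (hg i)

lemma IsOrdered.map {L : Type u₁} [Category.{v₁} L] {F : K ⥤ L} {x y : FinFam K} {f : x ⟶ y}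
    (hf : IsOrdered f) : IsOrdered ((map F).map f) := hf

lemma IsOrdered.concat {x y : FinFam (FinFam K)} {f : x ⟶ y} (hf : IsOrdered f)
    (h : ∀ i, IsOrdered (f.hom i)) : IsOrdered (concat.map f) := by
  refine IsOrdered.of_lt fun i j hij => ?_
  have aux : ∀ (i i' : Fin y.len) (e : i = i') (k : Fin (y.obj i).len) (k' : Fin (y.obj i').len)
      (_ : (k : ℕ) < k'), ((f.hom i).perm k : ℕ) < (f.hom i').perm k' := by
    intro i i' e k k' hk
    rw [h i k, h i' k']
    exact hk
  rcases finSigmaFinEquiv_symm_lt hij with h1 | ⟨h1, h2⟩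
  · refine finSigmaFinEquiv_lt ?_ _ _
    exact Fin.lt_def.2 (((hf _).trans_lt h1).trans_eq (hf _).symm)
  · exact finSigmaFinEquiv_lt_snd (congrArg f.perm h1) (aux _ _ h1 _ _ h2)

lemma finSigmaFinEquiv_lt_of_lt {n : ℕ} {m : Fin n → ℕ} {L : ((i : Fin n) × Fin (m i)) → ℕ}
    {p p' : (i : Fin n) × Fin (m i)} {l : Fin (L p)} {l' : Fin (L p')}
    (h : p.1 < p'.1 ∨ (p.1 = p'.1 ∧ ((p.2 : ℕ) < p'.2 ∨ ((p.2 : ℕ) = p'.2 ∧ (l : ℕ) < l')))) :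
    finSigmaFinEquiv (⟨p.1, finSigmaFinEquiv (⟨p.2, l⟩ : (k : Fin (m p.1)) × Fin (L ⟨p.1, k⟩))⟩ :
      (i : Fin n) × Fin (∑ k, L ⟨i, k⟩)) <
    finSigmaFinEquiv (⟨p'.1, finSigmaFinEquiv
      (⟨p'.2, l'⟩ : (k : Fin (m p'.1)) × Fin (L ⟨p'.1, k⟩))⟩ :
        (i : Fin n) × Fin (∑ k, L ⟨i, k⟩)) := by
  obtain ⟨i, k⟩ := p
  obtain ⟨i', k'⟩ := p'
  rcases h with h | ⟨h, h'⟩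
  · exact finSigmaFinEquiv_lt h _ _
  · simp only at h
    subst h
    refine finSigmaFinEquiv_lt_snd rfl ?_
    rcases h' with h' | ⟨h', h2⟩
    · exact Fin.lt_def.1 (finSigmaFinEquiv_lt (Fin.lt_def.2 h') _ _)
    · exact Fin.lt_def.1 (finSigmaFinEquiv_lt_snd (Fin.ext h') h2)

lemma isOrdered_concatAssoc (x : FinFam (FinFam (FinFam K))) : IsOrdered (concatAssoc x) := by
  refine IsOrdered.of_lt fun i j hij => ?_
  refine finSigmaFinEquiv_lt_of_lt 
    (L := fun p : (i : Fin x.len) × Fin (x.obj i).len => ((x.obj p.1).obj p.2).len) ?_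
  rcases finSigmaFinEquiv_symm_lt hij with h1 | ⟨h1, h2⟩
  · rcases finSigmaFinEquiv_symm_lt h1 with h3 | ⟨h3, h4⟩
    · exact Or.inl h3
    · exact Or.inr ⟨h3, Or.inl h4⟩
  · exact Or.inr ⟨congrArg (fun a => (finSigmaFinEquiv.symm a).1) h1,
      Or.inr ⟨congrArg (fun a => ((finSigmaFinEquiv.symm a).2 : ℕ)) h1, h2⟩⟩

lemma isOrdered_toConcatSingle (x : FinFam K) : IsOrdered (toConcatSingle x) := by
  refine IsOrdered.of_lt fun i j hij => ?_
  rcases finSigmaFinEquiv_symm_lt hij with h1 | ⟨h1, h2⟩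
  · exact absurd h1 (by rw [Subsingleton.elim (α := Fin 1) (finSigmaFinEquiv.symm i).1
      (finSigmaFinEquiv.symm j).1]; exact lt_irrefl _)
  · exact h2

lemma isOrdered_toConcatMapSingle (x : FinFam K) : IsOrdered (toConcatMapSingle x) := by
  refine IsOrdered.of_lt fun i j hij => ?_
  rcases finSigmaFinEquiv_symm_lt hij with h1 | ⟨h1, h2⟩
  · exact h1
  · exact absurd h2 (by
      have a : ∀ p q : Fin 1, ¬ (p : ℕ) < q := fun p q => by omega
      exact a _ _)

/-- Two increasing morphisms of profiles agree. -/
lemma IsOrdered.eq {𝔠 : Type w} {x y : Profile 𝔠} {f g : x ⟶ y} (hf : IsOrdered f)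
    (hg : IsOrdered g) : f = g :=
  profile_hom_ext fun i => Fin.ext ((hf i).trans (hg i).symm)

end Monotone

end FinFam

section TensColimit

variable {M : Type u} [Category.{v} M] [MonoidalCategory M] [SymmetricCategory M]
  [∀ A : M, PreservesColimitsOfSize.{w, w} (tensorLeft A)]

/-- Morphisms out of `N ⊗ (A ⊗ T)`, where `A` is a colimit, can be tested on the cocone of `A`. -/
lemma tensor_hom_ext {J : Type w} [SmallCategory J] {D : J ⥤ M} {c : Cocone D} (hc : IsColimit c)
    (N T : M) {Z : M} {f g : N ⊗ (c.pt ⊗ T) ⟶ Z}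
    (h : ∀ j, N ◁ (c.ι.app j ▷ T) ≫ f = N ◁ (c.ι.app j ▷ T) ≫ g) : f = g :=
  (isColimitOfPreserves (tensorRight T ⋙ tensorLeft N) hc).hom_ext h

lemma exists_tensor_desc {J : Type w} [SmallCategory J] {D : J ⥤ M} {c : Cocone D}
    (hc : IsColimit c) (N T : M) {Z : M} (k : ∀ j, N ⊗ (D.obj j ⊗ T) ⟶ Z)
    (hk : ∀ {j j' : J} (f : j ⟶ j'), N ◁ (D.map f ▷ T) ≫ k j' = k j) :
    ∃ d : N ⊗ (c.pt ⊗ T) ⟶ Z, ∀ j, N ◁ (c.ι.app j ▷ T) ≫ d = k j := by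
  let s : Cocone (D ⋙ tensorRight T ⋙ tensorLeft N) :=
    { pt := Z
      ι := { app := k
             naturality := fun _ _ f => (hk f).trans (Category.comp_id _).symm } }
  exact ⟨(isColimitOfPreserves (tensorRight T ⋙ tensorLeft N) hc).desc s,
    (isColimitOfPreserves (tensorRight T ⋙ tensorLeft N) hc).fac s⟩

lemma tensor_hom_ext_right {J : Type w} [SmallCategory J] {D : J ⥤ M} {c : Cocone D}
    (hc : IsColimit c) (T : M) {Z : M} {f g : c.pt ⊗ T ⟶ Z}
    (h : ∀ j, c.ι.app j ▷ T ≫ f = c.ι.app j ▷ T ≫ g) : f = g :=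
  (isColimitOfPreserves (tensorRight T) hc).hom_ext h

lemma exists_tensor_desc_right {J : Type w} [SmallCategory J] {D : J ⥤ M} {c : Cocone D}
    (hc : IsColimit c) (T : M) {Z : M} (k : ∀ j, D.obj j ⊗ T ⟶ Z)
    (hk : ∀ {j j' : J} (f : j ⟶ j'), D.map f ▷ T ≫ k j' = k j) :
    ∃ d : c.pt ⊗ T ⟶ Z, ∀ j, c.ι.app j ▷ T ≫ d = k j := by
  let s : Cocone (D ⋙ tensorRight T) :=
    { pt := Z
      ι := { app := k
             naturality := fun _ _ f => (hk f).trans (Category.comp_id _).symm } }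
  exact ⟨(isColimitOfPreserves (tensorRight T) hc).desc s,
    (isColimitOfPreserves (tensorRight T) hc).fac s⟩

/-- Morphisms out of an iterated tensor product of colimits can be tested on the cocones. -/
lemma tens_hom_ext (n : ℕ) {J : Fin n → Type w} [∀ i, SmallCategory (J i)] {D : ∀ i, J i ⥤ M}
    {c : ∀ i, Cocone (D i)} (hc : ∀ i, IsColimit (c i)) (N : M) {Z : M}
    {f g : N ⊗ tens n (fun i => (c i).pt) ⟶ Z}
    (h : ∀ j : ∀ i, J i, N ◁ tensMap n (fun i => (c i).ι.app (j i)) ≫ f =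
      N ◁ tensMap n (fun i => (c i).ι.app (j i)) ≫ g) : f = g := by
  induction n generalizing N with
  | zero =>
    have e : N ◁ tensMap 0 (fun i => (c i).ι.app (Fin.elim0 (α := J i) i)) = 𝟙 _ :=
      MonoidalCategory.whiskerLeft_id _ _
    have h' := h fun i => Fin.elim0 i
    rw [e] at h'
    exact (Category.id_comp _).symm.trans (h'.trans (Category.id_comp _))
  | succ n ih =>
    refine tensor_hom_ext (hc 0) N _ fun j₀ => ?_
    refine (cancel_epi (α_ N ((D 0).obj j₀) _).hom).1 ?_
    refine ih (fun i => hc i.succ) (N ⊗ (D 0).obj j₀) fun j => ?_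
    have h' := h (Fin.cons j₀ j)
    have aux : ∀ {A A' T T' : M} (a : A ⟶ A') (t : T ⟶ T') {f g : N ⊗ (A' ⊗ T') ⟶ Z}
        (_ : N ◁ (a ⊗ₘ t) ≫ f = N ◁ (a ⊗ₘ t) ≫ g),
        (N ⊗ A) ◁ t ≫ (α_ _ _ _).hom ≫ N ◁ (a ▷ T') ≫ f =
          (N ⊗ A) ◁ t ≫ (α_ _ _ _).hom ≫ N ◁ (a ▷ T') ≫ g := by
      intro A A' T T' a t f g h
      simp only [MonoidalCategory.tensorHom_def', MonoidalCategory.whiskerLeft_comp,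
        Category.assoc] at h
      simp only [tensor_whiskerLeft, Category.assoc, Iso.inv_hom_id_assoc, h]
    exact aux _ _ h'

/-- Morphisms out of an iterated tensor product of colimits, from compatible morphisms. -/
lemma exists_tens_desc (n : ℕ) {J : Fin n → Type w} [∀ i, SmallCategory (J i)]
    {D : ∀ i, J i ⥤ M} {c : ∀ i, Cocone (D i)} (hc : ∀ i, IsColimit (c i)) (N : M) {Z : M}
    (k : ∀ j : ∀ i, J i, N ⊗ tens n (fun i => (D i).obj (j i)) ⟶ Z)
    (hk : ∀ {j j' : ∀ i, J i} (f : ∀ i, j i ⟶ j' i),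
      N ◁ tensMap n (fun i => (D i).map (f i)) ≫ k j' = k j) :
    ∃ d : N ⊗ tens n (fun i => (c i).pt) ⟶ Z,
      ∀ j, N ◁ tensMap n (fun i => (c i).ι.app (j i)) ≫ d = k j := by
  induction n generalizing N with
  | zero =>
    refine ⟨k fun i => Fin.elim0 i, fun j => ?_⟩
    exact hk fun i => Fin.elim0 i
  | succ n ih =>
    have hd : ∀ j₀ : J 0, ∃ d : (N ⊗ (D 0).obj j₀) ⊗ tens n (fun i => (c i.succ).pt) ⟶ Z,
        ∀ j : ∀ i : Fin n, J i.succ, (N ⊗ (D 0).obj j₀) ◁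
          tensMap n (fun i => (c i.succ).ι.app (j i)) ≫ d =
            (α_ _ _ _).hom ≫ k (Fin.cons j₀ j) := by
      intro j₀
      refine ih (fun i => hc i.succ) (N ⊗ (D 0).obj j₀)
        (fun j => (α_ _ _ _).hom ≫ k (Fin.cons j₀ j)) fun {j j'} f => ?_
      have h := hk (j := Fin.cons j₀ j) (j' := Fin.cons j₀ j')
        (fun i => Fin.cases (motive := fun i => (Fin.cons j₀ j : ∀ i, J i) i ⟶
          (Fin.cons j₀ j' : ∀ i, J i) i) (𝟙 j₀) f i)
      have aux : ∀ {A T T' : M} (a : A ⟶ A) (_ : a = 𝟙 A) (t : T ⟶ T') {f : N ⊗ (A ⊗ T') ⟶ Z}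
          {g : N ⊗ (A ⊗ T) ⟶ Z} (_ : N ◁ (a ⊗ₘ t) ≫ f = g),
          (N ⊗ A) ◁ t ≫ (α_ _ _ _).hom ≫ f = (α_ _ _ _).hom ≫ g := by
        rintro A T T' _ rfl t f g h
        rw [← h]
        simp
      exact aux _ ((D 0).map_id j₀) _ h
    choose d hd using hd
    obtain ⟨e, he⟩ := exists_tensor_desc (hc 0) N (tens n (fun i => (c i.succ).pt))
      (fun j₀ => (α_ _ _ _).inv ≫ d j₀) (fun {j₀ j₀'} f => by
        refine (cancel_epi (α_ N ((D 0).obj j₀) _).hom).1 ?_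
        refine tens_hom_ext n (fun i => hc i.succ) _ fun j => ?_
        have h := hk (j := Fin.cons j₀ j) (j' := Fin.cons j₀' j)
          (fun i => Fin.cases (motive := fun i => (Fin.cons j₀ j : ∀ i, J i) i ⟶
            (Fin.cons j₀' j : ∀ i, J i) i) f (fun i => 𝟙 (j i)) i)
        have aux : ∀ {A A' T T' : M} (a : A ⟶ A') (t : T ⟶ T') (i : T ⟶ T) (_ : i = 𝟙 T)
            {f : N ⊗ (A' ⊗ T) ⟶ Z} {g : N ⊗ (A ⊗ T) ⟶ Z} (_ : N ◁ (a ⊗ₘ i) ≫ f = g)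
            {d : (N ⊗ A) ⊗ T' ⟶ Z} {d' : (N ⊗ A') ⊗ T' ⟶ Z}
            (_ : (N ⊗ A) ◁ t ≫ d = (α_ _ _ _).hom ≫ g)
            (_ : (N ⊗ A') ◁ t ≫ d' = (α_ _ _ _).hom ≫ f),
            (N ⊗ A) ◁ t ≫ (α_ _ _ _).hom ≫ N ◁ (a ▷ T') ≫ (α_ _ _ _).inv ≫ d' =
              (N ⊗ A) ◁ t ≫ (α_ _ _ _).hom ≫ (α_ _ _ _).inv ≫ d := by
          rintro A A' T T' a t _ rfl f g h d d' h1 h2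
          rw [Iso.hom_inv_id_assoc, h1, ← h, tensorHom_id]
          have e1 : (α_ N A T').hom ≫ N ◁ (a ▷ T') ≫ (α_ N A' T').inv = (N ◁ a) ▷ T' := by
            simp
          have e2 : (α_ N A T).hom ≫ N ◁ (a ▷ T) = (N ◁ a) ▷ T ≫ (α_ N A' T).hom := by
            simp
          rw [reassoc_of% e1, whisker_exchange_assoc, h2, reassoc_of% e2]
        exact aux _ _ _ ((congrArg (tensMap n) (funext fun i => (D i.succ).map_id (j i))).trans
          (tensMap_id _ _)) h (hd j₀ j) (hd j₀' j))
    refine ⟨e, fun j => ?_⟩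
    have h1 := hd (j 0) fun i => j i.succ
    have h2 := he (j 0)
    have h3 : (Fin.cons (j 0) (fun i => j i.succ) : ∀ i, J i) = j := Fin.cons_self_tail j
    have aux : ∀ {A A' T T' : M} (a : A ⟶ A') (t : T ⟶ T') {e : N ⊗ (A' ⊗ T') ⟶ Z}
        {d : (N ⊗ A) ⊗ T' ⟶ Z} {k : N ⊗ (A ⊗ T) ⟶ Z}
        (_ : (N ⊗ A) ◁ t ≫ d = (α_ _ _ _).hom ≫ k)
        (_ : N ◁ (a ▷ T') ≫ e = (α_ _ _ _).inv ≫ d), N ◁ (a ⊗ₘ t) ≫ e = k := by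
      intro A A' T T' a t e d k h1 h2
      rw [MonoidalCategory.tensorHom_def', MonoidalCategory.whiskerLeft_comp, Category.assoc, h2]
      have e1 : N ◁ A ◁ t ≫ (α_ N A T').inv = (α_ N A T).inv ≫ (N ⊗ A) ◁ t := by simp
      rw [reassoc_of% e1, h1, Iso.inv_hom_id_assoc]
    refine (aux _ _ h1 h2).trans ?_
    exact eq_of_heq (congr_arg_heq k h3)

end TensColimit

namespace wcoend

variable {B : Type w} [Category.{w} B] {P : Type u₁} [Category.{w} P]
  {M : Type u} [Category.{v} M] [HasColimitsOfSize.{w, w} M]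

/-- The coend `∫^b P(K b, c) ⊗ T b` as a cocone over the category of elements of `P(K -, c)`. -/
noncomputable def cocone (K : B ⥤ P) (T : B ⥤ M) (c : P) :
    Cocone (CostructuredArrow.proj K c ⋙ T) where
  pt := wcoend K T c
  ι :=
    { app := fun a => ι K T c a.left a.hom
      naturality := fun a a' g => by
        have h := condition (T := T) g.left a'.hom
        rw [CostructuredArrow.w g] at h
        exact h.symm.trans (Category.comp_id _).symm }

noncomputable def isColimit (K : B ⥤ P) (T : B ⥤ M) (c : P) : IsColimit (cocone K T c) where
  desc s := desc (fun b r => s.ι.app (CostructuredArrow.mk r)) fun {b b'} f r =>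
    (s.w (CostructuredArrow.homMk f rfl : CostructuredArrow.mk (K.map f ≫ r) ⟶
      CostructuredArrow.mk r)).symm
  fac s j := ι_desc _ _ j.left j.hom
  uniq s m hm := hom_ext fun b r => (hm (CostructuredArrow.mk r)).trans
    (ι_desc (fun b r => s.ι.app (CostructuredArrow.mk r)) (fun {b b'} f r =>
      (s.w (CostructuredArrow.homMk f rfl : CostructuredArrow.mk (K.map f ≫ r) ⟶
        CostructuredArrow.mk r)).symm) b r).symm

variable [MonoidalCategory M] [SymmetricCategory M]
  [∀ A : M, PreservesColimitsOfSize.{w, w} (tensorLeft A)]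

lemma tens_hom_ext {n : ℕ} {K : B ⥤ P} {T : Fin n → B ⥤ M} {c : Fin n → P} (N : M) {Z : M}
    {f g : N ⊗ tens n (fun i => wcoend K (T i) (c i)) ⟶ Z}
    (h : ∀ (b : Fin n → B) (s : ∀ i, K.obj (b i) ⟶ c i),
      N ◁ tensMap n (fun i => ι K (T i) (c i) (b i) (s i)) ≫ f =
        N ◁ tensMap n (fun i => ι K (T i) (c i) (b i) (s i)) ≫ g) : f = g :=
  SymSeqInv.tens_hom_ext n (fun i => isColimit K (T i) (c i)) N fun j =>
    h (fun i => (j i).left) fun i => (j i).hom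

lemma exists_tens_desc {n : ℕ} {K : B ⥤ P} {T : Fin n → B ⥤ M} {c : Fin n → P} (N : M) {Z : M}
    (k : ∀ (b : Fin n → B) (_ : ∀ i, K.obj (b i) ⟶ c i),
      N ⊗ tens n (fun i => (T i).obj (b i)) ⟶ Z)
    (hk : ∀ {b b' : Fin n → B} (f : ∀ i, b i ⟶ b' i) (s : ∀ i, K.obj (b' i) ⟶ c i),
      k b (fun i => K.map (f i) ≫ s i) = N ◁ tensMap n (fun i => (T i).map (f i)) ≫ k b' s) :
    ∃ d : N ⊗ tens n (fun i => wcoend K (T i) (c i)) ⟶ Z, ∀ b s,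
      N ◁ tensMap n (fun i => ι K (T i) (c i) (b i) (s i)) ≫ d = k b s := by
  obtain ⟨d, hd⟩ := SymSeqInv.exists_tens_desc n (fun i => isColimit K (T i) (c i)) N
    (fun j => k (fun i => (j i).left) fun i => (j i).hom) (fun {j j'} f => by
      refine (hk (fun i => (f i).left) fun i => (j' i).hom).symm.trans ?_
      exact congrArg (k _) (funext fun i => CostructuredArrow.w (f i)))
  exact ⟨d, fun b s => hd fun i => CostructuredArrow.mk (s i)⟩

lemma tensorRight_hom_ext {K : B ⥤ P} {T : B ⥤ M} {c : P} (A : M) {Z : M}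
    {f g : wcoend K T c ⊗ A ⟶ Z} (h : ∀ b s, ι K T c b s ▷ A ≫ f = ι K T c b s ▷ A ≫ g) : f = g :=
  tensor_hom_ext_right (isColimit K T c) A fun j => h j.left j.hom

lemma exists_tensorRight_desc {K : B ⥤ P} {T : B ⥤ M} {c : P} (A : M) {Z : M}
    (k : ∀ b (_ : K.obj b ⟶ c), T.obj b ⊗ A ⟶ Z)
    (hk : ∀ {b b' : B} (f : b ⟶ b') (s : K.obj b' ⟶ c),
      k b (K.map f ≫ s) = T.map f ▷ A ≫ k b' s) :
    ∃ d : wcoend K T c ⊗ A ⟶ Z, ∀ b s, ι K T c b s ▷ A ≫ d = k b s := by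
  obtain ⟨d, hd⟩ := exists_tensor_desc_right (isColimit K T c) A (fun j => k j.left j.hom)
    (fun {j j'} f => (hk f.left j'.hom).symm.trans (congrArg (k _) (CostructuredArrow.w f)))
  exact ⟨d, fun b s => hd (CostructuredArrow.mk s)⟩

end wcoend

namespace FinFam

section Regroup

variable {𝔠 : Type w} {A : Type w} [Category.{w} A]

/-- A family of pairs `(x_j, a_j)`, regrouped along a family of profiles whose concatenation is the
profile of the `a_j`. -/
def regroup (y : FinFam (A × Discrete 𝔠)) (b : Br 𝔠)
    (r : (conc 𝔠).obj b ⟶ (map (CategoryTheory.Prod.snd A (Discrete 𝔠))).obj y) :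
    FinFam (FinFam (A × Discrete 𝔠) × Discrete 𝔠) :=
  ⟨b.len, fun i => (⟨(b.obj i).1.len, fun k =>
    ((y.obj (r.perm.symm (finSigmaFinEquiv
      (⟨i, k⟩ : (i : Fin b.len) × Fin (b.obj i).1.len)))).1, (b.obj i).1.obj k)⟩, (b.obj i).2)⟩

lemma regroup_perm (y : FinFam (A × Discrete 𝔠)) (b : Br 𝔠)
    (r : (conc 𝔠).obj b ⟶ (map (CategoryTheory.Prod.snd A (Discrete 𝔠))).obj y) (i : Fin y.len) :
    r.perm.symm (finSigmaFinEquiv (finSigmaFinEquiv.symm (r.perm i))) = i :=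
  (congrArg r.perm.symm (finSigmaFinEquiv.apply_symm_apply (r.perm i))).trans
    (r.perm.symm_apply_apply i)

/-- The concatenation of the regrouped family is isomorphic to the family. -/
def regroupHom (y : FinFam (A × Discrete 𝔠)) (b : Br 𝔠)
    (r : (conc 𝔠).obj b ⟶ (map (CategoryTheory.Prod.snd A (Discrete 𝔠))).obj y) :
    concat.obj ((map (CategoryTheory.Prod.fst _ _)).obj (regroup y b r)) ⟶ y :=
  ⟨r.perm, fun i => Prod.mkHom (eqToHom (congrArg (fun j => (y.obj j).1) (regroup_perm y b r i))) (r.hom i)⟩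

instance (y : FinFam (A × Discrete 𝔠)) (b : Br 𝔠)
    (r : (conc 𝔠).obj b ⟶ (map (CategoryTheory.Prod.snd A (Discrete 𝔠))).obj y) :
    IsIso (regroupHom y b r) := by
  have aux : ∀ {a a' : A} {c c' : Discrete 𝔠} (f : a ⟶ a') (g : c ⟶ c'), IsIso f →
      IsIso (Prod.mkHom f g) := fun f g _ =>
    ⟨Prod.mkHom (inv f) (inv g), Prod.ext (IsIso.hom_inv_id f) (Subsingleton.elim _ _),
      Prod.ext (IsIso.inv_hom_id f) (Subsingleton.elim _ _)⟩
  exact isIso_of_isIso _ fun i => aux _ _ (instIsIsoEqToHom _)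

lemma exists_regroup_map {y y' : FinFam (A × Discrete 𝔠)} {b b' : Br 𝔠}
    (r : (conc 𝔠).obj b ⟶ (map (CategoryTheory.Prod.snd A (Discrete 𝔠))).obj y)
    (r' : (conc 𝔠).obj b' ⟶ (map (CategoryTheory.Prod.snd A (Discrete 𝔠))).obj y')
    (f : b ⟶ b') (φ : y ⟶ y')
    (h : r ≫ (map (CategoryTheory.Prod.snd A (Discrete 𝔠))).map φ = (conc 𝔠).map f ≫ r') :
    ∃ ψ : regroup y b r ⟶ regroup y' b' r',
      (map (Functor.prod (map (CategoryTheory.Prod.snd A (Discrete 𝔠)))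
        (𝟭 (Discrete 𝔠)))).map ψ = f ∧
      concat.map ((map (CategoryTheory.Prod.fst _ _)).map ψ) ≫ regroupHom y' b' r' =
        regroupHom y b r ≫ φ := by
  have hp : ∀ q, r.perm (φ.perm q) = ((conc 𝔠).map f).perm (r'.perm q) := fun q =>
    congrArg (fun t : (conc 𝔠).obj b ⟶ _ => t.perm q) h
  have hq : ∀ (i : Fin b'.len) (k : Fin (b'.obj i).1.len),
      r.perm.symm (finSigmaFinEquiv (⟨f.perm i, (f.hom i).1.perm k⟩ :
        (i : Fin b.len) × Fin (b.obj i).1.len)) =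
        φ.perm (r'.perm.symm (finSigmaFinEquiv
          (⟨i, k⟩ : (i : Fin b'.len) × Fin (b'.obj i).1.len))) := by
    intro i k
    refine (Equiv.symm_apply_eq _).2 ?_
    refine Eq.trans ?_ (hp _).symm
    refine Eq.trans ?_ (congrArg (fun t => ((conc 𝔠).map f).perm t)
      (r'.perm.apply_symm_apply _)).symm
    exact congrArg (fun p : (i : Fin b'.len) × Fin (b'.obj i).1.len =>
      finSigmaFinEquiv (⟨f.perm p.1, (f.hom p.1).1.perm p.2⟩ :
        (i : Fin b.len) × Fin (b.obj i).1.len)) (finSigmaFinEquiv.symm_apply_apply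
        (⟨i, k⟩ : (i : Fin b'.len) × Fin (b'.obj i).1.len)).symm
  refine ⟨⟨f.perm, fun i => Prod.mkHom ⟨(f.hom i).1.perm, fun k => Prod.mkHom
    (eqToHom (congrArg (fun j => (y.obj j).1) (hq i k)) ≫ (φ.hom _).1) ((f.hom i).1.hom k)⟩
      (f.hom i).2⟩, rfl, ?_⟩
  refine hom_ext (fun i => (hp i).symm) fun i => ?_
  have e2 := regroup_perm y' b' r' i
  have e3 := regroup_perm y b r (φ.perm i)
  have efst : ∀ {p p' : A × Discrete 𝔠} (e : p = p'),
      (eqToHom e).1 = eqToHom (congrArg Prod.fst e) := by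
    rintro p _ rfl
    rfl
  have aux : ∀ (q : Fin y'.len) (_ : q = i) {p p' p'' : A} (e0 : p' = p)
      (f0 : p' ⟶ p) (_ : f0 = eqToHom e0)
      (e1 : p = (y.obj (φ.perm q)).1) (e2 : (y'.obj q).1 = (y'.obj i).1) (e4 : p' = p'')
      (f4 : p' ⟶ p'') (_ : f4 = eqToHom e4) (e3 : p'' = (y.obj (φ.perm i)).1),
      (f0 ≫ (eqToHom e1 ≫ (φ.hom q).1)) ≫ eqToHom e2 = f4 ≫ eqToHom e3 ≫ (φ.hom i).1 := by
    rintro q rfl p p' p'' rfl _ rfl rfl e2 rfl _ rfl e3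
    exact ((Category.comp_id _).trans (Category.id_comp _)).trans (Category.id_comp _).symm
  let P : (i : Fin b'.len) × Fin (b'.obj i).1.len := finSigmaFinEquiv.symm (r'.perm i)
  let Q : (i : Fin b.len) × Fin (b.obj i).1.len := ⟨f.perm P.1, (f.hom P.1).1.perm P.2⟩
  have h9 := aux (r'.perm.symm (finSigmaFinEquiv P)) e2 _ _
    (efst (congrArg (fun p : (i : Fin b.len) × Fin (b.obj i).1.len =>
      ((regroup y b r).obj p.1).1.obj p.2) (finSigmaFinEquiv.symm_apply_apply Q)))
    (congrArg (fun j => (y.obj j).1) (hq P.1 P.2)) (congrArg (fun j => (y'.obj j).1) e2) _ _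
    (efst (congrArg (fun p => (concat.obj ((map (CategoryTheory.Prod.fst _ _)).obj
      (regroup y b r))).obj p) (hp i).symm)) (congrArg (fun j => (y.obj j).1) e3)
  exact Prod.ext h9 (Subsingleton.elim _ _)

lemma exists_regroup_join (h : FinFam (FinFam (A × Discrete 𝔠) × Discrete 𝔠)) :
    ∃ ψ : regroup (concat.obj ((map (CategoryTheory.Prod.fst _ _)).obj h))
        ((map (Functor.prod (map (CategoryTheory.Prod.snd A (Discrete 𝔠)))
          (𝟭 (Discrete 𝔠)))).obj h) (𝟙 _) ⟶ h,
      (map (Functor.prod (map (CategoryTheory.Prod.snd A (Discrete 𝔠)))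
        (𝟭 (Discrete 𝔠)))).map ψ = 𝟙 _ ∧
      concat.map ((map (CategoryTheory.Prod.fst _ _)).map ψ) = regroupHom _ _ _ := by
  refine ⟨⟨Equiv.refl _, fun i => Prod.mkHom ⟨Equiv.refl _, fun k => Prod.mkHom
    (eqToHom (congrArg Prod.fst (concat_obj_obj ((map (CategoryTheory.Prod.fst _ _)).obj h)
      ⟨i, k⟩))) (𝟙 _)⟩ (𝟙 _)⟩, rfl, ?_⟩
  refine hom_ext (fun i => finSigmaFinEquiv.apply_symm_apply i) fun i => ?_
  have efst : ∀ {p p' : A × Discrete 𝔠} (e : p = p'),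
      (eqToHom e).1 = eqToHom (congrArg Prod.fst e) := by
    rintro p _ rfl
    rfl
  have aux : ∀ {a b c d : A} {f : a ⟶ b} {g : b ⟶ c} {f' : a ⟶ d} {g' : d ⟶ c} (e1 : a = b)
      (e2 : b = c) (e3 : a = d) (e4 : d = c) (_ : f = eqToHom e1) (_ : g = eqToHom e2)
      (_ : f' = eqToHom e3) (_ : g' = eqToHom e4), f ≫ g = f' ≫ g' := by
    rintro a b c d _ _ _ _ rfl rfl rfl _ rfl rfl rfl rfl
    rfl
  refine Prod.ext ?_ (Subsingleton.elim _ _)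
  let y := (map (CategoryTheory.Prod.fst _ _)).obj h
  have e2 := congrArg Prod.fst (concat_obj_obj y (finSigmaFinEquiv.symm i))
  have e4 := congrArg (fun j => ((concat.obj y).obj j).1) (regroup_perm (concat.obj y)
    ((map (Functor.prod (map (CategoryTheory.Prod.snd A (Discrete 𝔠)))
      (𝟭 (Discrete 𝔠)))).obj h) (𝟙 _) i)
  exact aux _ e2 _ e4 (efst _) rfl (efst _) rfl

end Regroup

end FinFam

section Generators

variable {𝔠 : Type w} {M : Type u} [Category.{v} M] [MonoidalCategory M] [SymmetricCategory M]

/-- The functor `(g, a) ↦ Y(colours g; a) ⊗ ⨂_k Z(g_k)`. -/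
def branchPair (Y Z : SymSeq 𝔠 M) : Br 𝔠 × Discrete 𝔠 ⥤ M :=
  Functor.prod' (Functor.prod (colours 𝔠) (𝟭 _) ⋙ Y.toFunctor)
    (CategoryTheory.Prod.fst _ _ ⋙ branches Z) ⋙ tensor M

/-- The functor `(g_i, a_i)_i ↦ X(a; t) ⊗ ⨂_i (Y(colours g_i; a_i) ⊗ ⨂_k Z(g_{i,k}))`. -/
def rightTerm (X Y Z : SymSeq 𝔠 M) (t : Discrete 𝔠) : FinFam (Br 𝔠 × Discrete 𝔠) ⥤ M :=
  Functor.prod' (innerColours ⋙ Functor.prod' (colours 𝔠) ((Functor.const _).obj t) ⋙ X.toFunctor)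
    (FinFam.map (branchPair Y Z) ⋙ tensF M) ⋙ tensor M

/-- The functor `(g_i, a_i)_i ↦ (X(a; t) ⊗ ⨂_i Y(colours g_i; a_i)) ⊗ ⨂_i ⨂_k Z(g_{i,k})`. -/
def leftTerm (X Y Z : SymSeq 𝔠 M) (t : Discrete 𝔠) : FinFam (Br 𝔠 × Discrete 𝔠) ⥤ M :=
  Functor.prod' (innerColours ⋙ circleTerm X Y t)
    (FinFam.map (CategoryTheory.Prod.fst _ _ ⋙ branches Z) ⋙ tensF M) ⋙ tensor M

lemma whiskerLeft_tensorHom_eq {A A' B B' P P' Z : M} {a : A ⟶ A'} {b : B ⟶ B'} {n : B ⟶ P}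
    {n' : B' ⟶ P'} {p : P ⟶ P'} (h : b ≫ n' = n ≫ p) (g : A' ⊗ P' ⟶ Z) :
    (a ⊗ₘ b) ≫ A' ◁ n' ≫ g = A ◁ n ≫ (a ⊗ₘ p) ≫ g := by
  rw [← id_tensorHom, ← id_tensorHom, tensorHom_comp_tensorHom_assoc,
    tensorHom_comp_tensorHom_assoc, h, Category.comp_id, Category.id_comp]

/-- The natural isomorphism `(X ⊗ ⨂_i Y_i) ⊗ ⨂_i Z_i ⟶ X ⊗ ⨂_i (Y_i ⊗ Z_i)`. -/
def assocTerm (X Y Z : SymSeq 𝔠 M) (t : Discrete 𝔠) : leftTerm X Y Z t ⟶ rightTerm X Y Z t where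
  app h := (α_ _ _ _).hom ≫ X.toFunctor.obj ((colours 𝔠).obj (innerColours.obj h), t) ◁
    tensZip h.len (fun i => Y.toFunctor.obj ((colours 𝔠).obj (h.obj i).1, (h.obj i).2))
      (fun i => (branches Z).obj (h.obj i).1)
  naturality h h' φ := by
    have e := tensZip_natural h'.len h.len φ.perm
      (x' := fun i => Y.toFunctor.obj ((colours 𝔠).obj (h'.obj i).1, (h'.obj i).2))
      (y' := fun i => (branches Z).obj (h'.obj i).1)
      (fun i j hj => eqToHom (congrArg (fun j => Y.toFunctor.obj ((colours 𝔠).obj (h.obj j).1,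
        (h.obj j).2)) hj.symm) ≫ Y.toFunctor.map
          ((Functor.prod (colours 𝔠) (𝟭 (Discrete 𝔠))).map (φ.hom i)))
      (fun i j hj => eqToHom (congrArg (fun j => (branches Z).obj (h.obj j).1) hj.symm) ≫
        (branches Z).map (φ.hom i).1)
    have e' : tensPerm h'.len h.len φ.perm _ _ (fun i j hj =>
        ((eqToHom (congrArg (fun j => Y.toFunctor.obj ((colours 𝔠).obj (h.obj j).1,
          (h.obj j).2)) hj.symm) ≫ Y.toFunctor.map
            ((Functor.prod (colours 𝔠) (𝟭 (Discrete 𝔠))).map (φ.hom i))) ⊗ₘ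
        (eqToHom (congrArg (fun j => (branches Z).obj (h.obj j).1) hj.symm) ≫
          (branches Z).map (φ.hom i).1))) =
        (tensF M).map ((FinFam.map (branchPair Y Z)).map φ) :=
      tensPerm_congr rfl fun i j hj _ => by
        subst hj
        have aux : ∀ {A A' B B' : M} (f : A ⟶ A') (g : B ⟶ B'),
            ((𝟙 A ≫ f) ⊗ₘ (𝟙 B ≫ g)) = 𝟙 (A ⊗ B) ≫ (f ⊗ₘ g) := by
          intros
          simp
        exact aux _ _
    have aux : ∀ {A A' B B' D D' P P' : M} {u : A ⟶ A'} {v : B ⟶ B'} {w : D ⟶ D'}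
        {z : B ⊗ D ⟶ P} {z' : B' ⊗ D' ⟶ P'} {x : P ⟶ P'} (_ : (v ⊗ₘ w) ≫ z' = z ≫ x),
        ((u ⊗ₘ v) ⊗ₘ w) ≫ (α_ A' B' D').hom ≫ A' ◁ z' =
          ((α_ A B D).hom ≫ A ◁ z) ≫ (u ⊗ₘ x) := by
      intro A A' B B' D D' P P' u v w z z' x h
      rw [associator_naturality_assoc, Category.assoc, ← id_tensorHom, ← id_tensorHom,
        tensorHom_comp_tensorHom, tensorHom_comp_tensorHom, h, Category.comp_id, Category.id_comp]
    exact aux (e.trans (congrArg (fun t => _ ≫ t) e'))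

end Generators

section Circle

variable {𝔠 : Type w} {M : Type u} [Category.{v} M] [MonoidalCategory M] [SymmetricCategory M]
  [HasColimitsOfSize.{w, w} M]

lemma circleι_map_id (X Y : SymSeq 𝔠 M) {c c' : Profile 𝔠} (t : Discrete 𝔠) (f : c ⟶ c') (b : Br 𝔠)
    (s : (conc 𝔠).obj b ⟶ c) :
    circleι X Y (c, t) b s ≫ (circle X Y).toFunctor.map (Prod.mkHom f (𝟙 t)) =
      circleι X Y (c', t) b (s ≫ f) := by
  refine (circleι_map X Y (p := (c, t)) (q := (c', t)) (Prod.mkHom f (𝟙 t)) b s).trans ?_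
  have h : (circleTermMap (𝟙 X) (𝟙 Y) (𝟙 t)).app b = 𝟙 _ :=
    congrArg (fun α => NatTrans.app α b) (circleTermMap_id X Y t)
  exact (congrArg (fun t => t ≫ _) h).trans (Category.id_comp _)

lemma circleι_condition (X Y : SymSeq 𝔠 M) (p : Profile 𝔠 × Discrete 𝔠) {b b' : Br 𝔠} (f : b ⟶ b')
    (s : (conc 𝔠).obj b' ⟶ p.1) :
    circleι X Y p b ((conc 𝔠).map f ≫ s) =
      (X.toFunctor.map (Prod.mkHom ((colours 𝔠).map f) (𝟙 p.2)) ⊗ₘ (branches Y).map f) ≫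
        circleι X Y p b' s :=
  wcoend.condition f s

lemma circleι_circleMap {X X' Y Y' : SymSeq 𝔠 M} (f : X ⟶ X') (g : Y ⟶ Y')
    (p : Profile 𝔠 × Discrete 𝔠) (b : Br 𝔠) (s : (conc 𝔠).obj b ⟶ p.1) :
    circleι X Y p b s ≫ SymSeq.app (circleMap f g) p =
      (SymSeq.app f ((colours 𝔠).obj b, p.2) ⊗ₘ (branchesMap g).app b) ≫ circleι X' Y' p b s := by
  refine (wcoend.ι_map (K := conc 𝔠) (circleTermMap f g (𝟙 p.2)) (𝟙 p.1) b s).trans ?_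
  have h : (rootMap f (𝟙 p.2)).app b = SymSeq.app f ((colours 𝔠).obj b, p.2) := by
    rw [rootMap_app]
    refine (congrArg (fun t => t ≫ _) (X.toFunctor.map_id _)).trans (Category.id_comp _)
  have h' : (circleTermMap f g (𝟙 p.2)).app b =
      (SymSeq.app f ((colours 𝔠).obj b, p.2) ⊗ₘ (branchesMap g).app b) :=
    congrArg (fun t => t ⊗ₘ (branchesMap g).app b) h
  exact congr (congrArg (fun s t => s ≫ t) h')
    (congrArg (fun t => circleι X' Y' p b t) (Category.comp_id s))

lemma circle_hom_ext {X Y : SymSeq 𝔠 M} {p : Profile 𝔠 × Discrete 𝔠} {W : M}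
    {f g : (circle X Y).toFunctor.obj p ⟶ W}
    (h : ∀ b s, circleι X Y p b s ≫ f = circleι X Y p b s ≫ g) : f = g := wcoend.hom_ext h

/-- The canonical morphisms `Y(colours g; a) ⊗ ⨂_k Z(g_k) ⟶ (Y ∘ Z)(conc g; a)`. -/
noncomputable def pairι (Y Z : SymSeq 𝔠 M) :
    branchPair Y Z ⟶ Functor.prod (conc 𝔠) (𝟭 _) ⋙ (circle Y Z).toFunctor where
  app g := circleι Y Z ((conc 𝔠).obj g.1, g.2) g.1 (𝟙 _)
  naturality g g' f := by
    have h1 := circleι_condition Y Z ((conc 𝔠).obj g'.1, g'.2) f.1 (𝟙 _)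
    have h2 := circleι_map Y Z (p := ((conc 𝔠).obj g.1, g.2)) (q := ((conc 𝔠).obj g'.1, g'.2))
      (Prod.mkHom ((conc 𝔠).map f.1) f.2) g.1 (𝟙 _)
    have h3 := circleTermMap_id_app Y Z f.2 g.1
    have h4 := Y.toFunctor.map_comp (Prod.mkHom (𝟙 ((colours 𝔠).obj g.1)) f.2)
      (Prod.mkHom ((colours 𝔠).map f.1) (𝟙 g'.2))
    have h5 : Prod.mkHom (𝟙 ((colours 𝔠).obj g.1)) f.2 ≫
      Prod.mkHom ((colours 𝔠).map f.1) (𝟙 g'.2) = Prod.mkHom ((colours 𝔠).map f.1) f.2 :=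
        Prod.ext (Category.id_comp _) (Category.comp_id _)
    have h6 := (congrArg (fun t => Y.toFunctor.map t) h5).symm.trans h4
    have e : (𝟙 ((conc 𝔠).obj g.1)) ≫ (conc 𝔠).map f.1 = (conc 𝔠).map f.1 ≫ 𝟙 _ :=
      (Category.id_comp _).trans (Category.comp_id _).symm
    have h7 := h2.trans (congr (congrArg (fun s t => s ≫ t) h3)
      ((congrArg (fun t => circleι Y Z ((conc 𝔠).obj g'.1, g'.2) g.1 t) e).trans h1))
    have aux : ∀ {A A' A'' B B' P P' : M} {a : A ⟶ A'} {a' : A' ⟶ A''} {a'' : A ⟶ A''} {b : B ⟶ B'}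
        {i : A ⊗ B ⟶ P} {m : P ⟶ P'} {i' : A'' ⊗ B' ⟶ P'} (_ : a'' = a ≫ a')
        (_ : i ≫ m = a ▷ B ≫ (a' ⊗ₘ b) ≫ i'), (a'' ⊗ₘ b) ≫ i' = i ≫ m := by
      rintro A A' A'' B B' P P' a a' _ b i m i' rfl h
      rw [h, ← tensorHom_id, tensorHom_comp_tensorHom_assoc, Category.id_comp]
    exact aux h6 h7

lemma tensF_map_pairι (Y Z : SymSeq 𝔠 M) (h : FinFam (Br 𝔠 × Discrete 𝔠)) :
    (tensF M).map ((FinFam.mapNat (pairι Y Z)).app h) = tensMap h.len (fun i =>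
      circleι Y Z ((conc 𝔠).obj (h.obj i).1, (h.obj i).2) (h.obj i).1 (𝟙 _)) :=
  tensF_map_mapNat (pairι Y Z) h

/-- The canonical morphisms into `X ∘ (Y ∘ Z)`. -/
noncomputable def rightι (X Y Z : SymSeq 𝔠 M) (p : Profile 𝔠 × Discrete 𝔠)
    (h : FinFam (Br 𝔠 × Discrete 𝔠)) (s : (conc 𝔠).obj (innerConc.obj h) ⟶ p.1) :
    (rightTerm X Y Z p.2).obj h ⟶ (circle X (circle Y Z)).toFunctor.obj p :=
  X.toFunctor.obj ((colours 𝔠).obj (innerColours.obj h), p.2) ◁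
    tensMap h.len (fun i => circleι Y Z ((conc 𝔠).obj (h.obj i).1, (h.obj i).2) (h.obj i).1 (𝟙 _)) ≫
  circleι X (circle Y Z) p (innerConc.obj h) s

lemma rightι_condition (X Y Z : SymSeq 𝔠 M) (p : Profile 𝔠 × Discrete 𝔠)
    {h h' : FinFam (Br 𝔠 × Discrete 𝔠)} (φ : h ⟶ h')
    (s : (conc 𝔠).obj (innerConc.obj h') ⟶ p.1) :
    rightι X Y Z p h ((conc 𝔠).map (innerConc.map φ) ≫ s) =
      (rightTerm X Y Z p.2).map φ ≫ rightι X Y Z p h' s := by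
  have e1 := circleι_condition X (circle Y Z) p (innerConc.map φ) s
  have e2 := (Functor.whiskerRight (FinFam.mapNat (pairι Y Z)) (tensF M)).naturality φ
  have e3 := congr (congrArg (fun s t => s ≫ t) (rfl :
    (tensF M).map ((FinFam.map (branchPair Y Z)).map φ) = _)) (tensF_map_pairι Y Z h').symm
  have e4 := congrArg (fun t => t ≫ (branches (circle Y Z)).map (innerConc.map φ))
    (tensF_map_pairι Y Z h)
  have e5 := e3.trans (e2.trans e4)
  exact (congrArg (fun t => _ ≫ t) e1).trans (whiskerLeft_tensorHom_eq e5 _).symm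

/-- The canonical morphisms into `(X ∘ Y) ∘ Z`. -/
noncomputable def leftι (X Y Z : SymSeq 𝔠 M) (p : Profile 𝔠 × Discrete 𝔠)
    (h : FinFam (Br 𝔠 × Discrete 𝔠)) (s : (conc 𝔠).obj (joinBr.obj h) ⟶ p.1) :
    (leftTerm X Y Z p.2).obj h ⟶ (circle (circle X Y) Z).toFunctor.obj p :=
  (circleι X Y ((colours 𝔠).obj (joinBr.obj h), p.2) (innerColours.obj h) (joinColours h) ⊗ₘ
    tensConcat ((FinFam.map (CategoryTheory.Prod.fst _ _ ⋙ FinFam.map Z.toFunctor)).obj h)) ≫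
  circleι (circle X Y) Z p (joinBr.obj h) s

lemma colours_joinBr_map {h h' : FinFam (Br 𝔠 × Discrete 𝔠)} (φ : h ⟶ h') :
    (colours 𝔠).map (joinBr.map φ) = (conc 𝔠).map (innerColours.map φ) :=
  FinFam.map_concat_map (CategoryTheory.Prod.snd _ _)
    ((FinFam.map (CategoryTheory.Prod.fst _ _)).map φ)

lemma leftι_condition (X Y Z : SymSeq 𝔠 M) (p : Profile 𝔠 × Discrete 𝔠)
    {h h' : FinFam (Br 𝔠 × Discrete 𝔠)} (φ : h ⟶ h')
    (s : (conc 𝔠).obj (joinBr.obj h') ⟶ p.1) :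
    leftι X Y Z p h ((conc 𝔠).map (joinBr.map φ) ≫ s) =
      (leftTerm X Y Z p.2).map φ ≫ leftι X Y Z p h' s := by
  have e1 := circleι_condition (circle X Y) Z p (joinBr.map φ) s
  have e2 := circleι_condition X Y ((colours 𝔠).obj (joinBr.obj h'), p.2) (innerColours.map φ)
    (joinColours h')
  have e3 := circleι_map_id X Y p.2 ((colours 𝔠).map (joinBr.map φ)) (innerColours.obj h)
    (joinColours h)
  have e4 : joinColours h ≫ (colours 𝔠).map (joinBr.map φ) =
      (conc 𝔠).map (innerColours.map φ) ≫ joinColours h' :=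
    (Category.id_comp _).trans ((colours_joinBr_map φ).trans (Category.comp_id _).symm)
  have e5 := (e3.trans (congrArg (fun t => circleι X Y _ _ t) e4)).trans e2
  have e6 := tensConcat_natural
    ((FinFam.map (CategoryTheory.Prod.fst _ _ ⋙ FinFam.map Z.toFunctor)).map φ)
  have e7 : (branches Z).map (joinBr.map φ) = (tensF M).map (FinFam.concat.map
      ((FinFam.map (CategoryTheory.Prod.fst _ _ ⋙ FinFam.map Z.toFunctor)).map φ)) :=
    congrArg (fun t => (tensF M).map t) (FinFam.map_concat_map Z.toFunctor
      ((FinFam.map (CategoryTheory.Prod.fst _ _)).map φ))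
  have e8 := e6.trans (congrArg (fun t => _ ≫ t) e7.symm)
  have aux : ∀ {A A' B B' P P' Q Q' R : M} {i : A ⟶ P} {i' : A' ⟶ P'} {m : P ⟶ P'} {a : A ⟶ A'}
      {j : B ⟶ Q} {j' : B' ⟶ Q'} {n : Q ⟶ Q'} {b : B ⟶ B'} {g : P ⊗ Q ⟶ R} {g' : P' ⊗ Q' ⟶ R}
      (_ : i ≫ m = a ≫ i') (_ : b ≫ j' = j ≫ n) (_ : g = (m ⊗ₘ n) ≫ g'),
      (i ⊗ₘ j) ≫ g = (a ⊗ₘ b) ≫ (i' ⊗ₘ j') ≫ g' := by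
    rintro A A' B B' P P' Q Q' R i i' m a j j' n b _ g' h1 h2 rfl
    rw [tensorHom_comp_tensorHom_assoc, tensorHom_comp_tensorHom_assoc, h1, h2]
  exact aux e5 e8 e1

end Circle

section Right

variable {𝔠 : Type w} {M : Type u} [Category.{v} M] [MonoidalCategory M] [SymmetricCategory M]
  [HasColimitsOfSize.{w, w} M] [∀ A : M, PreservesColimitsOfSize.{w, w} (tensorLeft A)]

/-- The family of pairs `(β_i, a_i)` for a family `(b_i, a_i)_i`. -/
def refine (b : Br 𝔠) (β : Fin b.len → Br 𝔠) : FinFam (Br 𝔠 × Discrete 𝔠) :=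
  ⟨b.len, fun i => (β i, (b.obj i).2)⟩

/-- The morphism given by a family of morphisms from the concatenations of the `β_i` to the
`b_i`. -/
def refineHom (b : Br 𝔠) (β : Fin b.len → Br 𝔠) (s : ∀ i, (conc 𝔠).obj (β i) ⟶ (b.obj i).1) :
    innerConc.obj (refine b β) ⟶ b :=
  ⟨Equiv.refl _, fun i => Prod.mkHom (s i) (𝟙 (b.obj i).2)⟩

lemma tensMap_circleι (X Y Z : SymSeq 𝔠 M) (p : Profile 𝔠 × Discrete 𝔠) (b : Br 𝔠)
    (s : (conc 𝔠).obj b ⟶ p.1) (β : Fin b.len → Br 𝔠)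
    (r : ∀ i, (conc 𝔠).obj (β i) ⟶ (b.obj i).1) :
    X.toFunctor.obj ((colours 𝔠).obj b, p.2) ◁
        tensMap b.len (fun i => circleι Y Z (b.obj i) (β i) (r i)) ≫
      circleι X (circle Y Z) p b s =
    rightι X Y Z p (refine b β) ((conc 𝔠).map (refineHom b β r) ≫ s) := by
  have e1 := circleι_condition X (circle Y Z) p (refineHom b β r) s
  have e2 : (branches (circle Y Z)).map (refineHom b β r) = tensMap b.len fun i =>
      (circle Y Z).toFunctor.map (Prod.mkHom (r i) (𝟙 (b.obj i).2)) :=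
    (tensMap_eq_tensPerm _ _).symm
  have e3 : ∀ i, circleι Y Z ((conc 𝔠).obj (β i), (b.obj i).2) (β i) (𝟙 _) ≫
      (circle Y Z).toFunctor.map (Prod.mkHom (r i) (𝟙 (b.obj i).2)) =
        circleι Y Z (b.obj i) (β i) (r i) := fun i =>
    (circleι_map_id Y Z (b.obj i).2 (r i) (β i) (𝟙 _)).trans
      (congrArg (fun t => circleι Y Z (b.obj i) (β i) t) (Category.id_comp _))
  have e4 := (tensMap_comp b.len _ _).symm.trans (congrArg (fun t => tensMap b.len t) (funext e3))
  have e5 := (congrArg (fun t => tensMap b.len (fun i => circleι Y Z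
    ((conc 𝔠).obj (β i), (b.obj i).2) (β i) (𝟙 _)) ≫ t) e2).trans e4
  have e6 : X.toFunctor.map (Prod.mkHom ((colours 𝔠).map (refineHom b β r)) (𝟙 p.2)) = 𝟙 _ :=
    X.toFunctor.map_id ((colours 𝔠).obj b, p.2)
  have aux : ∀ {A B D E F : M} {x : A ⟶ A} {i : B ⟶ D} {m : D ⟶ E} {j : B ⟶ E} {g : A ⊗ E ⟶ F}
      {g' : A ⊗ D ⟶ F} (_ : g' = (x ⊗ₘ m) ≫ g) (_ : i ≫ m = j) (_ : x = 𝟙 A),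
      A ◁ j ≫ g = A ◁ i ≫ g' := by
    rintro A B D E F _ i m _ g _ rfl rfl rfl
    rw [id_tensorHom, MonoidalCategory.whiskerLeft_comp, Category.assoc]
  exact aux e1 e5 e6

lemma right_hom_ext {X Y Z : SymSeq 𝔠 M} {p : Profile 𝔠 × Discrete 𝔠} {W : M}
    {f g : (circle X (circle Y Z)).toFunctor.obj p ⟶ W}
    (h : ∀ h s, rightι X Y Z p h s ≫ f = rightι X Y Z p h s ≫ g) : f = g := by
  refine circle_hom_ext fun b s => ?_
  refine wcoend.tens_hom_ext (K := conc 𝔠) (T := fun i => circleTerm Y Z (b.obj i).2)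
    (c := fun i => (b.obj i).1) (X.toFunctor.obj ((colours 𝔠).obj b, p.2)) fun β r => ?_
  have e := tensMap_circleι X Y Z p b s β r
  have h' := h (refine b β) ((conc 𝔠).map (refineHom b β r) ≫ s)
  exact (Category.assoc _ _ _).symm.trans ((congrArg (fun t => t ≫ f) e).trans
    (h'.trans ((congrArg (fun t => t ≫ g) e).symm.trans (Category.assoc _ _ _))))

lemma exists_right_desc (X Y Z : SymSeq 𝔠 M) (p : Profile 𝔠 × Discrete 𝔠) {W : M}
    (k : ∀ (h : FinFam (Br 𝔠 × Discrete 𝔠)) (_ : (conc 𝔠).obj (innerConc.obj h) ⟶ p.1),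
      (rightTerm X Y Z p.2).obj h ⟶ W)
    (hk : ∀ {h h' : FinFam (Br 𝔠 × Discrete 𝔠)} (φ : h ⟶ h')
      (s : (conc 𝔠).obj (innerConc.obj h') ⟶ p.1),
      k h ((conc 𝔠).map (innerConc.map φ) ≫ s) = (rightTerm X Y Z p.2).map φ ≫ k h' s) :
    ∃ d : (circle X (circle Y Z)).toFunctor.obj p ⟶ W, ∀ h s, rightι X Y Z p h s ≫ d = k h s := by
  have h1 : ∀ (b : Br 𝔠) (s : (conc 𝔠).obj b ⟶ p.1),
      ∃ d : X.toFunctor.obj ((colours 𝔠).obj b, p.2) ⊗ (branches (circle Y Z)).obj b ⟶ W,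
        ∀ β r, X.toFunctor.obj ((colours 𝔠).obj b, p.2) ◁
          tensMap b.len (fun i => circleι Y Z (b.obj i) (β i) (r i)) ≫ d =
            k (refine b β) ((conc 𝔠).map (refineHom b β r) ≫ s) := by
    intro b s
    refine wcoend.exists_tens_desc (K := conc 𝔠) (T := fun i => circleTerm Y Z (b.obj i).2)
      (c := fun i => (b.obj i).1) (X.toFunctor.obj ((colours 𝔠).obj b, p.2))
      (fun β r => k (refine b β) ((conc 𝔠).map (refineHom b β r) ≫ s)) fun {β β'} f r => ?_
    let φ : refine b β ⟶ refine b β' :=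
      ⟨Equiv.refl _, fun i => Prod.mkHom (f i) (𝟙 (b.obj i).2)⟩
    have e1 := hk φ ((conc 𝔠).map (refineHom b β' r) ≫ s)
    have e2 : innerConc.map φ ≫ refineHom b β' r =
        refineHom b β (fun i => (conc 𝔠).map (f i) ≫ r i) :=
      FinFam.hom_ext (fun _ => rfl) fun i => Prod.ext (Category.id_comp _).symm
        (Subsingleton.elim _ _)
    have e3 : (conc 𝔠).map (innerConc.map φ) ≫ (conc 𝔠).map (refineHom b β' r) ≫ s =
        (conc 𝔠).map (refineHom b β (fun i => (conc 𝔠).map (f i) ≫ r i)) ≫ s := by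
      rw [← e2, Functor.map_comp, Category.assoc]
    have e4 : (tensF M).map ((FinFam.map (branchPair Y Z)).map φ) =
        tensMap b.len fun i => (circleTerm Y Z (b.obj i).2).map (f i) :=
      (tensMap_eq_tensPerm _ _).symm
    have e5 : X.toFunctor.map (Prod.mkHom ((colours 𝔠).map (innerColours.map φ)) (𝟙 p.2)) = 𝟙 _ :=
      X.toFunctor.map_id ((colours 𝔠).obj b, p.2)
    have aux : ∀ {A B D F : M} {x : A ⟶ A} {m m' : B ⟶ D} {g : A ⊗ D ⟶ F} (_ : m = m')
        (_ : x = 𝟙 A), (x ⊗ₘ m) ≫ g = A ◁ m' ≫ g := by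
      rintro A B D F _ m _ g rfl rfl
      rw [id_tensorHom]
    exact (congrArg (k _) e3).symm.trans (e1.trans (aux e4 e5))
  choose d hd using h1
  have h2 : ∀ {b b' : Br 𝔠} (f : b ⟶ b') (s : (conc 𝔠).obj b' ⟶ p.1),
      d b ((conc 𝔠).map f ≫ s) = (circleTerm X (circle Y Z) p.2).map f ≫ d b' s := by
    intro b b' f s
    refine wcoend.tens_hom_ext (K := conc 𝔠) (T := fun i => circleTerm Y Z (b.obj i).2)
      (c := fun i => (b.obj i).1) (X.toFunctor.obj ((colours 𝔠).obj b, p.2)) fun β r => ?_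
    have e1 := hd b ((conc 𝔠).map f ≫ s) β r
    let β' : Fin b'.len → Br 𝔠 := fun i => β (f.perm i)
    let r' : ∀ i, (conc 𝔠).obj (β' i) ⟶ (b'.obj i).1 := fun i => r (f.perm i) ≫ (f.hom i).1
    have e2 := hd b' s β' r'
    let ψ : refine b β ⟶ refine b' β' := ⟨f.perm, fun i => Prod.mkHom (𝟙 _) (f.hom i).2⟩
    have e3 := hk ψ ((conc 𝔠).map (refineHom b' β' r') ≫ s)
    have e4 : innerConc.map ψ ≫ refineHom b' β' r' = refineHom b β r ≫ f :=
      FinFam.hom_ext (fun _ => rfl) fun i => Prod.ext (by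
        have h : (conc 𝔠).map (𝟙 (β (f.perm i))) = 𝟙 _ :=
          CategoryTheory.Functor.map_id _ _
        have h' := congrArg (fun t => t ≫ r (f.perm i) ≫ (f.hom i).1) h
        exact h') (Subsingleton.elim _ _)
    have e5 : (conc 𝔠).map (innerConc.map ψ) ≫ (conc 𝔠).map (refineHom b' β' r') ≫ s =
        (conc 𝔠).map (refineHom b β r) ≫ (conc 𝔠).map f ≫ s := by
      rw [← Category.assoc, ← Functor.map_comp, e4, Functor.map_comp, Category.assoc]
    have e6 : tensMap b.len (fun i => circleι Y Z (b.obj i) (β i) (r i)) ≫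
        (branches (circle Y Z)).map f = (tensF M).map ((FinFam.map (branchPair Y Z)).map ψ) ≫
          tensMap b'.len (fun i => circleι Y Z (b'.obj i) (β' i) (r' i)) := by
      refine (tensMap_tensPerm _ _ _ _ _).trans (Eq.trans ?_ (tensPerm_tensMap _ _ _ _ _).symm)
      refine tensPerm_congr rfl fun i j hj _ => ?_
      subst hj
      have e := circleι_map Y Z (f.hom i) (β (f.perm i)) (r (f.perm i))
      have e' := circleTermMap_id_app Y Z (f.hom i).2 (β (f.perm i))
      have aux : ∀ {A B D E F : M} {a : A ⟶ B} {m : B ⟶ D} {u u' : A ⟶ E} {c : E ⟶ D}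
          (_ : a ≫ m = u ≫ c) (_ : u = u'), a ≫ 𝟙 B ≫ m = (𝟙 A ≫ u') ≫ c := by
        rintro A B D E F a m u _ c h rfl
        simpa using h
      refine aux (F := W) e (e'.trans ?_)
      have aux2 : ∀ {A B D : M} {a a' : A ⟶ B} {m : D ⟶ D} (_ : a = a') (_ : m = 𝟙 D),
          a ▷ D = a' ⊗ₘ m := by
        rintro A B D a _ _ rfl rfl
        simp
      exact aux2 (congrArg (fun t => Y.toFunctor.map t) (Prod.ext
        (CategoryTheory.Functor.map_id (colours 𝔠) (β (f.perm i))).symm rfl))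
        (CategoryTheory.Functor.map_id (branches Z) (β (f.perm i)))
    have e7 := whiskerLeft_tensorHom_eq
      (a := X.toFunctor.map (Prod.mkHom ((colours 𝔠).map f) (𝟙 p.2))) e6.symm (d b' s)
    exact e1.trans ((congrArg (k _) e5).symm.trans (e3.trans
      ((congrArg (fun t => _ ≫ t) e2).symm.trans e7)))
  refine ⟨wcoend.desc (K := conc 𝔠) (T := circleTerm X (circle Y Z) p.2) d h2, fun h s => ?_⟩
  have e1 := wcoend.ι_desc (K := conc 𝔠) (T := circleTerm X (circle Y Z) p.2) d h2 (innerConc.obj h) s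
  have e2 := hd (innerConc.obj h) s (fun i => (h.obj i).1) (fun i => 𝟙 _)
  have e3 : (conc 𝔠).map (refineHom (innerConc.obj h) (fun i => (h.obj i).1) (fun i => 𝟙 _)) = 𝟙 _ :=
    CategoryTheory.Functor.map_id (conc 𝔠) (innerConc.obj h)
  exact (Category.assoc _ _ _).trans ((congrArg (fun t => _ ≫ t) e1).trans (e2.trans
    (congrArg (k h) ((congrArg (fun t => t ≫ s) e3).trans (Category.id_comp s)))))

end Right

lemma functor_map_square {C : Type u} [Category.{v} C] {D : Type u₁} [Category.{v₁} D] (F : C ⥤ D)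
    {X Y Y' Z : C} {f : X ⟶ Y} {g : Y ⟶ Z} {f' : X ⟶ Y'} {g' : Y' ⟶ Z} (h : f ≫ g = f' ≫ g')
    {W : D} (s : F.obj Z ⟶ W) : F.map f ≫ F.map g ≫ s = F.map f' ≫ F.map g' ≫ s := by
  rw [← Functor.map_comp_assoc, h, Functor.map_comp_assoc]

section Left

variable {𝔠 : Type w} {M : Type u} [Category.{v} M] [MonoidalCategory M] [SymmetricCategory M]

/-- The morphism from the iterated tensor product over the regrouped family. -/
def regroupTens (Z : SymSeq 𝔠 M) (b β : Br 𝔠) (r : (conc 𝔠).obj β ⟶ (colours 𝔠).obj b) :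
    (FinFam.map (CategoryTheory.Prod.fst _ _ ⋙ branches Z) ⋙ tensF M).obj
      (FinFam.regroup b β r) ⟶ (branches Z).obj b :=
  tensConcat ((FinFam.map (CategoryTheory.Prod.fst _ _ ⋙ FinFam.map Z.toFunctor)).obj
    (FinFam.regroup b β r)) ≫ (branches Z).map (FinFam.regroupHom b β r)

instance (Z : SymSeq 𝔠 M) (b β : Br 𝔠) (r : (conc 𝔠).obj β ⟶ (colours 𝔠).obj b) :
    IsIso (regroupTens Z b β r) :=
  
  have : IsIso (FinFam.regroupHom b β r) := FinFam.instIsIsoProdDiscreteRegroupHom b β r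
  IsIso.comp_isIso' (isIso_tensConcat _) (CategoryTheory.Functor.map_isIso _ _)

lemma tensConcat_branches_natural (Z : SymSeq 𝔠 M) {h h' : FinFam (Br 𝔠 × Discrete 𝔠)}
    (φ : h ⟶ h') :
    (tensF M).map ((FinFam.map (CategoryTheory.Prod.fst _ _ ⋙ branches Z)).map φ) ≫
        tensConcat ((FinFam.map (CategoryTheory.Prod.fst _ _ ⋙
          FinFam.map Z.toFunctor)).obj h') =
      tensConcat ((FinFam.map (CategoryTheory.Prod.fst _ _ ⋙
        FinFam.map Z.toFunctor)).obj h) ≫ (branches Z).map (joinBr.map φ) := by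
  have e6 := tensConcat_natural
    ((FinFam.map (CategoryTheory.Prod.fst _ _ ⋙ FinFam.map Z.toFunctor)).map φ)
  have e7 : (branches Z).map (joinBr.map φ) = (tensF M).map (FinFam.concat.map
      ((FinFam.map (CategoryTheory.Prod.fst _ _ ⋙ FinFam.map Z.toFunctor)).map φ)) :=
    congrArg (fun t => (tensF M).map t) (FinFam.map_concat_map Z.toFunctor
      ((FinFam.map (CategoryTheory.Prod.fst _ _)).map φ))
  exact e6.trans (congrArg (fun t => _ ≫ t) e7.symm)

variable [HasColimitsOfSize.{w, w} M]

lemma leftι_regroup (X Y Z : SymSeq 𝔠 M) (p : Profile 𝔠 × Discrete 𝔠) (b : Br 𝔠)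
    (s : (conc 𝔠).obj b ⟶ p.1) (β : Br 𝔠) (r : (conc 𝔠).obj β ⟶ (colours 𝔠).obj b) :
    (circleTerm X Y p.2).obj β ◁ regroupTens Z b β r ≫
        circleι X Y ((colours 𝔠).obj b, p.2) β r ▷ (branches Z).obj b ≫
          circleι (circle X Y) Z p b s =
      leftι X Y Z p (FinFam.regroup b β r) ((conc 𝔠).map (FinFam.regroupHom b β r) ≫ s) := by
  let h := FinFam.regroup b β r
  have e1 := circleι_condition (circle X Y) Z p (FinFam.regroupHom b β r) s
  have e2 := (circleι_map_id X Y p.2 ((colours 𝔠).map (FinFam.regroupHom b β r)) β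
    (joinColours h)).trans (congrArg (fun t => circleι X Y ((colours 𝔠).obj b, p.2) β t)
      (Category.id_comp r))
  have aux : ∀ {A B B' D P P' R : M} {j : B ⟶ B'} {n : B' ⟶ D} {i : A ⟶ P} {m : P ⟶ P'}
      {i' : A ⟶ P'} {g : P ⊗ B' ⟶ R} {g' : P' ⊗ D ⟶ R} (_ : g = (m ⊗ₘ n) ≫ g')
      (_ : i ≫ m = i'), A ◁ (j ≫ n) ≫ i' ▷ D ≫ g' = (i ⊗ₘ j) ≫ g := by
    rintro A B B' D P P' R j n i m _ _ g' rfl rfl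
    rw [tensorHom_comp_tensorHom_assoc, MonoidalCategory.tensorHom_def', Category.assoc]
  exact aux e1 e2

variable [∀ A : M, PreservesColimitsOfSize.{w, w} (tensorLeft A)]

lemma left_hom_ext {X Y Z : SymSeq 𝔠 M} {p : Profile 𝔠 × Discrete 𝔠} {W : M}
    {f g : (circle (circle X Y) Z).toFunctor.obj p ⟶ W}
    (h : ∀ h s, leftι X Y Z p h s ≫ f = leftι X Y Z p h s ≫ g) : f = g := by
  refine circle_hom_ext fun b s => ?_
  refine wcoend.tensorRight_hom_ext (K := conc 𝔠) (T := circleTerm X Y p.2)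
    ((branches Z).obj b) fun β r => ?_
  have e := leftι_regroup X Y Z p b s β r
  have h' := h (FinFam.regroup b β r) ((conc 𝔠).map (FinFam.regroupHom b β r) ≫ s)
  have aux : ∀ {A B D E F : M} {a : A ⟶ B} {i : B ⟶ D} {j : D ⟶ E} {l : A ⟶ E} {f g : E ⟶ F}
      (_ : IsIso a) (_ : a ≫ i ≫ j = l) (_ : l ≫ f = l ≫ g), i ≫ j ≫ f = i ≫ j ≫ g := by
    rintro A B D E F a i j _ f g _ rfl h
    rw [← cancel_epi a]
    simpa using h
  exact aux inferInstance e h'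

lemma exists_left_desc (X Y Z : SymSeq 𝔠 M) (p : Profile 𝔠 × Discrete 𝔠) {W : M}
    (k : ∀ (h : FinFam (Br 𝔠 × Discrete 𝔠)) (_ : (conc 𝔠).obj (joinBr.obj h) ⟶ p.1),
      (leftTerm X Y Z p.2).obj h ⟶ W)
    (hk : ∀ {h h' : FinFam (Br 𝔠 × Discrete 𝔠)} (φ : h ⟶ h')
      (s : (conc 𝔠).obj (joinBr.obj h') ⟶ p.1),
      k h ((conc 𝔠).map (joinBr.map φ) ≫ s) = (leftTerm X Y Z p.2).map φ ≫ k h' s) :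
    ∃ d : (circle (circle X Y) Z).toFunctor.obj p ⟶ W, ∀ h s, leftι X Y Z p h s ≫ d = k h s := by
  let l : ∀ (b : Br 𝔠) (_ : (conc 𝔠).obj b ⟶ p.1) (β : Br 𝔠)
      (_ : (conc 𝔠).obj β ⟶ (colours 𝔠).obj b),
      (circleTerm X Y p.2).obj β ⊗ (branches Z).obj b ⟶ W := fun b s β r =>
    (circleTerm X Y p.2).obj β ◁ inv (regroupTens Z b β r) ≫
      k (FinFam.regroup b β r) ((conc 𝔠).map (FinFam.regroupHom b β r) ≫ s)
  have hl : ∀ {b b' β β' : Br 𝔠} (r : (conc 𝔠).obj β ⟶ (colours 𝔠).obj b)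
      (r' : (conc 𝔠).obj β' ⟶ (colours 𝔠).obj b') (f : β ⟶ β') (φ : b ⟶ b')
      (s : (conc 𝔠).obj b' ⟶ p.1) (_ : r ≫ (colours 𝔠).map φ = (conc 𝔠).map f ≫ r'),
      l b ((conc 𝔠).map φ ≫ s) β r = ((circleTerm X Y p.2).map f ⊗ₘ (branches Z).map φ) ≫
        l b' s β' r' := by
    intro b b' β β' r r' f φ s h
    obtain ⟨ψ, h1, h2⟩ := FinFam.exists_regroup_map r r' f φ h
    have e1 := hk ψ ((conc 𝔠).map (FinFam.regroupHom b' β' r') ≫ s)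
    have e2 : joinBr.map ψ ≫ FinFam.regroupHom b' β' r' = FinFam.regroupHom b β r ≫ φ := h2
    have e3 : (conc 𝔠).map (joinBr.map ψ) ≫ (conc 𝔠).map (FinFam.regroupHom b' β' r') ≫ s =
        (conc 𝔠).map (FinFam.regroupHom b β r) ≫ (conc 𝔠).map φ ≫ s  :=
      functor_map_square (conc 𝔠) e2 s
    have e4 := tensConcat_branches_natural Z ψ
    have e5 := ((branches Z).map_comp _ _).symm.trans ((congrArg (fun t => (branches Z).map t)
      e2).trans ((branches Z).map_comp _ _))
    have e6 : (tensF M).map ((FinFam.map (CategoryTheory.Prod.fst _ _ ⋙ branches Z)).map ψ) ≫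
        regroupTens Z b' β' r' = regroupTens Z b β r ≫ (branches Z).map φ := by
      have aux : ∀ {A B D A' B' D' : M} {a : A ⟶ B} {b : B ⟶ D} {a' : A' ⟶ B'} {b' : B' ⟶ D'}
          {x : A ⟶ A'} {y : B ⟶ B'} {z : D ⟶ D'} (_ : x ≫ a' = a ≫ y) (_ : y ≫ b' = b ≫ z),
          x ≫ a' ≫ b' = (a ≫ b) ≫ z := by
        intro A B D A' B' D' a b a' b' x y z h1 h2
        rw [reassoc_of% h1, h2, Category.assoc]
      exact aux e4 e5
    have e7 : (leftTerm X Y Z p.2).map ψ = (circleTerm X Y p.2).map f ⊗ₘ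
        (tensF M).map ((FinFam.map (CategoryTheory.Prod.fst _ _ ⋙ branches Z)).map ψ) :=
      congrArg (fun t => (circleTerm X Y p.2).map t ⊗ₘ
        (tensF M).map ((FinFam.map (CategoryTheory.Prod.fst _ _ ⋙ branches Z)).map ψ)) h1
    have e8 := (congrArg (k _) e3).symm.trans (e1.trans (congrArg (fun t => t ≫ _) e7))
    have aux : ∀ {A A' B B' D D' : M} {a : A ⟶ A'} {e : B ⟶ D} {e' : B' ⟶ D'} {x : B ⟶ B'}
        {y : D ⟶ D'} {m : A ⊗ B ⟶ W} {m' : A' ⊗ B' ⟶ W} (_ : IsIso e) (_ : IsIso e')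
        (_ : x ≫ e' = e ≫ y) (_ : m = (a ⊗ₘ x) ≫ m'),
        A ◁ inv e ≫ m = (a ⊗ₘ y) ≫ A' ◁ inv e' ≫ m' := by
      rintro A A' B B' D D' a e e' x y _ m' _ _ h rfl
      have h' : y ≫ inv e' = inv e ≫ x := by
        rw [IsIso.eq_inv_comp, ← reassoc_of% h, IsIso.hom_inv_id, Category.comp_id]
      rw [← id_tensorHom, ← id_tensorHom, tensorHom_comp_tensorHom_assoc,
        tensorHom_comp_tensorHom_assoc, h', Category.comp_id, Category.id_comp]
    exact aux inferInstance inferInstance e6 e8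
  have h1 : ∀ (b : Br 𝔠) (s : (conc 𝔠).obj b ⟶ p.1),
      ∃ d : (circle X Y).toFunctor.obj ((colours 𝔠).obj b, p.2) ⊗ (branches Z).obj b ⟶ W,
        ∀ β r, circleι X Y ((colours 𝔠).obj b, p.2) β r ▷ (branches Z).obj b ≫ d = l b s β r := by
    intro b s
    refine wcoend.exists_tensorRight_desc (K := conc 𝔠) (T := circleTerm X Y p.2)
      ((branches Z).obj b) (fun β r => l b s β r) fun {β β'} f r => ?_
    have e := hl ((conc 𝔠).map f ≫ r) r f (𝟙 b) s
      ((congrArg (fun t => _ ≫ t) (CategoryTheory.Functor.map_id (colours 𝔠) b)).trans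
        (Category.comp_id _))
    have e' : (conc 𝔠).map (𝟙 b) ≫ s = s :=
      (congrArg (fun t => t ≫ s) (CategoryTheory.Functor.map_id (conc 𝔠) b)).trans
        (Category.id_comp _)
    have e'' : (circleTerm X Y p.2).map f ⊗ₘ (branches Z).map (𝟙 b) =
        (circleTerm X Y p.2).map f ▷ (branches Z).obj b := by
      rw [CategoryTheory.Functor.map_id, tensorHom_id]
    exact (congrArg (fun t => l b t β ((conc 𝔠).map f ≫ r)) e').symm.trans
      (e.trans (congrArg (fun t => t ≫ _) e''))
  choose d hd using h1
  have h2 : ∀ {b b' : Br 𝔠} (φ : b ⟶ b') (s : (conc 𝔠).obj b' ⟶ p.1),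
      d b ((conc 𝔠).map φ ≫ s) = (circleTerm (circle X Y) Z p.2).map φ ≫ d b' s := by
    intro b b' φ s
    refine wcoend.tensorRight_hom_ext (K := conc 𝔠) (T := circleTerm X Y p.2)
      ((branches Z).obj b) fun β r => ?_
    have e1 := hd b ((conc 𝔠).map φ ≫ s) β r
    have e2 := hd b' s β (r ≫ (colours 𝔠).map φ)
    have e3 := hl r (r ≫ (colours 𝔠).map φ) (𝟙 β) φ s
      ((congrArg (fun t => t ≫ _) (CategoryTheory.Functor.map_id (conc 𝔠) β)).trans
        (Category.id_comp _)).symm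
    have e4 := circleι_map_id X Y p.2 ((colours 𝔠).map φ) β r
    have aux : ∀ {A B B' P P' : M} {i : A ⟶ P} {m : P ⟶ P'} {i' : A ⟶ P'} {n : B ⟶ B'}
        {d : P ⊗ B ⟶ W} {d' : P' ⊗ B' ⟶ W} {l : A ⊗ B ⟶ W} {l' : A ⊗ B' ⟶ W} {x : A ⟶ A}
        (_ : i ▷ B ≫ d = l) (_ : i' ▷ B' ≫ d' = l') (_ : l = (x ⊗ₘ n) ≫ l') (_ : i ≫ m = i')
        (_ : x = 𝟙 A), i ▷ B ≫ d = i ▷ B ≫ (m ⊗ₘ n) ≫ d' := by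
      rintro A B B' P P' i m _ n d d' _ _ _ h1 rfl h3 rfl rfl
      rw [h1, h3, ← tensorHom_id, ← tensorHom_id, tensorHom_comp_tensorHom_assoc,
        tensorHom_comp_tensorHom_assoc, Category.id_comp, Category.id_comp, Category.comp_id]
    exact aux e1 e2 e3 e4 (CategoryTheory.Functor.map_id (circleTerm X Y p.2) β)
  refine ⟨wcoend.desc (K := conc 𝔠) (T := circleTerm (circle X Y) Z p.2) d h2, fun h s => ?_⟩
  have e1 := wcoend.ι_desc (K := conc 𝔠) (T := circleTerm (circle X Y) Z p.2) d h2 (joinBr.obj h) s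
  have e2 := hd (joinBr.obj h) s (innerColours.obj h) (joinColours h)
  obtain ⟨ψ, h3, h4⟩ := FinFam.exists_regroup_join h
  have e3 := hk ψ s
  have e4 : (conc 𝔠).map (joinBr.map ψ) = (conc 𝔠).map (FinFam.regroupHom (joinBr.obj h)
      (innerColours.obj h) (joinColours h)) := congrArg (fun t => (conc 𝔠).map t) h4
  have e5 := tensConcat_branches_natural Z ψ
  have e6 := e5.trans (congrArg (fun t => _ ≫ (branches Z).map t) h4)
  have e7 : (leftTerm X Y Z p.2).map ψ = (circleTerm X Y p.2).map (𝟙 (innerColours.obj h)) ⊗ₘ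
      (tensF M).map ((FinFam.map (CategoryTheory.Prod.fst _ _ ⋙ branches Z)).map ψ) :=
    congrArg (fun t => (circleTerm X Y p.2).map t ⊗ₘ
      (tensF M).map ((FinFam.map (CategoryTheory.Prod.fst _ _ ⋙ branches Z)).map ψ)) h3
  have e8 := (congrArg (fun t => k _ (t ≫ s)) e4).symm.trans (e3.trans
    (congrArg (fun t => t ≫ _) e7))
  have aux : ∀ {A B B₀ D P R : M} {i : A ⟶ P} {c : B ⟶ D} {g : P ⊗ D ⟶ R} {q : R ⟶ W}
      {d : P ⊗ D ⟶ W} {E : B₀ ⟶ D} {k₀ : A ⊗ B₀ ⟶ W} {k : A ⊗ B ⟶ W} {x : A ⟶ A} {y : B₀ ⟶ B}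
      (_ : IsIso E) (_ : g ≫ q = d) (_ : i ▷ D ≫ d = A ◁ inv E ≫ k₀) (_ : k₀ = (x ⊗ₘ y) ≫ k)
      (_ : x = 𝟙 A) (_ : y ≫ c = E) (_ : IsIso c), ((i ⊗ₘ c) ≫ g) ≫ q = k := by
    rintro A B B₀ D P R i c g q _ E _ k _ y _ rfl h2 rfl rfl h5 _
    have h6 : y = E ≫ inv c := by rw [← h5, Category.assoc, IsIso.hom_inv_id, Category.comp_id]
    have h7 : (c ≫ inv E) ≫ E ≫ inv c = 𝟙 _ := by simp
    rw [MonoidalCategory.tensorHom_def', Category.assoc, Category.assoc, h2, id_tensorHom, h6,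
      ← MonoidalCategory.whiskerLeft_comp_assoc, ← MonoidalCategory.whiskerLeft_comp_assoc,
      h7, MonoidalCategory.whiskerLeft_id, Category.id_comp]
  exact aux (inferInstanceAs (IsIso (regroupTens Z (joinBr.obj h) (innerColours.obj h)
    (joinColours h)))) e1 e2 e8 (CategoryTheory.Functor.map_id _ _) e6 (isIso_tensConcat _)

end Left

section Associator

lemma natural_of_natural_fst {𝔠 : Type w} {M : Type u} [Category.{v} M] {X Y : SymSeq 𝔠 M}
    (f : ∀ p, X.toFunctor.obj p ⟶ Y.toFunctor.obj p)
    (h : ∀ {c c' : Profile 𝔠} (g : c ⟶ c') (t : Discrete 𝔠),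
      X.toFunctor.map (Prod.mkHom g (𝟙 t)) ≫ f (c', t) =
        f (c, t) ≫ Y.toFunctor.map (Prod.mkHom g (𝟙 t)))
    {p q : Profile 𝔠 × Discrete 𝔠} (s : p ⟶ q) :
    X.toFunctor.map s ≫ f q = f p ≫ Y.toFunctor.map s := by
  obtain ⟨c, ⟨t⟩⟩ := p
  obtain ⟨c', ⟨t'⟩⟩ := q
  obtain ⟨g, ⟨⟨e⟩⟩⟩ := s
  obtain rfl : t = t' := e
  exact h g ⟨t⟩

variable {𝔠 : Type w}

lemma joinConc_natural {h h' : FinFam (Br 𝔠 × Discrete 𝔠)} (φ : h ⟶ h') :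
    (conc 𝔠).map (innerConc.map φ) ≫ joinConc h' = joinConc h ≫ (conc 𝔠).map (joinBr.map φ) := by
  have e1 := FinFam.concatAssoc_natural ((FinFam.map (CategoryTheory.Prod.fst _ _ ⋙
    FinFam.map (CategoryTheory.Prod.fst (Profile 𝔠) (Discrete 𝔠)))).map φ)
  have e2 := congrArg (fun t => FinFam.concat.map t)
    (FinFam.map_concat_map (CategoryTheory.Prod.fst (Profile 𝔠) (Discrete 𝔠))
      ((FinFam.map (CategoryTheory.Prod.fst _ _)).map φ))
  exact e1.trans (congrArg (fun t => _ ≫ t) e2.symm)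

instance (h : FinFam (Br 𝔠 × Discrete 𝔠)) : IsIso (joinConc h) :=
  inferInstanceAs (IsIso (FinFam.concatAssoc _))

variable {M : Type u} [Category.{v} M] [MonoidalCategory M] [SymmetricCategory M]

instance (X Y Z : SymSeq 𝔠 M) (t : Discrete 𝔠) (h : FinFam (Br 𝔠 × Discrete 𝔠)) :
    IsIso ((assocTerm X Y Z t).app h) := by
  have aux : ∀ {A B D E : M} (z : B ⊗ D ⟶ E), IsIso z → IsIso ((α_ A B D).hom ≫ A ◁ z) :=
    fun _ _ => inferInstance
  exact aux _ (isIso_tensZip _ _ _)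

variable [HasColimitsOfSize.{w, w} M]

lemma leftι_map_id (X Y Z : SymSeq 𝔠 M) {c c' : Profile 𝔠} (t : Discrete 𝔠) (f : c ⟶ c')
    (h : FinFam (Br 𝔠 × Discrete 𝔠)) (s : (conc 𝔠).obj (joinBr.obj h) ⟶ c) :
    leftι X Y Z (c, t) h s ≫ (circle (circle X Y) Z).toFunctor.map (Prod.mkHom f (𝟙 t)) =
      leftι X Y Z (c', t) h (s ≫ f) :=
  (Category.assoc _ _ _).trans (congrArg (fun t => _ ≫ t) (circleι_map_id (circle X Y) Z t f _ s))

lemma rightι_map_id (X Y Z : SymSeq 𝔠 M) {c c' : Profile 𝔠} (t : Discrete 𝔠) (f : c ⟶ c')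
    (h : FinFam (Br 𝔠 × Discrete 𝔠)) (s : (conc 𝔠).obj (innerConc.obj h) ⟶ c) :
    rightι X Y Z (c, t) h s ≫ (circle X (circle Y Z)).toFunctor.map (Prod.mkHom f (𝟙 t)) =
      rightι X Y Z (c', t) h (s ≫ f) :=
  (Category.assoc _ _ _).trans (congrArg (fun t => _ ≫ t) (circleι_map_id X (circle Y Z) t f _ s))

lemma branchesMap_app {Y Y' : SymSeq 𝔠 M} (g : Y ⟶ Y') (b : Br 𝔠) :
    (branchesMap g).app b = tensMap b.len (fun i => SymSeq.app g (b.obj i)) :=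
  tensF_map_mapNat (C := M) (E := Profile 𝔠 × Discrete 𝔠) g b

lemma tensConcat_branchesMap {Z Z' : SymSeq 𝔠 M} (k : Z ⟶ Z') (h : FinFam (Br 𝔠 × Discrete 𝔠)) :
    tensMap h.len (fun i => (branchesMap k).app (h.obj i).1) ≫
        tensConcat ((FinFam.map (CategoryTheory.Prod.fst _ _ ⋙ FinFam.map Z'.toFunctor)).obj h) =
      tensConcat ((FinFam.map (CategoryTheory.Prod.fst _ _ ⋙ FinFam.map Z.toFunctor)).obj h) ≫
        (branchesMap k).app (joinBr.obj h) := by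
  let κ : Z.toFunctor ⟶ Z'.toFunctor := k
  have e1 := tensConcat_natural ((FinFam.mapNat (FinFam.mapNat κ)).app
    ((FinFam.map (CategoryTheory.Prod.fst _ _)).obj h))
  have e2 := tensF_map_mapNat (Functor.whiskerRight (FinFam.mapNat κ) (tensF M))
    ((FinFam.map (CategoryTheory.Prod.fst _ _)).obj h)
  have e3 := congrArg (fun t => (tensF M).map t) (FinFam.concat_map_mapNat κ
    ((FinFam.map (CategoryTheory.Prod.fst _ _)).obj h))
  exact (congrArg (fun t => t ≫ _) e2).symm.trans (e1.trans (congrArg (fun t => _ ≫ t) e3))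

lemma leftι_circleMap {X X' Y Y' Z Z' : SymSeq 𝔠 M} (f : X ⟶ X') (g : Y ⟶ Y') (k : Z ⟶ Z')
    (p : Profile 𝔠 × Discrete 𝔠) (h : FinFam (Br 𝔠 × Discrete 𝔠))
    (s : (conc 𝔠).obj (joinBr.obj h) ⟶ p.1) :
    leftι X Y Z p h s ≫ SymSeq.app (circleMap (circleMap f g) k) p =
      ((SymSeq.app f ((colours 𝔠).obj (innerColours.obj h), p.2) ⊗ₘ
          tensMap h.len (fun i => SymSeq.app g ((colours 𝔠).obj (h.obj i).1, (h.obj i).2))) ⊗ₘ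
        tensMap h.len (fun i => (branchesMap k).app (h.obj i).1)) ≫ leftι X' Y' Z' p h s := by
  have e1 := circleι_circleMap (circleMap f g) k p (joinBr.obj h) s
  have e2 := circleι_circleMap f g ((colours 𝔠).obj (joinBr.obj h), p.2) (innerColours.obj h)
    (joinColours h)
  have e3 := branchesMap_app g (innerColours.obj h)
  have e4 := tensConcat_branchesMap k h
  have aux : ∀ {A A' B B' B'' D D' E G' : M} {i : A ⊗ B ⟶ D} {i' : A' ⊗ B' ⟶ D'}
      {m : D ⟶ D'} {a : A ⟶ A'} {b b' : B ⟶ B'} {j : E ⟶ B''} {E₁ : M} {j' : E₁ ⟶ G'}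
      {n : B'' ⟶ G'} {l : E ⟶ E₁} {R R' : M} {c : D ⊗ B'' ⟶ R} {c' : D' ⊗ G' ⟶ R'} {r : R ⟶ R'}
      (_ : c ≫ r = (m ⊗ₘ n) ≫ c') (_ : i ≫ m = (a ⊗ₘ b) ≫ i') (_ : b = b')
      (_ : l ≫ j' = j ≫ n),
      ((i ⊗ₘ j) ≫ c) ≫ r = ((a ⊗ₘ b') ⊗ₘ l) ≫ (i' ⊗ₘ j') ≫ c' := by
    rintro A A' B B' B'' D D' E G' i i' m a b _ j E₁ j' n l R R' c c' r h1 h2 rfl h4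
    rw [Category.assoc, h1, tensorHom_comp_tensorHom_assoc, tensorHom_comp_tensorHom_assoc, h2, h4]
  exact aux e1 e2 e3 e4

lemma rightι_circleMap {X X' Y Y' Z Z' : SymSeq 𝔠 M} (f : X ⟶ X') (g : Y ⟶ Y') (k : Z ⟶ Z')
    (p : Profile 𝔠 × Discrete 𝔠) (h : FinFam (Br 𝔠 × Discrete 𝔠))
    (s : (conc 𝔠).obj (innerConc.obj h) ⟶ p.1) :
    rightι X Y Z p h s ≫ SymSeq.app (circleMap f (circleMap g k)) p =
      (SymSeq.app f ((colours 𝔠).obj (innerColours.obj h), p.2) ⊗ₘ tensMap h.len (fun i =>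
        SymSeq.app g ((colours 𝔠).obj (h.obj i).1, (h.obj i).2) ⊗ₘ
          (branchesMap k).app (h.obj i).1)) ≫ rightι X' Y' Z' p h s := by
  have e1 := circleι_circleMap f (circleMap g k) p (innerConc.obj h) s
  have e2 := branchesMap_app (circleMap g k) (innerConc.obj h)
  have e3 : ∀ i, _ := fun i => circleι_circleMap g k ((conc 𝔠).obj (h.obj i).1, (h.obj i).2)
    (h.obj i).1 (𝟙 _)
  have e4 := (tensMap_comp h.len _ _).symm.trans ((congrArg (fun t => tensMap h.len t)
    (funext e3)).trans (tensMap_comp h.len _ _))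
  have aux : ∀ {A A' B B' D D' R R' : M} {i : B ⟶ D} {i' : B' ⟶ D'} {m m' : D ⟶ D'} {a : A ⟶ A'}
      {l : B ⟶ B'} {c : A ⊗ D ⟶ R} {c' : A' ⊗ D' ⟶ R'} {r : R ⟶ R'}
      (_ : c ≫ r = (a ⊗ₘ m) ≫ c') (_ : m = m') (_ : i ≫ m' = l ≫ i'),
      (A ◁ i ≫ c) ≫ r = (a ⊗ₘ l) ≫ A' ◁ i' ≫ c' := by
    rintro A A' B B' D D' R R' i i' m _ a l c c' r h1 rfl h3
    rw [Category.assoc, h1]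
    exact (whiskerLeft_tensorHom_eq h3.symm c').symm
  exact aux e1 e2 e4

variable [∀ A : M, PreservesColimitsOfSize.{w, w} (tensorLeft A)]

lemma exists_assocHom (X Y Z : SymSeq 𝔠 M) (p : Profile 𝔠 × Discrete 𝔠) :
    ∃ d : (circle (circle X Y) Z).toFunctor.obj p ⟶ (circle X (circle Y Z)).toFunctor.obj p,
      ∀ h s, leftι X Y Z p h s ≫ d =
        (assocTerm X Y Z p.2).app h ≫ rightι X Y Z p h (joinConc h ≫ s) := by
  refine exists_left_desc X Y Z p (fun h s => (assocTerm X Y Z p.2).app h ≫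
    rightι X Y Z p h (joinConc h ≫ s)) fun {h h'} φ s => ?_
  have e1 := rightι_condition X Y Z p φ (joinConc h' ≫ s)
  have e2 : (conc 𝔠).map (innerConc.map φ) ≫ joinConc h' ≫ s =
      joinConc h ≫ (conc 𝔠).map (joinBr.map φ) ≫ s := by
    rw [← Category.assoc, joinConc_natural, Category.assoc]
  rw [← e2, e1, NatTrans.naturality_assoc]

lemma exists_assocInv (X Y Z : SymSeq 𝔠 M) (p : Profile 𝔠 × Discrete 𝔠) :
    ∃ d : (circle X (circle Y Z)).toFunctor.obj p ⟶ (circle (circle X Y) Z).toFunctor.obj p,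
      ∀ h s, rightι X Y Z p h s ≫ d =
        inv ((assocTerm X Y Z p.2).app h) ≫ leftι X Y Z p h (inv (joinConc h) ≫ s) := by
  refine exists_right_desc X Y Z p (fun h s => inv ((assocTerm X Y Z p.2).app h) ≫
    leftι X Y Z p h (inv (joinConc h) ≫ s)) fun {h h'} φ s => ?_
  have e1 := leftι_condition X Y Z p φ (inv (joinConc h') ≫ s)
  have e2 : (conc 𝔠).map (joinBr.map φ) ≫ inv (joinConc h') ≫ s =
      inv (joinConc h) ≫ (conc 𝔠).map (innerConc.map φ) ≫ s := by
    rw [IsIso.eq_inv_comp, ← Category.assoc, ← joinConc_natural, Category.assoc,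
      IsIso.hom_inv_id_assoc]
  rw [← e2, e1, IsIso.inv_comp_eq, ← NatTrans.naturality_assoc, IsIso.hom_inv_id_assoc]

/-- The components of the associativity isomorphism. -/
noncomputable def assocHomApp (X Y Z : SymSeq 𝔠 M) (p : Profile 𝔠 × Discrete 𝔠) :
    (circle (circle X Y) Z).toFunctor.obj p ⟶ (circle X (circle Y Z)).toFunctor.obj p :=
  (exists_assocHom X Y Z p).choose

/-- The components of the inverse of the associativity isomorphism. -/
noncomputable def assocInvApp (X Y Z : SymSeq 𝔠 M) (p : Profile 𝔠 × Discrete 𝔠) :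
    (circle X (circle Y Z)).toFunctor.obj p ⟶ (circle (circle X Y) Z).toFunctor.obj p :=
  (exists_assocInv X Y Z p).choose

lemma leftι_assocHomApp (X Y Z : SymSeq 𝔠 M) (p : Profile 𝔠 × Discrete 𝔠)
    (h : FinFam (Br 𝔠 × Discrete 𝔠)) (s : (conc 𝔠).obj (joinBr.obj h) ⟶ p.1) :
    leftι X Y Z p h s ≫ assocHomApp X Y Z p =
      (assocTerm X Y Z p.2).app h ≫ rightι X Y Z p h (joinConc h ≫ s) :=
  (exists_assocHom X Y Z p).choose_spec h s

lemma rightι_assocInvApp (X Y Z : SymSeq 𝔠 M) (p : Profile 𝔠 × Discrete 𝔠)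
    (h : FinFam (Br 𝔠 × Discrete 𝔠)) (s : (conc 𝔠).obj (innerConc.obj h) ⟶ p.1) :
    rightι X Y Z p h s ≫ assocInvApp X Y Z p =
      inv ((assocTerm X Y Z p.2).app h) ≫ leftι X Y Z p h (inv (joinConc h) ≫ s) :=
  (exists_assocInv X Y Z p).choose_spec h s

/-- The associativity isomorphism of the circle product. -/
noncomputable def circleAssoc (X Y Z : SymSeq 𝔠 M) :
    circle (circle X Y) Z ≅ circle X (circle Y Z) where
  hom := SymSeq.mkHom (X := circle (circle X Y) Z) (Y := circle X (circle Y Z))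
    (fun p => assocHomApp X Y Z p)
    (natural_of_natural_fst _ fun {c c'} g t => left_hom_ext fun h s => by
      have e1 := leftι_map_id X Y Z t g h s
      have e2 := leftι_assocHomApp X Y Z (c', t) h (s ≫ g)
      have e3 := leftι_assocHomApp X Y Z (c, t) h s
      have e4 := (rightι_map_id X Y Z t g h (joinConc h ≫ s)).trans
        (congrArg (fun t => rightι _ _ _ _ _ t) (Category.assoc _ _ _))
      rw [reassoc_of% e1, e2, reassoc_of% e3, e4])
  inv := SymSeq.mkHom (X := circle X (circle Y Z)) (Y := circle (circle X Y) Z)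
    (fun p => assocInvApp X Y Z p)
    (natural_of_natural_fst _ fun {c c'} g t => right_hom_ext fun h s => by
      have e1 := rightι_map_id X Y Z t g h s
      have e2 := rightι_assocInvApp X Y Z (c', t) h (s ≫ g)
      have e3 := rightι_assocInvApp X Y Z (c, t) h s
      have e4 := (leftι_map_id X Y Z t g h (inv (joinConc h) ≫ s)).trans
        (congrArg (fun t => leftι _ _ _ _ _ t) (Category.assoc _ _ _))
      rw [reassoc_of% e1, e2, reassoc_of% e3, e4])
  hom_inv_id := SymSeq.hom_ext fun p => left_hom_ext fun h s => by
    have e2 := leftι_assocHomApp X Y Z p h s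
    have e3 := rightι_assocInvApp X Y Z p h (joinConc h ≫ s)
    rw [SymSeq.app_comp, SymSeq.app_mkHom, SymSeq.app_mkHom, reassoc_of% e2, e3]
    simp
  inv_hom_id := SymSeq.hom_ext fun p => right_hom_ext fun h s => by
    have e2 := rightι_assocInvApp X Y Z p h s
    have e3 := leftι_assocHomApp X Y Z p h (inv (joinConc h) ≫ s)
    rw [SymSeq.app_comp, SymSeq.app_mkHom, SymSeq.app_mkHom, reassoc_of% e2, e3]
    simp

lemma leftι_circleAssoc (X Y Z : SymSeq 𝔠 M) (p : Profile 𝔠 × Discrete 𝔠)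
    (h : FinFam (Br 𝔠 × Discrete 𝔠)) (s : (conc 𝔠).obj (joinBr.obj h) ⟶ p.1) :
    leftι X Y Z p h s ≫ SymSeq.app (circleAssoc X Y Z).hom p =
      (assocTerm X Y Z p.2).app h ≫ rightι X Y Z p h (joinConc h ≫ s) :=
  leftι_assocHomApp X Y Z p h s

lemma circleAssoc_generator (X Y Z : SymSeq 𝔠 M) (h : FinFam (Br 𝔠 × Discrete 𝔠))
    (t : Discrete 𝔠) : generatorLeft X Y Z h t ≫ SymSeq.app (circleAssoc X Y Z).hom _ =
      generatorRight X Y Z h t := by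
  have e1 := leftι_circleAssoc X Y Z ((conc 𝔠).obj (joinBr.obj h), t) h (𝟙 _)
  have e2 : joinConc h ≫ 𝟙 _ = joinConc h := Category.comp_id _
  have e3 := e1.trans (congrArg (fun t => _ ≫ rightι _ _ _ _ _ t) e2)
  refine e3.trans ?_
  have aux : ∀ {A B D E F G : M} {a : A ⟶ B ⊗ D} {z : D ⟶ E} {u : E ⟶ F} {c : B ⊗ F ⟶ G},
      (a ≫ B ◁ z) ≫ B ◁ u ≫ c = a ≫ B ◁ (z ≫ u) ≫ c := by
    intros
    simp
  exact aux

lemma circleAssoc_naturality {X X' Y Y' Z Z' : SymSeq 𝔠 M} (f : X ⟶ X') (g : Y ⟶ Y')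
    (k : Z ⟶ Z') : circleMap (circleMap f g) k ≫ (circleAssoc X' Y' Z').hom =
      (circleAssoc X Y Z).hom ≫ circleMap f (circleMap g k) := by
  refine SymSeq.hom_ext fun p => left_hom_ext fun h s => ?_
  have e1 := leftι_circleMap f g k p h s
  have e2 := leftι_circleAssoc X' Y' Z' p h s
  have e3 := leftι_circleAssoc X Y Z p h s
  have e4 := rightι_circleMap f g k p h (joinConc h ≫ s)
  have e5 := tensZip_tensMap h.len
    (fun i => SymSeq.app g ((colours 𝔠).obj (h.obj i).1, (h.obj i).2))
    (fun i => (branchesMap k).app (h.obj i).1)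
  have aux : ∀ {A A' B B' D D' E E' L L' R R' : M} {l : (A ⊗ B) ⊗ D ⟶ L}
      {l' : (A' ⊗ B') ⊗ D' ⟶ L'} {m : L ⟶ L'} {n : R ⟶ R'} {d : L ⟶ R} {d' : L' ⟶ R'}
      {a : A ⟶ A'} {b : B ⟶ B'} {c : D ⟶ D'} {z : B ⊗ D ⟶ E} {z' : B' ⊗ D' ⟶ E'} {e : E ⟶ E'}
      {r : A ⊗ E ⟶ R} {r' : A' ⊗ E' ⟶ R'}
      (_ : l ≫ m = ((a ⊗ₘ b) ⊗ₘ c) ≫ l') (_ : l' ≫ d' = ((α_ A' B' D').hom ≫ A' ◁ z') ≫ r')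
      (_ : l ≫ d = ((α_ A B D).hom ≫ A ◁ z) ≫ r) (_ : r ≫ n = (a ⊗ₘ e) ≫ r')
      (_ : (b ⊗ₘ c) ≫ z' = z ≫ e), l ≫ m ≫ d' = l ≫ d ≫ n := by
    intro A A' B B' D D' E E' L L' R R' l l' m n d d' a b c z z' e r r' h1 h2 h3 h4 h5
    simp only [Category.assoc] at h2 h3
    rw [reassoc_of% h1, h2, reassoc_of% h3, h4,
      associator_naturality_assoc, ← whiskerLeft_tensorHom_eq h5]
  exact aux e1 e2 e3 e4 e5

end Associator

section UnitPerm

variable {C : Type u} [Category.{v} C] [MonoidalCategory C] [SymmetricCategory C]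

lemma tensUnit_pull (k : ℕ) : ∀ (n : ℕ) (h : k < n + 1),
    tensUnit (C := C) (n + 1) ≫ pull k n h (fun _ => 𝟙_ C) =
      (λ_ (𝟙_ C)).inv ≫ 𝟙_ C ◁ tensUnit n := by
  induction k with
  | zero => exact fun n h => Category.comp_id _
  | succ k ih =>
    intro n h
    cases n with
    | zero => omega
    | succ n =>
      have IH := ih n (by omega)
      have aux : ∀ {T T' : C} {t : 𝟙_ C ⟶ T'} {u : 𝟙_ C ⟶ T} {p : T' ⟶ 𝟙_ C ⊗ T}
          (_ : t ≫ p = (λ_ (𝟙_ C)).inv ≫ 𝟙_ C ◁ u),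
          ((λ_ (𝟙_ C)).inv ≫ 𝟙_ C ◁ t) ≫ 𝟙_ C ◁ p ≫ swapL (𝟙_ C) (𝟙_ C) T =
            (λ_ (𝟙_ C)).inv ≫ 𝟙_ C ◁ ((λ_ (𝟙_ C)).inv ≫ 𝟙_ C ◁ u) := by
        intro T T' t u p h
        have h1 := swapL_natural (𝟙 (𝟙_ C)) (𝟙 (𝟙_ C)) u
        simp only [id_tensorHom] at h1
        rw [Category.assoc, ← MonoidalCategory.whiskerLeft_comp_assoc, h,
          MonoidalCategory.whiskerLeft_comp_assoc, h1, MonoidalCategory.whiskerLeft_comp]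
        have h2 : swapL (𝟙_ C) (𝟙_ C) (𝟙_ C) = 𝟙 _ := by
          rw [swapL, braiding_tensorUnit_left]
          monoidal
        rw [h2, Category.id_comp]
      exact aux IH

lemma tensUnit_tensPerm (p : ℕ) : ∀ (q : ℕ) (e : Fin p ≃ Fin q),
    tensUnit (C := C) q ≫ tensPerm p q e (fun _ => 𝟙_ C) (fun _ => 𝟙_ C) (fun _ _ _ => 𝟙 _) =
      tensUnit p := by
  induction p with
  | zero =>
    intro q e
    cases q with
    | zero => exact Category.comp_id _
    | succ q => exact (e.symm 0).elim0
  | succ p ih =>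
    intro q e
    cases q with
    | zero => exact (e 0).elim0
    | succ q =>
      have IH := ih q (removeAt e 0)
      have h := tensUnit_pull (C := C) (e 0) q (e 0).2
      have aux : ∀ {T P Q : C} {t : 𝟙_ C ⟶ T} {x : T ⟶ 𝟙_ C ⊗ P} {u : 𝟙_ C ⟶ P} {y : P ⟶ Q}
          {z : 𝟙_ C ⟶ Q} (_ : t ≫ x = (λ_ (𝟙_ C)).inv ≫ 𝟙_ C ◁ u) (_ : u ≫ y = z),
          t ≫ x ≫ (𝟙 (𝟙_ C) ⊗ₘ y) = (λ_ (𝟙_ C)).inv ≫ 𝟙_ C ◁ z := by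
        rintro T P Q t x u y _ h rfl
        rw [reassoc_of% h, id_tensorHom, MonoidalCategory.whiskerLeft_comp]
      exact aux h IH

instance isIso_tensUnit (n : ℕ) : IsIso (tensUnit (C := C) n) := by
  induction n with
  | zero => exact inferInstanceAs (IsIso (𝟙 (𝟙_ C)))
  | succ n ih => exact inferInstanceAs (IsIso ((λ_ (𝟙_ C)).inv ≫ 𝟙_ C ◁ tensUnit n))

end UnitPerm

section LeftUnit

variable {𝔠 : Type w}

lemma hom_to_single_induction {t : Discrete 𝔠}
    {P : ∀ b : Br 𝔠, (FinFam.single.obj t ⟶ (colours 𝔠).obj b) → Prop}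
    (h : ∀ q, P (FinFam.single.obj (q, t)) (𝟙 (FinFam.single.obj t))) (b : Br 𝔠)
    (r : FinFam.single.obj t ⟶ (colours 𝔠).obj b) : P b r := by
  obtain ⟨n, o⟩ := b
  have hn : n = 1 := by
    have h := Fintype.card_congr r.perm
    change Fintype.card (Fin n) = Fintype.card (Fin 1) at h
    simpa using h
  subst hn
  obtain ⟨⟨q, ⟨a⟩⟩, ho⟩ : ∃ x, o 0 = x := ⟨_, rfl⟩
  obtain rfl : o = fun _ => (q, ⟨a⟩) := funext fun i => by
    rw [Subsingleton.elim i 0, ho]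
  obtain ⟨t⟩ := t
  have ha : t = a := (r.hom (0 : Fin 1)).down.down
  subst ha
  have hr : r = 𝟙 (FinFam.single.obj (Discrete.mk t)) := FinFam.profile_hom_ext fun i =>
    Subsingleton.elim (α := Fin 1) _ _
  exact (congrArg (P (FinFam.single.obj (q, Discrete.mk t))) hr).mpr (h q)

lemma single_hom_eq {q q' : Profile 𝔠} {t : Discrete 𝔠}
    (ψ : (FinFam.single.obj (q, t) : Br 𝔠) ⟶ FinFam.single.obj (q', t)) :
    ∃ g : q ⟶ q', ψ = FinFam.single.map (Prod.mkHom g (𝟙 t)) := by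
  refine ⟨(ψ.hom (0 : Fin 1)).1, FinFam.hom_ext (fun i => Subsingleton.elim (α := Fin 1) _ _)
    fun i => ?_⟩
  obtain rfl : i = (0 : Fin 1) := Subsingleton.elim (α := Fin 1) _ _
  exact Prod.ext (Category.id_comp _).symm (Subsingleton.elim _ _)

lemma tensF_toConcatSingle_natural {C : Type u} [Category.{v} C] [MonoidalCategory C]
    [SymmetricCategory C] {x y : FinFam C} (f : x ⟶ y) :
    (tensF C).map (f ≫ FinFam.toConcatSingle y) =
      (tensF C).map (FinFam.toConcatSingle x ≫ FinFam.concat.map (FinFam.single.map f)) := by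
  have h1 := toConcatSingle_eq x
  have h2 := toConcatSingle_eq y
  have h3 := tensConcat_natural (FinFam.single.map f)
  have h4 : (tensF C).map ((FinFam.map (tensF C)).map (FinFam.single.map f)) =
      (tensF C).map f ▷ 𝟙_ C := Eq.trans (tensMap_eq_tensPerm 1 (x := fun _ => (tensF C).obj x)
        (y := fun _ => (tensF C).obj y) fun _ => (tensF C).map f).symm (tensorHom_id _ _)
  have h5 := (congrArg (fun t => t ≫ _) h4).symm.trans h3
  have aux : ∀ {A B A' B' : C} {a : A ⟶ A'} {b : B ⟶ B'} {t : A ⊗ 𝟙_ C ⟶ B}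
      {t' : A' ⊗ 𝟙_ C ⟶ B'} {s : A ⟶ B} {s' : A' ⟶ B'} (_ : s = (ρ_ A).inv ≫ t)
      (_ : s' = (ρ_ A').inv ≫ t') (_ : a ▷ 𝟙_ C ≫ t' = t ≫ b), a ≫ s' = s ≫ b := by
    rintro A B A' B' a b t t' _ _ rfl rfl h
    rw [Category.assoc, ← h, rightUnitor_inv_naturality_assoc]
  exact ((tensF C).map_comp _ _).trans ((aux h1 h2 h5).trans ((tensF C).map_comp _ _).symm)

lemma toConcatSingle_natural {K : Type u} [Category.{v} K] {x y : FinFam K} (f : x ⟶ y) :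
    f ≫ FinFam.toConcatSingle y =
      FinFam.toConcatSingle x ≫ FinFam.concat.map (FinFam.single.map f) := by
  refine FinFam.hom_ext_tensF ?_
  have h := tensF_toConcatSingle_natural ((FinFam.map (Fam.single K)).map f)
  have h1 := FinFam.map_toConcatSingle (Fam.single K) x
  have h2 := FinFam.map_toConcatSingle (Fam.single K) y
  have h3 := FinFam.map_concat_map (Fam.single K) (FinFam.single.map f)
  have h4 := ((FinFam.map (Fam.single K)).map_comp f (FinFam.toConcatSingle y)).trans
    (congrArg (fun t => _ ≫ t) h2)
  have h5 := ((FinFam.map (Fam.single K)).map_comp (FinFam.toConcatSingle x)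
    (FinFam.concat.map (FinFam.single.map f))).trans (congrArg₂ (fun s t => s ≫ t) h1 h3)
  exact (congrArg (fun t => (tensF (Fam K)).map t) h4).trans (h.trans
    (congrArg (fun t => (tensF (Fam K)).map t) h5).symm)

lemma functor_map_id_comp {C : Type u} [Category.{v} C] {D : Type u₁} [Category.{v₁} D] (F : C ⥤ D)
    {X : C} {Y : D} (s : F.obj X ⟶ Y) : F.map (𝟙 X) ≫ s = s := by
  rw [CategoryTheory.Functor.map_id, Category.id_comp]

variable {M : Type u} [Category.{v} M] [MonoidalCategory M] [SymmetricCategory M]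
  [HasColimitsOfSize.{w, w} M]

/-- The canonical morphisms into `I_∘ ∘ X`. -/
noncomputable def leftUnitι (X : SymSeq 𝔠 M) (p : Profile 𝔠 × Discrete 𝔠) (q : Profile 𝔠)
    (s : (conc 𝔠).obj (FinFam.single.obj (q, p.2)) ⟶ p.1) :
    𝟙_ M ⊗ (X.toFunctor.obj (q, p.2) ⊗ 𝟙_ M) ⟶ (circle (circleUnit 𝔠 M) X).toFunctor.obj p :=
  unitι M (FinFam.single.obj p.2, p.2) (𝟙 _) ▷ (X.toFunctor.obj (q, p.2) ⊗ 𝟙_ M) ≫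
    circleι (circleUnit 𝔠 M) X p (FinFam.single.obj (q, p.2)) s

lemma branches_single_map (X : SymSeq 𝔠 M) {q q' : Profile 𝔠} (g : q ⟶ q') (t : Discrete 𝔠) :
    (branches X).map (FinFam.single.map (Prod.mkHom g (𝟙 t))) =
      X.toFunctor.map (Prod.mkHom g (𝟙 t)) ▷ 𝟙_ M := by
  have h : tensMap 1 (fun _ => X.toFunctor.map (Prod.mkHom g (𝟙 t))) =
      (branches X).map (FinFam.single.map (Prod.mkHom g (𝟙 t))) := tensMap_eq_tensPerm 1 _
  exact h.symm.trans (tensorHom_id _ _)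

lemma leftUnitι_condition (X : SymSeq 𝔠 M) (p : Profile 𝔠 × Discrete 𝔠) {q q' : Profile 𝔠}
    (g : q ⟶ q') (s : (conc 𝔠).obj (FinFam.single.obj (q', p.2)) ⟶ p.1) :
    leftUnitι X p q ((conc 𝔠).map (FinFam.single.map (Prod.mkHom g (𝟙 p.2))) ≫ s) =
      𝟙_ M ◁ (X.toFunctor.map (Prod.mkHom g (𝟙 p.2)) ▷ 𝟙_ M) ≫ leftUnitι X p q' s := by
  have e1 := circleι_condition (circleUnit 𝔠 M) X p
    (FinFam.single.map (Prod.mkHom g (𝟙 p.2))) s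
  have e2 := branches_single_map X g p.2
  have e3 : (circleUnit 𝔠 M).toFunctor.map (Prod.mkHom ((colours 𝔠).map
      (FinFam.single.map (Prod.mkHom g (𝟙 p.2)))) (𝟙 p.2)) = 𝟙 _ :=
    (circleUnit 𝔠 M).toFunctor.map_id (FinFam.single.obj p.2, p.2)
  have aux : ∀ {A B B' P R : M} {u : A ⟶ P} {x : P ⟶ P} {b b' : B ⟶ B'} {c : P ⊗ B' ⟶ R}
      {c' : P ⊗ B ⟶ R} (_ : c' = (x ⊗ₘ b) ≫ c) (_ : b = b') (_ : x = 𝟙 P),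
      u ▷ B ≫ c' = A ◁ b' ≫ u ▷ B' ≫ c := by
    rintro A B B' P R u _ b _ c _ rfl rfl rfl
    rw [id_tensorHom, whisker_exchange_assoc]
  exact aux e1 e2 e3

lemma leftUnitι_map_id (X : SymSeq 𝔠 M) {c c' : Profile 𝔠} (t : Discrete 𝔠) (f : c ⟶ c')
    (q : Profile 𝔠) (s : (conc 𝔠).obj (FinFam.single.obj (q, t)) ⟶ c) :
    leftUnitι X (c, t) q s ≫ (circle (circleUnit 𝔠 M) X).toFunctor.map (Prod.mkHom f (𝟙 t)) =
      leftUnitι X (c', t) q (s ≫ f) :=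
  (Category.assoc _ _ _).trans (congrArg (fun t => _ ≫ t)
    (circleι_map_id (circleUnit 𝔠 M) X t f
      (FinFam.single.obj (q, t)) s))

lemma leftUnitι_circleMap {X X' : SymSeq 𝔠 M} (f : X ⟶ X') (p : Profile 𝔠 × Discrete 𝔠)
    (q : Profile 𝔠) (s : (conc 𝔠).obj (FinFam.single.obj (q, p.2)) ⟶ p.1) :
    leftUnitι X p q s ≫ SymSeq.app (circleMap (𝟙 (circleUnit 𝔠 M)) f) p =
      𝟙_ M ◁ (SymSeq.app f (q, p.2) ▷ 𝟙_ M) ≫ leftUnitι X' p q s := by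
  have e1 := circleι_circleMap (𝟙 (circleUnit 𝔠 M)) f p (FinFam.single.obj (q, p.2)) s
  have e2 : (branchesMap f).app (FinFam.single.obj (q, p.2)) = SymSeq.app f (q, p.2) ▷ 𝟙_ M :=
    (branchesMap_app f _).trans (tensorHom_id _ _)
  have aux : ∀ {A B B' P R R' : M} {u : A ⟶ P} {b b' : B ⟶ B'} {c : P ⊗ B ⟶ R}
      {c' : P ⊗ B' ⟶ R'} {r : R ⟶ R'} (_ : c ≫ r = (𝟙 P ⊗ₘ b) ≫ c') (_ : b = b'),
      (u ▷ B ≫ c) ≫ r = A ◁ b' ≫ u ▷ B' ≫ c' := by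
    rintro A B B' P R R' u b _ c c' r h rfl
    rw [Category.assoc, h, id_tensorHom, whisker_exchange_assoc]
  exact aux e1 e2

variable [∀ A : M, PreservesColimitsOfSize.{w, w} (tensorLeft A)]

lemma unit_tensor_hom_ext {p : Profile 𝔠 × Discrete 𝔠} (T : M) {Z : M}
    {f g : (circleUnit 𝔠 M).toFunctor.obj p ⊗ T ⟶ Z}
    (h : ∀ r, unitι M p r ▷ T ≫ f = unitι M p r ▷ T ≫ g) : f = g :=
  tensor_hom_ext_right (colimit.isColimit (Discrete.functor fun _ :
    (FinFam.single.obj p.2 ⟶ p.1) => 𝟙_ M)) T fun j => h j.as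

lemma exists_unit_tensor_desc (p : Profile 𝔠 × Discrete 𝔠) (T : M) {Z : M}
    (k : (FinFam.single.obj p.2 ⟶ p.1) → (𝟙_ M ⊗ T ⟶ Z)) :
    ∃ d : (circleUnit 𝔠 M).toFunctor.obj p ⊗ T ⟶ Z, ∀ r, unitι M p r ▷ T ≫ d = k r := by
  obtain ⟨d, hd⟩ := exists_tensor_desc_right (colimit.isColimit (Discrete.functor fun _ :
    (FinFam.single.obj p.2 ⟶ p.1) => 𝟙_ M)) T (fun j => k j.as) (by
      rintro ⟨j⟩ ⟨j'⟩ ⟨⟨e⟩⟩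
      obtain rfl : j = j' := e
      have aux : ∀ {x : 𝟙_ M ⟶ 𝟙_ M} (_ : x = 𝟙 _), x ▷ T ≫ k j = k j := by
        rintro _ rfl
        simp
      exact aux (CategoryTheory.Functor.map_id (Discrete.functor _) _))
  exact ⟨d, fun r => hd ⟨r⟩⟩

lemma leftUnit_hom_ext {X : SymSeq 𝔠 M} {p : Profile 𝔠 × Discrete 𝔠} {W : M}
    {f g : (circle (circleUnit 𝔠 M) X).toFunctor.obj p ⟶ W}
    (h : ∀ q s, leftUnitι X p q s ≫ f = leftUnitι X p q s ≫ g) : f = g := by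
  refine circle_hom_ext fun b s => unit_tensor_hom_ext _ fun r => ?_
  revert s
  refine hom_to_single_induction (P := fun b r => ∀ s : (conc 𝔠).obj b ⟶ p.1,
    unitι M ((colours 𝔠).obj b, p.2) r ▷ (branches X).obj b ≫
        circleι (circleUnit 𝔠 M) X p b s ≫ f =
      unitι M ((colours 𝔠).obj b, p.2) r ▷ (branches X).obj b ≫
        circleι (circleUnit 𝔠 M) X p b s ≫ g) (fun q s => ?_) b r
  exact (Category.assoc _ _ _).symm.trans ((h q s).trans (Category.assoc _ _ _))

lemma exists_leftUnit_desc (X : SymSeq 𝔠 M) (p : Profile 𝔠 × Discrete 𝔠) {W : M}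
    (k : ∀ (q : Profile 𝔠) (_ : (conc 𝔠).obj (FinFam.single.obj (q, p.2)) ⟶ p.1),
      𝟙_ M ⊗ (X.toFunctor.obj (q, p.2) ⊗ 𝟙_ M) ⟶ W)
    (hk : ∀ {q q' : Profile 𝔠} (g : q ⟶ q') (s : (conc 𝔠).obj (FinFam.single.obj (q', p.2)) ⟶ p.1),
      k q ((conc 𝔠).map (FinFam.single.map (Prod.mkHom g (𝟙 p.2))) ≫ s) =
        𝟙_ M ◁ (X.toFunctor.map (Prod.mkHom g (𝟙 p.2)) ▷ 𝟙_ M) ≫ k q' s) :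
    ∃ d : (circle (circleUnit 𝔠 M) X).toFunctor.obj p ⟶ W,
      ∀ q s, leftUnitι X p q s ≫ d = k q s := by
  have h1 : ∀ (b : Br 𝔠) (r : FinFam.single.obj p.2 ⟶ (colours 𝔠).obj b)
      (s : (conc 𝔠).obj b ⟶ p.1), ∃ m : 𝟙_ M ⊗ (branches X).obj b ⟶ W,
        ∀ (q : Profile 𝔠) (ψ : FinFam.single.obj (q, p.2) ⟶ b),
          𝟙_ M ◁ (branches X).map ψ ≫ m = k q ((conc 𝔠).map ψ ≫ s) := by
    refine hom_to_single_induction fun q₀ s => ⟨k q₀ s, fun q ψ => ?_⟩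
    obtain ⟨g, rfl⟩ := single_hom_eq ψ
    refine Eq.trans ?_ (hk g s).symm
    exact congrArg (fun t => 𝟙_ M ◁ t ≫ k q₀ s) (branches_single_map X g p.2)
  choose m hm using h1
  have hm' : ∀ (q : Profile 𝔠) (s : (conc 𝔠).obj (FinFam.single.obj (q, p.2)) ⟶ p.1),
      m (FinFam.single.obj (q, p.2)) (𝟙 _) s = k q s := by
    intro q s
    have e2 := hm (FinFam.single.obj (q, p.2)) (𝟙 _) s q (𝟙 _)
    have e3 := CategoryTheory.Functor.map_id (branches X) (FinFam.single.obj (q, p.2))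
    have e4 := functor_map_id_comp (conc 𝔠) s
    have aux : ∀ {A B D : M} {x : B ⟶ B} {y z : A ⊗ B ⟶ D} (_ : A ◁ x ≫ y = z) (_ : x = 𝟙 B),
        y = z := by
      rintro A B D _ y z h rfl
      simpa using h
    exact (aux e2 e3).trans (congrArg (k q) e4)
  have h2 : ∀ (b : Br 𝔠) (s : (conc 𝔠).obj b ⟶ p.1), ∃ d : (circleUnit 𝔠 M).toFunctor.obj
      ((colours 𝔠).obj b, p.2) ⊗ (branches X).obj b ⟶ W,
        ∀ r, unitι M ((colours 𝔠).obj b, p.2) r ▷ (branches X).obj b ≫ d = m b r s :=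
    fun b s => exists_unit_tensor_desc ((colours 𝔠).obj b, p.2) _ fun r => m b r s
  choose d hd using h2
  have h3 : ∀ (b : Br 𝔠) (r : FinFam.single.obj p.2 ⟶ (colours 𝔠).obj b) (b' : Br 𝔠)
      (r' : FinFam.single.obj p.2 ⟶ (colours 𝔠).obj b') (f : b ⟶ b') (s : (conc 𝔠).obj b' ⟶ p.1),
      𝟙_ M ◁ (branches X).map f ≫ m b' r' s = m b r ((conc 𝔠).map f ≫ s) := by
    refine hom_to_single_induction fun q b' r' f s => ?_
    have e1 := hm b' r' s q f
    exact e1.trans (hm' q ((conc 𝔠).map f ≫ s)).symm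
  have h4 : ∀ {b b' : Br 𝔠} (f : b ⟶ b') (s : (conc 𝔠).obj b' ⟶ p.1),
      d b ((conc 𝔠).map f ≫ s) = (circleTerm (circleUnit 𝔠 M) X p.2).map f ≫ d b' s := by
    intro b b' f s
    refine unit_tensor_hom_ext _ fun r => ?_
    have e1 := unitι_map (M := M) (p := ((colours 𝔠).obj b, p.2)) (q := ((colours 𝔠).obj b', p.2))
      (Prod.mkHom ((colours 𝔠).map f) (𝟙 p.2)) r
    have e2 := h3 b r b' (FinFam.single.map (inv (𝟙 p.2)) ≫ r ≫ (colours 𝔠).map f) f s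
    have e3 := hd b' s (FinFam.single.map (inv (𝟙 p.2)) ≫ r ≫ (colours 𝔠).map f)
    have e4 := hd b ((conc 𝔠).map f ≫ s) r
    have aux : ∀ {I B B' P P' : M} {i : I ⟶ P} {i' : I ⟶ P'} {x : P ⟶ P'} {y : B ⟶ B'}
        {d : P ⊗ B ⟶ W} {d' : P' ⊗ B' ⟶ W} {n : I ⊗ B ⟶ W} {n' : I ⊗ B' ⟶ W}
        (_ : i ≫ x = i') (_ : I ◁ y ≫ n' = n) (_ : i' ▷ B' ≫ d' = n') (_ : i ▷ B ≫ d = n),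
        i ▷ B ≫ d = i ▷ B ≫ (x ⊗ₘ y) ≫ d' := by
      rintro I B B' P P' i _ x y d d' _ _ rfl rfl rfl h
      rw [h, ← id_tensorHom, ← tensorHom_id, ← tensorHom_id, tensorHom_comp_tensorHom_assoc,
        tensorHom_comp_tensorHom_assoc, Category.id_comp, Category.id_comp, Category.comp_id]
    exact aux e1 e2 e3 e4
  refine ⟨wcoend.desc (K := conc 𝔠) (T := circleTerm (circleUnit 𝔠 M) X p.2) d h4, fun q s => ?_⟩
  · have e1 := wcoend.ι_desc (K := conc 𝔠) (T := circleTerm (circleUnit 𝔠 M) X p.2) d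
      h4 (FinFam.single.obj (q, p.2)) s
    have e2 := hd (FinFam.single.obj (q, p.2)) s (𝟙 (FinFam.single.obj p.2))
    have aux : ∀ {I B P R : M} {u : I ⟶ P} {c : P ⊗ B ⟶ R} {x : R ⟶ W} {y : P ⊗ B ⟶ W}
        {z z' : I ⊗ B ⟶ W} (_ : c ≫ x = y) (_ : u ▷ B ≫ y = z) (_ : z = z'),
        (u ▷ B ≫ c) ≫ x = z' := by
      rintro I B P R u c x _ _ _ rfl rfl rfl
      exact Category.assoc _ _ _
    exact aux e1 e2 (hm' q s)

end LeftUnit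

section LeftUnitor

attribute [local irreducible] FinFam.concat

variable {𝔠 : Type w}

/-- The isomorphism `q ⟶ conc ((q, t))` for a profile `q`. -/
def toConc (q : Profile 𝔠) (t : Discrete 𝔠) : q ⟶ (conc 𝔠).obj (FinFam.single.obj (q, t)) :=
  FinFam.toConcatSingle q

instance (q : Profile 𝔠) (t : Discrete 𝔠) : IsIso (toConc q t) :=
  inferInstanceAs (IsIso (FinFam.toConcatSingle q))

lemma toConc_natural {q q' : Profile 𝔠} (g : q ⟶ q') (t : Discrete 𝔠) :
    toConc q t ≫ (conc 𝔠).map (FinFam.single.map (Prod.mkHom g (𝟙 t))) = g ≫ toConc q' t :=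
  (toConcatSingle_natural g).symm

variable {M : Type u} [Category.{v} M] [MonoidalCategory M] [SymmetricCategory M]
  [HasColimitsOfSize.{w, w} M] [∀ A : M, PreservesColimitsOfSize.{w, w} (tensorLeft A)]

lemma map_mkHom_comp (X : SymSeq 𝔠 M) {a b c : Profile 𝔠} (t : Discrete 𝔠) (f : a ⟶ b)
    (g : b ⟶ c) : X.toFunctor.map (Prod.mkHom f (𝟙 t)) ≫ X.toFunctor.map (Prod.mkHom g (𝟙 t)) =
      X.toFunctor.map (Prod.mkHom (f ≫ g) (𝟙 t)) :=
  (X.toFunctor.map_comp _ _).symm.trans (congrArg (fun s => X.toFunctor.map s)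
    (Prod.ext rfl (Subsingleton.elim _ _)))

lemma exists_leftUnitorHom (X : SymSeq 𝔠 M) (c : Profile 𝔠) (t : Discrete 𝔠) :
    ∃ d : (circle (circleUnit 𝔠 M) X).toFunctor.obj (c, t) ⟶ X.toFunctor.obj (c, t),
      ∀ q s, leftUnitι X (c, t) q s ≫ d =
        (λ_ _).hom ≫ (ρ_ _).hom ≫ X.toFunctor.map (Prod.mkHom (toConc q t ≫ s) (𝟙 t)) := by
  refine exists_leftUnit_desc X (c, t) (fun q s => (λ_ _).hom ≫ (ρ_ _).hom ≫
    X.toFunctor.map (Prod.mkHom (toConc q t ≫ s) (𝟙 t))) fun {q q'} g s => ?_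
  have e1 : toConc q t ≫ (conc 𝔠).map (FinFam.single.map (Prod.mkHom g (𝟙 t))) ≫ s =
      g ≫ toConc q' t ≫ s := by
    rw [← Category.assoc, toConc_natural, Category.assoc]
  have e2 := (congrArg (fun r => X.toFunctor.map (Prod.mkHom r (𝟙 t))) e1).trans
    (map_mkHom_comp X t g (toConc q' t ≫ s)).symm
  have aux : ∀ {A B D : M} {x : A ⟶ B} {y : B ⟶ D} {z : A ⟶ D} (_ : z = x ≫ y),
      (λ_ _).hom ≫ (ρ_ _).hom ≫ z = 𝟙_ M ◁ (x ▷ 𝟙_ M) ≫ (λ_ _).hom ≫ (ρ_ _).hom ≫ y := by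
    rintro A B D x y _ rfl
    rw [leftUnitor_naturality_assoc, rightUnitor_naturality_assoc]
  exact aux e2

/-- The components of the left unit isomorphism. -/
noncomputable def leftUnitorApp (X : SymSeq 𝔠 M) (p : Profile 𝔠 × Discrete 𝔠) :
    (circle (circleUnit 𝔠 M) X).toFunctor.obj p ⟶ X.toFunctor.obj p :=
  (exists_leftUnitorHom X p.1 p.2).choose

lemma leftUnitι_leftUnitorApp (X : SymSeq 𝔠 M) (c : Profile 𝔠) (t : Discrete 𝔠) (q : Profile 𝔠)
    (s : (conc 𝔠).obj (FinFam.single.obj (q, t)) ⟶ c) :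
    leftUnitι X (c, t) q s ≫ leftUnitorApp X (c, t) =
      (λ_ _).hom ≫ (ρ_ _).hom ≫ X.toFunctor.map (Prod.mkHom (toConc q t ≫ s) (𝟙 t)) :=
  (exists_leftUnitorHom X c t).choose_spec q s

/-- The morphism from the left unit isomorphism. -/
noncomputable def leftUnitorHom (X : SymSeq 𝔠 M) : circle (circleUnit 𝔠 M) X ⟶ X :=
  SymSeq.mkHom (fun p => leftUnitorApp X p)
    (natural_of_natural_fst _ fun {c c'} g t => leftUnit_hom_ext fun q s => by
      have e1 := leftUnitι_map_id X t g q s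
      have e2 := leftUnitι_leftUnitorApp X c' t q (s ≫ g)
      have e3 := leftUnitι_leftUnitorApp X c t q s
      have e4 := map_mkHom_comp X t (toConc q t ≫ s) g
      rw [reassoc_of% e1, e2, reassoc_of% e3, e4, Category.assoc])

instance (X : SymSeq 𝔠 M) (c : Profile 𝔠) (t : Discrete 𝔠) : IsIso (leftUnitorApp X (c, t)) := by
  refine ⟨(ρ_ _).inv ≫ (λ_ _).inv ≫ leftUnitι X (c, t) c (inv (toConc c t)),
    leftUnit_hom_ext fun q s => ?_, ?_⟩
  · have e1 := leftUnitι_leftUnitorApp X c t q s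
    have e2 := leftUnitι_condition X (c, t) (toConc q t ≫ s) (inv (toConc c t))
    have e3 : (conc 𝔠).map (FinFam.single.map (Prod.mkHom (toConc q t ≫ s) (𝟙 t))) ≫
        inv (toConc c t) = s := by
      rw [← cancel_epi (toConc q t), ← Category.assoc, toConc_natural]
      simp
    have e4 := (congrArg (fun r => leftUnitι X (c, t) q r) e3).symm.trans e2
    rw [reassoc_of% e1, Category.comp_id]
    have aux : ∀ {A B R : M} {x : A ⟶ B} {y : 𝟙_ M ⊗ (B ⊗ 𝟙_ M) ⟶ R} {z : 𝟙_ M ⊗ (A ⊗ 𝟙_ M) ⟶ R}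
        (_ : z = 𝟙_ M ◁ (x ▷ 𝟙_ M) ≫ y),
        (λ_ _).hom ≫ (ρ_ _).hom ≫ x ≫ (ρ_ _).inv ≫ (λ_ _).inv ≫ y = z := by
      rintro A B R x y _ rfl
      rw [rightUnitor_inv_naturality_assoc, leftUnitor_inv_naturality_assoc,
        Iso.hom_inv_id_assoc, Iso.hom_inv_id_assoc]
    exact aux e4
  · have e1 := leftUnitι_leftUnitorApp X c t c (inv (toConc c t))
    have e2 : toConc c t ≫ inv (toConc c t) = 𝟙 c := IsIso.hom_inv_id _
    have e3 := (congrArg (fun r => X.toFunctor.map (Prod.mkHom r (𝟙 t))) e2).trans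
      (X.toFunctor.map_id (c, t))
    have aux : ∀ {A R : M} {x : A ⟶ A} {y : R ⟶ A} {z : 𝟙_ M ⊗ (A ⊗ 𝟙_ M) ⟶ R}
        (_ : z ≫ y = (λ_ _).hom ≫ (ρ_ _).hom ≫ x) (_ : x = 𝟙 A),
        ((ρ_ _).inv ≫ (λ_ _).inv ≫ z) ≫ y = 𝟙 _ := by
      rintro A R x y z h rfl
      simp [h]
    exact aux e1 e3

lemma isIso_of_isIso_app {X Y : SymSeq 𝔠 M} (f : X ⟶ Y) (h : ∀ p, IsIso (SymSeq.app f p)) :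
    IsIso f := by
  have : ∀ p, IsIso (NatTrans.app (F := X.toFunctor) (G := Y.toFunctor) f p) := fun p => h p
  exact NatIso.isIso_of_isIso_app (F := X.toFunctor) (G := Y.toFunctor) f

instance (X : SymSeq 𝔠 M) : IsIso (leftUnitorHom X) :=
  isIso_of_isIso_app _ fun p => inferInstanceAs (IsIso (leftUnitorApp X (p.1, p.2)))

/-- The left unit isomorphism of the circle product. -/
noncomputable def circleLeftUnitor (X : SymSeq 𝔠 M) : circle (circleUnit 𝔠 M) X ≅ X :=
  asIso (leftUnitorHom X)

lemma leftUnitι_circleLeftUnitor (X : SymSeq 𝔠 M) (p : Profile 𝔠 × Discrete 𝔠) (q : Profile 𝔠)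
    (s : (conc 𝔠).obj (FinFam.single.obj (q, p.2)) ⟶ p.1) :
    leftUnitι X p q s ≫ SymSeq.app (circleLeftUnitor X).hom p =
      (λ_ _).hom ≫ (ρ_ _).hom ≫ X.toFunctor.map (Prod.mkHom (toConc q p.2 ≫ s) (𝟙 p.2)) :=
  leftUnitι_leftUnitorApp X p.1 p.2 q s

lemma circleLeftUnitor_generator (X : SymSeq 𝔠 M) (b : Profile 𝔠) (t : Discrete 𝔠) :
    generatorUnitLeft X b t ≫ SymSeq.app (circleLeftUnitor X).hom _ =
      (λ_ _).hom ≫ (ρ_ _).hom ≫ X.toFunctor.map (Prod.mkHom (FinFam.toConcatSingle b) (𝟙 t)) := by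
  have e1 := leftUnitι_circleLeftUnitor X ((conc 𝔠).obj (FinFam.single.obj (b, t)), t) b (𝟙 _)
  have e2 : toConc b t ≫ 𝟙 _ = toConc b t := Category.comp_id _
  exact e1.trans (congrArg (fun r => (λ_ _).hom ≫ (ρ_ _).hom ≫
    X.toFunctor.map (Prod.mkHom r (𝟙 t))) e2)

lemma circleLeftUnitor_naturality {X X' : SymSeq 𝔠 M} (f : X ⟶ X') :
    circleMap (𝟙 (circleUnit 𝔠 M)) f ≫ (circleLeftUnitor X').hom =
      (circleLeftUnitor X).hom ≫ f := by
  refine SymSeq.hom_ext fun p => leftUnit_hom_ext fun q s => ?_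
  have e1 := leftUnitι_circleMap f p q s
  have e2 := leftUnitι_circleLeftUnitor X' p q s
  have e3 := leftUnitι_circleLeftUnitor X p q s
  have e4 := SymSeq.naturality f (Prod.mkHom (toConc q p.2 ≫ s) (𝟙 p.2))
  have aux : ∀ {A A' B B' R R' : M} {x : 𝟙_ M ⊗ (A ⊗ 𝟙_ M) ⟶ R} {m : R ⟶ R'} {a : A ⟶ A'}
      {x' : 𝟙_ M ⊗ (A' ⊗ 𝟙_ M) ⟶ R'} {u : R ⟶ B} {u' : R' ⟶ B'} {k : A ⟶ B} {k' : A' ⟶ B'}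
      {b : B ⟶ B'} (_ : x ≫ m = 𝟙_ M ◁ (a ▷ 𝟙_ M) ≫ x')
      (_ : x' ≫ u' = (λ_ _).hom ≫ (ρ_ _).hom ≫ k') (_ : x ≫ u = (λ_ _).hom ≫ (ρ_ _).hom ≫ k)
      (_ : k ≫ b = a ≫ k'), x ≫ m ≫ u' = x ≫ u ≫ b := by
    intro A A' B B' R R' x m a x' u u' k k' b h1 h2 h3 h4
    rw [reassoc_of% h1, h2, reassoc_of% h3, h4, leftUnitor_naturality_assoc,
      rightUnitor_naturality_assoc]
  exact aux e1 e2 e3 e4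

end LeftUnitor

section RightUnitor

variable {𝔠 : Type w} {M : Type u} [Category.{v} M] [MonoidalCategory M] [SymmetricCategory M]

/-- The permutation isomorphism between iterated tensor products of the unit. -/
def unitsPerm (M : Type u) [Category.{v} M] [MonoidalCategory M] [SymmetricCategory M]
    {a a' : Profile 𝔠} (φ : a ⟶ a') :
    tens a.len (fun _ => 𝟙_ M) ⟶ tens a'.len (fun _ => 𝟙_ M) :=
  tensPerm a'.len a.len φ.perm _ _ fun _ _ _ => 𝟙 _

/-- The morphism from the family of one-term profiles. -/
def singlesHom (b : Br 𝔠) (r : ∀ i, FinFam.single.obj (b.obj i).2 ⟶ (b.obj i).1) :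
    singles.obj ((colours 𝔠).obj b) ⟶ b :=
  ⟨Equiv.refl _, fun i => Prod.mkHom (r i) (𝟙 (b.obj i).2)⟩

/-- Transport of a family of morphisms along a morphism. -/
noncomputable def pushHom {b b' : Br 𝔠} (f : b ⟶ b') (r : ∀ i, FinFam.single.obj (b.obj i).2 ⟶ (b.obj i).1)
    (i : Fin b'.len) : FinFam.single.obj (b'.obj i).2 ⟶ (b'.obj i).1 :=
  FinFam.single.map (inv (f.hom i).2) ≫ r (f.perm i) ≫ (f.hom i).1

lemma singlesHom_natural {b b' : Br 𝔠} (f : b ⟶ b')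
    (r : ∀ i, FinFam.single.obj (b.obj i).2 ⟶ (b.obj i).1) :
    singles.map ((colours 𝔠).map f) ≫ singlesHom b' (pushHom f r) = singlesHom b r ≫ f :=
  FinFam.hom_ext (fun _ => rfl) fun i => Prod.ext
    ((FinFam.profile_hom_ext fun _ => rfl).trans (Category.id_comp _).symm) (Subsingleton.elim _ _)

variable [HasColimitsOfSize.{w, w} M]

lemma tensMap_unitι_branches {b b' : Br 𝔠} (f : b ⟶ b')
    (r : ∀ i, FinFam.single.obj (b.obj i).2 ⟶ (b.obj i).1) :
    tensMap b.len (fun i => unitι M (b.obj i) (r i)) ≫ (branches (circleUnit 𝔠 M)).map f =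
      unitsPerm M ((colours 𝔠).map f) ≫
        tensMap b'.len (fun i => unitι M (b'.obj i) (pushHom f r i)) := by
  refine (tensMap_tensPerm _ _ _ _ _).trans (Eq.trans ?_ (tensPerm_tensMap _ _ _ _ _).symm)
  refine tensPerm_congr rfl fun i j hj _ => ?_
  subst hj
  have e := unitι_map (M := M) (f.hom i) (r (f.perm i))
  have aux : ∀ {A B D : M} {a : A ⟶ B} {m : B ⟶ D} {c : A ⟶ D} (_ : a ≫ m = c),
      a ≫ 𝟙 B ≫ m = 𝟙 A ≫ c := by
    rintro A B D a m _ rfl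
    simp
  exact aux e

/-- The canonical morphisms into `X ∘ I_∘`. -/
noncomputable def rightUnitι (X : SymSeq 𝔠 M) (p : Profile 𝔠 × Discrete 𝔠) (a : Profile 𝔠)
    (s : (conc 𝔠).obj (singles.obj a) ⟶ p.1) :
    X.toFunctor.obj (a, p.2) ⊗ tens a.len (fun _ => 𝟙_ M) ⟶
      (circle X (circleUnit 𝔠 M)).toFunctor.obj p :=
  X.toFunctor.obj (a, p.2) ◁
      tensMap a.len (fun i => unitι M (FinFam.single.obj (a.obj i), a.obj i) (𝟙 _)) ≫
    circleι X (circleUnit 𝔠 M) p (singles.obj a) s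

lemma tensMap_unitι (X : SymSeq 𝔠 M) (p : Profile 𝔠 × Discrete 𝔠) (b : Br 𝔠)
    (s : (conc 𝔠).obj b ⟶ p.1) (r : ∀ i, FinFam.single.obj (b.obj i).2 ⟶ (b.obj i).1) :
    X.toFunctor.obj ((colours 𝔠).obj b, p.2) ◁ tensMap b.len (fun i => unitι M (b.obj i) (r i)) ≫
        circleι X (circleUnit 𝔠 M) p b s =
      rightUnitι X p ((colours 𝔠).obj b) ((conc 𝔠).map (singlesHom b r) ≫ s) := by
  have e1 := circleι_condition X (circleUnit 𝔠 M) p (singlesHom b r) s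
  have e2 : (branches (circleUnit 𝔠 M)).map (singlesHom b r) = tensMap b.len fun i =>
      (circleUnit 𝔠 M).toFunctor.map (Prod.mkHom (r i) (𝟙 (b.obj i).2)) :=
    (tensMap_eq_tensPerm _ _).symm
  have e3 : ∀ i, unitι M (FinFam.single.obj (b.obj i).2, (b.obj i).2) (𝟙 _) ≫
      (circleUnit 𝔠 M).toFunctor.map (Prod.mkHom (r i) (𝟙 (b.obj i).2)) =
        unitι M (b.obj i) (r i) := fun i =>
    (unitι_map (M := M) (p := (FinFam.single.obj (b.obj i).2, (b.obj i).2)) (q := b.obj i)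
      (Prod.mkHom (r i) (𝟙 (b.obj i).2)) (𝟙 _)).trans
      (congrArg (fun t => unitι M (b.obj i) t) (FinFam.profile_hom_ext fun _ => rfl))
  have e4 := (tensMap_comp b.len _ _).symm.trans (congrArg (fun t => tensMap b.len t) (funext e3))
  have e5 := (congrArg (fun t => tensMap b.len (fun i => unitι M
    (FinFam.single.obj (b.obj i).2, (b.obj i).2) (𝟙 _)) ≫ t) e2).trans e4
  have e6 : X.toFunctor.map (Prod.mkHom ((colours 𝔠).map (singlesHom b r)) (𝟙 p.2)) = 𝟙 _ :=
    X.toFunctor.map_id ((colours 𝔠).obj b, p.2)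
  have aux : ∀ {A B D E F : M} {x : A ⟶ A} {i : B ⟶ D} {m : D ⟶ E} {j : B ⟶ E} {g : A ⊗ E ⟶ F}
      {g' : A ⊗ D ⟶ F} (_ : g' = (x ⊗ₘ m) ≫ g) (_ : i ≫ m = j) (_ : x = 𝟙 A),
      A ◁ j ≫ g = A ◁ i ≫ g' := by
    rintro A B D E F _ i m _ g _ rfl rfl rfl
    rw [id_tensorHom, MonoidalCategory.whiskerLeft_comp, Category.assoc]
  exact aux e1 e5 e6

lemma rightUnitι_condition (X : SymSeq 𝔠 M) (p : Profile 𝔠 × Discrete 𝔠) {a a' : Profile 𝔠}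
    (φ : a ⟶ a') (s : (conc 𝔠).obj (singles.obj a') ⟶ p.1) :
    rightUnitι X p a ((conc 𝔠).map (singles.map φ) ≫ s) =
      (X.toFunctor.map (Prod.mkHom φ (𝟙 p.2)) ⊗ₘ unitsPerm M φ) ≫ rightUnitι X p a' s := by
  have e1 := circleι_condition X (circleUnit 𝔠 M) p (singles.map φ) s
  have e2 := tensMap_unitι_branches (M := M) (singles.map φ)
    (fun i => 𝟙 (FinFam.single.obj (a.obj i)))
  have e3 : pushHom (singles.map φ) (fun i => 𝟙 (FinFam.single.obj (a.obj i))) =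
      fun i => 𝟙 (FinFam.single.obj (a'.obj i)) :=
    funext fun i => FinFam.profile_hom_ext fun _ => rfl
  have e4 := e2.trans (congrArg (fun r : ∀ i, FinFam.single.obj (a'.obj i) ⟶
    FinFam.single.obj (a'.obj i) => unitsPerm M φ ≫ tensMap a'.len (fun i =>
    unitι M (FinFam.single.obj (a'.obj i), a'.obj i) (r i))) e3)
  have e5 := (congrArg (fun t => X.toFunctor.obj (a, p.2) ◁ tensMap a.len (fun i =>
    unitι M (FinFam.single.obj (a.obj i), a.obj i) (𝟙 _)) ≫ t) e1)
  exact e5.trans (whiskerLeft_tensorHom_eq e4.symm _).symm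

lemma rightUnitι_map_id (X : SymSeq 𝔠 M) {c c' : Profile 𝔠} (t : Discrete 𝔠) (f : c ⟶ c')
    (a : Profile 𝔠) (s : (conc 𝔠).obj (singles.obj a) ⟶ c) :
    rightUnitι X (c, t) a s ≫ (circle X (circleUnit 𝔠 M)).toFunctor.map (Prod.mkHom f (𝟙 t)) =
      rightUnitι X (c', t) a (s ≫ f) :=
  (Category.assoc _ _ _).trans (congrArg (fun t => _ ≫ t)
    (circleι_map_id X (circleUnit 𝔠 M) t f (singles.obj a) s))

lemma rightUnitι_circleMap {X X' : SymSeq 𝔠 M} (f : X ⟶ X') (p : Profile 𝔠 × Discrete 𝔠)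
    (a : Profile 𝔠) (s : (conc 𝔠).obj (singles.obj a) ⟶ p.1) :
    rightUnitι X p a s ≫ SymSeq.app (circleMap f (𝟙 (circleUnit 𝔠 M))) p =
      SymSeq.app f (a, p.2) ▷ _ ≫ rightUnitι X' p a s := by
  have e1 := circleι_circleMap f (𝟙 (circleUnit 𝔠 M)) p (singles.obj a) s
  have e2 : (branchesMap (𝟙 (circleUnit 𝔠 M))).app (singles.obj a) = 𝟙 _ :=
    congrArg (fun α => NatTrans.app α (singles.obj a)) (branchesMap_id (circleUnit 𝔠 M))
  have aux : ∀ {A A' B D R R' : M} {x : A ⟶ A'} {i : B ⟶ D} {y : D ⟶ D} {g : A ⊗ D ⟶ R}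
      {g' : A' ⊗ D ⟶ R'} {m : R ⟶ R'} (_ : g ≫ m = (x ⊗ₘ y) ≫ g') (_ : y = 𝟙 D),
      (A ◁ i ≫ g) ≫ m = x ▷ B ≫ A' ◁ i ≫ g' := by
    rintro A A' B D R R' x i _ g g' m h rfl
    rw [Category.assoc, h, tensorHom_id, whisker_exchange_assoc]
  exact aux e1 e2

variable [∀ A : M, PreservesColimitsOfSize.{w, w} (tensorLeft A)]

lemma tens_unit_hom_ext {b : Br 𝔠} (N : M) {Z : M}
    {f g : N ⊗ (branches (circleUnit 𝔠 M)).obj b ⟶ Z}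
    (h : ∀ r : ∀ i, FinFam.single.obj (b.obj i).2 ⟶ (b.obj i).1, N ◁ tensMap b.len (fun i => unitι M (b.obj i) (r i)) ≫ f =
      N ◁ tensMap b.len (fun i => unitι M (b.obj i) (r i)) ≫ g) : f = g :=
  tens_hom_ext b.len (fun i => colimit.isColimit (Discrete.functor fun _ :
    (FinFam.single.obj (b.obj i).2 ⟶ (b.obj i).1) => 𝟙_ M)) N fun j => h fun i => (j i).as

lemma exists_tens_unit_desc (b : Br 𝔠) (N : M) {Z : M}
    (k : (∀ i, FinFam.single.obj (b.obj i).2 ⟶ (b.obj i).1) →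
      (N ⊗ tens b.len (fun _ => 𝟙_ M) ⟶ Z)) :
    ∃ d : N ⊗ (branches (circleUnit 𝔠 M)).obj b ⟶ Z,
      ∀ r : ∀ i, FinFam.single.obj (b.obj i).2 ⟶ (b.obj i).1,
      N ◁ tensMap b.len (fun i => unitι M (b.obj i) (r i)) ≫ d = k r := by
  obtain ⟨d, hd⟩ := exists_tens_desc b.len (fun i => colimit.isColimit (Discrete.functor fun _ :
    (FinFam.single.obj (b.obj i).2 ⟶ (b.obj i).1) => 𝟙_ M)) N (fun j => k fun i => (j i).as) (by
      intro j j' f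
      obtain rfl : j = j' := funext fun i => Discrete.ext (f i).down.down
      have e : tensMap b.len (fun i => (Discrete.functor fun _ :
          (FinFam.single.obj (b.obj i).2 ⟶ (b.obj i).1) => 𝟙_ M).map (f i)) = 𝟙 _ :=
        (congrArg (fun t => tensMap b.len t) (funext fun i =>
          (congrArg (fun t => (Discrete.functor fun _ :
            (FinFam.single.obj (b.obj i).2 ⟶ (b.obj i).1) => 𝟙_ M).map t)
              (Subsingleton.elim (f i) (𝟙 (j i)))).trans
                (CategoryTheory.Functor.map_id _ _))).trans (tensMap_id _ _)
      have aux : ∀ {A B : M} {x : A ⟶ A} {y : B ⊗ A ⟶ Z} (_ : x = 𝟙 A), B ◁ x ≫ y = y := by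
        rintro A B _ y rfl
        simp
      exact aux e)
  exact ⟨d, fun r => hd fun i => ⟨r i⟩⟩

lemma rightUnit_hom_ext {X : SymSeq 𝔠 M} {p : Profile 𝔠 × Discrete 𝔠} {W : M}
    {f g : (circle X (circleUnit 𝔠 M)).toFunctor.obj p ⟶ W}
    (h : ∀ a s, rightUnitι X p a s ≫ f = rightUnitι X p a s ≫ g) : f = g := by
  refine circle_hom_ext fun b s => tens_unit_hom_ext _ fun r => ?_
  have e := tensMap_unitι X p b s r
  exact (Category.assoc _ _ _).symm.trans ((congrArg (fun t => t ≫ f) e).trans ((h _ _).trans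
    ((congrArg (fun t => t ≫ g) e).symm.trans (Category.assoc _ _ _))))

lemma exists_rightUnit_desc (X : SymSeq 𝔠 M) (p : Profile 𝔠 × Discrete 𝔠) {W : M}
    (k : ∀ (a : Profile 𝔠) (_ : (conc 𝔠).obj (singles.obj a) ⟶ p.1),
      X.toFunctor.obj (a, p.2) ⊗ tens a.len (fun _ => 𝟙_ M) ⟶ W)
    (hk : ∀ {a a' : Profile 𝔠} (φ : a ⟶ a') (s : (conc 𝔠).obj (singles.obj a') ⟶ p.1),
      k a ((conc 𝔠).map (singles.map φ) ≫ s) =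
        (X.toFunctor.map (Prod.mkHom φ (𝟙 p.2)) ⊗ₘ unitsPerm M φ) ≫ k a' s) :
    ∃ d : (circle X (circleUnit 𝔠 M)).toFunctor.obj p ⟶ W,
      ∀ a s, rightUnitι X p a s ≫ d = k a s := by
  have h1 : ∀ (b : Br 𝔠) (s : (conc 𝔠).obj b ⟶ p.1),
      ∃ d : X.toFunctor.obj ((colours 𝔠).obj b, p.2) ⊗ (branches (circleUnit 𝔠 M)).obj b ⟶ W,
        ∀ r : ∀ i, FinFam.single.obj (b.obj i).2 ⟶ (b.obj i).1, X.toFunctor.obj ((colours 𝔠).obj b, p.2) ◁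
          tensMap b.len (fun i => unitι M (b.obj i) (r i)) ≫ d =
            k ((colours 𝔠).obj b) ((conc 𝔠).map (singlesHom b r) ≫ s) :=
    fun b s => exists_tens_unit_desc b _ fun r =>
      k ((colours 𝔠).obj b) ((conc 𝔠).map (singlesHom b r) ≫ s)
  choose d hd using h1
  have h2 : ∀ {b b' : Br 𝔠} (f : b ⟶ b') (s : (conc 𝔠).obj b' ⟶ p.1),
      d b ((conc 𝔠).map f ≫ s) = (circleTerm X (circleUnit 𝔠 M) p.2).map f ≫ d b' s := by
    intro b b' f s
    refine tens_unit_hom_ext _ fun r => ?_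
    have e1 := hd b ((conc 𝔠).map f ≫ s) r
    have e2 := hd b' s (pushHom f r)
    have e3 := hk ((colours 𝔠).map f) ((conc 𝔠).map (singlesHom b' (pushHom f r)) ≫ s)
    have e4 := functor_map_square (conc 𝔠) (singlesHom_natural f r) s
    have e5 := tensMap_unitι_branches (M := M) f r
    have e6 := whiskerLeft_tensorHom_eq
      (a := X.toFunctor.map (Prod.mkHom ((colours 𝔠).map f) (𝟙 p.2))) e5.symm (d b' s)
    exact e1.trans ((congrArg (k _) e4).symm.trans (e3.trans
      ((congrArg (fun t => _ ≫ t) e2).symm.trans e6)))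
  refine ⟨wcoend.desc (K := conc 𝔠) (T := circleTerm X (circleUnit 𝔠 M) p.2) d h2, fun a s => ?_⟩
  have e1 := wcoend.ι_desc (K := conc 𝔠) (T := circleTerm X (circleUnit 𝔠 M) p.2) d h2
    (singles.obj a) s
  have e2 := hd (singles.obj a) s (fun i => 𝟙 _)
  have e3 : singlesHom (singles.obj a) (fun i => 𝟙 _) = 𝟙 (singles.obj a) := rfl
  have e4 := (congrArg (fun t => (conc 𝔠).map t ≫ s) e3).trans (functor_map_id_comp (conc 𝔠) s)
  exact (Category.assoc _ _ _).trans ((congrArg (fun t => _ ≫ t) e1).trans (e2.trans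
    (congrArg (k a) e4)))

end RightUnitor

section ToConcat

/-- The right unit isomorphisms, as a natural transformation to one-term tensor products. -/
def tensSingleNat (C : Type u) [Category.{v} C] [MonoidalCategory C] [SymmetricCategory C] :
    𝟭 C ⟶ FinFam.single ⋙ tensF C where
  app x := (ρ_ x).inv
  naturality x y f := by
    have h : (tensF C).map (FinFam.single.map f) = f ▷ 𝟙_ C :=
      Eq.trans (tensMap_eq_tensPerm 1 (x := fun _ => x) (y := fun _ => y) fun _ => f).symm
        (tensorHom_id _ _)
    exact (rightUnitor_inv_naturality f).trans (congrArg (fun t => (ρ_ x).inv ≫ t) h).symm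

lemma tensF_toConcatMapSingle_natural {C : Type u} [Category.{v} C] [MonoidalCategory C]
    [SymmetricCategory C] {x y : FinFam C} (f : x ⟶ y) :
    (tensF C).map (f ≫ FinFam.toConcatMapSingle y) = (tensF C).map
      (FinFam.toConcatMapSingle x ≫ FinFam.concat.map ((FinFam.map FinFam.single).map f)) := by
  have h1 := toConcatMapSingle_eq x
  have h2 := toConcatMapSingle_eq y
  have h3 := tensConcat_natural ((FinFam.map FinFam.single).map f)
  have h4 := tensF_map_mapNat (tensSingleNat C) x
  have h5 := tensF_map_mapNat (tensSingleNat C) y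
  have h6 := ((tensF C).map_comp _ _).symm.trans ((congrArg (fun t => (tensF C).map t)
    ((FinFam.mapNat (tensSingleNat C)).naturality f)).trans ((tensF C).map_comp _ _))
  have aux : ∀ {A B A' B' T T' : C} {a : A ⟶ A'} {b : B ⟶ B'} {c : T ⟶ T'} {t : T ⟶ B}
      {t' : T' ⟶ B'} {s : A ⟶ B} {s' : A' ⟶ B'} {r q : A ⟶ T} {r' q' : A' ⟶ T'} (_ : s = r ≫ t)
      (_ : s' = r' ≫ t') (_ : c ≫ t' = t ≫ b) (_ : q = r) (_ : q' = r') (_ : a ≫ q' = q ≫ c),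
      a ≫ s' = s ≫ b := by
    rintro A B A' B' T T' a b c t t' _ _ r q r' q' rfl rfl h rfl rfl h'
    rw [Category.assoc, ← h, reassoc_of% h']
  exact ((tensF C).map_comp _ _).trans ((aux h1 h2 h3 h4 h5 h6).trans
    ((tensF C).map_comp _ _).symm)

lemma toConcatMapSingle_natural {K : Type u} [Category.{v} K] {x y : FinFam K} (f : x ⟶ y) :
    f ≫ FinFam.toConcatMapSingle y =
      FinFam.toConcatMapSingle x ≫ FinFam.concat.map ((FinFam.map FinFam.single).map f) := by
  refine FinFam.hom_ext_tensF ?_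
  have h := tensF_toConcatMapSingle_natural ((FinFam.map (Fam.single K)).map f)
  have h1 := FinFam.map_toConcatMapSingle (Fam.single K) x
  have h2 := FinFam.map_toConcatMapSingle (Fam.single K) y
  have h3 := FinFam.map_concat_map (Fam.single K) ((FinFam.map FinFam.single).map f)
  have h4 := ((FinFam.map (Fam.single K)).map_comp f (FinFam.toConcatMapSingle y)).trans
    (congrArg (fun t => _ ≫ t) h2)
  have h5 := ((FinFam.map (Fam.single K)).map_comp (FinFam.toConcatMapSingle x)
    (FinFam.concat.map ((FinFam.map FinFam.single).map f))).trans
      (congrArg₂ (fun s t => s ≫ t) h1 h3)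
  exact (congrArg (fun t => (tensF (Fam K)).map t) h4).trans (h.trans
    (congrArg (fun t => (tensF (Fam K)).map t) h5).symm)

end ToConcat

section RightUnitor

attribute [local irreducible] FinFam.concat

variable {𝔠 : Type w}

/-- The isomorphism `a ⟶ conc (((a₀), a₀), …)` for a profile `a`. -/
def toConcSingles (a : Profile 𝔠) : a ⟶ (conc 𝔠).obj (singles.obj a) :=
  FinFam.toConcatMapSingle a

instance (a : Profile 𝔠) : IsIso (toConcSingles a) :=
  inferInstanceAs (IsIso (FinFam.toConcatMapSingle a))

lemma toConcSingles_natural {a a' : Profile 𝔠} (φ : a ⟶ a') :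
    toConcSingles a ≫ (conc 𝔠).map (singles.map φ) = φ ≫ toConcSingles a' :=
  (toConcatMapSingle_natural φ).symm

variable {M : Type u} [Category.{v} M] [MonoidalCategory M] [SymmetricCategory M]

lemma tensUnit_unitsPerm {a a' : Profile 𝔠} (φ : a ⟶ a') :
    tensUnit (C := M) a.len ≫ unitsPerm M φ = tensUnit a'.len :=
  tensUnit_tensPerm _ _ _

variable [HasColimitsOfSize.{w, w} M] [∀ A : M, PreservesColimitsOfSize.{w, w} (tensorLeft A)]

lemma exists_rightUnitorHom (X : SymSeq 𝔠 M) (c : Profile 𝔠) (t : Discrete 𝔠) :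
    ∃ d : (circle X (circleUnit 𝔠 M)).toFunctor.obj (c, t) ⟶ X.toFunctor.obj (c, t),
      ∀ a s, X.toFunctor.obj (a, t) ◁ tensUnit a.len ≫ rightUnitι X (c, t) a s ≫ d =
        (ρ_ _).hom ≫ X.toFunctor.map (Prod.mkHom (toConcSingles a ≫ s) (𝟙 t)) := by
  obtain ⟨d, hd⟩ := exists_rightUnit_desc X (c, t) (fun a s =>
    X.toFunctor.obj (a, t) ◁ inv (tensUnit a.len) ≫ (ρ_ _).hom ≫
      X.toFunctor.map (Prod.mkHom (toConcSingles a ≫ s) (𝟙 t))) (fun {a a'} φ s => by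
    have e1 : toConcSingles a ≫ (conc 𝔠).map (singles.map φ) ≫ s =
        φ ≫ toConcSingles a' ≫ s := by
      rw [← Category.assoc, toConcSingles_natural, Category.assoc]
    have e2 := (congrArg (fun r => X.toFunctor.map (Prod.mkHom r (𝟙 t))) e1).trans
      (map_mkHom_comp X t φ (toConcSingles a' ≫ s)).symm
    have e3 := tensUnit_unitsPerm (M := M) φ
    have aux : ∀ {A B D T T' : M} {x : A ⟶ B} {y : B ⟶ D} {z : A ⟶ D} {τ : 𝟙_ M ⟶ T}
        {τ' : 𝟙_ M ⟶ T'} {u : T ⟶ T'} [IsIso τ] [IsIso τ'] (_ : z = x ≫ y) (_ : τ ≫ u = τ'),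
        A ◁ inv τ ≫ (ρ_ _).hom ≫ z = (x ⊗ₘ u) ≫ B ◁ inv τ' ≫ (ρ_ _).hom ≫ y := by
      rintro A B D T T' x y _ τ τ' u _ _ rfl rfl
      have : IsIso u := IsIso.of_isIso_comp_left τ u
      have h : u ≫ inv (τ ≫ u) = inv τ := by simp
      rw [tensorHom_def_assoc, ← MonoidalCategory.whiskerLeft_comp_assoc, h,
        ← whisker_exchange_assoc, rightUnitor_naturality_assoc]
    exact aux e2 e3)
  refine ⟨d, fun a s => ?_⟩
  have aux : ∀ {A D R T : M} {τ : 𝟙_ M ⟶ T} [IsIso τ] {r : A ⊗ T ⟶ R} {d : R ⟶ D}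
      {y : A ⊗ 𝟙_ M ⟶ D} (_ : r ≫ d = A ◁ inv τ ≫ y), A ◁ τ ≫ r ≫ d = y := by
    intro A D R T τ _ r d y h
    rw [h, ← MonoidalCategory.whiskerLeft_comp_assoc, IsIso.hom_inv_id,
      MonoidalCategory.whiskerLeft_id, Category.id_comp]
  exact aux (hd a s)

/-- The components of the right unit isomorphism. -/
noncomputable def rightUnitorApp (X : SymSeq 𝔠 M) (p : Profile 𝔠 × Discrete 𝔠) :
    (circle X (circleUnit 𝔠 M)).toFunctor.obj p ⟶ X.toFunctor.obj p :=
  (exists_rightUnitorHom X p.1 p.2).choose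

lemma rightUnitι_rightUnitorApp (X : SymSeq 𝔠 M) (c : Profile 𝔠) (t : Discrete 𝔠)
    (a : Profile 𝔠) (s : (conc 𝔠).obj (singles.obj a) ⟶ c) :
    X.toFunctor.obj (a, t) ◁ tensUnit a.len ≫ rightUnitι X (c, t) a s ≫
        rightUnitorApp X (c, t) =
      (ρ_ _).hom ≫ X.toFunctor.map (Prod.mkHom (toConcSingles a ≫ s) (𝟙 t)) :=
  (exists_rightUnitorHom X c t).choose_spec a s

lemma rightUnit_hom_ext' {X : SymSeq 𝔠 M} {p : Profile 𝔠 × Discrete 𝔠} {W : M}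
    {f g : (circle X (circleUnit 𝔠 M)).toFunctor.obj p ⟶ W}
    (h : ∀ a s, X.toFunctor.obj (a, p.2) ◁ tensUnit a.len ≫ rightUnitι X p a s ≫ f =
      X.toFunctor.obj (a, p.2) ◁ tensUnit a.len ≫ rightUnitι X p a s ≫ g) : f = g :=
  rightUnit_hom_ext fun a s => (cancel_epi _).1 (h a s)

/-- The morphism from the right unit isomorphism. -/
noncomputable def rightUnitorHom (X : SymSeq 𝔠 M) : circle X (circleUnit 𝔠 M) ⟶ X :=
  SymSeq.mkHom (fun p => rightUnitorApp X p)
    (natural_of_natural_fst _ fun {c c'} g t => rightUnit_hom_ext' fun a s => by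
      have e1 := rightUnitι_map_id X t g a s
      have e2 := rightUnitι_rightUnitorApp X c' t a (s ≫ g)
      have e3 := rightUnitι_rightUnitorApp X c t a s
      have e4 := map_mkHom_comp X t (toConcSingles a ≫ s) g
      rw [reassoc_of% e1, e2, reassoc_of% e3, e4, Category.assoc])

instance (X : SymSeq 𝔠 M) (c : Profile 𝔠) (t : Discrete 𝔠) : IsIso (rightUnitorApp X (c, t)) := by
  refine ⟨(ρ_ _).inv ≫ X.toFunctor.obj (c, t) ◁ tensUnit c.len ≫
    rightUnitι X (c, t) c (inv (toConcSingles c)), rightUnit_hom_ext' fun a s => ?_, ?_⟩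
  · have e1 := rightUnitι_rightUnitorApp X c t a s
    have e2 := rightUnitι_condition X (c, t) (toConcSingles a ≫ s) (inv (toConcSingles c))
    have e3 : (conc 𝔠).map (singles.map (toConcSingles a ≫ s)) ≫ inv (toConcSingles c) = s := by
      rw [← cancel_epi (toConcSingles a), ← Category.assoc, toConcSingles_natural]
      simp
    have e4 := (congrArg (fun r => rightUnitι X (c, t) a r) e3).symm.trans e2
    have e5 := tensUnit_unitsPerm (M := M) (toConcSingles a ≫ s)
    rw [reassoc_of% e1, Category.comp_id]
    have aux : ∀ {A B R T T' : M} {x : A ⟶ B} {τ : 𝟙_ M ⟶ T} {τ' : 𝟙_ M ⟶ T'} {u : T ⟶ T'}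
        {y : B ⊗ T' ⟶ R} {z : A ⊗ T ⟶ R} (_ : z = (x ⊗ₘ u) ≫ y) (_ : τ ≫ u = τ'),
        (ρ_ _).hom ≫ x ≫ (ρ_ _).inv ≫ B ◁ τ' ≫ y = A ◁ τ ≫ z := by
      rintro A B R T T' x τ _ u y _ rfl rfl
      rw [rightUnitor_inv_naturality_assoc, Iso.hom_inv_id_assoc, tensorHom_def'_assoc,
        MonoidalCategory.whiskerLeft_comp_assoc, whisker_exchange_assoc,
        whisker_exchange_assoc]
    exact aux e4 e5
  · have e1 := rightUnitι_rightUnitorApp X c t c (inv (toConcSingles c))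
    have e2 : toConcSingles c ≫ inv (toConcSingles c) = 𝟙 c := IsIso.hom_inv_id _
    have e3 := (congrArg (fun r => X.toFunctor.map (Prod.mkHom r (𝟙 t))) e2).trans
      (X.toFunctor.map_id (c, t))
    have aux : ∀ {A R T : M} {x : A ⟶ A} {u : A ⊗ 𝟙_ M ⟶ T} {y : R ⟶ A} {z : T ⟶ R}
        (_ : u ≫ z ≫ y = (ρ_ _).hom ≫ x) (_ : x = 𝟙 A),
        ((ρ_ _).inv ≫ u ≫ z) ≫ y = 𝟙 _ := by
      rintro A R T x u y z h rfl
      simp [h]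
    exact aux e1 e3

instance (X : SymSeq 𝔠 M) : IsIso (rightUnitorHom X) :=
  isIso_of_isIso_app _ fun p => inferInstanceAs (IsIso (rightUnitorApp X (p.1, p.2)))

/-- The right unit isomorphism of the circle product. -/
noncomputable def circleRightUnitor (X : SymSeq 𝔠 M) : circle X (circleUnit 𝔠 M) ≅ X :=
  asIso (rightUnitorHom X)

lemma rightUnitι_circleRightUnitor (X : SymSeq 𝔠 M) (p : Profile 𝔠 × Discrete 𝔠)
    (a : Profile 𝔠) (s : (conc 𝔠).obj (singles.obj a) ⟶ p.1) :
    X.toFunctor.obj (a, p.2) ◁ tensUnit a.len ≫ rightUnitι X p a s ≫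
        SymSeq.app (circleRightUnitor X).hom p =
      (ρ_ _).hom ≫ X.toFunctor.map (Prod.mkHom (toConcSingles a ≫ s) (𝟙 p.2)) :=
  rightUnitι_rightUnitorApp X p.1 p.2 a s

lemma circleRightUnitor_generator (X : SymSeq 𝔠 M) (a : Profile 𝔠) (t : Discrete 𝔠) :
    (ρ_ _).inv ≫ X.toFunctor.obj (a, t) ◁ tensUnit a.len ≫
        generatorUnitRight X a t ≫ SymSeq.app (circleRightUnitor X).hom _ =
      X.toFunctor.map (Prod.mkHom (FinFam.toConcatMapSingle a) (𝟙 t)) := by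
  have e1 := rightUnitι_circleRightUnitor X ((conc 𝔠).obj (singles.obj a), t) a (𝟙 _)
  have e2 : toConcSingles a ≫ 𝟙 _ = toConcSingles a := Category.comp_id _
  have e3 := congrArg (fun r => X.toFunctor.map (Prod.mkHom r (𝟙 t))) e2
  exact (congrArg (fun r => (ρ_ _).inv ≫ r) e1).trans ((Iso.inv_hom_id_assoc _ _).trans e3)

lemma circleRightUnitor_naturality {X X' : SymSeq 𝔠 M} (f : X ⟶ X') :
    circleMap f (𝟙 (circleUnit 𝔠 M)) ≫ (circleRightUnitor X').hom =
      (circleRightUnitor X).hom ≫ f := by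
  refine SymSeq.hom_ext fun p => rightUnit_hom_ext' fun a s => ?_
  have e1 := rightUnitι_circleMap f p a s
  have e2 := rightUnitι_circleRightUnitor X' p a s
  have e3 := rightUnitι_circleRightUnitor X p a s
  have e4 := SymSeq.naturality f (Prod.mkHom (toConcSingles a ≫ s) (𝟙 p.2))
  have aux : ∀ {A A' B B' R R' T : M} {τ : 𝟙_ M ⟶ T} {x : A ⊗ T ⟶ R} {m : R ⟶ R'} {a : A ⟶ A'}
      {x' : A' ⊗ T ⟶ R'} {u : R ⟶ B} {u' : R' ⟶ B'} {k : A ⟶ B} {k' : A' ⟶ B'}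
      {b : B ⟶ B'} (_ : x ≫ m = a ▷ T ≫ x')
      (_ : A' ◁ τ ≫ x' ≫ u' = (ρ_ _).hom ≫ k') (_ : A ◁ τ ≫ x ≫ u = (ρ_ _).hom ≫ k)
      (_ : k ≫ b = a ≫ k'), A ◁ τ ≫ x ≫ m ≫ u' = A ◁ τ ≫ x ≫ u ≫ b := by
    intro A A' B B' R R' T τ x m a x' u u' k k' b h1 h2 h3 h4
    rw [reassoc_of% h1, whisker_exchange_assoc, h2, reassoc_of% h3, h4,
      rightUnitor_naturality_assoc]
  exact aux e1 e2 e3 e4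

end RightUnitor

section Tens

variable {C : Type u} [Category.{v} C] [MonoidalCategory C] [SymmetricCategory C]

lemma tensConcat_mapNat {A : Type u₁} [Category.{v₁} A] {F G : A ⥤ C} (α : F ⟶ G)
    (x : FinFam (FinFam A)) :
    tensMap x.len (fun i => tensMap (x.obj i).len (fun k => α.app ((x.obj i).obj k))) ≫
        tensConcat ((FinFam.map (FinFam.map G)).obj x) =
      tensConcat ((FinFam.map (FinFam.map F)).obj x) ≫
        tensMap (FinFam.concat.obj x).len (fun l => α.app ((FinFam.concat.obj x).obj l)) := by
  have e1 := tensConcat_natural ((FinFam.mapNat (FinFam.mapNat α)).app x)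
  have e2 := tensF_map_mapNat (Functor.whiskerRight (FinFam.mapNat α) (tensF C)) x
  have e3 := (congrArg (fun t => (tensF C).map t) (FinFam.concat_map_mapNat α x)).trans
    (tensF_map_mapNat α (FinFam.concat.obj x))
  have e4 : ∀ i, (tensF C).map ((FinFam.mapNat α).app (x.obj i)) =
      tensMap (x.obj i).len (fun k => α.app ((x.obj i).obj k)) := fun i => tensF_map_mapNat α _
  have e5 := e2.trans (congrArg (fun t => tensMap x.len t) (funext e4))
  exact (congrArg (fun t => t ≫ _) e5).symm.trans (e1.trans (congrArg (fun t => _ ≫ t) e3))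

lemma tensZip_tensConcat {A : Type u₁} [Category.{v₁} A] (F G : A ⥤ C)
    (x : FinFam (FinFam A)) :
    (tensConcat ((FinFam.map (FinFam.map F)).obj x) ⊗ₘ
        tensConcat ((FinFam.map (FinFam.map G)).obj x)) ≫
        tensZip (FinFam.concat.obj x).len (fun l => F.obj ((FinFam.concat.obj x).obj l))
          (fun l => G.obj ((FinFam.concat.obj x).obj l)) =
      tensZip x.len (fun i => (FinFam.map F ⋙ tensF C).obj (x.obj i))
          (fun i => (FinFam.map G ⋙ tensF C).obj (x.obj i)) ≫
        tensMap x.len (fun i => tensZip (x.obj i).len (fun k => F.obj ((x.obj i).obj k))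
          (fun k => G.obj ((x.obj i).obj k))) ≫
        tensConcat ((FinFam.map (FinFam.map (Functor.prod' F G ⋙ tensor C))).obj x) :=
  tensZip_tensJoin x.len _ (fun i => (x.obj i).len) rfl (fun i k => F.obj ((x.obj i).obj k))
    (fun i k => G.obj ((x.obj i).obj k)) (fun l => F.obj ((FinFam.concat.obj x).obj l))
    (fun l => G.obj ((FinFam.concat.obj x).obj l)) _ _

lemma tensZip_pentagon (n : ℕ) (W : C) {x y z u v : Fin n → C} (g : ∀ i, y i ⊗ z i ⟶ u i)
    (c : ∀ i, x i ⊗ u i ⟶ v i) :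
    ((α_ W (tens n x) (tens n y)).hom ≫ W ◁ tensZip n x y) ▷ tens n z ≫ (α_ _ _ _).hom ≫
        W ◁ (tensZip n (fun i => x i ⊗ y i) z ≫
          tensMap n (fun i => (α_ (x i) (y i) (z i)).hom ≫ x i ◁ g i ≫ c i)) =
      (α_ (W ⊗ tens n x) (tens n y) (tens n z)).hom ≫
        (W ⊗ tens n x) ◁ (tensZip n y z ≫ tensMap n g) ≫ (α_ _ _ _).hom ≫
          W ◁ (tensZip n x u ≫ tensMap n c) := by
  have e1 := tensZip_assoc n x y z
  have e2 := tensZip_tensMap n (fun i => 𝟙 (x i)) g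
  have e3 : tensMap n (fun i => (α_ (x i) (y i) (z i)).hom ≫ x i ◁ g i ≫ c i) =
      tensMap n (fun i => (α_ (x i) (y i) (z i)).hom) ≫
        tensMap n (fun i => x i ◁ g i) ≫ tensMap n c := by
    rw [← tensMap_comp, ← tensMap_comp]
  have e4 : tensMap n (fun i => 𝟙 (x i)) = 𝟙 (tens n x) := tensMap_id n x
  simp only [e4, id_tensorHom] at e2
  have aux : ∀ {X Y Z XY YZ U V XYZ XYZ' P : C} {zxy : X ⊗ Y ⟶ XY} {zyz : Y ⊗ Z ⟶ YZ}
      {p : XY ⊗ Z ⟶ XYZ} {a : XYZ ⟶ XYZ'} {q : X ⊗ YZ ⟶ XYZ'} {g : YZ ⟶ U} {gg : XYZ' ⟶ P}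
      {zu : X ⊗ U ⟶ P} {c : P ⟶ V} (_ : zxy ▷ Z ≫ p ≫ a = (α_ X Y Z).hom ≫ X ◁ zyz ≫ q)
      (_ : X ◁ g ≫ zu = q ≫ gg),
      ((α_ W X Y).hom ≫ W ◁ zxy) ▷ Z ≫ (α_ _ _ _).hom ≫ W ◁ (p ≫ a ≫ gg ≫ c) =
        (α_ (W ⊗ X) Y Z).hom ≫ (W ⊗ X) ◁ (zyz ≫ g) ≫ (α_ _ _ _).hom ≫ W ◁ (zu ≫ c) := by
    intro X Y Z XY YZ U V XYZ XYZ' P zxy zyz p a q g gg zu c h1 h2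
    rw [comp_whiskerRight_assoc, associator_naturality_middle_assoc,
      ← MonoidalCategory.whiskerLeft_comp, reassoc_of% h1, ← reassoc_of% h2]
    simp
  rw [e3]
  exact aux e1 e2

end Tens

section Pentagon

variable {𝔠 : Type w}

/-- The family joined at the outer level. -/
def outerJoin (z : FinFam (FinFam (Br 𝔠 × Discrete 𝔠) × Discrete 𝔠)) :
    FinFam (Br 𝔠 × Discrete 𝔠) :=
  FinFam.concat.obj ((FinFam.map (CategoryTheory.Prod.fst _ _)).obj z)

/-- The family joined at the inner level. -/
def innerJoin (z : FinFam (FinFam (Br 𝔠 × Discrete 𝔠) × Discrete 𝔠)) :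
    FinFam (Br 𝔠 × Discrete 𝔠) :=
  (FinFam.map (Functor.prod joinBr (𝟭 (Discrete 𝔠)))).obj z

/-- The family with the innermost profiles concatenated. -/
def concInner (z : FinFam (FinFam (Br 𝔠 × Discrete 𝔠) × Discrete 𝔠)) :
    FinFam (Br 𝔠 × Discrete 𝔠) :=
  (FinFam.map (Functor.prod innerConc (𝟭 (Discrete 𝔠)))).obj z

/-- The family with the innermost families replaced by their colours. -/
def coloursInner (z : FinFam (FinFam (Br 𝔠 × Discrete 𝔠) × Discrete 𝔠)) :
    FinFam (Br 𝔠 × Discrete 𝔠) :=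
  (FinFam.map (Functor.prod innerColours (𝟭 (Discrete 𝔠)))).obj z

/-- The family of outer colours. -/
def coloursOuter (z : FinFam (FinFam (Br 𝔠 × Discrete 𝔠) × Discrete 𝔠)) : Br 𝔠 :=
  (FinFam.map (Functor.prod (FinFam.map (CategoryTheory.Prod.snd (Br 𝔠) (Discrete 𝔠)))
    (𝟭 (Discrete 𝔠)))).obj z

/-- The associativity isomorphism between the two total joins. -/
def joinJoin (z : FinFam (FinFam (Br 𝔠 × Discrete 𝔠) × Discrete 𝔠)) :
    joinBr.obj (innerJoin z) ⟶ joinBr.obj (outerJoin z) :=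
  FinFam.concatAssoc ((FinFam.map (CategoryTheory.Prod.fst _ _ ⋙
    FinFam.map (CategoryTheory.Prod.fst _ _))).obj z)

/-- The identity between the two descriptions of the profile of outer colours. -/
def outerColours (z : FinFam (FinFam (Br 𝔠 × Discrete 𝔠) × Discrete 𝔠)) :
    (conc 𝔠).obj (coloursOuter z) ⟶ (colours 𝔠).obj (innerColours.obj (outerJoin z)) :=
  𝟙 ((conc 𝔠).obj (coloursOuter z))

/-- The family of the associativity isomorphisms of the members. -/
def concJoin (z : FinFam (FinFam (Br 𝔠 × Discrete 𝔠) × Discrete 𝔠)) :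
    innerConc.obj (concInner z) ⟶ innerConc.obj (innerJoin z) :=
  ⟨Equiv.refl _, fun i => Prod.mkHom (joinConc (z.obj i).1) (𝟙 (z.obj i).2)⟩

lemma isOrdered_joinConc (h : FinFam (Br 𝔠 × Discrete 𝔠)) : FinFam.IsOrdered (joinConc h) :=
  FinFam.isOrdered_concatAssoc _

lemma joinColours_joinJoin (z : FinFam (FinFam (Br 𝔠 × Discrete 𝔠) × Discrete 𝔠)) :
    joinColours (innerJoin z) ≫ (colours 𝔠).map (joinJoin z) =
      joinConc (coloursInner z) ≫ joinColours (outerJoin z) := by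
  have e := FinFam.map_concatAssoc (CategoryTheory.Prod.snd (Profile 𝔠) (Discrete 𝔠))
    ((FinFam.map (CategoryTheory.Prod.fst _ _ ⋙
      FinFam.map (CategoryTheory.Prod.fst _ _))).obj z)
  have aux : ∀ {A B : Profile 𝔠} {a b : A ⟶ B} (_ : a = b), 𝟙 A ≫ a = b ≫ 𝟙 B := by
    rintro A B a _ rfl
    rw [Category.id_comp, Category.comp_id]
  exact aux e

lemma isOrdered_eqToHom_fst {p q : Profile 𝔠 × Discrete 𝔠} (e : p = q) :
    FinFam.IsOrdered (eqToHom e).1 := by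
  subst e
  exact FinFam.isOrdered_id _

lemma concJoin_joinConc (z : FinFam (FinFam (Br 𝔠 × Discrete 𝔠) × Discrete 𝔠)) :
    (conc 𝔠).map (concJoin z) ≫ joinConc (innerJoin z) ≫ (conc 𝔠).map (joinJoin z) =
      joinConc (concInner z) ≫ joinConc (outerJoin z) := by
  have h1 : FinFam.IsOrdered (concJoin z) := fun _ => rfl
  have h2 : FinFam.IsOrdered ((conc 𝔠).map (concJoin z)) :=
    FinFam.IsOrdered.concat (FinFam.IsOrdered.map h1) fun i => isOrdered_joinConc (z.obj i).1
  have h3 : FinFam.IsOrdered (joinJoin z) := FinFam.isOrdered_concatAssoc _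
  have h4 : FinFam.IsOrdered ((conc 𝔠).map (joinJoin z)) :=
    FinFam.IsOrdered.concat (FinFam.IsOrdered.map h3) fun _ =>
      (isOrdered_eqToHom_fst _).comp (isOrdered_eqToHom_fst _)
  have aux : ∀ {A B D E G : Profile 𝔠} {a : A ⟶ B} {b : B ⟶ D} {c : D ⟶ E} {d : A ⟶ G} {e : G ⟶ E}
      (_ : FinFam.IsOrdered a) (_ : FinFam.IsOrdered b) (_ : FinFam.IsOrdered c)
      (_ : FinFam.IsOrdered d) (_ : FinFam.IsOrdered e), a ≫ b ≫ c = d ≫ e :=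
    fun h1 h2 h3 h4 h5 => FinFam.IsOrdered.eq (h1.comp (h2.comp h3)) (h4.comp h5)
  exact aux h2 (isOrdered_joinConc (innerJoin z)) h4 (isOrdered_joinConc (concInner z))
    (isOrdered_joinConc (outerJoin z))

end Pentagon

section Pentagon

variable {𝔠 : Type w} {M : Type u} [Category.{v} M] [MonoidalCategory M] [SymmetricCategory M]

/-- The concatenation isomorphism for the branches of a joined family. -/
def branchesJoin (Y : SymSeq 𝔠 M) (h : FinFam (Br 𝔠 × Discrete 𝔠)) :
    tens h.len (fun i => (branches Y).obj (h.obj i).1) ⟶ (branches Y).obj (joinBr.obj h) :=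
  tensConcat ((FinFam.map (CategoryTheory.Prod.fst _ _ ⋙ FinFam.map Y.toFunctor)).obj h)

/-- The concatenation isomorphism for families of families of branches. -/
def outerBranchesJoin (Z : SymSeq 𝔠 M)
    (z : FinFam (FinFam (Br 𝔠 × Discrete 𝔠) × Discrete 𝔠)) :
    tens z.len (fun i => tens (z.obj i).1.len fun k => (branches Z).obj ((z.obj i).1.obj k).1) ⟶
      tens (outerJoin z).len (fun l => (branches Z).obj ((outerJoin z).obj l).1) :=
  tensConcat ((FinFam.map (CategoryTheory.Prod.fst _ _ ⋙
    FinFam.map (CategoryTheory.Prod.fst _ _ ⋙ branches Z))).obj z)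

instance (Y : SymSeq 𝔠 M) (h : FinFam (Br 𝔠 × Discrete 𝔠)) : IsIso (branchesJoin Y h) :=
  isIso_tensConcat _

instance (Z : SymSeq 𝔠 M) (z : FinFam (FinFam (Br 𝔠 × Discrete 𝔠) × Discrete 𝔠)) :
    IsIso (outerBranchesJoin Z z) :=
  isIso_tensConcat _

lemma branchesJoin_assoc (Z : SymSeq 𝔠 M)
    (z : FinFam (FinFam (Br 𝔠 × Discrete 𝔠) × Discrete 𝔠)) :
    tensMap z.len (fun i => branchesJoin Z (z.obj i).1) ≫ branchesJoin Z (innerJoin z) ≫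
        (branches Z).map (joinJoin z) =
      outerBranchesJoin Z z ≫ branchesJoin Z (outerJoin z) := by
  have e1 := tensConcat_assoc ((FinFam.map (CategoryTheory.Prod.fst _ _ ⋙
    FinFam.map (CategoryTheory.Prod.fst _ _ ⋙ FinFam.map Z.toFunctor))).obj z)
  have e2 := congrArg (fun t => (tensF M).map t) (FinFam.map_concatAssoc Z.toFunctor
    ((FinFam.map (CategoryTheory.Prod.fst _ _ ⋙ FinFam.map (CategoryTheory.Prod.fst _ _))).obj z))
  have aux : ∀ {A B D E : M} {a : A ⟶ B} {b : B ⟶ D} {c c' : D ⟶ E} {d : A ⟶ E} (_ : c' = c)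
      (_ : a ≫ b ≫ c = d), a ≫ b ≫ c' = d := by
    rintro A B D E a b c _ d rfl h
    exact h
  exact aux e2 e1

lemma branchesJoin_zip (Y Z : SymSeq 𝔠 M)
    (z : FinFam (FinFam (Br 𝔠 × Discrete 𝔠) × Discrete 𝔠)) :
    (branchesJoin Y (coloursInner z) ⊗ₘ outerBranchesJoin Z z) ≫
        tensZip (outerJoin z).len (fun l => Y.toFunctor.obj
            ((colours 𝔠).obj ((outerJoin z).obj l).1, ((outerJoin z).obj l).2))
          (fun l => (branches Z).obj ((outerJoin z).obj l).1) =
      tensZip z.len (fun i => (branches Y).obj (innerColours.obj (z.obj i).1))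
          (fun i => tens (z.obj i).1.len fun k => (branches Z).obj ((z.obj i).1.obj k).1) ≫
        tensMap z.len (fun i => tensZip (z.obj i).1.len (fun k => Y.toFunctor.obj
            ((colours 𝔠).obj ((z.obj i).1.obj k).1, ((z.obj i).1.obj k).2))
          (fun k => (branches Z).obj ((z.obj i).1.obj k).1)) ≫
        tensConcat ((FinFam.map (FinFam.map (branchPair Y Z))).obj
          ((FinFam.map (CategoryTheory.Prod.fst _ _)).obj z)) :=
  tensZip_tensConcat (Functor.prod (colours 𝔠) (𝟭 _) ⋙ Y.toFunctor)
    (CategoryTheory.Prod.fst _ _ ⋙ branches Z) ((FinFam.map (CategoryTheory.Prod.fst _ _)).obj z)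

variable [HasColimitsOfSize.{w, w} M]

lemma tensConcat_pairι (Y Z : SymSeq 𝔠 M)
    (z : FinFam (FinFam (Br 𝔠 × Discrete 𝔠) × Discrete 𝔠)) :
    tensMap z.len (fun i => tensMap (z.obj i).1.len fun k => circleι Y Z
        ((conc 𝔠).obj ((z.obj i).1.obj k).1, ((z.obj i).1.obj k).2) ((z.obj i).1.obj k).1 (𝟙 _)) ≫
        branchesJoin (circle Y Z) (concInner z) =
      tensConcat ((FinFam.map (FinFam.map (branchPair Y Z))).obj
          ((FinFam.map (CategoryTheory.Prod.fst _ _)).obj z)) ≫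
        tensMap (outerJoin z).len (fun l => circleι Y Z
          ((conc 𝔠).obj ((outerJoin z).obj l).1, ((outerJoin z).obj l).2)
            ((outerJoin z).obj l).1 (𝟙 _)) :=
  tensConcat_mapNat (pairι Y Z) ((FinFam.map (CategoryTheory.Prod.fst _ _)).obj z)

/-- The canonical morphisms into `((W ∘ X) ∘ Y) ∘ Z`. -/
noncomputable def leftLeftι (W X Y Z : SymSeq 𝔠 M) (p : Profile 𝔠 × Discrete 𝔠)
    (z : FinFam (FinFam (Br 𝔠 × Discrete 𝔠) × Discrete 𝔠))
    (s : (conc 𝔠).obj (joinBr.obj (outerJoin z)) ⟶ p.1) :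
    ((circleTerm W X p.2).obj (coloursOuter z) ⊗
        tens z.len (fun i => (branches Y).obj (innerColours.obj (z.obj i).1))) ⊗
        tens z.len (fun i => tens (z.obj i).1.len fun k => (branches Z).obj ((z.obj i).1.obj k).1) ⟶
      (circle (circle (circle W X) Y) Z).toFunctor.obj p :=
  ((circleι W X ((colours 𝔠).obj (innerColours.obj (outerJoin z)), p.2) (coloursOuter z)
    (outerColours z) ⊗ₘ branchesJoin Y (coloursInner z)) ⊗ₘ outerBranchesJoin Z z) ≫
    leftι (circle W X) Y Z p (outerJoin z) s

/-- The morphism given by the canonical morphisms into `Y ∘ Z`. -/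
noncomputable def zipι (Y Z : SymSeq 𝔠 M) (h : FinFam (Br 𝔠 × Discrete 𝔠)) :
    (branches Y).obj (innerColours.obj h) ⊗ tens h.len (fun k => (branches Z).obj (h.obj k).1) ⟶
      (branches (circle Y Z)).obj (innerConc.obj h) :=
  tensZip h.len (fun k => Y.toFunctor.obj ((colours 𝔠).obj (h.obj k).1, (h.obj k).2))
      (fun k => (branches Z).obj (h.obj k).1) ≫
    tensMap h.len (fun k => circleι Y Z ((conc 𝔠).obj (h.obj k).1, (h.obj k).2)
      (h.obj k).1 (𝟙 _))

lemma leftLeftι_eq (W X Y Z : SymSeq 𝔠 M) (p : Profile 𝔠 × Discrete 𝔠)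
    (z : FinFam (FinFam (Br 𝔠 × Discrete 𝔠) × Discrete 𝔠))
    (s : (conc 𝔠).obj (joinBr.obj (outerJoin z)) ⟶ p.1) :
    leftLeftι W X Y Z p z s =
      (leftι W X Y ((colours 𝔠).obj (joinBr.obj (outerJoin z)), p.2) (coloursInner z)
        (joinColours (outerJoin z)) ⊗ₘ (outerBranchesJoin Z z ≫ branchesJoin Z (outerJoin z))) ≫
      circleι (circle (circle W X) Y) Z p (joinBr.obj (outerJoin z)) s := by
  have aux : ∀ {A A' B B' D D' E F G : M} {a : A ⟶ A'} {b : B ⟶ B'} {c : D ⟶ D'} {d : D' ⟶ E}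
      {e : A' ⊗ B' ⟶ F} {f : F ⊗ E ⟶ G}, ((a ⊗ₘ b) ⊗ₘ c) ≫ (e ⊗ₘ d) ≫ f =
        (((a ⊗ₘ b) ≫ e) ⊗ₘ (c ≫ d)) ≫ f := by
    intros
    rw [tensorHom_comp_tensorHom_assoc]
  exact aux

variable [∀ A : M, PreservesColimitsOfSize.{w, w} (tensorLeft A)]

lemma leftι_circleAssoc_right (X Y Z : SymSeq 𝔠 M) (p : Profile 𝔠 × Discrete 𝔠)
    (h : FinFam (Br 𝔠 × Discrete 𝔠)) (s : (conc 𝔠).obj (joinBr.obj h) ⟶ p.1) :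
    leftι X Y Z p h s ≫ SymSeq.app (circleAssoc X Y Z).hom p =
      (α_ _ _ _).hom ≫ X.toFunctor.obj ((colours 𝔠).obj (innerColours.obj h), p.2) ◁ zipι Y Z h ≫
        circleι X (circle Y Z) p (innerConc.obj h) (joinConc h ≫ s) := by
  have e := leftι_circleAssoc X Y Z p h s
  have aux : ∀ {A B D E F G : M} {a : A ⟶ B ⊗ D} {c : D ⟶ E} {d : E ⟶ F} {f : B ⊗ F ⟶ G}
      {l : A ⟶ G} (_ : l = (a ≫ B ◁ c) ≫ B ◁ d ≫ f), l = a ≫ B ◁ (c ≫ d) ≫ f := by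
    rintro A B D E F G a c d f _ rfl
    rw [MonoidalCategory.whiskerLeft_comp, Category.assoc, Category.assoc]
  exact aux e

lemma leftLeftι_circleAssoc (W X Y Z : SymSeq 𝔠 M) (p : Profile 𝔠 × Discrete 𝔠)
    (z : FinFam (FinFam (Br 𝔠 × Discrete 𝔠) × Discrete 𝔠))
    (s : (conc 𝔠).obj (joinBr.obj (outerJoin z)) ⟶ p.1) :
    leftLeftι W X Y Z p z s ≫ SymSeq.app (circleAssoc (circle W X) Y Z).hom p =
      (α_ _ _ _).hom ≫ (circleTerm W X p.2).obj (coloursOuter z) ◁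
        (tensZip z.len (fun i => (branches Y).obj (innerColours.obj (z.obj i).1))
          (fun i => tens (z.obj i).1.len fun k => (branches Z).obj ((z.obj i).1.obj k).1) ≫
        tensMap z.len (fun i => zipι Y Z (z.obj i).1)) ≫
      leftι W X (circle Y Z) p (concInner z) (joinConc (outerJoin z) ≫ s) := by
  have e1 := leftι_circleAssoc_right (circle W X) Y Z p (outerJoin z) s
  have e2 := branchesJoin_zip Y Z z
  have e3 := tensConcat_pairι Y Z z
  have e4 : tensMap z.len (fun i => zipι Y Z (z.obj i).1) = _ := tensMap_comp z.len _ _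
  have aux : ∀ {A A' B B' D D' E E' F G H K L : M} {a : A ⟶ A'} {b : B ⟶ B'} {c : D ⟶ D'}
      {l : (A' ⊗ B') ⊗ D' ⟶ K} {m : K ⟶ L} {zz : B' ⊗ D' ⟶ E} {g : E ⟶ E'} {f : A' ⊗ E' ⟶ L}
      {z' : B ⊗ D ⟶ F} {t : F ⟶ G} {j : G ⟶ E} {g' : G ⟶ H} {j' : H ⟶ E'} {tg : F ⟶ H}
      (_ : l ≫ m = (α_ _ _ _).hom ≫ A' ◁ (zz ≫ g) ≫ f) (_ : (b ⊗ₘ c) ≫ zz = z' ≫ t ≫ j)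
      (_ : g' ≫ j' = j ≫ g) (_ : tg = t ≫ g'),
      (((a ⊗ₘ b) ⊗ₘ c) ≫ l) ≫ m = (α_ _ _ _).hom ≫ A ◁ (z' ≫ tg) ≫ (a ⊗ₘ j') ≫ f := by
    rintro A A' B B' D D' E E' F G H K L a b c l m zz g f z' t j g' j' _ h1 h2 h3 rfl
    rw [Category.assoc, h1, associator_naturality_assoc, ← id_tensorHom, ← id_tensorHom,
      tensorHom_comp_tensorHom_assoc, tensorHom_comp_tensorHom_assoc, reassoc_of% h2,
      Category.id_comp, Category.comp_id, Category.assoc, Category.assoc, ← h3]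
  exact aux e1 e2 e3 e4

lemma leftLeftι_circleMap_circleAssoc (W X Y Z : SymSeq 𝔠 M) (p : Profile 𝔠 × Discrete 𝔠)
    (z : FinFam (FinFam (Br 𝔠 × Discrete 𝔠) × Discrete 𝔠))
    (s : (conc 𝔠).obj (joinBr.obj (outerJoin z)) ⟶ p.1) :
    leftLeftι W X Y Z p z s ≫ SymSeq.app (circleMap (circleAssoc W X Y).hom (𝟙 Z)) p =
      (((α_ _ _ _).hom ≫ W.toFunctor.obj ((colours 𝔠).obj (innerColours.obj (coloursInner z)), p.2) ◁
          zipι X Y (coloursInner z)) ⊗ₘ tensMap z.len (fun i => branchesJoin Z (z.obj i).1)) ≫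
        leftι W (circle X Y) Z p (innerJoin z) ((conc 𝔠).map (joinJoin z) ≫ s) := by
  have e1 := leftLeftι_eq W X Y Z p z s
  have e2 := circleι_circleMap (circleAssoc W X Y).hom (𝟙 Z) p (joinBr.obj (outerJoin z)) s
  have e3 : (branchesMap (𝟙 Z)).app (joinBr.obj (outerJoin z)) = 𝟙 _ :=
    congrArg (fun α => NatTrans.app α (joinBr.obj (outerJoin z))) (branchesMap_id Z)
  have e4 := leftι_circleAssoc_right W X Y ((colours 𝔠).obj (joinBr.obj (outerJoin z)), p.2)
    (coloursInner z) (joinColours (outerJoin z))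
  have e5 := branchesJoin_assoc Z z
  have e6 := circleι_condition (circle W (circle X Y)) Z p (joinJoin z) s
  have e7 := circleι_map_id W (circle X Y) p.2 ((colours 𝔠).map (joinJoin z))
    (innerConc.obj (coloursInner z)) (joinColours (innerJoin z))
  have e8 := congrArg (fun t => circleι W (circle X Y)
    ((colours 𝔠).obj (joinBr.obj (outerJoin z)), p.2) (innerConc.obj (coloursInner z)) t)
      (joinColours_joinJoin z)
  have aux : ∀ {A B D E F G H I K R R' : M} {x : B ⊗ A ⟶ R} {L : B ⟶ D} {cd : A ⟶ E}
      {e : D ⊗ E ⟶ R}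
      {m : R ⟶ R'} {a : D ⟶ F} {o : E ⟶ E} {e' : F ⊗ E ⟶ R'} {q : B ⟶ G} {c : G ⟶ F}
      {tm : A ⟶ H} {tj : H ⟶ I} {bz : I ⟶ E} {e'' : K ⊗ I ⟶ R'} {w : K ⟶ F} {c0 : G ⟶ K}
      {c1 : G ⟶ F} (_ : x = (L ⊗ₘ cd) ≫ e) (_ : e ≫ m = (a ⊗ₘ o) ≫ e') (_ : o = 𝟙 E)
      (_ : L ≫ a = q ≫ c) (_ : tm ≫ tj ≫ bz = cd) (_ : e'' = (w ⊗ₘ bz) ≫ e')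
      (_ : c0 ≫ w = c1) (_ : c1 = c), x ≫ m = (q ⊗ₘ tm) ≫ (c0 ⊗ₘ tj) ≫ e'' := by
    rintro A B D E F G H I K R R' _ L _ e m a _ e' q _ tm tj bz _ w c0 _ rfl h2 rfl h4 rfl
      rfl rfl rfl
    rw [Category.assoc, h2, tensorHom_comp_tensorHom_assoc, tensorHom_comp_tensorHom_assoc,
      tensorHom_comp_tensorHom_assoc, h4]
    simp
  have aux2 : ∀ {A B D E F : M} {a : A ⟶ B ⊗ D} {b : D ⟶ E} {c : B ⊗ E ⟶ F} {l : A ⟶ F}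
      (_ : l = a ≫ B ◁ b ≫ c), l = (a ≫ B ◁ b) ≫ c := by
    rintro A B D E F a b c _ rfl
    rw [Category.assoc]
  exact aux e1 e2 e3 (aux2 e4) e5 e6 e7 e8

end Pentagon

section Pentagon

variable {𝔠 : Type w} {M : Type u} [Category.{v} M] [MonoidalCategory M] [SymmetricCategory M]
  [HasColimitsOfSize.{w, w} M]

lemma circleι_concJoin (W X Y Z : SymSeq 𝔠 M) (p : Profile 𝔠 × Discrete 𝔠)
    (z : FinFam (FinFam (Br 𝔠 × Discrete 𝔠) × Discrete 𝔠))
    (s : (conc 𝔠).obj (innerConc.obj (innerJoin z)) ⟶ p.1) :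
    W.toFunctor.obj ((colours 𝔠).obj (innerColours.obj (concInner z)), p.2) ◁
        tensMap z.len (fun i => circleι X (circle Y Z)
          ((conc 𝔠).obj (innerConc.obj (z.obj i).1), (z.obj i).2) (innerConc.obj (z.obj i).1)
            (𝟙 _)) ≫
      circleι W (circle X (circle Y Z)) p (innerConc.obj (concInner z))
        ((conc 𝔠).map (concJoin z) ≫ s) =
    W.toFunctor.obj ((colours 𝔠).obj (innerColours.obj (concInner z)), p.2) ◁
        tensMap z.len (fun i => circleι X (circle Y Z)
          ((conc 𝔠).obj (joinBr.obj (z.obj i).1), (z.obj i).2) (innerConc.obj (z.obj i).1)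
            (joinConc (z.obj i).1)) ≫
      circleι W (circle X (circle Y Z)) p (innerConc.obj (innerJoin z)) s := by
  have e1 := circleι_condition W (circle X (circle Y Z)) p (concJoin z) s
  have e2 : (branches (circle X (circle Y Z))).map (concJoin z) = tensMap z.len fun i =>
      (circle X (circle Y Z)).toFunctor.map (Prod.mkHom (joinConc (z.obj i).1) (𝟙 (z.obj i).2)) :=
    (tensMap_eq_tensPerm _ _).symm
  have e3 : ∀ i : Fin z.len, _ := fun i => (circleι_map_id X (circle Y Z) (z.obj i).2
    (joinConc (z.obj i).1) (innerConc.obj (z.obj i).1) (𝟙 _)).trans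
      (congrArg (fun t => circleι X (circle Y Z) ((conc 𝔠).obj (joinBr.obj (z.obj i).1),
        (z.obj i).2) (innerConc.obj (z.obj i).1) t) (Category.id_comp (joinConc (z.obj i).1)))
  have e4 := (tensMap_comp z.len _ _).symm.trans (congrArg (fun t => tensMap z.len t) (funext e3))
  have e6 : W.toFunctor.map (Prod.mkHom ((colours 𝔠).map (concJoin z)) (𝟙 p.2)) = 𝟙 _ :=
    W.toFunctor.map_id ((colours 𝔠).obj (innerConc.obj (concInner z)), p.2)
  have aux : ∀ {A B D E F : M} {x : A ⟶ A} {i : B ⟶ D} {m m' : D ⟶ E} {j : B ⟶ E}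
      {g : A ⊗ E ⟶ F} {g' : A ⊗ D ⟶ F} (_ : g' = (x ⊗ₘ m) ≫ g) (_ : m = m') (_ : i ≫ m' = j)
      (_ : x = 𝟙 A), A ◁ i ≫ g' = A ◁ j ≫ g := by
    rintro A B D E F _ i m _ _ g _ rfl rfl rfl rfl
    rw [id_tensorHom, MonoidalCategory.whiskerLeft_comp, Category.assoc]
  exact aux e1 e2 e4 e6

variable [∀ A : M, PreservesColimitsOfSize.{w, w} (tensorLeft A)]

lemma leftLeft_hom_ext {W X Y Z : SymSeq 𝔠 M} {p : Profile 𝔠 × Discrete 𝔠} {V : M}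
    {f g : (circle (circle (circle W X) Y) Z).toFunctor.obj p ⟶ V}
    (h : ∀ z s, leftLeftι W X Y Z p z s ≫ f = leftLeftι W X Y Z p z s ≫ g) : f = g := by
  refine left_hom_ext fun k s => ?_
  have ext : ∀ {B D R : M} {a b : ((circle W X).toFunctor.obj
      ((colours 𝔠).obj (innerColours.obj k), p.2) ⊗ B) ⊗ D ⟶ R}
      (_ : ∀ β r, (circleι W X ((colours 𝔠).obj (innerColours.obj k), p.2) β r ▷ B) ▷ D ≫ a =
        (circleι W X ((colours 𝔠).obj (innerColours.obj k), p.2) β r ▷ B) ▷ D ≫ b), a = b := by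
    intro B D R a b hab
    rw [← cancel_epi (α_ _ _ _).inv]
    refine wcoend.tensorRight_hom_ext (K := conc 𝔠) (T := circleTerm W X p.2) (B ⊗ D)
      fun β r => ?_
    have e := hab β r
    have aux : ∀ {P Q : M} {i : P ⟶ Q} {a b : (Q ⊗ B) ⊗ D ⟶ R}
        (_ : (i ▷ B) ▷ D ≫ a = (i ▷ B) ▷ D ≫ b),
        i ▷ (B ⊗ D) ≫ (α_ _ _ _).inv ≫ a = i ▷ (B ⊗ D) ≫ (α_ _ _ _).inv ≫ b := by
      intro P Q i a b h
      rw [associator_inv_naturality_left_assoc, associator_inv_naturality_left_assoc, h]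
    exact aux e
  refine ext fun β r => ?_
  let φ : outerJoin (FinFam.regroup k β r) ⟶ k := FinFam.regroupHom k β r
  have hφ : IsIso φ := FinFam.instIsIsoProdDiscreteRegroupHom k β r
  have e1 := leftι_condition (circle W X) Y Z p φ s
  have e2 := (circleι_map_id W X p.2 ((colours 𝔠).map (innerColours.map φ)) β
    (outerColours (FinFam.regroup k β r))).trans
      (congrArg (fun t => circleι W X ((colours 𝔠).obj (innerColours.obj k), p.2) β t)
        (Category.id_comp r))
  have e3 := h (FinFam.regroup k β r) ((conc 𝔠).map (joinBr.map φ) ≫ s)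
  have i1 : IsIso ((branches Y).map (innerColours.map φ)) :=
    CategoryTheory.Functor.map_isIso (innerColours ⋙ branches Y) φ
  have i2 : IsIso ((tensF M).map ((FinFam.map (CategoryTheory.Prod.fst _ _ ⋙ branches Z)).map φ)) :=
    CategoryTheory.Functor.map_isIso (FinFam.map (CategoryTheory.Prod.fst _ _ ⋙ branches Z) ⋙
      tensF M) φ
  have aux : ∀ {A P P' B B' B'' D D' D'' R : M} {i : A ⟶ P} {m : P ⟶ P'} {i' : A ⟶ P'}
      {n : B ⟶ B'} {l : D ⟶ D'} {b : B'' ⟶ B} {d : D'' ⟶ D} {g₀ : (P ⊗ B) ⊗ D ⟶ R}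
      {g' : (P' ⊗ B') ⊗ D' ⟶ R} {f g : R ⟶ V} (_ : IsIso n) (_ : IsIso l) (_ : IsIso b)
      (_ : IsIso d) (_ : g₀ = ((m ⊗ₘ n) ⊗ₘ l) ≫ g') (_ : i ≫ m = i')
      (_ : (((i ⊗ₘ b) ⊗ₘ d) ≫ g₀) ≫ f = (((i ⊗ₘ b) ⊗ₘ d) ≫ g₀) ≫ g),
      (i' ▷ B') ▷ D' ≫ g' ≫ f = (i' ▷ B') ▷ D' ≫ g' ≫ g := by
    rintro A P P' B B' B'' D D' D'' R i m _ n l b d _ g' f g _ _ _ _ rfl rfl h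
    have hh : ((i ⊗ₘ b) ⊗ₘ d) ≫ ((m ⊗ₘ n) ⊗ₘ l) = ((A ◁ (b ≫ n)) ▷ D'' ≫ _ ◁ (d ≫ l)) ≫
        ((i ≫ m) ▷ B') ▷ D' := by
      rw [tensorHom_comp_tensorHom, tensorHom_comp_tensorHom, Category.assoc, whisker_exchange,
        MonoidalCategory.tensorHom_def ((i ≫ m) ⊗ₘ (b ≫ n)),
        MonoidalCategory.tensorHom_def' (i ≫ m), comp_whiskerRight, Category.assoc]
    simp only [Category.assoc] at h
    rw [reassoc_of% hh, reassoc_of% hh] at h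
    simpa only [Category.assoc, cancel_epi] using h
  have i3 : IsIso (branchesJoin Y (coloursInner (FinFam.regroup k β r))) := inferInstance
  have i4 : IsIso (outerBranchesJoin Z (FinFam.regroup k β r)) := inferInstance
  exact aux i1 i2 i3 i4 e1 e2 e3

lemma leftι_circleAssoc_circleMap (W X Y Z : SymSeq 𝔠 M) (p : Profile 𝔠 × Discrete 𝔠)
    (z : FinFam (FinFam (Br 𝔠 × Discrete 𝔠) × Discrete 𝔠))
    (s : (conc 𝔠).obj (joinBr.obj (innerJoin z)) ⟶ p.1) :
    (((α_ _ _ _).hom ≫ W.toFunctor.obj ((colours 𝔠).obj (innerColours.obj (coloursInner z)), p.2) ◁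
          zipι X Y (coloursInner z)) ⊗ₘ tensMap z.len (fun i => branchesJoin Z (z.obj i).1)) ≫
        leftι W (circle X Y) Z p (innerJoin z) s ≫
          SymSeq.app (circleAssoc W (circle X Y) Z).hom p ≫
            SymSeq.app (circleMap (𝟙 W) (circleAssoc X Y Z).hom) p =
      ((α_ _ _ _).hom ≫ W.toFunctor.obj ((colours 𝔠).obj (innerColours.obj (coloursInner z)), p.2) ◁
          tensZip z.len (fun i => X.toFunctor.obj
              ((colours 𝔠).obj (innerColours.obj (z.obj i).1), (z.obj i).2))
            (fun i => (branches Y).obj (innerColours.obj (z.obj i).1))) ▷ _ ≫ (α_ _ _ _).hom ≫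
        W.toFunctor.obj ((colours 𝔠).obj (innerColours.obj (coloursInner z)), p.2) ◁
          (tensZip z.len (fun i => X.toFunctor.obj
              ((colours 𝔠).obj (innerColours.obj (z.obj i).1), (z.obj i).2) ⊗
                (branches Y).obj (innerColours.obj (z.obj i).1))
            (fun i => tens (z.obj i).1.len fun k => (branches Z).obj ((z.obj i).1.obj k).1) ≫
          tensMap z.len (fun i => (α_ _ _ _).hom ≫ X.toFunctor.obj
              ((colours 𝔠).obj (innerColours.obj (z.obj i).1), (z.obj i).2) ◁ zipι Y Z (z.obj i).1 ≫
            circleι X (circle Y Z) ((conc 𝔠).obj (joinBr.obj (z.obj i).1), (z.obj i).2)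
              (innerConc.obj (z.obj i).1) (joinConc (z.obj i).1))) ≫
        circleι W (circle X (circle Y Z)) p (innerConc.obj (innerJoin z))
          (joinConc (innerJoin z) ≫ s) := by
  have e1 := leftι_circleAssoc_right W (circle X Y) Z p (innerJoin z) s
  have e2 := circleι_circleMap (𝟙 W) (circleAssoc X Y Z).hom p (innerConc.obj (innerJoin z))
    (joinConc (innerJoin z) ≫ s)
  have e3 := branchesMap_app (circleAssoc X Y Z).hom (innerConc.obj (innerJoin z))
  have e4 := tensZip_tensMap z.len (fun i => circleι X Y
    ((conc 𝔠).obj (innerColours.obj (z.obj i).1), (z.obj i).2) (innerColours.obj (z.obj i).1) (𝟙 _))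
      (fun i => branchesJoin Z (z.obj i).1)
  have e5 : ∀ i : Fin z.len, _ := fun i => (leftι_circleAssoc_right X Y Z
    ((conc 𝔠).obj (joinBr.obj (z.obj i).1), (z.obj i).2) (z.obj i).1 (𝟙 _)).trans
      (congrArg (fun t => (α_ _ _ _).hom ≫ X.toFunctor.obj
        ((colours 𝔠).obj (innerColours.obj (z.obj i).1), (z.obj i).2) ◁ zipι Y Z (z.obj i).1 ≫
          circleι X (circle Y Z) ((conc 𝔠).obj (joinBr.obj (z.obj i).1), (z.obj i).2)
            (innerConc.obj (z.obj i).1) t) (Category.comp_id (joinConc (z.obj i).1)))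
  have e6 := (tensMap_comp z.len _ _).symm.trans (congrArg (fun t => tensMap z.len t) (funext e5))
  have e7 := (congrArg (fun t => t ≫ tensMap z.len fun i => SymSeq.app (circleAssoc X Y Z).hom
    ((conc 𝔠).obj (joinBr.obj (z.obj i).1), (z.obj i).2)) (tensMap_comp z.len (fun i => circleι X Y
    ((conc 𝔠).obj (innerColours.obj (z.obj i).1), (z.obj i).2) (innerColours.obj (z.obj i).1)
      (𝟙 _) ⊗ₘ branchesJoin Z (z.obj i).1) (fun i => circleι (circle X Y) Z
        ((conc 𝔠).obj (joinBr.obj (z.obj i).1), (z.obj i).2) (joinBr.obj (z.obj i).1)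
          (𝟙 _)))).symm.trans e6
  have aux : ∀ {A B D E F G H I K R R' S T : M} {zxy : B ⟶ D} {g : D ⟶ E} {bj : F ⟶ G}
      {l : (A ⊗ E) ⊗ G ⟶ R} {m : R ⟶ R'} {r : R' ⟶ K} {z2 : E ⊗ G ⟶ H} {g2 : H ⟶ I}
      {c : A ⊗ I ⟶ R'} {a a' : I ⟶ S} {c' : A ⊗ S ⟶ K} {z3 : D ⊗ F ⟶ T} {gb : T ⟶ H}
      {f : T ⟶ S} (_ : l ≫ m = (α_ _ _ _).hom ≫ A ◁ (z2 ≫ g2) ≫ c)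
      (_ : c ≫ r = (𝟙 A ⊗ₘ a) ≫ c') (_ : a = a') (_ : (g ⊗ₘ bj) ≫ z2 = z3 ≫ gb)
      (_ : (gb ≫ g2) ≫ a' = f) {P : M} {al : P ⟶ A ⊗ B},
      ((al ≫ A ◁ (zxy ≫ g)) ⊗ₘ bj) ≫ l ≫ m ≫ r =
        (al ≫ A ◁ zxy) ▷ F ≫ (α_ _ _ _).hom ≫ A ◁ (z3 ≫ f) ≫ c' := by
    rintro A B D E F G H I K R R' S T zxy g bj l m r z2 g2 c a _ c' z3 gb _ h1 h2 rfl h3 rfl P al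
    have h4 : ((al ≫ A ◁ (zxy ≫ g)) ⊗ₘ bj) = (al ≫ A ◁ zxy) ▷ F ≫ ((A ◁ g) ⊗ₘ bj) := by
      rw [← tensorHom_id, tensorHom_comp_tensorHom, Category.id_comp, Category.assoc,
        MonoidalCategory.whiskerLeft_comp]
    rw [h4, reassoc_of% h1, h2, ← id_tensorHom A g, Category.assoc,
      associator_naturality_assoc, ← id_tensorHom, ← id_tensorHom, tensorHom_comp_tensorHom_assoc,
      tensorHom_comp_tensorHom_assoc]
    simp [reassoc_of% h3]
  exact aux e1 e2 e3 e4 e7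

lemma circleAssoc_pentagon (W X Y Z : SymSeq 𝔠 M) :
    circleMap (circleAssoc W X Y).hom (𝟙 Z) ≫ (circleAssoc W (circle X Y) Z).hom ≫
        circleMap (𝟙 W) (circleAssoc X Y Z).hom =
      (circleAssoc (circle W X) Y Z).hom ≫ (circleAssoc W X (circle Y Z)).hom := by
  refine SymSeq.hom_ext fun p => leftLeft_hom_ext fun z s => ?_
  have e1 := leftLeftι_circleMap_circleAssoc W X Y Z p z s
  have e2 := leftι_circleAssoc_circleMap W X Y Z p z ((conc 𝔠).map (joinJoin z) ≫ s)
  have e3 := leftLeftι_circleAssoc W X Y Z p z s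
  have e4 := leftι_circleAssoc W X (circle Y Z) p (concInner z) (joinConc (outerJoin z) ≫ s)
  have e5 : joinConc (concInner z) ≫ joinConc (outerJoin z) ≫ s =
      (conc 𝔠).map (concJoin z) ≫ joinConc (innerJoin z) ≫ (conc 𝔠).map (joinJoin z) ≫ s := by
    have h := concJoin_joinConc z
    have aux : ∀ {A B D E G K : Profile 𝔠} {a : A ⟶ B} {b : B ⟶ D} {c : D ⟶ E} {d : A ⟶ G}
        {e : G ⟶ E} {s : E ⟶ K} (_ : a ≫ b ≫ c = d ≫ e), d ≫ e ≫ s = a ≫ b ≫ c ≫ s := by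
      intro A B D E G K a b c d e s h
      rw [← Category.assoc, ← h, Category.assoc, Category.assoc]
    exact aux h
  have e6 := circleι_concJoin W X Y Z p z (joinConc (innerJoin z) ≫ (conc 𝔠).map (joinJoin z) ≫ s)
  have e7 := (congrArg (fun t => W.toFunctor.obj
    ((colours 𝔠).obj (innerColours.obj (concInner z)), p.2) ◁ tensMap z.len (fun i =>
      circleι X (circle Y Z) ((conc 𝔠).obj (innerConc.obj (z.obj i).1), (z.obj i).2)
        (innerConc.obj (z.obj i).1) (𝟙 _)) ≫ circleι W (circle X (circle Y Z)) p
          (innerConc.obj (concInner z)) t) e5).trans e6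
  have e8 := tensZip_pentagon z.len
    (W.toFunctor.obj ((colours 𝔠).obj (innerColours.obj (coloursInner z)), p.2))
    (x := fun i => X.toFunctor.obj ((colours 𝔠).obj (innerColours.obj (z.obj i).1), (z.obj i).2))
    (fun i => zipι Y Z (z.obj i).1)
    (fun i => circleι X (circle Y Z) ((conc 𝔠).obj (joinBr.obj (z.obj i).1), (z.obj i).2)
      (innerConc.obj (z.obj i).1) (joinConc (z.obj i).1))
  have aux : ∀ {A B D E F G H I K N P Q : M} {G₀ : A ⟶ B} {m1 : B ⟶ D} {m2 : D ⟶ E} {m3 : E ⟶ F}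
      {n1 : B ⟶ G} {n2 : G ⟶ F} {u : A ⟶ H} {l : H ⟶ D} {a : A ⟶ I} {b : I ⟶ K} {wf : K ⟶ N}
      {k : N ⟶ F} {c : A ⟶ P} {l' : P ⟶ G} {at' : P ⟶ Q} {rt : Q ⟶ F} (_ : G₀ ≫ m1 = u ≫ l)
      (_ : u ≫ l ≫ m2 ≫ m3 = a ≫ b ≫ wf ≫ k) (_ : G₀ ≫ n1 = c ≫ l')
      (_ : l' ≫ n2 = at' ≫ rt) (_ : a ≫ b ≫ wf ≫ k = c ≫ at' ≫ rt),
      G₀ ≫ m1 ≫ m2 ≫ m3 = G₀ ≫ n1 ≫ n2 := by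
    intro A B D E F G H I K N P Q G₀ m1 m2 m3 n1 n2 u l a b wf k c l' at' rt h1 h2 h3 h4 h5
    rw [reassoc_of% h1, reassoc_of% h3, h2, h4, h5]
  have aux2 : ∀ {V A B D E F G H I K : M} {a : A ⟶ B} {al : B ⟶ V ⊗ D} {wf : D ⟶ E}
      {c : A ⟶ F} {g : F ⟶ G} {al' : G ⟶ V ⊗ H} {zx : H ⟶ I} {cc : I ⟶ E} {k : V ⊗ E ⟶ K}
      {r : V ⊗ I ⟶ K} (_ : a ≫ al ≫ V ◁ wf = c ≫ g ≫ al' ≫ V ◁ (zx ≫ cc))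
      (_ : r = V ◁ cc ≫ k), a ≫ al ≫ V ◁ wf ≫ k = (c ≫ g) ≫ (al' ≫ V ◁ zx) ≫ r := by
    rintro V A B D E F G H I K a al wf c g al' zx cc k _ h rfl
    rw [reassoc_of% h]
    simp
  have e3' := e3.trans (Category.assoc _ _ _).symm
  exact aux e1 e2 e3' e4 (aux2 e8 e7)

end Pentagon

section Tens

variable {C : Type u} [Category.{v} C] [MonoidalCategory C] [SymmetricCategory C]

lemma tensMap_comp_comp (n : ℕ) {x y z u v : Fin n → C} {a : ∀ i, x i ⟶ y i} {b : ∀ i, y i ⟶ z i}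
    {c : ∀ i, z i ⟶ u i} {d : ∀ i, x i ⟶ v i} {e : ∀ i, v i ⟶ u i}
    (h : ∀ i, a i ≫ b i ≫ c i = d i ≫ e i) :
    tensMap n a ≫ tensMap n b ≫ tensMap n c = tensMap n d ≫ tensMap n e := by
  rw [← tensMap_comp, ← tensMap_comp, ← tensMap_comp, funext h]

end Tens

section Triangle

variable {𝔠 : Type w}

/-- The family of one-term families associated with a family. -/
def singleBr (b : Br 𝔠) : FinFam (Br 𝔠 × Discrete 𝔠) :=
  (FinFam.map (Functor.prod' FinFam.single (CategoryTheory.Prod.snd _ _))).obj b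

/-- The isomorphism to the join of the one-term families. -/
def toJoinSingle (b : Br 𝔠) : b ⟶ joinBr.obj (singleBr b) := FinFam.toConcatMapSingle b

/-- The isomorphism to the concatenation of the one-term families. -/
def toConcSingle (b : Br 𝔠) : b ⟶ innerConc.obj (singleBr b) :=
  ⟨Equiv.refl _, fun i => Prod.mkHom (toConc (b.obj i).1 (b.obj i).2) (𝟙 (b.obj i).2)⟩

section

attribute [local irreducible] FinFam.concat

lemma isOrdered_toConc (q : Profile 𝔠) (t : Discrete 𝔠) : FinFam.IsOrdered (toConc q t) :=
  FinFam.isOrdered_toConcatSingle q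

end

lemma toConcSingle_joinConc (b : Br 𝔠) :
    (conc 𝔠).map (toConcSingle b) ≫ joinConc (singleBr b) = (conc 𝔠).map (toJoinSingle b) := by
  have h1 : FinFam.IsOrdered (toConcSingle b) := fun _ => rfl
  have h2 : FinFam.IsOrdered ((conc 𝔠).map (toConcSingle b)) :=
    FinFam.IsOrdered.concat (FinFam.IsOrdered.map h1) fun i => isOrdered_toConc _ _
  have h3 : FinFam.IsOrdered (toJoinSingle b) := FinFam.isOrdered_toConcatMapSingle _
  have h4 : FinFam.IsOrdered ((conc 𝔠).map (toJoinSingle b)) :=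
    FinFam.IsOrdered.concat (FinFam.IsOrdered.map h3) fun _ =>
      (isOrdered_eqToHom_fst _).comp (FinFam.isOrdered_id _)
  exact FinFam.IsOrdered.eq (h2.comp (isOrdered_joinConc (singleBr b))) h4

lemma colours_toJoinSingle (b : Br 𝔠) :
    inv (toConcSingles ((colours 𝔠).obj b)) ≫ (colours 𝔠).map (toJoinSingle b) =
      joinColours (singleBr b) :=
  (IsIso.inv_comp_eq _).2 ((FinFam.map_toConcatMapSingle
    (CategoryTheory.Prod.snd (Profile 𝔠) (Discrete 𝔠)) b).trans (Category.comp_id _).symm)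

variable {M : Type u} [Category.{v} M] [MonoidalCategory M] [SymmetricCategory M]

lemma branches_toJoinSingle (Y : SymSeq 𝔠 M) (b : Br 𝔠) :
    (branches Y).map (toJoinSingle b) =
      tensMap b.len (fun i => (ρ_ (Y.toFunctor.obj (b.obj i))).inv) ≫ branchesJoin Y (singleBr b) :=
  (congrArg (fun t => (tensF M).map t) (FinFam.map_toConcatMapSingle Y.toFunctor b)).trans
    (toConcatMapSingle_eq ((FinFam.map Y.toFunctor).obj b))

lemma branches_toConcSingle (Y : SymSeq 𝔠 M) (b : Br 𝔠) :
    (branches Y).map (toConcSingle b) = tensMap b.len (fun i => Y.toFunctor.map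
      (Prod.mkHom (toConc (b.obj i).1 (b.obj i).2) (𝟙 (b.obj i).2))) :=
  (tensMap_eq_tensPerm _ _).symm

variable [HasColimitsOfSize.{w, w} M] [∀ A : M, PreservesColimitsOfSize.{w, w} (tensorLeft A)]

/-- The right unit isomorphism in terms of the canonical morphisms. -/
noncomputable def rightUnitInvι (X : SymSeq 𝔠 M) (p : Profile 𝔠 × Discrete 𝔠) :
    X.toFunctor.obj p ⊗ 𝟙_ M ⟶ (circle X (circleUnit 𝔠 M)).toFunctor.obj p :=
  X.toFunctor.obj (p.1, p.2) ◁ tensUnit p.1.len ≫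
    rightUnitι X p p.1 (inv (toConcSingles p.1))

lemma rightUnitInvι_circleRightUnitor (X : SymSeq 𝔠 M) (p : Profile 𝔠 × Discrete 𝔠) :
    rightUnitInvι X p ≫ SymSeq.app (circleRightUnitor X).hom p = (ρ_ _).hom := by
  have e1 := rightUnitι_circleRightUnitor X p p.1 (inv (toConcSingles p.1))
  have e2 : toConcSingles p.1 ≫ inv (toConcSingles p.1) = 𝟙 p.1 := IsIso.hom_inv_id _
  have e3 := (congrArg (fun r => X.toFunctor.map (Prod.mkHom r (𝟙 p.2))) e2).trans
    (X.toFunctor.map_id p)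
  have aux : ∀ {A B D E : M} {a : A ⟶ B} {b : B ⟶ D} {c : D ⟶ E} {d : A ⟶ E} {r : E ⟶ E}
      (_ : a ≫ b ≫ c = d ≫ r) (_ : r = 𝟙 E), (a ≫ b) ≫ c = d := by
    rintro A B D E a b c d _ h rfl
    simpa using h
  exact aux e1 e3

instance (X : SymSeq 𝔠 M) (p : Profile 𝔠 × Discrete 𝔠) :
    IsIso (SymSeq.app (circleRightUnitor X).hom p) :=
  ⟨SymSeq.app (circleRightUnitor X).inv p,
    congrArg (fun f => SymSeq.app f p) (circleRightUnitor X).hom_inv_id,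
    congrArg (fun f => SymSeq.app f p) (circleRightUnitor X).inv_hom_id⟩

instance (X : SymSeq 𝔠 M) (p : Profile 𝔠 × Discrete 𝔠) : IsIso (rightUnitInvι X p) :=
  have : IsIso (rightUnitInvι X p ≫ SymSeq.app (circleRightUnitor X).hom p) := by
    rw [rightUnitInvι_circleRightUnitor]
    infer_instance
  IsIso.of_isIso_comp_right _ (SymSeq.app (circleRightUnitor X).hom p)

lemma rightUnitInvι_circleι (X Y : SymSeq 𝔠 M) (p : Profile 𝔠 × Discrete 𝔠) (b : Br 𝔠)
    (s : (conc 𝔠).obj (joinBr.obj (singleBr b)) ⟶ p.1) :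
    rightUnitInvι X ((colours 𝔠).obj b, p.2) ▷ (branches Y).obj b ≫
        circleι (circle X (circleUnit 𝔠 M)) Y p b ((conc 𝔠).map (toJoinSingle b) ≫ s) =
      (X.toFunctor.obj ((colours 𝔠).obj b, p.2) ◁ (tensUnit b.len ≫ tensMap b.len (fun i =>
        unitι M (FinFam.single.obj (b.obj i).2, (b.obj i).2) (𝟙 _))) ⊗ₘ
          tensMap b.len (fun i => (ρ_ (Y.toFunctor.obj (b.obj i))).inv)) ≫
        leftι X (circleUnit 𝔠 M) Y p (singleBr b) s := by
  have e1 := circleι_condition (circle X (circleUnit 𝔠 M)) Y p (toJoinSingle b) s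
  have e2 := circleι_map_id X (circleUnit 𝔠 M) p.2 ((colours 𝔠).map (toJoinSingle b))
    (singles.obj ((colours 𝔠).obj b)) (inv (toConcSingles ((colours 𝔠).obj b)))
  have e3 := congrArg (fun t => circleι X (circleUnit 𝔠 M)
    ((colours 𝔠).obj (joinBr.obj (singleBr b)), p.2) (singles.obj ((colours 𝔠).obj b)) t)
      (colours_toJoinSingle b)
  have e4 := branches_toJoinSingle Y b
  have aux : ∀ {A B D E F G K N R I : M} {u : I ⟶ B} {m : B ⟶ D} {c : A ⊗ D ⟶ E} {w : E ⟶ F}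
      {c' c'' : A ⊗ D ⟶ F} {g : E ⊗ G ⟶ R} {bz : G ⟶ N} {g' : F ⊗ N ⟶ R} {r : G ⟶ K} {j : K ⟶ N}
      (_ : g = (w ⊗ₘ bz) ≫ g') (_ : c ≫ w = c') (_ : c' = c'') (_ : bz = r ≫ j),
      (A ◁ u ≫ A ◁ m ≫ c) ▷ G ≫ g = (A ◁ (u ≫ m) ⊗ₘ r) ≫ (c'' ⊗ₘ j) ≫ g' := by
    rintro A B D E F G K N R I u m c w _ _ _ _ g' r j rfl rfl rfl rfl
    rw [← tensorHom_id, tensorHom_comp_tensorHom_assoc, tensorHom_comp_tensorHom_assoc,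
      MonoidalCategory.whiskerLeft_comp, Category.id_comp, Category.assoc, Category.assoc,
      Category.assoc]
  exact aux e1 e2 e3 e4

lemma tensUnit_zipι_leftUnitor (Y : SymSeq 𝔠 M) (b : Br 𝔠) :
    ((tensUnit b.len ≫ tensMap b.len (fun i =>
        unitι M (FinFam.single.obj (b.obj i).2, (b.obj i).2) (𝟙 _))) ⊗ₘ
          tensMap b.len (fun i => (ρ_ (Y.toFunctor.obj (b.obj i))).inv)) ≫
      zipι (circleUnit 𝔠 M) Y (singleBr b) ≫
        (branchesMap (circleLeftUnitor Y).hom).app (innerConc.obj (singleBr b)) =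
    (λ_ _).hom ≫ (branches Y).map (toConcSingle b) := by
  have e1 := branchesMap_app (circleLeftUnitor Y).hom (innerConc.obj (singleBr b))
  have e2 := tensZip_tensMap b.len (fun i =>
        unitι M (FinFam.single.obj (b.obj i).2, (b.obj i).2) (𝟙 _))
    (fun i => (ρ_ (Y.toFunctor.obj (b.obj i))).inv)
  have e3 : ∀ i : Fin b.len, leftUnitι Y ((conc 𝔠).obj (FinFam.single.obj (b.obj i)), (b.obj i).2)
      (b.obj i).1 (𝟙 _) ≫ SymSeq.app (circleLeftUnitor Y).hom _ = (λ_ _).hom ≫ (ρ_ _).hom ≫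
        Y.toFunctor.map (Prod.mkHom (toConc (b.obj i).1 (b.obj i).2) (𝟙 (b.obj i).2)) := fun i =>
    (leftUnitι_circleLeftUnitor Y ((conc 𝔠).obj (FinFam.single.obj (b.obj i)), (b.obj i).2)
      (b.obj i).1 (𝟙 _)).trans (congrArg (fun t => (λ_ _).hom ≫ (ρ_ _).hom ≫
        Y.toFunctor.map (Prod.mkHom t (𝟙 (b.obj i).2))) (Category.comp_id _))
  have e4 := branches_toConcSingle Y b
  have e5 := tensZip_tensUnit_left b.len (fun i => Y.toFunctor.obj (b.obj i))
  have aux3 : ∀ {A B D E : M} {u : 𝟙_ M ⟶ A} {c : A ⊗ (B ⊗ 𝟙_ M) ⟶ D} {l : D ⟶ E}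
      {k : B ⟶ E} (_ : (u ▷ _ ≫ c) ≫ l = (λ_ _).hom ≫ (ρ_ _).hom ≫ k),
      (u ⊗ₘ (ρ_ B).inv) ≫ c ≫ l = (λ_ _).hom ≫ k := by
    intro A B D E u c l k h
    rw [MonoidalCategory.tensorHom_def', Category.assoc, ← Category.assoc (u ▷ _), h,
      leftUnitor_naturality_assoc, Iso.inv_hom_id_assoc]
  have e6 : ∀ i : Fin b.len, _ := fun i => aux3 (e3 i)
  have e7 := tensMap_comp_comp b.len e6
  have e8 := (tensMap_comp b.len (fun i => (λ_ (Y.toFunctor.obj (b.obj i))).inv)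
    (fun i => (λ_ (Y.toFunctor.obj (b.obj i))).hom)).symm.trans
      ((congrArg (fun t => tensMap b.len t) (funext fun i => Iso.inv_hom_id _)).trans
        (tensMap_id _ _))
  have aux : ∀ {A B D E F G H K : M} {τ : 𝟙_ M ⟶ A} {mu : A ⟶ B} {mr : D ⟶ E} {z : B ⊗ E ⟶ F}
      {z' : A ⊗ D ⟶ G} {ur : G ⟶ F} {ci : F ⟶ H} {bm ap : H ⟶ K} {la : G ⟶ D} {la' : D ⟶ G}
      {k br : D ⟶ K} (_ : bm = ap) (_ : (mu ⊗ₘ mr) ≫ z = z' ≫ ur)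
      (_ : ur ≫ ci ≫ ap = la ≫ k) (_ : br = k) (_ : (λ_ D).inv ≫ τ ▷ D ≫ z' = la')
      (_ : la' ≫ la = 𝟙 D), ((τ ≫ mu) ⊗ₘ mr) ≫ (z ≫ ci) ≫ bm = (λ_ D).hom ≫ br := by
    rintro A B D E F G H K τ mu mr z z' ur ci _ ap la la' k _ rfl h2 h3 rfl h5 h6
    have h7 : ((τ ≫ mu) ⊗ₘ mr) = τ ▷ D ≫ (mu ⊗ₘ mr) := by
      rw [← tensorHom_id, tensorHom_comp_tensorHom, Category.id_comp]
    rw [← cancel_epi (λ_ D).inv, h7, Category.assoc, Category.assoc, reassoc_of% h2, h3,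
      reassoc_of% h5, reassoc_of% h6, Iso.inv_hom_id_assoc]
  exact aux e1 e2 e7 e4 e5 e8

lemma circle_triangle (X Y : SymSeq 𝔠 M) :
    (circleAssoc X (circleUnit 𝔠 M) Y).hom ≫ circleMap (𝟙 X) (circleLeftUnitor Y).hom =
      circleMap (circleRightUnitor X).hom (𝟙 Y) := by
  refine SymSeq.hom_ext fun p => circle_hom_ext fun b s => ?_
  obtain ⟨s, rfl⟩ : ∃ s', s = (conc 𝔠).map (toJoinSingle b) ≫ s' :=
    ⟨inv ((conc 𝔠).map (toJoinSingle b)) ≫ s, (IsIso.hom_inv_id_assoc _ _).symm⟩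
  have e1 := rightUnitInvι_circleι X Y p b s
  have e2 := leftι_circleAssoc_right X (circleUnit 𝔠 M) Y p (singleBr b) s
  have e3 := circleι_circleMap (𝟙 X) (circleLeftUnitor Y).hom p (innerConc.obj (singleBr b))
    (joinConc (singleBr b) ≫ s)
  have e4 := tensUnit_zipι_leftUnitor Y b
  have e5 := circleι_circleMap (circleRightUnitor X).hom (𝟙 Y) p b
    ((conc 𝔠).map (toJoinSingle b) ≫ s)
  have e6 := rightUnitInvι_circleRightUnitor X ((colours 𝔠).obj b, p.2)
  have e7 : (branchesMap (𝟙 Y)).app b = 𝟙 _ :=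
    congrArg (fun α => NatTrans.app α b) (branchesMap_id Y)
  have e8 := circleι_condition X Y p (toConcSingle b) (joinConc (singleBr b) ≫ s)
  have e9 : (conc 𝔠).map (toConcSingle b) ≫ joinConc (singleBr b) ≫ s =
      (conc 𝔠).map (toJoinSingle b) ≫ s :=
    (Category.assoc _ _ _).symm.trans (congrArg (fun t => t ≫ s) (toConcSingle_joinConc b))
  have e10 := (congrArg (fun t => circleι X Y p b t) e9).symm.trans e8
  have e11 : X.toFunctor.map (Prod.mkHom ((colours 𝔠).map (toConcSingle b)) (𝟙 p.2)) = 𝟙 _ :=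
    X.toFunctor.map_id ((colours 𝔠).obj b, p.2)
  have i1 : IsIso (rightUnitInvι X ((colours 𝔠).obj b, p.2)) := inferInstance
  have aux : ∀ {A B D E F G H I K R : M} {q : A ⊗ 𝟙_ M ⟶ R} {c : R ⊗ B ⟶ D} {u : 𝟙_ M ⟶ E}
      {r : B ⟶ F} {l : (A ⊗ E) ⊗ F ⟶ D} {m : D ⟶ G} {zz : E ⊗ F ⟶ H} {d : A ⊗ H ⟶ G} {n : G ⟶ I}
      {bm : H ⟶ K} {d' : A ⊗ K ⟶ I} {bt : B ⟶ K} {cm : D ⟶ I} {rr : R ⟶ A} {o : B ⟶ B}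
      {f : A ⊗ B ⟶ I} {x : A ⟶ A} (_ : IsIso q) (_ : q ▷ B ≫ c = (A ◁ u ⊗ₘ r) ≫ l)
      (_ : l ≫ m = (α_ _ _ _).hom ≫ A ◁ zz ≫ d) (_ : d ≫ n = (𝟙 A ⊗ₘ bm) ≫ d')
      (_ : (u ⊗ₘ r) ≫ zz ≫ bm = (λ_ _).hom ≫ bt) (_ : c ≫ cm = (rr ⊗ₘ o) ≫ f)
      (_ : q ≫ rr = (ρ_ _).hom) (_ : o = 𝟙 B) (_ : f = (x ⊗ₘ bt) ≫ d') (_ : x = 𝟙 A),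
      c ≫ m ≫ n = c ≫ cm := by
    rintro A B D E F G H I K R q c u r l m zz d n bm d' bt cm rr _ _ _ _ h1 h2 h3 h4 h5 h6 rfl
      rfl rfl
    rw [← cancel_epi (q ▷ B), h5, tensorHom_id, ← comp_whiskerRight_assoc, h6, reassoc_of% h1,
      reassoc_of% h2, h3, ← id_tensorHom A u, associator_naturality_assoc, id_tensorHom,
      id_tensorHom, id_tensorHom, ← MonoidalCategory.whiskerLeft_comp_assoc,
      ← MonoidalCategory.whiskerLeft_comp_assoc, Category.assoc, h4, MonoidalCategory.whiskerLeft_comp_assoc,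
      triangle_assoc]
  exact aux i1 e1 e2 e3 e4 e5 e6 e7 e10 e11

end Triangle

section Monoidal

variable (𝔠 : Type w) (M : Type u) [Category.{v} M] [MonoidalCategory M] [SymmetricCategory M]
  [HasColimitsOfSize.{w, w} M] [∀ A : M, PreservesColimitsOfSize.{w, w} (tensorLeft A)]

/-- The monoidal structure on symmetric sequences given by the circle product. -/
noncomputable def circleMonoidal : CircleMonoidal 𝔠 M where
  assoc := circleAssoc
  leftUnitor := circleLeftUnitor
  rightUnitor := circleRightUnitor
  assoc_generator := circleAssoc_generator
  leftUnitor_generator := circleLeftUnitor_generator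
  rightUnitor_generator := circleRightUnitor_generator
  assoc_naturality := circleAssoc_naturality
  leftUnitor_naturality := circleLeftUnitor_naturality
  rightUnitor_naturality := circleRightUnitor_naturality
  pentagon := circleAssoc_pentagon
  triangle := circle_triangle

end Monoidal

section LaxTens

variable {C : Type u₁} [Category.{v₁} C] [MonoidalCategory C] [SymmetricCategory C]
  {D : Type u₂} [Category.{v₂} D] [MonoidalCategory D] [SymmetricCategory D]
  (F : C ⥤ D) [F.LaxBraided]

lemma tensUnit_tensLax (n : ℕ) :
    tensUnit n ≫ tensMap n (fun _ => ε F) ≫ tensLax F n (fun _ => 𝟙_ C) =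
      ε F ≫ F.map (tensUnit n) := by
  induction n with
  | zero => exact (Category.id_comp _).trans ((Category.id_comp _).trans
      ((congrArg (fun t => ε F ≫ t) (F.map_id _)).trans (Category.comp_id _)).symm)
  | succ n ih =>
    have aux : ∀ {T : C} {S S' : D} {u : 𝟙_ D ⟶ S} {e : S ⟶ S'} {l : S' ⟶ F.obj T}
        {m : 𝟙_ C ⟶ T} (_ : u ≫ e ≫ l = ε F ≫ F.map m),
        ((λ_ (𝟙_ D)).inv ≫ 𝟙_ D ◁ u) ≫ (ε F ⊗ₘ e) ≫ F.obj (𝟙_ C) ◁ l ≫ μ F (𝟙_ C) T =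
          ε F ≫ F.map ((λ_ (𝟙_ C)).inv ≫ 𝟙_ C ◁ m) := by
      intro T S S' u e l m h
      rw [MonoidalCategory.tensorHom_def', Category.assoc, Category.assoc,
        ← whisker_exchange_assoc, ← MonoidalCategory.whiskerLeft_comp_assoc,
        ← MonoidalCategory.whiskerLeft_comp_assoc, Category.assoc, h,
        MonoidalCategory.whiskerLeft_comp_assoc, whisker_exchange_assoc,
        Functor.LaxMonoidal.μ_natural_right, F.map_comp, ← leftUnitor_inv_naturality_assoc,
        Functor.LaxMonoidal.left_unitality_inv_assoc]
    exact aux ih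

lemma tensMap_comp_comp_tensLax (n : ℕ) {x y : Fin n → C} {z : Fin n → D}
    {f : ∀ i, x i ⟶ y i} {g : ∀ i, z i ⟶ F.obj (x i)} {k : ∀ i, z i ⟶ F.obj (y i)}
    (h : ∀ i, g i ≫ F.map (f i) = k i) :
    tensMap n k ≫ tensLax F n y = tensMap n g ≫ tensLax F n x ≫ F.map (tensMap n f) := by
  rw [tensLax_tensMap, ← Category.assoc, ← tensMap_comp]
  exact congrArg (fun t => tensMap n t ≫ _) (funext fun i => (h i).symm)

end LaxTens

section Lax

variable {𝔠 : Type w} {M : Type u₁} [Category.{v₁} M] [MonoidalCategory M] [SymmetricCategory M]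
  {N : Type u₂} [Category.{v₂} N] [MonoidalCategory N] [SymmetricCategory N]
  (F : M ⥤ N) [F.LaxBraided]

/-- The canonical comparison morphism for families of families of branches. -/
def branchesLaxJoin (Z : SymSeq 𝔠 M) (h : FinFam (Br 𝔠 × Discrete 𝔠)) :
    tens h.len (fun i => (branches ((SymSeq.map 𝔠 F).obj Z)).obj (h.obj i).1) ⟶
      F.obj (tens h.len (fun i => (branches Z).obj (h.obj i).1)) :=
  tensMap h.len (fun i => (branchesLax F Z).app (h.obj i).1) ≫
    tensLax F h.len (fun i => (branches Z).obj (h.obj i).1)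

lemma branchesJoin_branchesLax (Z : SymSeq 𝔠 M) (h : FinFam (Br 𝔠 × Discrete 𝔠)) :
    branchesJoin ((SymSeq.map 𝔠 F).obj Z) h ≫ (branchesLax F Z).app (joinBr.obj h) =
      branchesLaxJoin F Z h ≫ F.map (branchesJoin Z h) :=
  (tensLax_tensJoin F _ _ _ _ _ _ _).symm.trans (Category.assoc _ _ _).symm

variable [HasColimitsOfSize.{w, w} M] [HasColimitsOfSize.{w, w} N]

lemma branchesMap_branchesLax {Y Y' : SymSeq 𝔠 M} (g : Y ⟶ Y') (b : Br 𝔠) :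
    (branchesMap ((SymSeq.map 𝔠 F).map g)).app b ≫ (branchesLax F Y').app b =
      (branchesLax F Y).app b ≫ F.map ((branchesMap g).app b) := by
  rw [branchesMap_app, branchesMap_app]
  exact (tensLax_tensMap F b.len (fun i => SymSeq.app g (b.obj i))).symm

lemma circleι_circleμ (X Y : SymSeq 𝔠 M) (p : Profile 𝔠 × Discrete 𝔠) (b : Br 𝔠)
    (s : (conc 𝔠).obj b ⟶ p.1) :
    circleι ((SymSeq.map 𝔠 F).obj X) ((SymSeq.map 𝔠 F).obj Y) p b s ≫
        SymSeq.app (circleμ F X Y) p =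
      F.obj (X.toFunctor.obj ((colours 𝔠).obj b, p.2)) ◁ (branchesLax F Y).app b ≫
        μ F _ _ ≫ F.map (circleι X Y p b s) :=
  (ι_circleμApp F X Y p b s).trans (Category.assoc _ _ _)

lemma unitι_circleε (p : Profile 𝔠 × Discrete 𝔠) (s : FinFam.single.obj p.2 ⟶ p.1) :
    unitι N p s ≫ SymSeq.app (circleε F) p = ε F ≫ F.map (unitι M p s) :=
  Limits.Sigma.ι_desc _ s

lemma circleμ_natural {X X' Y Y' : SymSeq 𝔠 M} (f : X ⟶ X') (g : Y ⟶ Y') :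
    circleMap ((SymSeq.map 𝔠 F).map f) ((SymSeq.map 𝔠 F).map g) ≫ circleμ F X' Y' =
      circleμ F X Y ≫ (SymSeq.map 𝔠 F).map (circleMap f g) := by
  refine SymSeq.hom_ext fun p => circle_hom_ext fun b s => ?_
  have e1 := circleι_circleMap ((SymSeq.map 𝔠 F).map f) ((SymSeq.map 𝔠 F).map g) p b s
  have e2 := circleι_circleμ F X' Y' p b s
  have e3 := circleι_circleμ F X Y p b s
  have e4 := circleι_circleMap f g p b s
  have e5 := branchesMap_branchesLax F g b
  have aux : ∀ {A A' B B' D D' : M} {P P' E E' : N} {i : F.obj A ⊗ P ⟶ E} {cm : E ⟶ E'}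
      {f : A ⟶ A'} {bm : P ⟶ P'} {i' : F.obj A' ⊗ P' ⟶ E'} {m' : E' ⟶ F.obj D'}
      {l : P ⟶ F.obj B} {l' : P' ⟶ F.obj B'} {k' : A' ⊗ B' ⟶ D'} {m : E ⟶ F.obj D}
      {k : A ⊗ B ⟶ D} {c : D ⟶ D'} {b : B ⟶ B'} (_ : i ≫ cm = (F.map f ⊗ₘ bm) ≫ i')
      (_ : i' ≫ m' = F.obj A' ◁ l' ≫ μ F _ _ ≫ F.map k')
      (_ : i ≫ m = F.obj A ◁ l ≫ μ F _ _ ≫ F.map k) (_ : k ≫ c = (f ⊗ₘ b) ≫ k')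
      (_ : bm ≫ l' = l ≫ F.map b), i ≫ cm ≫ m' = i ≫ m ≫ F.map c := by
    intro A A' B B' D D' P P' E E' i cm f bm i' m' l l' k' m k c b h1 h2 h3 h4 h5
    rw [reassoc_of% h1, h2, reassoc_of% h3, ← F.map_comp, h4, F.map_comp,
      whiskerLeft_tensorHom_eq h5, Functor.LaxMonoidal.μ_natural_assoc]
  exact aux e1 e2 e3 e4 e5

lemma leftι_circleμ (X Y Z : SymSeq 𝔠 M) (p : Profile 𝔠 × Discrete 𝔠)
    (h : FinFam (Br 𝔠 × Discrete 𝔠)) (s : (conc 𝔠).obj (joinBr.obj h) ⟶ p.1) :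
    leftι ((SymSeq.map 𝔠 F).obj X) ((SymSeq.map 𝔠 F).obj Y) ((SymSeq.map 𝔠 F).obj Z) p h s ≫
        SymSeq.app (circleMap (circleμ F X Y) (𝟙 ((SymSeq.map 𝔠 F).obj Z))) p ≫
        SymSeq.app (circleμ F (circle X Y) Z) p =
      ((F.obj (X.toFunctor.obj ((colours 𝔠).obj (innerColours.obj h), p.2)) ◁
          (branchesLax F Y).app (innerColours.obj h) ≫ μ F _ _) ⊗ₘ branchesLaxJoin F Z h) ≫
        μ F _ _ ≫ F.map (leftι X Y Z p h s) := by
  have e1 := circleι_circleMap (circleμ F X Y) (𝟙 ((SymSeq.map 𝔠 F).obj Z)) p (joinBr.obj h) s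
  have e2 := circleι_circleμ F (circle X Y) Z p (joinBr.obj h) s
  have e3 := circleι_circleμ F X Y ((colours 𝔠).obj (joinBr.obj h), p.2) (innerColours.obj h)
    (joinColours h)
  have e4 := branchesJoin_branchesLax F Z h
  have e5 : (branchesMap (𝟙 ((SymSeq.map 𝔠 F).obj Z))).app (joinBr.obj h) = 𝟙 _ :=
    congrArg (fun α => NatTrans.app α (joinBr.obj h)) (branchesMap_id _)
  have aux : ∀ {A B D E G H : M} {P Q R S U : N} {i : F.obj A ⊗ P ⟶ Q} {j : R ⟶ S}
      {c : Q ⊗ S ⟶ U} {U' : N} {cm : U ⟶ U'} {m : Q ⟶ F.obj D} {o : S ⟶ S}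
      {c' : F.obj D ⊗ S ⟶ U'} {m' : U' ⟶ F.obj H} {l : S ⟶ F.obj E} {k : D ⊗ E ⟶ H}
      {bl : P ⟶ F.obj B} {n : A ⊗ B ⟶ D} {lj : R ⟶ F.obj G} {bj : G ⟶ E}
      (_ : c ≫ cm = (m ⊗ₘ o) ≫ c') (_ : c' ≫ m' = F.obj D ◁ l ≫ μ F _ _ ≫ F.map k)
      (_ : i ≫ m = F.obj A ◁ bl ≫ μ F _ _ ≫ F.map n) (_ : j ≫ l = lj ≫ F.map bj) (_ : o = 𝟙 S),
      ((i ⊗ₘ j) ≫ c) ≫ cm ≫ m' =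
        ((F.obj A ◁ bl ≫ μ F _ _) ⊗ₘ lj) ≫ μ F _ _ ≫ F.map ((n ⊗ₘ bj) ≫ k) := by
    rintro A B D E G H P Q R S U i j c U' cm m _ c' m' l k bl n lj bj h1 h2 h3 h4 rfl
    rw [Category.assoc, reassoc_of% h1, h2, F.map_comp, ← Functor.LaxMonoidal.μ_natural_assoc,
      tensorHom_comp_tensorHom_assoc, tensorHom_comp_tensorHom_assoc, h3, ← h4, Category.assoc,
      Category.comp_id, ← tensorHom_comp_whiskerLeft_assoc]
  exact aux e1 e2 e3 e4 e5

lemma zipι_circleμ (Y Z : SymSeq 𝔠 M) (h : FinFam (Br 𝔠 × Discrete 𝔠)) :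
    zipι ((SymSeq.map 𝔠 F).obj Y) ((SymSeq.map 𝔠 F).obj Z) h ≫
        (branchesMap (circleμ F Y Z)).app (innerConc.obj h) ≫
        (branchesLax F (circle Y Z)).app (innerConc.obj h) =
      ((branchesLax F Y).app (innerColours.obj h) ⊗ₘ branchesLaxJoin F Z h) ≫ μ F _ _ ≫
        F.map (zipι Y Z h) := by
  have e1 := branchesMap_app (circleμ F Y Z) (innerConc.obj h)
  have e2 := fun i : Fin h.len => circleι_circleμ F Y Z
    ((conc 𝔠).obj (h.obj i).1, (h.obj i).2) (h.obj i).1 (𝟙 _)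
  have e3 := tensMap_comp h.len (fun k => circleι ((SymSeq.map 𝔠 F).obj Y)
    ((SymSeq.map 𝔠 F).obj Z) ((conc 𝔠).obj (h.obj k).1, (h.obj k).2) (h.obj k).1 (𝟙 _))
    (fun i => SymSeq.app (circleμ F Y Z) ((conc 𝔠).obj (h.obj i).1, (h.obj i).2))
  have e4 := tensMap_comp_comp_tensLax F h.len
    (g := fun i => F.obj (Y.toFunctor.obj ((colours 𝔠).obj (h.obj i).1, (h.obj i).2)) ◁
      (branchesLax F Z).app (h.obj i).1 ≫ μ F _ _)
    (fun i => (Category.assoc _ _ _).trans (e2 i).symm)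
  have e5 := tensMap_comp h.len
    (fun i => 𝟙 (F.obj (Y.toFunctor.obj ((colours 𝔠).obj (h.obj i).1, (h.obj i).2))) ⊗ₘ
      (branchesLax F Z).app (h.obj i).1)
    (fun i => μ F (Y.toFunctor.obj ((colours 𝔠).obj (h.obj i).1, (h.obj i).2))
      ((branches Z).obj (h.obj i).1))
  have e6 := tensZip_tensMap h.len
    (fun i => 𝟙 (F.obj (Y.toFunctor.obj ((colours 𝔠).obj (h.obj i).1, (h.obj i).2))))
    (fun i => (branchesLax F Z).app (h.obj i).1)
  have e7 := tensLax_tensZip F h.len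
    (fun i => Y.toFunctor.obj ((colours 𝔠).obj (h.obj i).1, (h.obj i).2))
    (fun i => (branches Z).obj (h.obj i).1)
  have e8 := tensMap_id h.len
    (fun i => F.obj (Y.toFunctor.obj ((colours 𝔠).obj (h.obj i).1, (h.obj i).2)))
  have e9 := congrArg (tensMap h.len) (funext fun i => congrArg (fun t => t ≫ μ F _ _)
    (id_tensorHom (F.obj (Y.toFunctor.obj ((colours 𝔠).obj (h.obj i).1, (h.obj i).2)))
      ((branchesLax F Z).app (h.obj i).1)))
  have aux : ∀ {A B D E : M} {P Q R Q' R' U V V' : N} {z : P ⊗ Q ⟶ R} {i : R ⟶ U} {bm tm : U ⟶ V}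
      {bl : V ⟶ F.obj D} {g : R ⟶ V'} {l : V' ⟶ F.obj E} {f : E ⟶ D} {im : R ⟶ V} {t : R ⟶ R'}
      {m : R' ⟶ V'} {o : P ⟶ P} {n : Q ⟶ Q'} {z' : P ⊗ Q' ⟶ R'} {ly : P ⟶ F.obj A}
      {lz : Q' ⟶ F.obj B} {zz : A ⊗ B ⟶ E} (_ : bm = tm) (_ : im = i ≫ tm)
      (_ : im ≫ bl = g ≫ l ≫ F.map f) (_ : t ≫ m = g) (_ : (o ⊗ₘ n) ≫ z' = z ≫ t)
      (_ : (ly ⊗ₘ lz) ≫ μ F _ _ ≫ F.map zz = z' ≫ m ≫ l) (_ : o = 𝟙 P),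
      (z ≫ i) ≫ bm ≫ bl = (ly ⊗ₘ (n ≫ lz)) ≫ μ F _ _ ≫ F.map (zz ≫ f) := by
    rintro A B D E P Q R Q' R' U V V' z i _ tm bl _ l f _ t m _ n z' ly lz zz rfl rfl h3 rfl h5 h6
      rfl
    have h7 : (ly ⊗ₘ (n ≫ lz)) = (𝟙 P ⊗ₘ n) ≫ (ly ⊗ₘ lz) := by
      rw [tensorHom_comp_tensorHom, Category.id_comp]
    rw [h7, F.map_comp, Category.assoc, Category.assoc, reassoc_of% h6, reassoc_of% h5,
      ← Category.assoc i, h3, Category.assoc]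
  exact aux e1 e3 e4 (e5.symm.trans e9) e6 e7 e8

end Lax

section LaxCoherence

variable {𝔠 : Type w} {M : Type u₁} [Category.{v₁} M] [MonoidalCategory M] [SymmetricCategory M]
  {N : Type u₂} [Category.{v₂} N] [MonoidalCategory N] [SymmetricCategory N]
  (F : M ⥤ N) [F.LaxBraided] [HasColimitsOfSize.{w, w} M] [HasColimitsOfSize.{w, w} N]
  [∀ A : M, PreservesColimitsOfSize.{w, w} (tensorLeft A)]
  [∀ A : N, PreservesColimitsOfSize.{w, w} (tensorLeft A)]

lemma circleμ_associativity (X Y Z : SymSeq 𝔠 M) :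
    circleMap (circleμ F X Y) (𝟙 ((SymSeq.map 𝔠 F).obj Z)) ≫ circleμ F (circle X Y) Z ≫
        (SymSeq.map 𝔠 F).map (circleAssoc X Y Z).hom =
      (circleAssoc ((SymSeq.map 𝔠 F).obj X) ((SymSeq.map 𝔠 F).obj Y)
          ((SymSeq.map 𝔠 F).obj Z)).hom ≫
        circleMap (𝟙 ((SymSeq.map 𝔠 F).obj X)) (circleμ F Y Z) ≫ circleμ F X (circle Y Z) := by
  refine SymSeq.hom_ext fun p => left_hom_ext fun h s => ?_
  have e1 := leftι_circleμ F X Y Z p h s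
  have e2 := leftι_circleAssoc_right X Y Z p h s
  have e3 := leftι_circleAssoc_right ((SymSeq.map 𝔠 F).obj X) ((SymSeq.map 𝔠 F).obj Y)
    ((SymSeq.map 𝔠 F).obj Z) p h s
  have e4 := circleι_circleMap (𝟙 ((SymSeq.map 𝔠 F).obj X)) (circleμ F Y Z) p (innerConc.obj h)
    (joinConc h ≫ s)
  have e5 := circleι_circleμ F X (circle Y Z) p (innerConc.obj h) (joinConc h ≫ s)
  have e6 := zipι_circleμ F Y Z h
  have aux : ∀ {A B E D H K : M} {P Q R S S' : N} {i : (F.obj A ⊗ P) ⊗ Q ⟶ R}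
      {a : D ⟶ K} {l : P ⟶ F.obj B} {j : Q ⟶ F.obj E} {k : (A ⊗ B) ⊗ E ⟶ D}
      {z : B ⊗ E ⟶ H} {d : A ⊗ H ⟶ K} {a' : R ⟶ S} {T T' : N} {z' : P ⊗ Q ⟶ T}
      {c : F.obj A ⊗ T ⟶ S} {cm : S ⟶ S'} {bm : T ⟶ T'} {c' : F.obj A ⊗ T' ⟶ S'}
      {m' : S' ⟶ F.obj K} {l' : T' ⟶ F.obj H} {R' : N} {m₁ : R ⟶ R'} {m₂ : R' ⟶ F.obj D}
      (_ : i ≫ m₁ ≫ m₂ = ((F.obj A ◁ l ≫ μ F _ _) ⊗ₘ j) ≫ μ F _ _ ≫ F.map k)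
      (_ : k ≫ a = (α_ _ _ _).hom ≫ A ◁ z ≫ d) (_ : i ≫ a' = (α_ _ _ _).hom ≫ F.obj A ◁ z' ≫ c)
      (_ : c ≫ cm = (𝟙 _ ⊗ₘ bm) ≫ c') (_ : c' ≫ m' = F.obj A ◁ l' ≫ μ F _ _ ≫ F.map d)
      (_ : z' ≫ bm ≫ l' = (l ⊗ₘ j) ≫ μ F _ _ ≫ F.map z),
      i ≫ m₁ ≫ m₂ ≫ F.map a = i ≫ a' ≫ cm ≫ m' := by
    intro A B E D H K P Q R S S' i a l j k z d a' T T' z' c cm bm c' m' l' R' m₁ m₂ h1 h2 h3 h4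
      h5 h6
    have h7 : ((F.obj A ◁ l ≫ μ F A B) ⊗ₘ j) = ((𝟙 (F.obj A) ⊗ₘ l) ⊗ₘ j) ≫ μ F A B ▷ _ := by
      rw [← tensorHom_id, tensorHom_comp_tensorHom, id_tensorHom, Category.comp_id]
    rw [reassoc_of% h1, reassoc_of% h3, reassoc_of% h4, h5, ← F.map_comp, h2, F.map_comp,
      F.map_comp, id_tensorHom, ← MonoidalCategory.whiskerLeft_comp_assoc,
      ← MonoidalCategory.whiskerLeft_comp_assoc, Category.assoc, h6,
      MonoidalCategory.whiskerLeft_comp_assoc, MonoidalCategory.whiskerLeft_comp_assoc,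
      Functor.LaxMonoidal.μ_natural_right_assoc, h7, Category.assoc,
      Functor.LaxMonoidal.associativity_assoc, associator_naturality_assoc, id_tensorHom]
  exact aux e1 e2 e3 e4 e5 e6

lemma circleμ_left_unitality (X : SymSeq 𝔠 M) :
    (circleLeftUnitor ((SymSeq.map 𝔠 F).obj X)).hom =
      circleMap (circleε F) (𝟙 ((SymSeq.map 𝔠 F).obj X)) ≫ circleμ F (circleUnit 𝔠 M) X ≫
        (SymSeq.map 𝔠 F).map (circleLeftUnitor X).hom := by
  refine SymSeq.hom_ext fun p => leftUnit_hom_ext fun q s => ?_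
  have e1 := leftUnitι_circleLeftUnitor X p q s
  have e2 := leftUnitι_circleLeftUnitor ((SymSeq.map 𝔠 F).obj X) p q s
  have e3 := circleι_circleMap (circleε F) (𝟙 ((SymSeq.map 𝔠 F).obj X)) p
    (FinFam.single.obj (q, p.2)) s
  have e4 := circleι_circleμ F (circleUnit 𝔠 M) X p (FinFam.single.obj (q, p.2)) s
  have e5 := unitι_circleε F (FinFam.single.obj p.2, p.2) (𝟙 _)
  have e6 : (branchesMap (𝟙 ((SymSeq.map 𝔠 F).obj X))).app (FinFam.single.obj (q, p.2)) = 𝟙 _ :=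
    congrArg (fun α => NatTrans.app α (FinFam.single.obj (q, p.2))) (branchesMap_id _)
  have e7 := tensLax_one F (X.toFunctor.obj (q, p.2))
  have aux : ∀ {A B D E : M} {P Q Q' : N} {u : 𝟙_ N ⟶ P} {c : P ⊗ (F.obj B ⊗ 𝟙_ N) ⟶ Q}
      {lu : Q ⟶ F.obj A} {x : B ⟶ A} {cm : Q ⟶ Q'} {e : P ⟶ F.obj E}
      {o : F.obj B ⊗ 𝟙_ N ⟶ F.obj B ⊗ 𝟙_ N} {c' : F.obj E ⊗ (F.obj B ⊗ 𝟙_ N) ⟶ Q'}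
      {m : Q' ⟶ F.obj D} {l : F.obj B ⊗ 𝟙_ N ⟶ F.obj (B ⊗ 𝟙_ M)} {k : E ⊗ (B ⊗ 𝟙_ M) ⟶ D}
      {u' : 𝟙_ M ⟶ E} {v : D ⟶ A} (_ : (u' ▷ (B ⊗ 𝟙_ M) ≫ k) ≫ v = (λ_ _).hom ≫ (ρ_ _).hom ≫ x)
      (_ : (u ▷ (F.obj B ⊗ 𝟙_ N) ≫ c) ≫ lu = (λ_ _).hom ≫ (ρ_ _).hom ≫ F.map x)
      (_ : c ≫ cm = (e ⊗ₘ o) ≫ c') (_ : c' ≫ m = F.obj E ◁ l ≫ μ F _ _ ≫ F.map k)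
      (_ : u ≫ e = ε F ≫ F.map u') (_ : o = 𝟙 _) (_ : (ρ_ _).inv ≫ l = F.map (ρ_ B).inv),
      (u ▷ (F.obj B ⊗ 𝟙_ N) ≫ c) ≫ lu =
        (u ▷ (F.obj B ⊗ 𝟙_ N) ≫ c) ≫ cm ≫ m ≫ F.map v := by
    rintro A B D E P Q Q' u c lu x cm e _ c' m l k u' v h1 h2 h3 h4 h5 rfl h7
    have h8 : l ≫ F.map (ρ_ B).hom = (ρ_ (F.obj B)).hom := by
      rw [← cancel_epi (ρ_ (F.obj B)).inv, ← Category.assoc, h7, ← F.map_comp, Iso.inv_hom_id,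
        Iso.inv_hom_id, F.map_id]
    rw [h2, Category.assoc, reassoc_of% h3, reassoc_of% h4, tensorHom_id,
      ← comp_whiskerRight_assoc, h5, comp_whiskerRight_assoc, ← whisker_exchange_assoc (F.map u'),
      Functor.LaxMonoidal.μ_natural_left_assoc, ← F.map_comp, ← F.map_comp, ← Category.assoc (u' ▷ _),
      h1, F.map_comp, F.map_comp, ← whisker_exchange_assoc,
      ← Functor.LaxMonoidal.left_unitality_assoc, leftUnitor_naturality_assoc, reassoc_of% h8]
  exact aux e1 e2 e3 e4 e5 e6 e7

lemma circleμ_right_unitality (X : SymSeq 𝔠 M) :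
    (circleRightUnitor ((SymSeq.map 𝔠 F).obj X)).hom =
      circleMap (𝟙 ((SymSeq.map 𝔠 F).obj X)) (circleε F) ≫ circleμ F X (circleUnit 𝔠 M) ≫
        (SymSeq.map 𝔠 F).map (circleRightUnitor X).hom := by
  refine SymSeq.hom_ext fun p => rightUnit_hom_ext' fun a s => ?_
  have e1 := rightUnitι_circleRightUnitor X p a s
  have e2 := rightUnitι_circleRightUnitor ((SymSeq.map 𝔠 F).obj X) p a s
  have e3 := circleι_circleMap (𝟙 ((SymSeq.map 𝔠 F).obj X)) (circleε F) p (singles.obj a) s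
  have e4 := circleι_circleμ F X (circleUnit 𝔠 M) p (singles.obj a) s
  have e5 := branchesMap_app (circleε (𝔠 := 𝔠) F) (singles.obj a)
  have e6 := tensMap_comp a.len (fun i => unitι N (FinFam.single.obj (a.obj i), a.obj i) (𝟙 _))
    (fun i => SymSeq.app (circleε F) (FinFam.single.obj (a.obj i), a.obj i))
  have e7 := tensMap_comp_comp_tensLax F a.len (g := fun _ => ε F)
    (fun i => (unitι_circleε F (FinFam.single.obj (a.obj i), a.obj i) (𝟙 _)).symm)
  have e8 := tensUnit_tensLax F a.len
  have aux : ∀ {A B D E G : M} {P Q R S S' : N} {t : 𝟙_ N ⟶ P} {u : P ⟶ Q}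
      {c : F.obj A ⊗ Q ⟶ S} {ru : S ⟶ F.obj B} {x : A ⟶ B} {cm : S ⟶ S'} {bm em : Q ⟶ R}
      {c' : F.obj A ⊗ R ⟶ S'} {m : S' ⟶ F.obj D} {l : R ⟶ F.obj E} {k : A ⊗ E ⟶ D} {tu : P ⟶ R}
      {T : N} {te : P ⟶ T} {lt : T ⟶ F.obj G} {u' : G ⟶ E} {t' : 𝟙_ M ⟶ G}
      {v : D ⟶ B} (_ : A ◁ t' ≫ (A ◁ u' ≫ k) ≫ v = (ρ_ _).hom ≫ x)
      (_ : F.obj A ◁ t ≫ (F.obj A ◁ u ≫ c) ≫ ru = (ρ_ _).hom ≫ F.map x)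
      (_ : c ≫ cm = (𝟙 _ ⊗ₘ bm) ≫ c') (_ : c' ≫ m = F.obj A ◁ l ≫ μ F _ _ ≫ F.map k)
      (_ : bm = em) (_ : tu = u ≫ em) (_ : tu ≫ l = te ≫ lt ≫ F.map u')
      (_ : t ≫ te ≫ lt = ε F ≫ F.map t'),
      F.obj A ◁ t ≫ (F.obj A ◁ u ≫ c) ≫ ru =
        F.obj A ◁ t ≫ (F.obj A ◁ u ≫ c) ≫ cm ≫ m ≫ F.map v := by
    rintro A B D E G P Q R S S' t u c ru x cm bm _ c' m l k _ T te lt u' t' v h1 h2 h3 h4 rfl rfl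
      h7 h8
    rw [Category.assoc] at h7
    have h9 : t ≫ u ≫ bm ≫ l = ε F ≫ F.map (t' ≫ u') := by
      rw [h7, reassoc_of% h8, F.map_comp]
    rw [h2, Category.assoc, reassoc_of% h3, reassoc_of% h4, id_tensorHom,
      ← MonoidalCategory.whiskerLeft_comp_assoc, ← MonoidalCategory.whiskerLeft_comp_assoc,
      ← MonoidalCategory.whiskerLeft_comp_assoc, Category.assoc, Category.assoc, h9,
      MonoidalCategory.whiskerLeft_comp_assoc, Functor.LaxMonoidal.μ_natural_right_assoc,
      ← F.map_comp, ← F.map_comp, MonoidalCategory.whiskerLeft_comp_assoc, ← Category.assoc (A ◁ u'),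
      h1, F.map_comp, ← Functor.LaxMonoidal.right_unitality_assoc]
  exact aux e1 e2 e3 e4 e5 e6 e7 e8

end LaxCoherence

section NatTrans

variable {C : Type u₁} [Category.{v₁} C] [MonoidalCategory C] [SymmetricCategory C]
  {D : Type u₂} [Category.{v₂} D] [MonoidalCategory D] [SymmetricCategory D]
  {E : Type u} [Category.{v} E] [MonoidalCategory E] [SymmetricCategory E]
  {F G : C ⥤ D} [F.LaxBraided] [G.LaxBraided] (H : D ⥤ E) [H.LaxBraided]

lemma tensLax_natTrans (α : F ⟶ G) [NatTrans.IsMonoidal α] (n : ℕ) (x : Fin n → C) :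
    tensMap n (fun i => α.app (x i)) ≫ tensLax G n x = tensLax F n x ≫ α.app (tens n x) := by
  induction n with
  | zero => exact (Category.id_comp _).trans (NatTrans.IsMonoidal.unit (τ := α)).symm
  | succ n ih =>
    have aux : ∀ {A T : C} {S S' : D} {e : S ⟶ S'} {l' : S' ⟶ G.obj T} {l : S ⟶ F.obj T}
        (_ : e ≫ l' = l ≫ α.app T), (α.app A ⊗ₘ e) ≫ G.obj A ◁ l' ≫ μ G A T =
          (F.obj A ◁ l ≫ μ F A T) ≫ α.app (A ⊗ T) := by
      intro A T S S' e l' l h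
      rw [whiskerLeft_tensorHom_eq h, Category.assoc, NatTrans.IsMonoidal.tensor (τ := α)]
    exact aux (ih _)

lemma tensLax_comp (n : ℕ) (x : Fin n → C) :
    tensLax (F ⋙ H) n x = tensLax H n (fun i => F.obj (x i)) ≫ H.map (tensLax F n x) := by
  induction n with
  | zero => exact Functor.LaxMonoidal.comp_ε F H
  | succ n ih =>
    have aux : ∀ {A T : C} {S : D} {R : E} {l : R ⟶ H.obj S} {k : S ⟶ F.obj T}
        {t : R ⟶ H.obj (F.obj T)} (_ : t = l ≫ H.map k),
        H.obj (F.obj A) ◁ t ≫ μ H _ _ ≫ H.map (μ F A T) =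
          (H.obj (F.obj A) ◁ l ≫ μ H _ _) ≫ H.map (F.obj A ◁ k ≫ μ F A T) := by
      rintro A T S R l k t rfl
      rw [H.map_comp, Category.assoc, ← Functor.LaxMonoidal.μ_natural_right_assoc,
        MonoidalCategory.whiskerLeft_comp_assoc]
    exact aux (ih _)

lemma tensLax_id (n : ℕ) (x : Fin n → C) : tensLax (𝟭 C) n x = 𝟙 _ := by
  induction n with
  | zero => rfl
  | succ n ih =>
    have aux : ∀ {A T : C} {t : T ⟶ T} (_ : t = 𝟙 T), A ◁ t ≫ μ (𝟭 C) A T = 𝟙 (A ⊗ T) := by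
      rintro A T _ rfl
      rw [MonoidalCategory.whiskerLeft_id, Category.id_comp]
      rfl
    exact aux (ih _)

/-- Postcomposition of a symmetric sequence with a natural transformation. -/
def whiskerNat {𝔠 : Type w} (α : F ⟶ G) (X : SymSeq 𝔠 C) :
    (SymSeq.map 𝔠 F).obj X ⟶ (SymSeq.map 𝔠 G).obj X :=
  SymSeq.mkHom (fun p => α.app (X.toFunctor.obj p)) fun s => α.naturality (X.toFunctor.map s)

variable {𝔠 : Type w} [HasColimitsOfSize.{w, w} C] [HasColimitsOfSize.{w, w} D]
  [HasColimitsOfSize.{w, w} E]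

lemma circleμ_natTrans (α : F ⟶ G) [NatTrans.IsMonoidal α] (X Y : SymSeq 𝔠 C) :
    circleMap (whiskerNat α X) (whiskerNat α Y) ≫ circleμ G X Y =
      circleμ F X Y ≫ whiskerNat α (circle X Y) := by
  refine SymSeq.hom_ext fun p => circle_hom_ext fun b s => ?_
  have e1 := circleι_circleMap (whiskerNat α X) (whiskerNat α Y) p b s
  have e2 := circleι_circleμ G X Y p b s
  have e3 := circleι_circleμ F X Y p b s
  have e4 := branchesMap_app (whiskerNat α Y) b
  have e5 := tensLax_natTrans α b.len (fun i => Y.toFunctor.obj (b.obj i))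
  have aux : ∀ {A B T : C} {P Q R S : D} {i : F.obj A ⊗ P ⟶ R} {cm : R ⟶ S} {bm t : P ⟶ Q}
      {i' : G.obj A ⊗ Q ⟶ S} {m' : S ⟶ G.obj T} {l' : Q ⟶ G.obj B} {k : A ⊗ B ⟶ T}
      {m : R ⟶ F.obj T} {l : P ⟶ F.obj B} (_ : i ≫ cm = (α.app A ⊗ₘ bm) ≫ i')
      (_ : i' ≫ m' = G.obj A ◁ l' ≫ μ G _ _ ≫ G.map k)
      (_ : i ≫ m = F.obj A ◁ l ≫ μ F _ _ ≫ F.map k) (_ : bm = t) (_ : t ≫ l' = l ≫ α.app B),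
      i ≫ cm ≫ m' = i ≫ m ≫ α.app T := by
    rintro A B T P Q R S i cm bm _ i' m' l' k m l h1 h2 h3 rfl h5
    rw [reassoc_of% h1, h2, reassoc_of% h3, whiskerLeft_tensorHom_eq h5,
      ← NatTrans.IsMonoidal.tensor_assoc (τ := α), α.naturality]
  exact aux e1 e2 e3 e4 e5

lemma circleε_natTrans (α : F ⟶ G) [NatTrans.IsMonoidal α] :
    circleε F ≫ whiskerNat α (circleUnit 𝔠 C) = circleε G := by
  refine SymSeq.hom_ext fun p => Limits.Sigma.hom_ext _ _ fun s => ?_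
  have e1 := unitι_circleε F p s
  have e2 := unitι_circleε G p s
  have aux : ∀ {P : D} {T : C} {u : 𝟙_ D ⟶ P} {e : P ⟶ F.obj T} {e' : P ⟶ G.obj T}
      {u' : 𝟙_ C ⟶ T} (_ : u ≫ e = ε F ≫ F.map u') (_ : u ≫ e' = ε G ≫ G.map u'),
      u ≫ e ≫ α.app T = u ≫ e' := by
    intro P T u e e' u' h1 h2
    rw [reassoc_of% h1, h2, α.naturality, NatTrans.IsMonoidal.unit_assoc (τ := α)]
  exact aux e1 e2

lemma circleμ_comp (X Y : SymSeq 𝔠 C) :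
    circleμ (F ⋙ H) X Y =
      circleμ H ((SymSeq.map 𝔠 F).obj X) ((SymSeq.map 𝔠 F).obj Y) ≫
        (SymSeq.map 𝔠 H).map (circleμ F X Y) := by
  refine SymSeq.hom_ext fun p => circle_hom_ext fun b s => ?_
  have e1 := circleι_circleμ (F ⋙ H) X Y p b s
  have e2 := circleι_circleμ H ((SymSeq.map 𝔠 F).obj X) ((SymSeq.map 𝔠 F).obj Y) p b s
  have e3 := circleι_circleμ F X Y p b s
  have e4 : (branchesLax (F ⋙ H) Y).app b = _ :=
    tensLax_comp (F := F) H b.len (fun i => Y.toFunctor.obj (b.obj i))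
  have aux : ∀ {A B T : C} {P Q : D} {R S : E} {i : H.obj (F.obj A) ⊗ R ⟶ S}
      {m : S ⟶ H.obj (F.obj T)} {t : R ⟶ H.obj (F.obj B)} {k : A ⊗ B ⟶ T} {m₁ : S ⟶ H.obj Q}
      {l : R ⟶ H.obj P} {n : F.obj A ⊗ P ⟶ Q} {c : Q ⟶ F.obj T} {l' : P ⟶ F.obj B}
      (_ : i ≫ m = H.obj (F.obj A) ◁ t ≫ (μ H _ _ ≫ H.map (μ F _ _)) ≫ H.map (F.map k))
      (_ : i ≫ m₁ = H.obj (F.obj A) ◁ l ≫ μ H _ _ ≫ H.map n)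
      (_ : n ≫ c = F.obj A ◁ l' ≫ μ F _ _ ≫ F.map k) (_ : t = l ≫ H.map l'),
      i ≫ m = i ≫ m₁ ≫ H.map c := by
    rintro A B T P Q R S i m t k m₁ l n c l' h1 h2 h3 rfl
    rw [h1, reassoc_of% h2, ← H.map_comp, h3, H.map_comp, H.map_comp,
      ← Functor.LaxMonoidal.μ_natural_right_assoc, MonoidalCategory.whiskerLeft_comp_assoc,
      Category.assoc]
  exact aux e1 e2 e3 e4

lemma circleε_comp : circleε (𝔠 := 𝔠) (F ⋙ H) = circleε H ≫ (SymSeq.map 𝔠 H).map (circleε F) := by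
  refine SymSeq.hom_ext fun p => Limits.Sigma.hom_ext _ _ fun s => ?_
  have e1 := unitι_circleε (F ⋙ H) p s
  have e2 := unitι_circleε H p s
  have e3 := unitι_circleε F p s
  have aux : ∀ {P : E} {Q : D} {T : C} {u : 𝟙_ E ⟶ P} {e : P ⟶ H.obj (F.obj T)}
      {e' : P ⟶ H.obj Q} {d : Q ⟶ F.obj T} {u' : 𝟙_ D ⟶ Q} {u'' : 𝟙_ C ⟶ T}
      (_ : u ≫ e = ε (F ⋙ H) ≫ (F ⋙ H).map u'') (_ : u ≫ e' = ε H ≫ H.map u')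
      (_ : u' ≫ d = ε F ≫ F.map u''), u ≫ e = u ≫ e' ≫ H.map d := by
    intro P Q T u e e' d u' u'' h1 h2 h3
    rw [h1, reassoc_of% h2, ← H.map_comp, h3, Functor.LaxMonoidal.comp_ε, H.map_comp,
      Category.assoc, Functor.comp_map]
  exact aux e1 e2 e3

lemma circleμ_id (X Y : SymSeq 𝔠 C) : circleμ (𝟭 C) X Y = 𝟙 (circle X Y) := by
  refine SymSeq.hom_ext fun p => circle_hom_ext fun b s => ?_
  have e1 := circleι_circleμ (𝟭 C) X Y p b s
  have e2 := tensLax_id (C := C) b.len (fun i => Y.toFunctor.obj (b.obj i))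
  have aux : ∀ {A B T : C} {i : A ⊗ B ⟶ T} {m : T ⟶ T} {l : B ⟶ B}
      (_ : i ≫ m = A ◁ l ≫ μ (𝟭 C) A B ≫ i) (_ : l = 𝟙 B), i ≫ m = i ≫ 𝟙 T := by
    rintro A B T i m _ h rfl
    rw [h, MonoidalCategory.whiskerLeft_id, Category.id_comp, Category.comp_id]
    exact Category.id_comp i
  exact aux e1 e2

lemma circleε_id : circleε (𝔠 := 𝔠) (𝟭 C) = 𝟙 (circleUnit 𝔠 C) := by
  refine SymSeq.hom_ext fun p => Limits.Sigma.hom_ext _ _ fun s => ?_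
  exact (unitι_circleε (𝟭 C) p s).trans ((Category.id_comp _).trans (Category.comp_id _).symm)

end NatTrans

section LaxMonoidal

variable (𝔠 : Type w) {M : Type u₁} [Category.{v₁} M] [MonoidalCategory M] [SymmetricCategory M]
  {N : Type u₂} [Category.{v₂} N] [MonoidalCategory N] [SymmetricCategory N]
  (F : M ⥤ N) [F.LaxBraided] [HasColimitsOfSize.{w, w} M] [HasColimitsOfSize.{w, w} N]
  [∀ A : M, PreservesColimitsOfSize.{w, w} (tensorLeft A)]
  [∀ A : N, PreservesColimitsOfSize.{w, w} (tensorLeft A)]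

/-- Postcomposition with a lax symmetric monoidal functor is lax monoidal for the circle
products. -/
@[reducible]
noncomputable def laxMonoidalMap :
    letI := (circleMonoidal 𝔠 M).monoidalCategory
    letI := (circleMonoidal 𝔠 N).monoidalCategory
    (SymSeq.map 𝔠 F).LaxMonoidal :=
  letI := (circleMonoidal 𝔠 M).monoidalCategory
  letI := (circleMonoidal 𝔠 N).monoidalCategory
  { ε := circleε F
    μ := circleμ F
    μ_natural_left := fun f Y =>
      (congrArg (fun t => circleMap _ t ≫ _) ((SymSeq.map 𝔠 F).map_id Y).symm).trans
        (circleμ_natural F f (𝟙 Y))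
    μ_natural_right := fun X g =>
      (congrArg (fun t => circleMap t _ ≫ _) ((SymSeq.map 𝔠 F).map_id X).symm).trans
        (circleμ_natural F (𝟙 X) g)
    associativity := circleμ_associativity F
    left_unitality := circleμ_left_unitality F
    right_unitality := circleμ_right_unitality F }

end LaxMonoidal

section Involution

variable (𝔠 : Type w) (M : Type u) [Category.{v} M] [MonoidalCategory M] [SymmetricCategory M]
  [HasColimitsOfSize.{w, w} M] [∀ A : M, PreservesColimitsOfSize.{w, w} (tensorLeft A)]
  [InvolutiveCategory M] [InvolutiveSymmetricMonoidalCategory M]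

/-- The involutive monoidal structure on symmetric sequences. -/
noncomputable def circleInvolution : CircleInvolution (circleMonoidal 𝔠 M) where
  toInvolutive :=
    letI := (circleMonoidal 𝔠 M).monoidalCategory
    letI : (invJ (SymSeq 𝔠 M)).LaxMonoidal := laxMonoidalMap 𝔠 (invJ M)
    { laxJ := laxMonoidalMap 𝔠 (invJ M)
      isMonoidal_j :=
        { unit := by
            have e1 := circleε_natTrans (𝔠 := 𝔠) (invj M).hom
            have e2 := circleε_id (𝔠 := 𝔠) (C := M)
            have e3 := circleε_comp (𝔠 := 𝔠) (F := invJ M) (invJ M)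
            exact (congrArg (fun t => t ≫ whiskerNat (invj M).hom (circleUnit 𝔠 M)) e2).symm.trans
              (e1.trans e3)
          tensor := fun X Y => by
            have e1 := circleμ_natTrans (invj M).hom X Y
            have e2 := circleμ_id X Y
            have e3 := circleμ_comp (F := invJ M) (invJ M) X Y
            exact (congrArg (fun t => t ≫ whiskerNat (invj M).hom (circle X Y)) e2).symm.trans
              (e1.symm.trans (congrArg (fun t => circleMap (whiskerNat (invj M).hom X)
                (whiskerNat (invj M).hom Y) ≫ t) e3)) } }
  μ_eq _ _ := rfl
  ε_eq := rfl

end Involution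

section Strong

variable {C : Type u₁} [Category.{v₁} C] [MonoidalCategory C] [SymmetricCategory C]
  {D : Type u₂} [Category.{v₂} D] [MonoidalCategory D] [SymmetricCategory D]
  (F : C ⥤ D) [F.LaxBraided] [IsIso (ε F)] [∀ A B, IsIso (μ F A B)]

lemma isIso_tensLax (n : ℕ) : ∀ x : Fin n → C, IsIso (tensLax F n x) := by
  induction n with
  | zero => exact fun x => inferInstanceAs (IsIso (ε F))
  | succ n ih =>
    intro x
    have := ih fun i => x i.succ
    exact inferInstanceAs (IsIso (F.obj (x 0) ◁ tensLax F n (fun i => x i.succ) ≫ μ F (x 0) _))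

variable {𝔠 : Type w}

instance (X Y : SymSeq 𝔠 C) (t : Discrete 𝔠) : IsIso (circleTermLax F X Y t) := by
  have : ∀ b, IsIso ((circleTermLax F X Y t).app b) := fun b => by
    have : IsIso ((branchesLax F Y).app b) := isIso_tensLax F b.len _
    exact inferInstanceAs (IsIso (F.obj (X.toFunctor.obj ((colours 𝔠).obj b, t)) ◁
      (branchesLax F Y).app b ≫ μ F _ _))
  exact NatIso.isIso_of_isIso_app _

variable [HasColimitsOfSize.{w, w} C] [HasColimitsOfSize.{w, w} D]
  [PreservesColimitsOfSize.{w, w} F] [∀ A : D, PreservesColimitsOfSize.{w, w} (tensorLeft A)]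

lemma isIso_circleμ (X Y : SymSeq 𝔠 C) : IsIso (circleμ F X Y) := by
  refine isIso_of_isIso_app _ fun p => ?_
  let w : CostructuredArrow.proj (conc 𝔠) p.1 ⋙
      circleTerm ((SymSeq.map 𝔠 F).obj X) ((SymSeq.map 𝔠 F).obj Y) p.2 ≅
      (CostructuredArrow.proj (conc 𝔠) p.1 ⋙ circleTerm X Y p.2) ⋙ F :=
    Functor.isoWhiskerLeft _ (asIso (circleTermLax F X Y p.2))
  let e := IsColimit.coconePointsIsoOfNatIso (wcoend.isColimit (conc 𝔠) _ p.1)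
    (isColimitOfPreserves F (wcoend.isColimit (conc 𝔠) (circleTerm X Y p.2) p.1)) w
  have h : SymSeq.app (circleμ F X Y) p = e.hom := circle_hom_ext fun b s =>
    (ι_circleμApp F X Y p b s).trans (IsColimit.comp_coconePointsIsoOfNatIso_hom
      (wcoend.isColimit (conc 𝔠) _ p.1) (isColimitOfPreserves F
        (wcoend.isColimit (conc 𝔠) (circleTerm X Y p.2) p.1)) w (CostructuredArrow.mk s)).symm
  exact (congrArg (fun f => IsIso f) h).mpr e.isIso_hom

lemma isIso_circleε : IsIso (circleε (𝔠 := 𝔠) F) := by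
  refine isIso_of_isIso_app _ fun p => ?_
  let w : Discrete.functor (fun _ : (FinFam.single.obj p.2 ⟶ p.1) => 𝟙_ D) ≅
      Discrete.functor (fun _ : (FinFam.single.obj p.2 ⟶ p.1) => 𝟙_ C) ⋙ F :=
    Discrete.natIso fun _ => asIso (ε F)
  let e := IsColimit.coconePointsIsoOfNatIso (colimit.isColimit _)
    (isColimitOfPreserves F (colimit.isColimit
      (Discrete.functor (fun _ : (FinFam.single.obj p.2 ⟶ p.1) => 𝟙_ C)))) w
  have h : SymSeq.app (circleε F) p = e.hom := Limits.Sigma.hom_ext _ _ fun s =>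
    (unitι_circleε F p s).trans (IsColimit.comp_coconePointsIsoOfNatIso_hom (colimit.isColimit _)
      (isColimitOfPreserves F (colimit.isColimit
        (Discrete.functor (fun _ : (FinFam.single.obj p.2 ⟶ p.1) => 𝟙_ C)))) w ⟨s⟩).symm
  exact (congrArg (fun f => IsIso f) h).mpr e.isIso_hom

end Strong

section StarColimits

variable (C : Type u) [Category.{v} C] [InvolutiveCategory C]

instance : (StarObj.forget C).ReflectsIsomorphisms where
  reflects {A B} f h := by
    have : IsIso f.hom := h
    exact (StarObj.mkIso (asIso f.hom) f.comm).isIso_hom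

variable [HasColimitsOfSize.{w, w} C]

instance : PreservesColimitsOfSize.{w, w} (StarObj.forget C) where
  preservesColimitsOfShape {_} _ := ⟨fun {F} => preservesColimit_of_preserves_colimit_cocone
    (StarObj.colimIsColimit F) (IsColimit.ofIsoColimit (colimit.isColimit (F ⋙ StarObj.forget C))
      (Cocone.ext (Iso.refl _) fun _ => Category.comp_id _))⟩

instance : ReflectsColimitsOfSize.{w, w} (StarObj.forget C) :=
  reflectsColimits_of_reflectsIsomorphisms

instance [MonoidalCategory C] [InvolutiveMonoidalCategory C]
    [∀ A : C, PreservesColimitsOfSize.{w, w} (tensorLeft A)] (A : StarObj C) :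
    PreservesColimitsOfSize.{w, w} (tensorLeft A) :=
  have : PreservesColimitsOfSize.{w, w} (tensorLeft A ⋙ StarObj.forget C) :=
    inferInstanceAs (PreservesColimitsOfSize.{w, w} (StarObj.forget C ⋙ tensorLeft A.obj))
  preservesColimits_of_reflects_of_preserves (tensorLeft A) (StarObj.forget C)

end StarColimits

section StarNat

variable (C : Type u) [Category.{v} C] [MonoidalCategory C] [InvolutiveCategory C]
  [InvolutiveMonoidalCategory C]

instance : IsIso (ε (StarObj.forget C)) := inferInstanceAs (IsIso (𝟙 (𝟙_ C)))

instance (A B : StarObj C) : IsIso (μ (StarObj.forget C) A B) :=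
  inferInstanceAs (IsIso (𝟙 (A.obj ⊗ B.obj)))

/-- The involutions of `*`-objects form a natural transformation. -/
def forgetStar : StarObj.forget C ⟶ StarObj.forget C ⋙ invJ C where
  app A := A.star
  naturality _ _ f := f.comm.symm

instance : NatTrans.IsMonoidal (forgetStar C) where
  unit := (Category.id_comp _).trans ((congrArg (fun t => ε (invJ C) ≫ t)
    ((invJ C).map_id _)).trans (Category.comp_id _)).symm
  tensor A B := (Category.id_comp _).trans (congrArg (fun t => (A.star ⊗ₘ B.star) ≫ t)
    ((congrArg (fun t => μ (invJ C) A.obj B.obj ≫ t) ((invJ C).map_id _)).trans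
      (Category.comp_id _))).symm

end StarNat

section Comparison

variable {𝔠 : Type w} {M : Type u} [Category.{v} M] [MonoidalCategory M] [SymmetricCategory M]
  [HasColimitsOfSize.{w, w} M] [InvolutiveCategory M] [InvolutiveSymmetricMonoidalCategory M]

lemma map_forget_injective {X Y : SymSeq 𝔠 (StarObj M)} {f g : X ⟶ Y}
    (h : (SymSeq.map 𝔠 (StarObj.forget M)).map f = (SymSeq.map 𝔠 (StarObj.forget M)).map g) :
    f = g :=
  SymSeq.hom_ext fun p => StarObj.hom_ext (congrArg (fun t => SymSeq.app t p) h)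

lemma circleμ_forget_star (A B : StarObj (SymSeq 𝔠 M)) :
    (circleMap A.star B.star ≫ circleμ (invJ M) A.obj B.obj) ≫ (SymSeq.map 𝔠 (invJ M)).map
        (circleμ (StarObj.forget M) ((starSymSeq 𝔠 M).obj A) ((starSymSeq 𝔠 M).obj B)) =
      circleμ (StarObj.forget M) ((starSymSeq 𝔠 M).obj A) ((starSymSeq 𝔠 M).obj B) ≫
        whiskerNat (forgetStar M) (circle ((starSymSeq 𝔠 M).obj A) ((starSymSeq 𝔠 M).obj B)) := by
  have e1 := circleμ_natTrans (forgetStar M) ((starSymSeq 𝔠 M).obj A) ((starSymSeq 𝔠 M).obj B)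
  have e2 := circleμ_comp (F := StarObj.forget M) (invJ M) ((starSymSeq 𝔠 M).obj A)
    ((starSymSeq 𝔠 M).obj B)
  exact (Category.assoc _ _ _).trans ((congrArg (fun t => circleMap A.star B.star ≫ t) e2).symm.trans
    e1)

lemma circleε_forget_star :
    circleε (invJ M) ≫ (SymSeq.map 𝔠 (invJ M)).map (circleε (StarObj.forget M)) =
      circleε (StarObj.forget M) ≫ whiskerNat (forgetStar M) (circleUnit 𝔠 (StarObj M)) :=
  (circleε_comp (F := StarObj.forget M) (invJ M)).symm.trans
    (circleε_natTrans (forgetStar M)).symm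

variable [∀ A : M, PreservesColimitsOfSize.{w, w} (tensorLeft A)]

variable (𝔠 M) in
/-- The monoidal category of symmetric sequences. -/
@[reducible]
noncomputable def circleMonoidalCategory : MonoidalCategory (SymSeq 𝔠 M) :=
  (circleMonoidal 𝔠 M).monoidalCategory

attribute [local instance] circleMonoidalCategory

variable (𝔠 M) in
/-- The involutive monoidal category of symmetric sequences. -/
@[reducible]
noncomputable def circleInvolutive : InvolutiveMonoidalCategory (SymSeq 𝔠 M) :=
  (circleInvolution 𝔠 M).toInvolutive

attribute [local instance] circleInvolutive

/-- The canonical morphism from the tensor product of `*`-objects to the circle product of the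
associated symmetric sequences. -/
noncomputable def starδ (A B : StarObj (SymSeq 𝔠 M)) :
    (starSymSeq 𝔠 M).obj (A ⊗ B) ⟶ (starSymSeq 𝔠 M).obj A ⊗ (starSymSeq 𝔠 M).obj B :=
  SymSeq.mkHom (fun p => ⟨SymSeq.app (circleμ (StarObj.forget M) ((starSymSeq 𝔠 M).obj A)
      ((starSymSeq 𝔠 M).obj B)) p,
      congrArg (fun t => SymSeq.app t p) (circleμ_forget_star A B)⟩)
    fun s => StarObj.hom_ext (SymSeq.naturality (circleμ (StarObj.forget M)
      ((starSymSeq 𝔠 M).obj A) ((starSymSeq 𝔠 M).obj B)) s)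

variable (𝔠 M) in
/-- The canonical morphism from the unit `*`-object to the circle unit. -/
noncomputable def starη : (starSymSeq 𝔠 M).obj (𝟙_ (StarObj (SymSeq 𝔠 M))) ⟶
    𝟙_ (SymSeq 𝔠 (StarObj M)) :=
  SymSeq.mkHom (fun p => ⟨SymSeq.app (circleε (StarObj.forget M)) p,
      congrArg (fun t => SymSeq.app t p) circleε_forget_star⟩)
    fun s => StarObj.hom_ext (SymSeq.naturality (circleε (StarObj.forget M)) s)

instance (A B : StarObj (SymSeq 𝔠 M)) : IsIso (starδ A B) := by
  refine isIso_of_isIso_app _ fun p => ?_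
  have h := isIso_circleμ (StarObj.forget M) ((starSymSeq 𝔠 M).obj A) ((starSymSeq 𝔠 M).obj B)
  have : IsIso ((StarObj.forget M).map (SymSeq.app (starδ A B) p)) :=
    @NatIso.isIso_app_of_isIso _ _ _ _ _ _ (circleμ (StarObj.forget M)
      ((starSymSeq 𝔠 M).obj A) ((starSymSeq 𝔠 M).obj B)) h p
  exact isIso_of_reflects_iso _ (StarObj.forget M)

instance : IsIso (starη 𝔠 M) := by
  refine isIso_of_isIso_app _ fun p => ?_
  have h := isIso_circleε (𝔠 := 𝔠) (StarObj.forget M)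
  have : IsIso ((StarObj.forget M).map (SymSeq.app (starη 𝔠 M) p)) :=
    @NatIso.isIso_app_of_isIso _ _ _ _ _ _ (circleε (StarObj.forget M)) h p
  exact isIso_of_reflects_iso _ (StarObj.forget M)

variable (𝔠 M) in
/-- The canonical oplax monoidal structure on the comparison functor. -/
@[reducible]
noncomputable def starOplax : (starSymSeq 𝔠 M).OplaxMonoidal where
  η := starη 𝔠 M
  δ := starδ
  δ_natural_left {A A'} f B := map_forget_injective
    (circleμ_natural (StarObj.forget M) ((starSymSeq 𝔠 M).map f) (𝟙 ((starSymSeq 𝔠 M).obj B))).symm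
  δ_natural_right {B B'} A f := map_forget_injective
    (circleμ_natural (StarObj.forget M) (𝟙 ((starSymSeq 𝔠 M).obj A)) ((starSymSeq 𝔠 M).map f)).symm
  oplax_associativity A B D := map_forget_injective (by
    have e1 := circleμ_natural (StarObj.forget M) (starδ A B) (𝟙 ((starSymSeq 𝔠 M).obj D))
    have e2 := circleμ_associativity (StarObj.forget M) ((starSymSeq 𝔠 M).obj A)
      ((starSymSeq 𝔠 M).obj B) ((starSymSeq 𝔠 M).obj D)
    have e3 := circleμ_natural (StarObj.forget M) (𝟙 ((starSymSeq 𝔠 M).obj A)) (starδ B D)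
    have aux : ∀ {P Q R S T U V W : SymSeq 𝔠 M} {c : P ⟶ Q} {m : Q ⟶ R} {m' : P ⟶ S} {d : S ⟶ R}
        {a : R ⟶ T} {b : P ⟶ U} {c' : U ⟶ V} {n : V ⟶ T} {n' : U ⟶ W} {d' : W ⟶ T}
        (_ : c ≫ m = m' ≫ d) (_ : c ≫ m ≫ a = b ≫ c' ≫ n) (_ : c' ≫ n = n' ≫ d'),
        m' ≫ d ≫ a = b ≫ n' ≫ d' := by
      intro P Q R S T U V W c m m' d a b c' n n' d' h1 h2 h3
      rw [← reassoc_of% h1, h2, h3]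
    exact aux e1 e2 e3)
  oplax_left_unitality A := map_forget_injective (by
    have e1 := circleμ_natural (StarObj.forget M) (starη 𝔠 M) (𝟙 ((starSymSeq 𝔠 M).obj A))
    have e2 := circleμ_left_unitality (StarObj.forget M) ((starSymSeq 𝔠 M).obj A)
    have e3 := ((SymSeq.map 𝔠 (StarObj.forget M)).mapIso
      (circleLeftUnitor ((starSymSeq 𝔠 M).obj A))).hom_inv_id
    have aux : ∀ {P Q R S T : SymSeq 𝔠 M} {l : P ≅ T} {c : P ⟶ Q} {m : Q ⟶ R} {a : R ⟶ T}
        {b : T ⟶ R} {m' : P ⟶ S} {d : S ⟶ R} (_ : c ≫ m = m' ≫ d) (_ : l.hom = c ≫ m ≫ a)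
        (_ : a ≫ b = 𝟙 _), b = l.inv ≫ m' ≫ d := by
      intro P Q R S T l c m a b m' d h1 h2 h3
      rw [← h1, Iso.eq_inv_comp, h2, Category.assoc, Category.assoc, h3, Category.comp_id]
    exact aux e1 e2 e3)
  oplax_right_unitality A := map_forget_injective (by
    have e1 := circleμ_natural (StarObj.forget M) (𝟙 ((starSymSeq 𝔠 M).obj A)) (starη 𝔠 M)
    have e2 := circleμ_right_unitality (StarObj.forget M) ((starSymSeq 𝔠 M).obj A)
    have e3 := ((SymSeq.map 𝔠 (StarObj.forget M)).mapIso
      (circleRightUnitor ((starSymSeq 𝔠 M).obj A))).hom_inv_id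
    have aux : ∀ {P Q R S T : SymSeq 𝔠 M} {l : P ≅ T} {c : P ⟶ Q} {m : Q ⟶ R} {a : R ⟶ T}
        {b : T ⟶ R} {m' : P ⟶ S} {d : S ⟶ R} (_ : c ≫ m = m' ≫ d) (_ : l.hom = c ≫ m ≫ a)
        (_ : a ≫ b = 𝟙 _), b = l.inv ≫ m' ≫ d := by
      intro P Q R S T l c m a b m' d h1 h2 h3
      rw [← h1, Iso.eq_inv_comp, h2, Category.assoc, Category.assoc, h3, Category.comp_id]
    exact aux e1 e2 e3)

variable (𝔠 M) in
/-- The canonical strong monoidal structure on the comparison functor. -/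
@[reducible]
noncomputable def starMonoidal : (starSymSeq 𝔠 M).Monoidal :=
  letI : (starSymSeq 𝔠 M).OplaxMonoidal := starOplax 𝔠 M
  haveI : ∀ A B, IsIso (Functor.OplaxMonoidal.δ (starSymSeq 𝔠 M) A B) := fun A B =>
    inferInstanceAs (IsIso (starδ A B))
  haveI : IsIso (Functor.OplaxMonoidal.η (starSymSeq 𝔠 M)) := inferInstanceAs (IsIso (starη 𝔠 M))
  Functor.Monoidal.ofOplaxMonoidal (starSymSeq 𝔠 M)

end Comparison

end SymSeqInv

open SymSeqInv

theorem proposition4p8 (𝔠 : Type w) [Nonempty 𝔠] (M : Type u) [Category.{v} M]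
    [MonoidalCategory M] [SymmetricCategory M] [MonoidalClosed M] [HasColimitsOfSize.{w, w} M]
    [InvolutiveCategory M] [InvolutiveSymmetricMonoidalCategory M] :
    starSymSeq 𝔠 M ⋙ symSeqStar 𝔠 M = 𝟭 (StarObj (SymSeq 𝔠 M)) ∧
    symSeqStar 𝔠 M ⋙ starSymSeq 𝔠 M = 𝟭 (SymSeq 𝔠 (StarObj M)) ∧
    ∃ (K : CircleMonoidal 𝔠 M) (L : CircleInvolution K) (K' : CircleMonoidal 𝔠 (StarObj M)),
      letI : MonoidalCategory (SymSeq 𝔠 M) := K.monoidalCategory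
      letI : InvolutiveMonoidalCategory (SymSeq 𝔠 M) := L.toInvolutive
      letI : MonoidalCategory (SymSeq 𝔠 (StarObj M)) := K'.monoidalCategory
      ∃ Φ : (starSymSeq 𝔠 M).Monoidal,
        (∀ A B : StarObj (SymSeq 𝔠 M),
          circleμ (StarObj.forget M) ((starSymSeq 𝔠 M).obj A) ((starSymSeq 𝔠 M).obj B) ≫
            (SymSeq.map 𝔠 (StarObj.forget M)).map (Φ.toLaxMonoidal.μ A B) =
              𝟙 (circle A.obj B.obj)) ∧
        circleε (StarObj.forget M) ≫
            (SymSeq.map 𝔠 (StarObj.forget M)).map Φ.toLaxMonoidal.ε =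
          𝟙 (circleUnit 𝔠 M) := by
  have : ∀ A : M, PreservesColimitsOfSize.{w, w} (tensorLeft A) := fun A =>
    (ihom.adjunction A).leftAdjoint_preservesColimits
  refine ⟨rfl, rfl, circleMonoidal 𝔠 M, circleInvolution 𝔠 M, circleMonoidal 𝔠 (StarObj M),
    starMonoidal 𝔠 M, fun A B => ?_, ?_⟩
  · exact congrArg (fun t => (SymSeq.map 𝔠 (StarObj.forget M)).map t)
      (IsIso.hom_inv_id (starδ A B))
  · exact congrArg (fun t => (SymSeq.map 𝔠 (StarObj.forget M)).map t)
      (IsIso.hom_inv_id (starη 𝔠 M))
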